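/- Fix constants $\hbar,c,m>0$ and $Q\in\mathbb{R}\setminus\{0\}$. Let $\sigma^1,\sigma^2,\sigma^3$ be the Pauli matrices. For $\psi_t(t):\mathbb{R}^3\to\mathbb{C}^2$ and $A_t(t):\mathbb{R}^3\to\mathbb{R}^3$ put $\nabla_{S,A}=i\hbar\nabla+\frac{Q}{c}A$ and $\nabla_{P,A}=\sigma\cdot\nabla_{S,A}$, and define the currents $$J_S[\psi,A]=-\tfrac{Q}{m}\,\mathrm{Re}\langle\psi,\nabla_{S,A}\psi\rangle,\qquad J_P[\psi,A]=-\tfrac{Q}{m}\,\mathrm{Re}\langle\psi,\sigma\nabla_{P,A}\psi\rangle ,$$ the field energy $$\mathscr{E}_{EM}[A_t,\partial_tA_t](t)=\frac{1}{8\pi}\int_{\mathbb{R}^3}\Bigl(|\nabla\times A_t(t)|^2+\bigl|\tfrac1c\partial_tA_t(t)\bigr|^2\Bigr)\,dy ,$$ the d'Alembertian $\Box=\frac{1}{c^2}\partial_t^2-\Delta$ and the Helmholtz projection $P=1-\nabla\,\mathrm{div}\,\Delta^{-1}$, where $\Delta^{-1}f(x)=-\frac{1}{4\pi}\int_{\mathbb{R}^3}\frac{f(y)}{|x-y|}\,dy$.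 For $j\in\{S,P\}$ consider the Maxwell–Schrödinger ($j=S$) respectively Maxwell–Pauli ($j=P$) system in Coulomb gauge $$\Box A_t=\tfrac{4\pi}{c}PJ_j[\psi_t,A_t],\qquad i\hbar\partial_t\psi_t=\Bigl(\tfrac{1}{2m}\nabla_{j,A_t}^2+\mathscr{E}_{EM}[A_t,\partial_tA_t]\Bigr)\psi_t,\qquad \mathrm{div}\,A_t=0, \tag{MSP}$$ understood in the sense of distributions on $\mathbb{R}\times\mathbb{R}^3$. Let $H^1$ be the usual Sobolev space on $\mathbb{R}^3$, and let $D^1$ be the space of locally integrable functions $f$ on $\mathbb{R}^3$ whose distributional first order derivatives lie in $L^2$ and for which $\{x : |f(x)|>s\}$ has finite Lebesgue measure for every $s>0$. Let $K_S$ be the optimal constant in the Sobolev inequality $\|f\|_{L^6}\le K_S\|\nabla f\|_{L^2}$ for real-valued $f\in D^1$, and for $\lambda>0$ set $$\Theta_{S,+}^{\lambda}=c,\qquad \Theta_{P,+}^{\lambda}=-\frac{8\pi K_S^3Q^2\lambda}{\hbar}+\sqrt{\frac{(8\pi)^2K_S^6Q^4\lambda^2}{\hbar^2}+c^2}.$$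 Theorem. For all $j\in\{S,P\}$, $\lambda>0$ and $v\in\mathbb{R}^3$ with $0<|v|<\Theta_{j,+}^{\lambda}$ there exist $\omega\in\mathbb{R}$, $\psi:\mathbb{R}^3\to\mathbb{C}^2$ in $H^1$ and $A:\mathbb{R}^3\to\mathbb{R}^3$ in $D^1$ with $\|\psi\|_{L^2}^2=\lambda$ such that $$\psi_t(t)(x)=e^{-i\omega t}\psi(x-vt),\qquad A_t(t)(x)=A(x-vt)$$ solves (MSP). -/

import Mathlib

open MeasureTheory

noncomputable section

namespace MaxwellPauli

/-- Physical space `ℝ³` with the Euclidean norm and Lebesgue measure. -/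
abbrev Space := EuclideanSpace ℝ (Fin 3)

/-- The spin space `ℂ²` with its usual inner product. -/
abbrev Spinor := EuclideanSpace ℂ (Fin 2)

/-- Space-time `ℝ × ℝ³`; a point is `(t, x)`. -/
abbrev SpaceTime := ℝ × Space

/-- The standard unit vector of `ℝ³` in direction `k`. -/
def e (k : Fin 3) : Space := EuclideanSpace.single k 1

/-- The time direction in space-time. -/
def dirT : SpaceTime := (1, 0)

/-- The `k`-th spatial direction in space-time. -/
def dirX (k : Fin 3) : SpaceTime := (0, e k)

/-! ### Weak derivatives and function spaces -/

section Weak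

variable {X : Type*} [NormedAddCommGroup X] [NormedSpace ℝ X]
variable {F : Type*} [NormedAddCommGroup F] [NormedSpace ℝ F]

/-- The (classical) directional derivative of a function, here only used for test functions. -/
def pd (u : X) (φ : X → ℝ) : X → ℝ := fun x => fderiv ℝ φ x u

/-- Real-valued test functions, i.e. elements of `C₀^∞`. -/
def IsTest (φ : X → ℝ) : Prop := ContDiff ℝ (⊤ : ℕ∞) φ ∧ HasCompactSupport φ

/-- The locally integrable function `g` is the distributional derivative of the locally integrable
function `f` in the direction `u`. -/
def HasWeakDeriv [MeasureSpace X] (u : X) (f g : X → F) : Prop :=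
  LocallyIntegrable f ∧ LocallyIntegrable g ∧
    ∀ φ : X → ℝ, IsTest φ → ∫ x, pd u φ x • f x = -∫ x, φ x • g x

/-- `G k` is the distributional derivative `∂ₖ f` on `ℝ³` and is square integrable, `k = 1, 2, 3`. -/
def HasL2Gradient (f : Space → F) (G : Fin 3 → Space → F) : Prop :=
  ∀ k, HasWeakDeriv (e k) f (G k) ∧ MemLp (G k) 2

/-- The Sobolev space `H¹` on `ℝ³`. -/
def MemH1 (f : Space → F) : Prop := MemLp f 2 ∧ ∃ G, HasL2Gradient f G

/-- `f` vanishes at infinity: `{x | |f(x)| > t}` has finite measure for all `t > 0`. -/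
def VanishesAtInfinity (f : Space → F) : Prop :=
  ∀ t : ℝ, 0 < t → volume {x | t < ‖f x‖} < ⊤

/-- The space `D¹` on `ℝ³`: locally integrable functions that vanish at infinity and have
distributional first order derivatives in `L²`. -/
def MemD1 (f : Space → F) : Prop :=
  LocallyIntegrable f ∧ VanishesAtInfinity f ∧ ∃ G, HasL2Gradient f G

end Weak

/-- The optimal constant `K_S` in the Sobolev inequality `‖f‖_{L⁶} ≤ K_S ‖∇f‖_{L²}` on `D¹`. -/
def sobolevConst : ℝ :=
  sInf {K : ℝ | 0 ≤ K ∧ ∀ (f : Space → ℝ) (G : Fin 3 → Space → ℝ),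
    MemD1 f → HasL2Gradient f G →
      eLpNorm f 6 volume ≤
        ENNReal.ofReal K *
          eLpNorm (fun x => (WithLp.toLp 2 (fun k => G k x) : Space)) 2 volume}

/-- The two models: `S` is Maxwell–Schrödinger, `P` is Maxwell–Pauli. -/
inductive Model
  | S
  | P

/-- The critical speed `Θ^λ_{j,+}`. -/
def criticalSpeed (ħ c Q : ℝ) (j : Model) (lam : ℝ) : ℝ :=
  match j with
  | .S => c
  | .P => -(8 * Real.pi * sobolevConst ^ 3 * Q ^ 2 * lam / ħ)
      + Real.sqrt ((8 * Real.pi) ^ 2 * sobolevConst ^ 6 * Q ^ 4 * lam ^ 2 / ħ ^ 2 + c ^ 2)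

/-! ### The terms of the system -/

/-- The Pauli matrices. -/
def pauli : Fin 3 → Matrix (Fin 2) (Fin 2) ℂ :=
  ![!![0, 1; 1, 0], !![0, -Complex.I; Complex.I, 0], !![1, 0; 0, -1]]

/-- The action of a `2 × 2` matrix on a spinor. -/
def act (M : Matrix (Fin 2) (Fin 2) ℂ) (w : Spinor) : Spinor := WithLp.toLp 2 (M.mulVec w.ofLp)

/-- The components of `∇_{S,A} ψ = iħ∇ψ + (Q/c) A ψ` at a point, where `w = ψ(x)`, `Dw k = ∂ₖψ(x)`
and `a = A(x)`. -/
def covS (ħ c Q : ℝ) (w : Spinor) (Dw : Fin 3 → Spinor) (a : Space) (k : Fin 3) : Spinor :=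
  (Complex.I * (ħ : ℂ)) • Dw k + (((Q / c) * a k : ℝ) : ℂ) • w

/-- `∇_{P,A} ψ = σ · ∇_{S,A} ψ` at a point. -/
def covP (ħ c Q : ℝ) (w : Spinor) (Dw : Fin 3 → Spinor) (a : Space) : Spinor :=
  ∑ l, act (pauli l) (covS ħ c Q w Dw a l)

/-- The three-component object `∇_{S,A} ψ` for `j = S` and `σ ∇_{P,A} ψ` for `j = P`.
In both cases the current is `J_j = -(Q/m) Re ⟨ψ, cov_j⟩`, and, the `σᵏ` being constant,
`∇_{j,A}² ψ = ∑ₖ (iħ∂ₖ + (Q/c) Aₖ) (cov_j)ₖ`. -/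
def cov (ħ c Q : ℝ) (j : Model) (w : Spinor) (Dw : Fin 3 → Spinor) (a : Space) (k : Fin 3) :
    Spinor :=
  match j with
  | .S => covS ħ c Q w Dw a k
  | .P => act (pauli k) (covP ħ c Q w Dw a)

/-- The probability current density `J_j[ψ, A]` at a point. -/
def current (ħ c m Q : ℝ) (j : Model) (w : Spinor) (Dw : Fin 3 → Spinor) (a : Space) : Space :=
  WithLp.toLp 2 fun k => -(Q / m) * (inner ℂ w (cov ħ c Q j w Dw a k)).re

/-- The curl of a vector field at a point in terms of its partial derivatives `Da k = ∂ₖA(x)`. -/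
def curl (Da : Fin 3 → Space) : Space :=
  !₂[Da 1 2 - Da 2 1, Da 2 0 - Da 0 2, Da 0 1 - Da 1 0]

/-- The energy `(8π)⁻¹ ∫ (|∇ × A|² + |c⁻¹ ∂ₜA|²)` of the electromagnetic field at a fixed time, in
terms of the spatial derivatives `DA k = ∂ₖA` and the time derivative `dtA`. -/
def fieldEnergy (c : ℝ) (DA : Fin 3 → Space → Space) (dtA : Space → Space) : ℝ :=
  1 / (8 * Real.pi) * ∫ y, (‖curl (fun k => DA k y)‖ ^ 2 + ‖c⁻¹ • dtA y‖ ^ 2)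

/-- `Δ⁻¹ f`, the solution of `Δu = f` on `ℝ³` given by the Newtonian potential; it is meaningful
if `∫ |f(y)| / (1 + |y|) dy < ∞`. -/
def invLaplace (f : Space → Space) : Space → Space :=
  fun x => -(1 / (4 * Real.pi)) • ∫ y, ‖x - y‖⁻¹ • f y

/-- The pairing of the `k`-th component of the distribution `P J = J - ∇ div Δ⁻¹ J` on space-time
(`Δ⁻¹` acting on `J(t)` at each time `t`) with a test function `φ`. -/
def helmholtzPairing (J : ℝ → Space → Space) (k : Fin 3) (φ : SpaceTime → ℝ) : ℝ :=
  (∫ z : SpaceTime, φ z * J z.1 z.2 k)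
    - ∑ l, ∫ z : SpaceTime, pd (dirX k) (pd (dirX l) φ) z * invLaplace (J z.1) z.2 l

/-! ### Solutions -/

/-- The pair `(ψ, A)`, with `ψ(t) : ℝ³ → ℂ²` and `A(t) : ℝ³ → ℝ³`, solves the Coulomb gauge system

* `□A = (4π/c) P J_j[ψ, A]`,
* `iħ ∂ₜψ = ((2m)⁻¹ ∇_{j,A}² + E_EM[A, ∂ₜA]) ψ`,
* `div A = 0`

in the sense of distributions on space-time `ℝ × ℝ³`. The first order derivatives `∂ₖψ`, `∂ₖA`,
`∂ₜA` are required to be functions, and every product that occurs has to be locally integrable,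
so that all terms are well defined. -/
def IsSolution (ħ c m Q : ℝ) (j : Model) (ψ : ℝ → Space → Spinor) (A : ℝ → Space → Space) : Prop :=
  ∃ (Dψ : Fin 3 → ℝ → Space → Spinor) (DA : Fin 3 → ℝ → Space → Space) (dtA : ℝ → Space → Space),
    let K : Fin 3 → ℝ → Space → Spinor :=
      fun k t x => cov ħ c Q j (ψ t x) (fun l => Dψ l t x) (A t x) k
    let J : ℝ → Space → Space :=
      fun t x => current ħ c m Q j (ψ t x) (fun l => Dψ l t x) (A t x)
    let EM : ℝ → ℝ := fun t => fieldEnergy c (fun k => DA k t) (dtA t)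
    -- first order derivatives
    (∀ k, HasWeakDeriv (dirX k) (fun z : SpaceTime => ψ z.1 z.2) (fun z => Dψ k z.1 z.2)) ∧
    (∀ k, HasWeakDeriv (dirX k) (fun z : SpaceTime => A z.1 z.2) (fun z => DA k z.1 z.2)) ∧
    HasWeakDeriv dirT (fun z : SpaceTime => A z.1 z.2) (fun z => dtA z.1 z.2) ∧
    -- the terms of the equations are well defined
    (∀ᵐ t : ℝ, MemLp (fun x => curl (fun k => DA k t x)) 2 ∧ MemLp (dtA t) 2) ∧
    (LocallyIntegrable fun z : SpaceTime => EM z.1 • ψ z.1 z.2) ∧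
    (∀ k, LocallyIntegrable fun z : SpaceTime => K k z.1 z.2) ∧
    (∀ k, LocallyIntegrable fun z : SpaceTime => A z.1 z.2 k • K k z.1 z.2) ∧
    (LocallyIntegrable fun z : SpaceTime => J z.1 z.2) ∧
    (∀ᵐ t : ℝ, Integrable fun y => (1 + ‖y‖)⁻¹ • J t y) ∧
    (LocallyIntegrable fun z : SpaceTime => invLaplace (J z.1) z.2) ∧
    -- the Maxwell equation
    (∀ (k : Fin 3) (φ : SpaceTime → ℝ), IsTest φ →
      ∫ z : SpaceTime,
          (1 / c ^ 2 * pd dirT (pd dirT φ) z - ∑ l, pd (dirX l) (pd (dirX l) φ) z) * A z.1 z.2 k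
        = 4 * Real.pi / c * helmholtzPairing J k φ) ∧
    -- the Schrödinger respectively Pauli equation
    (∀ φ : SpaceTime → ℝ, IsTest φ →
      -((Complex.I * (ħ : ℂ)) • ∫ z : SpaceTime, pd dirT φ z • ψ z.1 z.2)
        = ((1 / (2 * m) : ℝ) : ℂ) •
            ∑ k, (-((Complex.I * (ħ : ℂ)) • ∫ z : SpaceTime, pd (dirX k) φ z • K k z.1 z.2)
              + ((Q / c : ℝ) : ℂ) • ∫ z : SpaceTime, φ z • (A z.1 z.2 k • K k z.1 z.2))
          + ∫ z : SpaceTime, φ z • (EM z.1 • ψ z.1 z.2)) ∧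
    -- the Coulomb gauge condition
    (∀ φ : SpaceTime → ℝ, IsTest φ →
      ∑ k, ∫ z : SpaceTime, pd (dirX k) φ z * A z.1 z.2 k = 0)

end MaxwellPauli

end

open MeasureTheory Filter Topology
open scoped ENNReal NNReal

noncomputable section

namespace MaxwellPauli

/-! ### Lebesgue norms -/

section LpNorm

variable {α : Type*} {mα : MeasurableSpace α} {μ : Measure α}
variable {E F G : Type*} [NormedAddCommGroup E] [NormedAddCommGroup F] [NormedAddCommGroup G]

/-! A profile `(ψ, A)` moving with velocity `v` solves the system if `div A = 0` and, in the moving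
frame, `(1/2m) ∇_{j,A}² ψ + iħ v·∇ψ = (ħω - E) ψ` and `c⁻² (v·∇)² A - ΔA = (4π/c) P J`. The nonlocal
field energy `E` is constant along the wave, so it only shifts `ω`. Completing the square in the
first equation shows that both are Euler–Lagrange equations of `energy (ψ, A) = (1/2m) ‖(∇_{j,A} + m
v) ψ‖² - (Q/c) ∫ v·A |ψ|² + (1/8π) ∫ (|∇A|² - c⁻² |(v·∇)A|²)` under the constraints `‖ψ‖² = λ` and
`div A = 0`. The norm in the first term is that of the form `kin j`. It remains to find a minimizer
(`exists_minimizer`).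

Coercivity (`coercive`). The field term dominates `‖∇A‖²` because `|v| < c`. The coupling term,
called `flux`, is bounded by Hölder's inequality with exponents 6, 3 and 2, the Sobolev inequality
and the diamagnetic inequality. In the Pauli case the form controls the Schrödinger form only up to
a magnetic term `∫ curl A · ⟨ψ, σψ⟩`. The competition between this term, the coupling and the field
energy is settled by the elementary inequality `coercive_aux`, and its smallness condition is
precisely that `|v|` lies below the critical speed. Since the Sobolev constant is defined as an
infimum, the Sobolev inequality on `D¹` has to be proved first (`exists_sobolev_D1`), in order that
the infimum be taken over a nonempty set.

Negativity (`exists_energy_neg`). The infimum `I` is negative. A plane wave cancels `m v`; a slowly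
varying envelope at scale `R` makes the kinetic term `O(R⁻²)`, while a divergence free potential
parallel to `v` on the envelope gains a multiple of `R⁻¹`. As the kinetic and the field terms are
nonnegative, the coupling cannot tend to zero along a minimizing sequence (`not_tendsto_flux`).

Compactness. If a minimizing sequence vanished, `ψ` would tend to zero in `L³`
(`tendsto_three_of_vanishing`) and so would the coupling. Hence, after translations, a subsequence
converges weakly to some `v` of positive mass (`exists_weak_minimizing`). Mass and energy split
asymptotically into the parts of `v` and of the remainder `w n`. Kinetic energy and coupling are
quadratic in `ψ`, so rescaling `ψ` alone yields `energy u ≥ μ I + (1 - μ) F`, where `μ` is the mass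
fraction of `u` and `F` its field energy (`energy_ge_of_inf`). Adding this for both parts forces
equality everywhere: the field energy of the remainder vanishes in the limit, and so does that of
`v` if `v` carries only part of the mass. In that case the coupling would tend to zero, which is
impossible. So `v` has full mass and minimizes.

Euler–Lagrange equations. The energy is quadratic in each unknown separately, so comparing
coefficients of a nonnegative polynomial in `t` suffices. The inequality `energy_ge_of_inf` also
replaces the Lagrange multiplier argument for the mass constraint (`spinor_equation`). In the Pauli
case, anticommutation of the matrices removes the velocity from the square (`stationary_spinor`).
For the potential, the admissible variations are divergence free; the Helmholtz projection of a test
field `η eₖ` is one, by an explicit study of the Newtonian potential (`sum_newt_pdv_pdv`,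
`newt_adm`), and it produces `P J` (`stationary_maxwell`).

Space-time. Shearing space-time into the moving frame reduces each distributional identity to the
stationary one on every time slice (`hasInt_boost`, `integral_pd_dirT_boost`). -/

instance holderTriple_six_three_two : ENNReal.HolderTriple 6 3 2 where
  inv_add_inv_eq_inv := by
    rw [← ENNReal.toReal_eq_toReal_iff' (by simp) (by simp),
      ENNReal.toReal_add (by simp) (by simp)]
    simp only [ENNReal.toReal_inv, ENNReal.toReal_ofNat]
    norm_num

/-- The exponents 6 for the potential and 3 for the spinor are those with which the coupling `A ψ`
lands in `L²`; both orders of the factors occur. -/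
instance holderTriple_three_six_two : ENNReal.HolderTriple 3 6 2 where
  inv_add_inv_eq_inv := by
    rw [add_comm]; exact holderTriple_six_three_two.inv_add_inv_eq_inv

theorem sq_lpNorm_two {f : α → E} (hf : AEStronglyMeasurable f μ) :
    lpNorm f 2 μ ^ 2 = ∫ x, ‖f x‖ ^ 2 ∂μ := by
  rw [lpNorm_eq_integral_norm_rpow_toReal (by simp) (by simp) hf]
  simp only [ENNReal.toReal_ofNat, Real.rpow_two]
  rw [← Real.rpow_natCast, ← Real.rpow_mul (integral_nonneg fun x => by positivity)]
  norm_num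

theorem cube_lpNorm_three {f : α → E} (hf : AEStronglyMeasurable f μ) :
    lpNorm f 3 μ ^ 3 = ∫ x, ‖f x‖ ^ 3 ∂μ := by
  rw [lpNorm_eq_integral_norm_rpow_toReal (by simp) (by simp) hf]
  simp only [ENNReal.toReal_ofNat]
  rw [← Real.rpow_natCast, ← Real.rpow_mul (integral_nonneg fun x => by positivity)]
  norm_num

/-- No measurability is needed, because `lpNorm` is zero for functions that are not almost
everywhere strongly measurable. -/
theorem lpNorm_le_of_eLpNorm_le {f : α → E} {p : ℝ≥0∞} {C : ℝ} (hC : 0 ≤ C)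
    (h : eLpNorm f p μ ≤ ENNReal.ofReal C) : lpNorm f p μ ≤ C := by
  by_cases hf : AEStronglyMeasurable f μ
  · rw [← toReal_eLpNorm hf]
    exact ENNReal.toReal_le_of_le_ofReal hC h
  · rw [lpNorm_of_not_aestronglyMeasurable hf]; exact hC

theorem lpNorm_congr_norm {f : α → E} {g : α → F} {p : ℝ≥0∞} (hf : AEStronglyMeasurable f μ)
    (hg : AEStronglyMeasurable g μ) (h : ∀ᵐ x ∂μ, ‖f x‖ = ‖g x‖) :
    lpNorm f p μ = lpNorm g p μ := by
  rw [← toReal_eLpNorm hf, ← toReal_eLpNorm hg, eLpNorm_congr_norm_ae h]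

theorem lpNorm_congr_ae' {f g : α → E} {p : ℝ≥0∞} (h : f =ᵐ[μ] g) :
    lpNorm f p μ = lpNorm g p μ := by
  by_cases hf : AEStronglyMeasurable f μ
  · exact lpNorm_congr_norm hf (hf.congr h) (h.mono fun x hx => by rw [hx])
  · rw [lpNorm_of_not_aestronglyMeasurable hf, lpNorm_of_not_aestronglyMeasurable]
    exact fun h' => hf (h'.congr h.symm)

theorem lpNorm_mono_norm {f : α → E} {g : α → F} {p : ℝ≥0∞} (hg : MemLp g p μ)
    (h : ∀ᵐ x ∂μ, ‖f x‖ ≤ ‖g x‖) : lpNorm f p μ ≤ lpNorm g p μ := by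
  refine lpNorm_le_of_eLpNorm_le lpNorm_nonneg ?_
  rw [ofReal_lpNorm hg]
  exact eLpNorm_mono_ae h

theorem memLp_fun_add {f g : α → E} {p : ℝ≥0∞} (hf : MemLp f p μ) (hg : MemLp g p μ) :
    MemLp (fun x => f x + g x) p μ := hf.add hg

theorem memLp_fun_sub {f g : α → E} {p : ℝ≥0∞} (hf : MemLp f p μ) (hg : MemLp g p μ) :
    MemLp (fun x => f x - g x) p μ := hf.sub hg

theorem lpNorm_fun_add_le {f g : α → E} {p : ℝ≥0∞} (hf : MemLp f p μ) (hp : 1 ≤ p) :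
    lpNorm (fun x => f x + g x) p μ ≤ lpNorm f p μ + lpNorm g p μ := lpNorm_add_le hf hp

theorem lpNorm_fun_const_smul [NormedSpace ℝ E] (c : ℝ) (f : α → E) (p : ℝ≥0∞) :
    lpNorm (fun x => c • f x) p μ = |c| * lpNorm f p μ := by
  have := lpNorm_const_smul c f μ (p := p)
  rwa [coe_nnnorm] at this

/-- Hölder's inequality for a product of functions. -/
theorem lpNorm_bilin_le {p q r : ℝ≥0∞} [ENNReal.HolderTriple p q r] {f : α → E} {g : α → F}
    (hf : MemLp f p μ) (hg : MemLp g q μ) (b : E → F → G)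
    (h : ∀ x, ‖b (f x) (g x)‖ ≤ ‖f x‖ * ‖g x‖) :
    lpNorm (fun x => b (f x) (g x)) r μ ≤ lpNorm f p μ * lpNorm g q μ := by
  refine lpNorm_le_of_eLpNorm_le (mul_nonneg lpNorm_nonneg lpNorm_nonneg) ?_
  rw [ENNReal.ofReal_mul lpNorm_nonneg, ofReal_lpNorm hf, ofReal_lpNorm hg]
  simpa using eLpNorm_le_eLpNorm_mul_eLpNorm'_of_norm hf.1 hg.1 b 1
    (Eventually.of_forall fun x => by simpa using h x)

theorem memLp_bilin {p q r : ℝ≥0∞} [ENNReal.HolderTriple p q r] {f : α → E} {g : α → F}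
    (hf : MemLp f p μ) (hg : MemLp g q μ) (b : E → F → G)
    (hm : AEStronglyMeasurable (fun x => b (f x) (g x)) μ)
    (h : ∀ x, ‖b (f x) (g x)‖ ≤ ‖f x‖ * ‖g x‖) :
    MemLp (fun x => b (f x) (g x)) r μ :=
  hf.of_bilin b 1 hg hm (Eventually.of_forall fun x => by
    have := h x
    simpa [← NNReal.coe_le_coe] using this)

/-- Pointwise, `s³ ≤ s² + s⁶` for `s ≥ 0`. -/
theorem memLp_three {f : α → E} (h2 : MemLp f 2 μ) (h6 : MemLp f 6 μ) : MemLp f 3 μ := by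
  refine ⟨h2.1, ?_⟩
  have hlt := h2.2
  have hlt6 := h6.2
  rw [eLpNorm_lt_top_iff_lintegral_rpow_enorm_lt_top (by norm_num) (by norm_num)] at hlt hlt6 ⊢
  simp only [ENNReal.toReal_ofNat] at hlt hlt6 ⊢
  refine lt_of_le_of_lt (b := ∫⁻ x, (‖f x‖ₑ ^ (2 : ℝ) + ‖f x‖ₑ ^ (6 : ℝ)) ∂μ)
    (lintegral_mono fun x => ?_) ?_
  · rcases le_total ‖f x‖ₑ 1 with h | h
    · exact (ENNReal.rpow_le_rpow_of_exponent_ge h (by norm_num)).trans le_self_add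
    · exact (ENNReal.rpow_le_rpow_of_exponent_le h (by norm_num)).trans le_add_self
  · rw [lintegral_add_left' (h2.1.enorm.pow_const _)]
    exact ENNReal.add_lt_top.2 ⟨hlt, hlt6⟩

/-- Interpolation of `L³` between `L²` and `L⁶`. -/
theorem sq_lpNorm_three_le {f : α → E} (h2 : MemLp f 2 μ) (h6 : MemLp f 6 μ) :
    lpNorm f 3 μ ^ 2 ≤ lpNorm f 2 μ * lpNorm f 6 μ := by
  have key : ∫⁻ x, ‖f x‖ₑ ^ (3 : ℝ) ∂μ ≤
      (∫⁻ x, ‖f x‖ₑ ^ (2 : ℝ) ∂μ) ^ (3 / 4 : ℝ) * (∫⁻ x, ‖f x‖ₑ ^ (6 : ℝ) ∂μ) ^ (1 / 4 : ℝ) := by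
    -- Hölder with the exponents `4/3` and `4` for `|f|³ = |f|^{3/2} |f|^{3/2}`: the two factors
    -- become `|f|²` and `|f|⁶`.
    have := ENNReal.lintegral_mul_le_Lp_mul_Lq μ (p := 4 / 3) (q := 4)
      (by rw [Real.holderConjugate_iff]; norm_num)
      (f := fun x => ‖f x‖ₑ ^ (3 / 2 : ℝ)) (g := fun x => ‖f x‖ₑ ^ (3 / 2 : ℝ))
      (h2.1.enorm.pow_const _) (h2.1.enorm.pow_const _)
    simp only [Pi.mul_apply, ← ENNReal.rpow_mul] at this
    have e3 : ∀ x, ‖f x‖ₑ ^ (3 / 2 : ℝ) * ‖f x‖ₑ ^ (3 / 2 : ℝ) = ‖f x‖ₑ ^ (3 : ℝ) := fun x => by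
      rw [← ENNReal.rpow_add_of_nonneg _ _ (by norm_num) (by norm_num)]; norm_num
    simp only [e3] at this
    norm_num at this ⊢
    exact this
  have h3 := memLp_three h2 h6
  rw [← ENNReal.ofReal_le_ofReal_iff (mul_nonneg lpNorm_nonneg lpNorm_nonneg),
    ENNReal.ofReal_mul lpNorm_nonneg, ENNReal.ofReal_pow lpNorm_nonneg, ofReal_lpNorm h3, ofReal_lpNorm h2, ofReal_lpNorm h6,
    eLpNorm_eq_lintegral_rpow_enorm_toReal (by norm_num) (by norm_num),
    eLpNorm_eq_lintegral_rpow_enorm_toReal (by norm_num) (by norm_num),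
    eLpNorm_eq_lintegral_rpow_enorm_toReal (by norm_num) (by norm_num)]
  simp only [ENNReal.toReal_ofNat]
  refine (pow_le_pow_left' (ENNReal.rpow_le_rpow key (by norm_num)) 2).trans_eq ?_
  rw [← ENNReal.rpow_natCast, ← ENNReal.rpow_mul, ENNReal.mul_rpow_of_nonneg _ _ (by norm_num),
    ← ENNReal.rpow_mul, ← ENNReal.rpow_mul]
  norm_num

variable {H : Type*} [NormedAddCommGroup H] [InnerProductSpace ℝ H]

theorem abs_integral_inner_le {f g : α → H} (hf : MemLp f 2 μ) (hg : MemLp g 2 μ) :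
    |∫ x, inner ℝ (f x) (g x) ∂μ| ≤ lpNorm f 2 μ * lpNorm g 2 μ := by
  have h1 : lpNorm (fun x => inner ℝ (f x) (g x)) 1 μ ≤ lpNorm f 2 μ * lpNorm g 2 μ :=
    lpNorm_bilin_le hf hg (fun a b => inner ℝ a b) fun x => norm_inner_le_norm _ _
  refine le_trans ?_ h1
  rw [lpNorm_one_eq_integral_norm (hf.1.inner hg.1)]
  exact norm_integral_le_integral_norm (μ := μ) fun x => inner ℝ (f x) (g x)

theorem integrable_inner {f g : α → H} (hf : MemLp f 2 μ) (hg : MemLp g 2 μ) :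
    Integrable (fun x => inner ℝ (f x) (g x)) μ :=
  memLp_one_iff_integrable.1 (memLp_bilin hf hg (fun a b => inner ℝ a b) (hf.1.inner hg.1)
    fun _ => norm_inner_le_norm _ _)

theorem integral_mul_norm_le {f : α → E} {g : α → F} (hf : MemLp f 2 μ) (hg : MemLp g 2 μ) :
    ∫ x, ‖f x‖ * ‖g x‖ ∂μ ≤ lpNorm f 2 μ * lpNorm g 2 μ := by
  have h1 := abs_integral_inner_le hg.norm hf.norm
  rw [lpNorm_norm hf.1, lpNorm_norm hg.1, mul_comm] at h1
  exact (le_abs_self _).trans (by simpa using h1)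

theorem integrable_mul_norm {f : α → E} {g : α → F} (hf : MemLp f 2 μ) (hg : MemLp g 2 μ) :
    Integrable (fun x => ‖f x‖ * ‖g x‖) μ := by
  simpa using integrable_inner hg.norm hf.norm

/-- Fatou's lemma for Lebesgue norms. -/
theorem memLp_of_tendsto_ae {p : ℝ≥0∞} {f : ℕ → α → E} {g : α → E} {c : ℕ → ℝ} {C : ℝ}
    (hf : ∀ n, AEStronglyMeasurable (f n) μ)
    (hC : ∀ n, eLpNorm (f n) p μ ≤ ENNReal.ofReal (c n)) (hc : Tendsto c atTop (𝓝 C))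
    (h : ∀ᵐ x ∂μ, Tendsto (fun n => f n x) atTop (𝓝 (g x))) :
    MemLp g p μ ∧ eLpNorm g p μ ≤ ENNReal.ofReal C := by
  have h1 : eLpNorm g p μ ≤ ENNReal.ofReal C := by
    refine (Lp.eLpNorm_lim_le_liminf_eLpNorm hf g h).trans ?_
    exact (liminf_le_liminf (Eventually.of_forall hC)).trans_eq
      (ENNReal.tendsto_ofReal hc).liminf_eq
  exact ⟨⟨aestronglyMeasurable_of_tendsto_ae _ hf h, h1.trans_lt ENNReal.ofReal_lt_top⟩, h1⟩

theorem tendsto_eLpNorm_of_lpNorm {p : ℝ≥0∞} {f : ℕ → α → E} (hf : ∀ n, MemLp (f n) p μ)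
    (h : Tendsto (fun n => lpNorm (f n) p μ) atTop (𝓝 0)) :
    Tendsto (fun n => eLpNorm (f n) p μ) atTop (𝓝 0) := by
  have := ENNReal.tendsto_ofReal h
  simpa [ofReal_lpNorm (hf _)] using this

/-- Convergence in `Lᵖ` implies convergence almost everywhere along a subsequence. -/
theorem exists_subseq_tendsto_ae {p : ℝ≥0∞} (hp : p ≠ 0) {f : ℕ → α → E} {g : α → E}
    (hf : ∀ n, MemLp (f n) p μ) (hg : MemLp g p μ)
    (h : Tendsto (fun n => lpNorm (fun x => g x - f n x) p μ) atTop (𝓝 0)) :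
    ∃ ns : ℕ → ℕ, StrictMono ns ∧ ∀ᵐ x ∂μ, Tendsto (fun i => f (ns i) x) atTop (𝓝 (g x)) := by
  have h' := tendsto_eLpNorm_of_lpNorm (fun n => hg.sub (hf n)) h
  have h'' : Tendsto (fun n => eLpNorm (f n - g) p μ) atTop (𝓝 0) := by
    refine h'.congr fun n => ?_
    rw [← eLpNorm_neg]; congr 1; ext1 x; simp
  exact (tendstoInMeasure_of_tendsto_eLpNorm hp (fun n => (hf n).1) hg.1 h'').exists_seq_tendsto_ae

/-- The square of an average is at most the average of the square. -/
theorem enorm_integral_sq_le [NormedSpace ℝ E] [IsProbabilityMeasure μ] {f : α → E}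
    (hf : AEStronglyMeasurable f μ) : ‖∫ x, f x ∂μ‖ₑ ^ 2 ≤ ∫⁻ x, ‖f x‖ₑ ^ 2 ∂μ := by
  have h1 : ‖∫ x, f x ∂μ‖ₑ ≤ eLpNorm f 1 μ := by
    rw [eLpNorm_one_eq_lintegral_enorm]; exact enorm_integral_le_lintegral_enorm f
  have h2 := pow_le_pow_left' (h1.trans
    (eLpNorm_le_eLpNorm_of_exponent_le (q := 2) (by norm_num) hf)) 2
  refine h2.trans_eq ?_
  rw [eLpNorm_eq_lintegral_rpow_enorm_toReal (by norm_num) (by norm_num), ← ENNReal.rpow_natCast,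
    ← ENNReal.rpow_mul]
  norm_num

theorem eLpNorm_two_sq (f : α → E) : eLpNorm f 2 μ ^ 2 = ∫⁻ x, ‖f x‖ₑ ^ 2 ∂μ := by
  rw [eLpNorm_eq_lintegral_rpow_enorm_toReal (by norm_num) (by norm_num), ← ENNReal.rpow_natCast,
    ← ENNReal.rpow_mul]
  norm_num

end LpNorm

/-! ### Vector-valued test functions -/

section VTest

variable {F : Type*} [NormedAddCommGroup F] [NormedSpace ℝ F]

/-- Smooth compactly supported functions with values in a normed space. -/
def VTest (f : Space → F) : Prop := ContDiff ℝ (⊤ : ℕ∞) f ∧ HasCompactSupport f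

/-- The `k`-th partial derivative. -/
def pdv (k : Fin 3) (f : Space → F) : Space → F := fun x => fderiv ℝ f x (e k)

theorem space_eq_sum (u : Space) : u = ∑ k, u k • e k := by
  ext i
  fin_cases i <;> simp [e, Fin.sum_univ_three]

@[simp] theorem norm_e (k : Fin 3) : ‖e k‖ = 1 := by simp [e]

theorem fderiv_eq_sum (L : Space →L[ℝ] F) (u : Space) : L u = ∑ k, u k • L (e k) := by
  conv_lhs => rw [space_eq_sum u]
  simp

theorem norm_clm_le (L : Space →L[ℝ] F) : ‖L‖ ≤ ∑ k, ‖L (e k)‖ := by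
  refine L.opNorm_le_bound (by positivity) fun u => ?_
  rw [fderiv_eq_sum L u, Finset.sum_mul]
  refine (norm_sum_le _ _).trans (Finset.sum_le_sum fun k _ => ?_)
  rw [norm_smul, mul_comm]
  exact mul_le_mul_of_nonneg_left (PiLp.norm_apply_le u k) (norm_nonneg _)

theorem norm_clm_sq_le (L : Space →L[ℝ] F) : ‖L‖ ^ 2 ≤ ∑ k, ‖L (e k)‖ ^ 2 := by
  refine (Real.le_sqrt (norm_nonneg _) (by positivity)).1 (L.opNorm_le_bound (by positivity)
    fun u => ?_)
  rw [fderiv_eq_sum L u, EuclideanSpace.norm_eq, mul_comm]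
  refine (norm_sum_le _ _).trans ?_
  simp only [norm_smul]
  exact Real.sum_mul_le_sqrt_mul_sqrt _ _ _

namespace VTest

variable {f g : Space → F}

theorem continuous (hf : VTest f) : Continuous f := hf.1.continuous

theorem differentiable (hf : VTest f) : Differentiable ℝ f := hf.1.differentiable (by simp)

theorem memLp (hf : VTest f) (p : ℝ≥0∞) : MemLp f p volume :=
  hf.continuous.memLp_of_hasCompactSupport hf.2

theorem pdv (hf : VTest f) (k : Fin 3) : VTest (pdv k f) := by
  refine ⟨?_, hf.2.fderiv_apply ℝ (e k)⟩
  exact (hf.1.fderiv_right (m := (⊤ : ℕ∞)) (by simp)).clm_apply contDiff_const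

theorem add (hf : VTest f) (hg : VTest g) : VTest (fun x => f x + g x) :=
  ⟨hf.1.add hg.1, hf.2.add hg.2⟩

theorem const_smul (hf : VTest f) (c : ℝ) : VTest (fun x => c • f x) :=
  ⟨hf.1.const_smul c, hf.2.comp_left (g := fun y => c • y) (by simp)⟩

theorem clm {F' : Type*} [NormedAddCommGroup F'] [NormedSpace ℝ F'] (hf : VTest f)
    (L : F →L[ℝ] F') : VTest (fun x => L (f x)) :=
  ⟨L.contDiff.comp hf.1, hf.2.comp_left (g := L) (by simp)⟩

theorem sub (hf : VTest f) (hg : VTest g) : VTest (fun x => f x - g x) := by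
  simpa [sub_eq_add_neg] using hf.add (hg.const_smul (-1))

theorem translate (hf : VTest f) (y : Space) : VTest (fun x => f (x + y)) :=
  ⟨hf.1.comp (contDiff_id.add contDiff_const), hf.2.comp_homeomorph (Homeomorph.addRight y)⟩

theorem smul_right {φ : Space → ℝ} (hφ : VTest φ) (hf : ContDiff ℝ (⊤ : ℕ∞) f) :
    VTest (fun x => φ x • f x) :=
  ⟨hφ.1.smul hf, hφ.2.smul_right⟩

end VTest

theorem vtest_zero : VTest (fun _ => 0 : Space → F) := ⟨contDiff_const, HasCompactSupport.zero⟩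

theorem pdv_add {f g : Space → F} (hf : Differentiable ℝ f) (hg : Differentiable ℝ g) (k : Fin 3) :
    pdv k (fun x => f x + g x) = fun x => pdv k f x + pdv k g x := by
  ext1 x; simp only [pdv]; rw [fderiv_fun_add (hf x) (hg x)]; rfl

theorem pdv_sub {f g : Space → F} (hf : Differentiable ℝ f) (hg : Differentiable ℝ g) (k : Fin 3) :
    pdv k (fun x => f x - g x) = fun x => pdv k f x - pdv k g x := by
  ext1 x; simp only [pdv]; rw [fderiv_fun_sub (hf x) (hg x)]; rfl

theorem pdv_const_smul {f : Space → F} (hf : Differentiable ℝ f) (c : ℝ) (k : Fin 3) :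
    pdv k (fun x => c • f x) = fun x => c • pdv k f x := by
  ext1 x; simp only [pdv]; rw [fderiv_fun_const_smul (hf x)]; rfl

theorem pdv_smul {φ : Space → ℝ} {f : Space → F} (hφ : Differentiable ℝ φ)
    (hf : Differentiable ℝ f) (k : Fin 3) :
    pdv k (fun x => φ x • f x) = fun x => φ x • pdv k f x + pdv k φ x • f x := by
  ext1 x; simp only [pdv]; rw [fderiv_fun_smul (hφ x) (hf x)]; simp

theorem pdv_mul {φ f : Space → ℝ} (hφ : Differentiable ℝ φ)
    (hf : Differentiable ℝ f) (k : Fin 3) :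
    pdv k (fun x => φ x * f x) = fun x => φ x * pdv k f x + pdv k φ x * f x :=
  pdv_smul hφ hf k

theorem pdv_clm {F' : Type*} [NormedAddCommGroup F'] [NormedSpace ℝ F'] {f : Space → F}
    (hf : Differentiable ℝ f) (L : F →L[ℝ] F') (k : Fin 3) :
    pdv k (fun x => L (f x)) = fun x => L (pdv k f x) := by
  ext1 x
  have := (L.hasFDerivAt.comp x (hf x).hasFDerivAt).fderiv
  simp only [pdv]
  rw [show (fun x => L (f x)) = L ∘ f from rfl, this]; rfl

theorem pdv_translate (f : Space → F) (y : Space) (k : Fin 3) :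
    pdv k (fun x => f (x + y)) = fun x => pdv k f (x + y) := by
  ext1 x; simp only [pdv, fderiv_comp_add_right]

theorem pdv_comm {f : Space → F} (hf : ContDiff ℝ (⊤ : ℕ∞) f) (k l : Fin 3) :
    pdv k (pdv l f) = pdv l (pdv k f) := by
  ext1 x
  have hs : IsSymmSndFDerivAt ℝ f x :=
    hf.contDiffAt.isSymmSndFDerivAt (by
      rw [minSmoothness_of_isRCLikeNormedField]
      exact (WithTop.coe_le_coe.2 le_top : ((2 : ℕ∞) : WithTop ℕ∞) ≤ ((⊤ : ℕ∞) : WithTop ℕ∞)))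
  have hd : DifferentiableAt ℝ (fderiv ℝ f) x :=
    (hf.fderiv_right (m := (⊤ : ℕ∞)) (by simp)).differentiable (by simp) x
  have key : ∀ i j : Fin 3, pdv i (pdv j f) x = fderiv ℝ (fderiv ℝ f) x (e i) (e j) := by
    intro i j
    change fderiv ℝ (fun y => fderiv ℝ f y (e j)) x (e i) = _
    rw [fderiv_clm_apply hd (differentiableAt_const _)]
    simp
  rw [key, key]
  exact hs _ _

/-- Integrals of derivatives of test functions vanish. -/
theorem integral_pdv_eq_zero {f : Space → F} (hf : VTest f) (k : Fin 3) :
    ∫ x, pdv k f x = 0 := by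
  -- A cutoff equal to one on the support turns the statement into integration by parts for `χ f`;
  -- the derivative of `χ` vanishes wherever `f` does not.
  obtain ⟨χ, hχ1, -, hχ⟩ : ∃ χ : Space → ℝ, (∀ x ∈ tsupport f, χ x = 1) ∧ True ∧ VTest χ := by
    obtain ⟨R, hR, hsub⟩ := hf.2.isCompact.isBounded.subset_ball_lt 0 (0 : Space)
    let b : ContDiffBump (0 : Space) := ⟨R, R + 1, hR, by linarith⟩
    exact ⟨b, fun x hx => b.one_of_mem_closedBall (Metric.ball_subset_closedBall (hsub hx)),
      trivial, b.contDiff, b.hasCompactSupport⟩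
  have h := integral_smul_fderiv_eq_neg_fderiv_smul_of_integrable (μ := (volume : Measure Space))
    (f := χ) (g := f) (v := e k)
    (((hχ.pdv k).continuous.smul hf.continuous).integrable_of_hasCompactSupport hf.2.smul_left)
    ((hχ.continuous.smul (hf.pdv k).continuous).integrable_of_hasCompactSupport hχ.2.smul_right)
    ((hχ.continuous.smul hf.continuous).integrable_of_hasCompactSupport hf.2.smul_left)
    (fun x _ => hχ.differentiable x) (fun x _ => hf.differentiable x)
  have h1 : ∀ x, χ x • fderiv ℝ f x (e k) = pdv k f x := by
    intro x
    by_cases hx : x ∈ tsupport f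
    · rw [hχ1 x hx, one_smul]; rfl
    · have : fderiv ℝ f x = 0 :=
        image_eq_zero_of_notMem_tsupport fun h => hx (tsupport_fderiv_subset ℝ h)
      simp [pdv, this]
  have h2 : ∀ x, fderiv ℝ χ x (e k) • f x = 0 := by
    intro x
    by_cases hx : f x = 0
    · rw [hx, smul_zero]
    · have hmem : x ∈ interior (tsupport f) := by
        refine mem_interior.2 ⟨Function.support f, subset_tsupport f, ?_, hx⟩
        exact hf.continuous.isOpen_support
      have : χ =ᶠ[𝓝 x] fun _ => 1 := by
        filter_upwards [mem_interior_iff_mem_nhds.1 hmem] with y hy using hχ1 y hy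
      rw [this.fderiv_eq]; simp
  simp only [h1, h2] at h
  simpa using h

/-- Only `φ` has compact support; `f` will also be a potential plus a constant, or a regularized
Newtonian kernel. -/
theorem VTest.integral_smul_pdv {φ : Space → ℝ} {f : Space → F} (hφ : VTest φ)
    (hf : ContDiff ℝ (⊤ : ℕ∞) f) (k : Fin 3) :
    ∫ x, φ x • MaxwellPauli.pdv k f x = -∫ x, MaxwellPauli.pdv k φ x • f x := by
  have hfd : Differentiable ℝ f := hf.differentiable (by simp)
  have h := integral_pdv_eq_zero (hφ.smul_right hf) k
  have hc : Continuous (MaxwellPauli.pdv k f) :=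
    (hf.continuous_fderiv (by simp)).clm_apply continuous_const
  rw [pdv_smul hφ.differentiable hfd, integral_add] at h
  · exact eq_neg_of_add_eq_zero_left h
  · exact (hφ.continuous.smul hc).integrable_of_hasCompactSupport hφ.2.smul_right
  · exact ((hφ.pdv k).continuous.smul hf.continuous).integrable_of_hasCompactSupport
      (hφ.pdv k).2.smul_right

/-- The classical derivative of a test function is its weak derivative. -/
theorem VTest.hasWeakDeriv {f : Space → F} (hf : VTest f) (k : Fin 3) :
    HasWeakDeriv (e k) f (MaxwellPauli.pdv k f) := by
  refine ⟨hf.continuous.locallyIntegrable, (hf.pdv k).continuous.locallyIntegrable, fun φ hφ => ?_⟩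
  have := VTest.integral_smul_pdv (φ := φ) hφ hf.1 k
  rw [this, neg_neg]; rfl

end VTest

/-! ### Averages -/

section Average

variable {F : Type*} [NormedAddCommGroup F] [NormedSpace ℝ F]

/-- A smooth bump supported in the ball of radius `(n + 1)⁻¹`. -/
def bumpAt (n : ℕ) : ContDiffBump (0 : Space) :=
  ⟨1 / (2 * ((n : ℝ) + 1)), 1 / ((n : ℝ) + 1), by positivity,
    one_div_lt_one_div_of_lt (by positivity) (by linarith)⟩

/-- A smooth approximate identity. -/
def ker (n : ℕ) : Space → ℝ := (bumpAt n).normed volume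

/-- The probability measure with density `ker n`. -/
def kerMeasure (n : ℕ) : Measure Space := volume.withDensity fun x => ENNReal.ofReal (ker n x)

theorem ker_nonneg (n : ℕ) (x : Space) : 0 ≤ ker n x := (bumpAt n).nonneg_normed x

theorem ker_test (n : ℕ) : VTest (ker n) :=
  ⟨(bumpAt n).contDiff_normed, (bumpAt n).hasCompactSupport_normed⟩

theorem ker_neg (n : ℕ) (x : Space) : ker n (-x) = ker n x := (bumpAt n).normed_neg x

theorem ker_eq_zero {n : ℕ} {x : Space} (hx : 1 / ((n : ℝ) + 1) ≤ ‖x‖) : ker n x = 0 := by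
  by_contra h
  have : x ∈ Function.support ((bumpAt n).normed volume) := h
  rw [(bumpAt n).support_normed_eq, mem_ball_zero_iff] at this
  exact absurd this (not_lt.2 hx)

instance (n : ℕ) : IsProbabilityMeasure (kerMeasure n) where
  measure_univ := by
    rw [kerMeasure, withDensity_apply _ MeasurableSet.univ, Measure.restrict_univ,
      ← ofReal_integral_eq_lintegral_ofReal (f := ker n) (bumpAt n).integrable_normed
        (Eventually.of_forall fun x => ker_nonneg n x)]
    simp [ker, (bumpAt n).integral_normed]

/-- The average of `f` with respect to the kernel `ker n`. -/
def moll (n : ℕ) (f : Space → F) : Space → F := fun x => ∫ y, f (x - y) ∂kerMeasure n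

/-- As an integral against a probability measure the average obeys Jensen's inequality; as an
integral against a smooth kernel it is smooth and continuous under weak limits. Both readings are
used. -/
theorem moll_eq (n : ℕ) (f : Space → F) (x : Space) : moll n f x = ∫ y, ker n y • f (x - y) := by
  have hm : Measurable fun x => Real.toNNReal (ker n x) :=
    (ker_test n).continuous.measurable.real_toNNReal
  have := integral_withDensity_eq_integral_smul hm (μ := volume) (fun y => f (x - y))
  rw [moll, kerMeasure]
  refine (Eq.trans ?_ this).trans ?_
  · rfl
  · refine integral_congr_ae (Eventually.of_forall fun y => ?_)
    simp [NNReal.smul_def, Real.coe_toNNReal _ (ker_nonneg n y)]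

theorem moll_eq' (n : ℕ) (f : Space → F) (x : Space) : moll n f x = ∫ y, ker n (x - y) • f y := by
  rw [moll_eq, ← integral_sub_left_eq_self _ volume x]
  simp

theorem moll_eq_convolution (n : ℕ) (f : Space → F) :
    moll n f = MeasureTheory.convolution ((bumpAt n).normed volume) f
      (ContinuousLinearMap.lsmul ℝ ℝ) volume := by
  ext1 x
  rw [moll_eq, convolution_def]; rfl

theorem aestronglyMeasurable_sub_prod {F : Type*} [NormedAddCommGroup F] {f : Space → F} (hf : AEStronglyMeasurable f volume)
    (ν : Measure Space) [SFinite ν] :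
    AEStronglyMeasurable (fun p : Space × Space => f (p.1 - p.2)) (volume.prod ν) :=
  hf.comp_quasiMeasurePreserving (quasiMeasurePreserving_sub_of_right_invariant volume ν)

theorem ac_kerMeasure (n : ℕ) : kerMeasure n ≪ volume := withDensity_absolutelyContinuous _ _

theorem aestronglyMeasurable_sub_ker {F : Type*} [NormedAddCommGroup F] {f : Space → F} (hf : AEStronglyMeasurable f volume) (n : ℕ)
    (x : Space) : AEStronglyMeasurable (fun y => f (x - y)) (kerMeasure n) :=
  (hf.comp_quasiMeasurePreserving
    (Measure.measurePreserving_sub_left volume x).quasiMeasurePreserving).mono_ac (ac_kerMeasure n)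

theorem moll_aestronglyMeasurable {f : Space → F} (hf : AEStronglyMeasurable f volume) (n : ℕ) :
    AEStronglyMeasurable (moll n f) volume :=
  (aestronglyMeasurable_sub_prod hf (kerMeasure n)).integral_prod_right'

/-- Averaging does not increase the `L²` norm. -/
theorem eLpNorm_moll_le {f : Space → F} (hf : AEStronglyMeasurable f volume) (n : ℕ) :
    eLpNorm (moll n f) 2 volume ≤ eLpNorm f 2 volume := by
  have h : eLpNorm (moll n f) 2 volume ^ 2 ≤ eLpNorm f 2 volume ^ 2 := by
    rw [eLpNorm_two_sq, eLpNorm_two_sq]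
    calc ∫⁻ x, ‖moll n f x‖ₑ ^ 2 ≤ ∫⁻ x, ∫⁻ y, ‖f (x - y)‖ₑ ^ 2 ∂kerMeasure n :=
          lintegral_mono fun x => enorm_integral_sq_le (aestronglyMeasurable_sub_ker hf n x)
      _ = ∫⁻ y, ∫⁻ x, ‖f (x - y)‖ₑ ^ 2 ∂volume ∂kerMeasure n :=
          lintegral_lintegral_swap ((aestronglyMeasurable_sub_prod hf _).enorm.pow_const 2)
      _ = ∫⁻ _, ∫⁻ x, ‖f x‖ₑ ^ 2 ∂volume ∂kerMeasure n :=
          lintegral_congr fun y => lintegral_sub_right_eq_self (fun x => ‖f x‖ₑ ^ 2) y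
      _ = ∫⁻ x, ‖f x‖ₑ ^ 2 := by simp
  exact (ENNReal.pow_le_pow_left_iff two_ne_zero).1 h

/-- The outer radius of each bump is twice the inner one; this uniform ratio is what Lebesgue
differentiation requires. -/
theorem moll_tendsto_ae [CompleteSpace F] {f : Space → F} (hf : LocallyIntegrable f) :
    ∀ᵐ x, Tendsto (fun n => moll n f x) atTop (𝓝 (f x)) := by
  simp only [moll_eq_convolution]
  refine ContDiffBump.ae_convolution_tendsto_right_of_locallyIntegrable (K := 2) ?_ ?_ hf
  · exact tendsto_one_div_add_atTop_nhds_zero_nat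
  · refine Eventually.of_forall fun n => ?_
    simp only [bumpAt]
    apply le_of_eq
    field_simp

theorem moll_contDiff [CompleteSpace F] {f : Space → F} (hf : LocallyIntegrable f) (n : ℕ) :
    ContDiff ℝ (⊤ : ℕ∞) (moll n f) := by
  rw [moll_eq_convolution]
  exact (bumpAt n).hasCompactSupport_normed.contDiff_convolution_left _
    (bumpAt n).contDiff_normed hf

/-- Averages of a function with a weak derivative are differentiable. -/
theorem pdv_moll [CompleteSpace F] {f g : Space → F} {k : Fin 3} (h : HasWeakDeriv (e k) f g)
    (n : ℕ) : pdv k (moll n f) = moll n g := by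
  ext1 x
  have hd := HasCompactSupport.hasFDerivAt_convolution_left (ContinuousLinearMap.lsmul ℝ ℝ)
    (ker_test n).2 ((ker_test n).1.of_le (by simp)) h.1 x (μ := volume)
  have hτ : VTest (fun y => ker n (x - y)) := by
    have : (fun y => ker n (x - y)) = fun y => ker n (y + -x) := by
      ext1 y; rw [← ker_neg]; congr 1; abel
    rw [this]; exact (ker_test n).translate _
  -- The weak derivative is tested with `y ↦ ker n (x - y)`; differentiating in `y` instead of `x`
  -- accounts for the sign.
  have hw := h.2.2 _ hτ
  rw [moll_eq' n g, ← neg_neg (∫ y, ker n (x - y) • g y), ← hw, pdv, moll_eq_convolution,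
    ← ker, hd.fderiv, convolution_def, ContinuousLinearMap.integral_apply, ← integral_neg,
    ← integral_sub_left_eq_self _ volume x]
  · refine integral_congr_ae (Eventually.of_forall fun y => ?_)
    have h1 : pd (e k) (fun y => ker n (x - y)) y = -fderiv ℝ (ker n) (x - y) (e k) := by
      have := ((ker_test n).differentiable (x - y)).hasFDerivAt.comp y
        ((hasFDerivAt_const x y).sub (hasFDerivAt_id y))
      simp only [pd]
      rw [show (fun y => ker n (x - y)) = ker n ∘ HSub.hSub x from rfl, HasFDerivAt.fderiv this]
      simp
    simp only [h1, neg_smul, neg_neg, sub_sub_cancel]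
    rfl
  · have := HasCompactSupport.convolutionExists_left
      (ContinuousLinearMap.precompL Space (ContinuousLinearMap.lsmul ℝ ℝ : ℝ →L[ℝ] F →L[ℝ] F))
      ((bumpAt n).hasCompactSupport_normed (μ := volume) |>.fderiv ℝ)
      ((bumpAt n).contDiff_normed (n := 1) (μ := volume) |>.continuous_fderiv (by simp)) h.1 x (μ := volume)
    exact this

end Average

/-! ### The Sobolev inequality on `D¹` -/

section Sobolev

/-- The Gagliardo–Nirenberg–Sobolev inequality on `ℝ³` in the exponents `2` and `6`. -/
theorem exists_sobolev_fderiv : ∃ C : ℝ≥0, ∀ u : Space → ℝ, VTest u →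
    eLpNorm u 6 volume ≤ C * eLpNorm (fderiv ℝ u) 2 volume := by
  refine ⟨SNormLESNormFDerivOfEqConst ℝ (volume : Measure Space) 2, fun u hu => ?_⟩
  have := eLpNorm_le_eLpNorm_fderiv_of_eq (volume : Measure Space) (u := u) (p := 2) (p' := 6)
    (hu.1.of_le (by simp)) hu.2 (by norm_num) (by simp) (by simp; norm_num)
  exact_mod_cast this

/-- A smooth cutoff on the real line. -/
def lineBump : ContDiffBump (0 : ℝ) := ⟨1, 2, by norm_num, by norm_num⟩

/-- A smooth cutoff on `ℝ³`. -/
def spaceBump : ContDiffBump (0 : Space) := ⟨1, 2, by norm_num, by norm_num⟩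

/-- The cutoff at scale `R = n + 1`. -/
def cutoff (n : ℕ) (x : Space) : ℝ := spaceBump (((n : ℝ) + 1)⁻¹ • x)

theorem cutoff_test (n : ℕ) : VTest (cutoff n) := by
  have hn : ((n : ℝ) + 1)⁻¹ ≠ 0 := by positivity
  exact ⟨spaceBump.contDiff.comp (contDiff_id.const_smul _),
    spaceBump.hasCompactSupport.comp_homeomorph (Homeomorph.smulOfNeZero _ hn)⟩

theorem cutoff_nonneg (n : ℕ) (x : Space) : 0 ≤ cutoff n x := spaceBump.nonneg

theorem cutoff_le_one (n : ℕ) (x : Space) : cutoff n x ≤ 1 := spaceBump.le_one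

theorem cutoff_eq_one {n : ℕ} {x : Space} (hx : ‖x‖ ≤ (n : ℝ) + 1) : cutoff n x = 1 := by
  refine spaceBump.one_of_mem_closedBall ?_
  rw [mem_closedBall_zero_iff, norm_smul, Real.norm_of_nonneg (by positivity)]
  exact (inv_mul_le_one₀ (by positivity)).2 hx

theorem cutoff_tendsto (x : Space) : Tendsto (fun n => cutoff n x) atTop (𝓝 1) := by
  refine tendsto_const_nhds.congr' ?_
  filter_upwards [eventually_ge_atTop ⌈‖x‖⌉₊] with n hn
  rw [cutoff_eq_one]
  have : ‖x‖ ≤ n := (Nat.le_ceil _).trans (by exact_mod_cast hn)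
  linarith

theorem exists_fderiv_cutoff_le :
    ∃ C : ℝ, 0 ≤ C ∧ ∀ (n : ℕ) (x : Space), ‖fderiv ℝ (cutoff n) x‖ ≤ C / ((n : ℝ) + 1) := by
  have hc : Continuous (fderiv ℝ spaceBump) := spaceBump.contDiff.continuous_fderiv one_ne_zero
  obtain ⟨C, hC⟩ := hc.bounded_above_of_compact_support (spaceBump.hasCompactSupport.fderiv ℝ)
  refine ⟨C, (norm_nonneg _).trans (hC 0), fun n x => ?_⟩
  have : fderiv ℝ (cutoff n) x = ((n : ℝ) + 1)⁻¹ • fderiv ℝ spaceBump (((n : ℝ) + 1)⁻¹ • x) :=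
    fderiv_comp_smul _
  rw [this, norm_smul, Real.norm_of_nonneg (by positivity), div_eq_inv_mul]
  exact mul_le_mul_of_nonneg_left (hC _) (by positivity)

/-- A smooth bounded truncation of the identity that vanishes near `0`. -/
def trunc (n : ℕ) (y : ℝ) : ℝ :=
  y * (1 - lineBump (((n : ℝ) + 1) * y)) * lineBump (((n : ℝ) + 1)⁻¹ * y)

theorem trunc_contDiff (n : ℕ) : ContDiff ℝ (⊤ : ℕ∞) (trunc n) := by
  unfold trunc
  have h : ContDiff ℝ (⊤ : ℕ∞) (lineBump : ℝ → ℝ) := lineBump.contDiff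
  exact (contDiff_id.mul (contDiff_const.sub (h.comp (contDiff_const.mul contDiff_id)))).mul
    (h.comp (contDiff_const.mul contDiff_id))

theorem trunc_eq_zero {n : ℕ} {y : ℝ} (hy : |y| ≤ ((n : ℝ) + 1)⁻¹) : trunc n y = 0 := by
  have : lineBump (((n : ℝ) + 1) * y) = 1 := by
    refine lineBump.one_of_mem_closedBall ?_
    rw [mem_closedBall_zero_iff, norm_mul, Real.norm_of_nonneg (by positivity), Real.norm_eq_abs]
    calc ((n : ℝ) + 1) * |y| ≤ ((n : ℝ) + 1) * ((n : ℝ) + 1)⁻¹ := by gcongr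
      _ = 1 := mul_inv_cancel₀ (by positivity)
  simp [trunc, this]

theorem abs_trunc_le (n : ℕ) (y : ℝ) : |trunc n y| ≤ 2 * ((n : ℝ) + 1) := by
  have h1 : |1 - lineBump (((n : ℝ) + 1) * y)| ≤ 1 := by
    rw [abs_le]; constructor <;> linarith [lineBump.nonneg (x := ((n : ℝ) + 1) * y),
      lineBump.le_one (x := ((n : ℝ) + 1) * y)]
  by_cases hy : 2 * ((n : ℝ) + 1) ≤ |y|
  · have : lineBump (((n : ℝ) + 1)⁻¹ * y) = 0 := by
      refine lineBump.zero_of_le_dist ?_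
      rw [dist_zero_right, norm_mul, Real.norm_of_nonneg (by positivity), Real.norm_eq_abs,
        ← div_eq_inv_mul, le_div_iff₀ (by positivity)]
      exact hy
    simp only [trunc, this, mul_zero, abs_zero]; positivity
  · push Not at hy
    rw [trunc, abs_mul, abs_mul, abs_of_nonneg (lineBump.nonneg (x := ((n : ℝ) + 1)⁻¹ * y))]
    calc _ ≤ |y| * 1 * 1 := by
          gcongr
          · exact lineBump.nonneg
          · exact lineBump.le_one
      _ ≤ _ := by linarith

theorem trunc_tendsto (y : ℝ) : Tendsto (fun n => trunc n y) atTop (𝓝 y) := by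
  rcases eq_or_ne y 0 with rfl | hy
  · simp [trunc]
  refine tendsto_const_nhds.congr' ?_
  have hy' : 0 < |y| := abs_pos.2 hy
  filter_upwards [eventually_ge_atTop ⌈|y|⌉₊, eventually_ge_atTop ⌈2 / |y|⌉₊] with n h1 h2
  have h1' : |y| ≤ n := (Nat.le_ceil _).trans (by exact_mod_cast h1)
  have h2' : 2 / |y| ≤ n := (Nat.le_ceil _).trans (by exact_mod_cast h2)
  have e1 : lineBump (((n : ℝ) + 1) * y) = 0 := by
    refine lineBump.zero_of_le_dist ?_
    rw [dist_zero_right, norm_mul, Real.norm_of_nonneg (by positivity), Real.norm_eq_abs]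
    rw [div_le_iff₀ hy'] at h2'
    change (2 : ℝ) ≤ _
    nlinarith
  have e2 : lineBump (((n : ℝ) + 1)⁻¹ * y) = 1 := by
    refine lineBump.one_of_mem_closedBall ?_
    rw [mem_closedBall_zero_iff, norm_mul, Real.norm_of_nonneg (by positivity), Real.norm_eq_abs]
    exact (inv_mul_le_one₀ (by positivity)).2 (by linarith)
  simp [trunc, e1, e2]

/-- The bound is uniform in `n`: up to bounded factors, both scales enter the derivative only
through `z β'(z)`, with `β` the bump on the line, and this function is bounded. -/
theorem exists_deriv_trunc_le : ∃ C : ℝ, 0 ≤ C ∧ ∀ (n : ℕ) (y : ℝ), |deriv (trunc n) y| ≤ C := by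
  have hb : ContDiff ℝ (⊤ : ℕ∞) (lineBump : ℝ → ℝ) := lineBump.contDiff
  have hc : Continuous fun z => z * deriv lineBump z :=
    continuous_id.mul (hb.continuous_deriv (by simp))
  have hs : HasCompactSupport fun z => z * deriv lineBump z := by
    have : HasCompactSupport (deriv lineBump) := lineBump.hasCompactSupport.deriv
    exact this.mul_left
  obtain ⟨M, hM⟩ := hc.bounded_above_of_compact_support hs
  have hM0 : 0 ≤ M := (norm_nonneg _).trans (hM 0)
  refine ⟨1 + 2 * M, by positivity, fun n y => ?_⟩
  set a : ℝ := (n : ℝ) + 1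
  have ha : 0 < a := by positivity
  have hd : ∀ c z : ℝ, HasDerivAt (fun y => lineBump (c * y)) (deriv lineBump (c * z) * c) z := by
    intro c z
    have h1 : HasDerivAt lineBump (deriv lineBump (c * z)) (c * z) :=
      ((hb.differentiable (by simp)) _).hasDerivAt
    have h2 : HasDerivAt (fun y => c * y) c z := by
      simpa using (hasDerivAt_id z).const_mul c
    exact h1.comp z h2
  have h := (((hasDerivAt_id y).mul ((hd a y).const_sub 1)).mul (hd a⁻¹ y)).deriv
  have h' : deriv (trunc n) y = (1 * (1 - lineBump (a * y)) +
      y * -(deriv lineBump (a * y) * a)) * lineBump (a⁻¹ * y) +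
      y * (1 - lineBump (a * y)) * (deriv lineBump (a⁻¹ * y) * a⁻¹) := h
  have hβ : ∀ z, |(lineBump z : ℝ)| ≤ 1 := fun z => by
    rw [abs_of_nonneg lineBump.nonneg]; exact lineBump.le_one
  have hβ' : ∀ z, |1 - (lineBump z : ℝ)| ≤ 1 := fun z => by
    rw [abs_le]; constructor <;> linarith [lineBump.nonneg (x := z), lineBump.le_one (x := z)]
  have e1 : |y * -(deriv lineBump (a * y) * a)| ≤ M := by
    have := hM (a * y)
    rw [Real.norm_eq_abs] at this
    rw [mul_neg, abs_neg]
    convert this using 2; ring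
  have e2 : |y * (deriv lineBump (a⁻¹ * y) * a⁻¹)| ≤ M := by
    have := hM (a⁻¹ * y)
    rw [Real.norm_eq_abs] at this
    convert this using 2; ring
  rw [h']
  have f1 : |(1 * (1 - lineBump (a * y)) + y * -(deriv lineBump (a * y) * a)) *
      lineBump (a⁻¹ * y)| ≤ (1 + M) * 1 := by
    rw [abs_mul]
    refine mul_le_mul ((abs_add_le _ _).trans (add_le_add ?_ e1)) (hβ _) (abs_nonneg _)
      (by positivity)
    rw [one_mul]; exact hβ' _
  have f2 : |y * (1 - lineBump (a * y)) * (deriv lineBump (a⁻¹ * y) * a⁻¹)| ≤ 1 * M := by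
    rw [mul_comm y, mul_assoc, abs_mul]
    exact mul_le_mul (hβ' _) e2 (abs_nonneg _) (by positivity)
  refine (abs_add_le _ _).trans ?_
  linarith

theorem eLpNorm_fderiv_moll_le {f : Space → ℝ} {G : Fin 3 → Space → ℝ} (h : HasL2Gradient f G)
    (n : ℕ) : eLpNorm (fderiv ℝ (moll n f)) 2 volume ≤ ∑ k, eLpNorm (G k) 2 volume := by
  have hle : ∀ x, ‖fderiv ℝ (moll n f) x‖ ≤ ∑ k, ‖moll n (G k) x‖ := by
    intro x
    refine (norm_clm_le _).trans (le_of_eq (Finset.sum_congr rfl fun k _ => ?_))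
    rw [← pdv_moll (h k).1]; rfl
  refine (eLpNorm_mono_real hle).trans ?_
  have : (fun x => ∑ k, ‖moll n (G k) x‖) = ∑ k, fun x => ‖moll n (G k) x‖ := by
    ext1 x; simp
  rw [this]
  refine (eLpNorm_sum_le (fun k _ =>
    (moll_aestronglyMeasurable (h k).2.1 n).norm) (by norm_num)).trans ?_
  refine Finset.sum_le_sum fun k _ => ?_
  rw [eLpNorm_norm]
  exact eLpNorm_moll_le (h k).2.1 n

/-- The Sobolev inequality for functions in `D¹`, without the optimal constant. -/
theorem exists_sobolev_D1 : ∃ C : ℝ≥0, ∀ (f : Space → ℝ) (G : Fin 3 → Space → ℝ), MemD1 f →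
    HasL2Gradient f G → eLpNorm f 6 volume ≤ C * ∑ k, eLpNorm (G k) 2 volume := by
  obtain ⟨C₀, hC₀⟩ := exists_sobolev_fderiv
  obtain ⟨T, hT0, hT⟩ := exists_deriv_trunc_le
  obtain ⟨M, hM0, hM⟩ := exists_fderiv_cutoff_le
  refine ⟨C₀ * T.toNNReal, fun f G hf hG => ?_⟩
  set D := ∑ k, eLpNorm (G k) 2 volume
  have hfm : AEStronglyMeasurable f volume := hf.1.aestronglyMeasurable
  -- Three parameters are removed one after the other: the averaging index `i` at fixed cutoff and
  -- truncation, then the cutoff radius `R`, and finally the truncation level `n`.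
  have bound_average : ∀ R n i : ℕ, eLpNorm (fun x => cutoff R x * trunc n (moll i f x)) 6 volume ≤
      C₀ * (ENNReal.ofReal T * D +
        eLpNorm (fun x => ‖fderiv ℝ (cutoff R) x‖ * |trunc n (moll i f x)|) 2 volume) := by
    intro R n i
    have hs : ContDiff ℝ (⊤ : ℕ∞) (moll i f) := moll_contDiff hf.1 i
    have ht : ContDiff ℝ (⊤ : ℕ∞) fun x => trunc n (moll i f x) := (trunc_contDiff n).comp hs
    refine (hC₀ _ ((cutoff_test R).smul_right ht)).trans ?_
    gcongr
    have hle : ∀ x, ‖fderiv ℝ (fun x => cutoff R x • trunc n (moll i f x)) x‖ ≤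
        T * ‖fderiv ℝ (moll i f) x‖ + ‖fderiv ℝ (cutoff R) x‖ * |trunc n (moll i f x)| := by
      intro x
      rw [fderiv_fun_smul ((cutoff_test R).differentiable x) (ht.differentiable (by simp) x)]
      refine (norm_add_le _ _).trans (add_le_add ?_ ?_)
      · have hd : HasDerivAt (trunc n) (deriv (trunc n) (moll i f x)) (moll i f x) :=
          ((trunc_contDiff n).differentiable (by simp) _).hasDerivAt
        have := (hd.comp_hasFDerivAt x (hs.differentiable (by simp) x).hasFDerivAt).fderiv
        rw [show (fun x => trunc n (moll i f x)) = trunc n ∘ moll i f from rfl, this, norm_smul,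
          norm_smul, Real.norm_of_nonneg (cutoff_nonneg _ _)]
        calc _ ≤ 1 * (T * ‖fderiv ℝ (moll i f) x‖) := by
              gcongr
              · exact cutoff_le_one R x
              · exact hT n _
          _ = _ := one_mul _
      · rw [ContinuousLinearMap.norm_smulRight_apply]; rfl
    refine (eLpNorm_mono_real hle).trans ((eLpNorm_add_le ?_ ?_ (by norm_num)).trans ?_)
    · exact (continuous_const.mul (hs.continuous_fderiv (by simp)).norm).aestronglyMeasurable
    · exact (((cutoff_test R).1.continuous_fderiv (by simp)).norm.mul
        ht.continuous.abs).aestronglyMeasurable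
    · gcongr
      have := eLpNorm_const_smul T (fun x => ‖fderiv ℝ (moll i f) x‖) 2 (volume : Measure Space)
      rw [show (fun x => T * ‖fderiv ℝ (moll i f) x‖) = T • fun x => ‖fderiv ℝ (moll i f) x‖ from
        rfl, this, eLpNorm_norm, Real.enorm_of_nonneg hT0]
      gcongr
      exact eLpNorm_fderiv_moll_le hG i
  have bound_cutoff : ∀ R n : ℕ, eLpNorm (fun x => cutoff R x * trunc n (f x)) 6 volume ≤
      C₀ * (ENNReal.ofReal T * D +
        eLpNorm (fun x => ‖fderiv ℝ (cutoff R) x‖ * |trunc n (f x)|) 2 volume) := by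
    intro R n
    have hae := moll_tendsto_ae hf.1
    have htc : Continuous (trunc n) := (trunc_contDiff n).continuous
    have hmm : ∀ i, AEStronglyMeasurable (fun x => cutoff R x * trunc n (moll i f x)) volume :=
      fun i => ((cutoff_test R).continuous.mul
        (htc.comp (moll_contDiff hf.1 i).continuous)).aestronglyMeasurable
    refine (Lp.eLpNorm_lim_le_liminf_eLpNorm hmm _ ?_).trans ?_
    · filter_upwards [hae] with x hx
      exact tendsto_const_nhds.mul ((htc.tendsto _).comp hx)
    have hlim : Tendsto (fun i => eLpNorm (fun x => ‖fderiv ℝ (cutoff R) x‖ *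
        |trunc n (moll i f x)|) 2 volume) atTop
        (𝓝 (eLpNorm (fun x => ‖fderiv ℝ (cutoff R) x‖ * |trunc n (f x)|) 2 volume)) := by
      have h2 : ∀ g : Space → ℝ, eLpNorm g 2 volume = (∫⁻ x, ‖g x‖ₑ ^ 2) ^ (1 / 2 : ℝ) := by
        intro g
        rw [← eLpNorm_two_sq, ← ENNReal.rpow_natCast, ← ENNReal.rpow_mul]; norm_num
      simp only [h2]
      refine (ENNReal.continuous_rpow_const.tendsto _).comp ?_
      refine tendsto_lintegral_of_dominated_convergence'
        (fun x => ‖‖fderiv ℝ (cutoff R) x‖ * (2 * ((n : ℝ) + 1))‖ₑ ^ 2) ?_ ?_ ?_ ?_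
      · intro i
        exact (((cutoff_test R).1.continuous_fderiv (by simp)).norm.mul
          (htc.comp (moll_contDiff hf.1 i).continuous).abs).aestronglyMeasurable.enorm.pow_const 2
      · intro i
        refine Eventually.of_forall fun x => ?_
        refine pow_le_pow_left' (enorm_le_iff_norm_le.2 ?_) 2
        rw [norm_mul, norm_mul, Real.norm_eq_abs |trunc n _|, abs_abs,
          Real.norm_of_nonneg (r := 2 * _) (by positivity)]
        exact mul_le_mul_of_nonneg_left (abs_trunc_le n _) (norm_nonneg _)
      · rw [← eLpNorm_two_sq]
        have : MemLp (fun x => ‖fderiv ℝ (cutoff R) x‖ * (2 * ((n : ℝ) + 1))) 2 volume := by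
          refine Continuous.memLp_of_hasCompactSupport ?_ ?_
          · exact ((cutoff_test R).1.continuous_fderiv (by simp)).norm.mul continuous_const
          · exact HasCompactSupport.mul_right ((cutoff_test R).2.fderiv ℝ).norm
        exact ENNReal.pow_ne_top this.2.ne
      · filter_upwards [hae] with x hx
        refine ((ENNReal.continuous_pow 2).tendsto _).comp ?_
        refine (continuous_enorm.tendsto _).comp ?_
        exact tendsto_const_nhds.mul ((htc.abs.tendsto _).comp hx)
    refine (liminf_le_liminf (Eventually.of_forall fun i => bound_average R n i)).trans_eq ?_
    refine Tendsto.liminf_eq ?_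
    refine ENNReal.Tendsto.const_mul (tendsto_const_nhds.add hlim) (Or.inr (by simp))
  have bound_trunc : ∀ n : ℕ, eLpNorm (fun x => trunc n (f x)) 6 volume ≤
      C₀ * (ENNReal.ofReal T * D) := by
    intro n
    have htc : Continuous (trunc n) := (trunc_contDiff n).continuous
    have htm : AEStronglyMeasurable (fun x => trunc n (f x)) volume :=
      htc.comp_aestronglyMeasurable hfm
    -- Vanishing at infinity enters here. The truncation discards small values, so the truncated
    -- function is bounded with support of finite measure, hence square integrable; the gradient of
    -- the cutoff, of size `1/(R + 1)`, then costs nothing in the limit.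
    have hL2 : MemLp (fun x => trunc n (f x)) 2 volume := by
      have hbd : MemLp (fun x => trunc n (f x)) ∞ volume :=
        memLp_top_of_bound htm (2 * ((n : ℝ) + 1))
          (Eventually.of_forall fun x => abs_trunc_le n (f x))
      refine hbd.mono_exponent_of_measure_support_ne_top (s := {x | ((n : ℝ) + 1)⁻¹ < ‖f x‖})
        (fun x hx => trunc_eq_zero (not_lt.1 hx)) ?_ le_top
      exact (hf.2.1 _ (by positivity)).ne
    refine (Lp.eLpNorm_lim_le_liminf_eLpNorm (f := fun R x => cutoff R x * trunc n (f x))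
      (fun R => (cutoff_test R).continuous.aestronglyMeasurable.mul htm) _ ?_).trans ?_
    · refine Eventually.of_forall fun x => ?_
      simpa using (cutoff_tendsto x).mul_const (trunc n (f x))
    refine (liminf_le_liminf (Eventually.of_forall fun R => (bound_cutoff R n).trans
      (b := _) (c := C₀ * (ENNReal.ofReal T * D + ENNReal.ofReal (M / ((R : ℝ) + 1)) *
        eLpNorm (fun x => trunc n (f x)) 2 volume)) ?_)).trans_eq ?_
    · gcongr
      rw [← Real.enorm_of_nonneg (by positivity : 0 ≤ M / ((R : ℝ) + 1)), ← eLpNorm_const_smul]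
      refine eLpNorm_mono fun x => ?_
      rw [Pi.smul_apply, norm_smul, norm_mul, norm_norm, Real.norm_of_nonneg (r := M / _)
        (by positivity)]
      simp only [Real.norm_eq_abs, abs_abs]
      gcongr
      exact hM R x
    · refine Tendsto.liminf_eq ?_
      have h0 : Tendsto (fun R : ℕ => ENNReal.ofReal (M / ((R : ℝ) + 1))) atTop (𝓝 0) := by
        rw [← ENNReal.ofReal_zero]
        refine ENNReal.tendsto_ofReal ?_
        simpa [div_eq_mul_one_div M] using
          (tendsto_one_div_add_atTop_nhds_zero_nat (𝕜 := ℝ)).const_mul M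
      have h1 := ENNReal.Tendsto.mul_const (b := eLpNorm (fun x => trunc n (f x)) 2 volume) h0
        (Or.inr hL2.2.ne)
      have h2 := ENNReal.Tendsto.const_mul (a := (C₀ : ℝ≥0∞))
        ((tendsto_const_nhds (x := ENNReal.ofReal T * D)).add h1) (Or.inr (by simp))
      simpa using h2
  refine (Lp.eLpNorm_lim_le_liminf_eLpNorm (f := fun n x => trunc n (f x))
    (fun n => (trunc_contDiff n).continuous.comp_aestronglyMeasurable hfm) _
    (Eventually.of_forall fun x => trunc_tendsto (f x))).trans ?_
  refine (liminf_le_liminf (Eventually.of_forall bound_trunc)).trans ?_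
  simp only [liminf_const]
  rw [← mul_assoc]
  push_cast
  rfl

/-- The optimal constant is attained as a bound for test functions. -/
theorem sobolevConst_spec : 0 ≤ sobolevConst ∧ ∀ (f : Space → ℝ), VTest f →
    eLpNorm f 6 volume ≤ ENNReal.ofReal sobolevConst *
      eLpNorm (fun x => (WithLp.toLp 2 (fun k => pdv k f x) : Space)) 2 volume := by
  set S := {K : ℝ | 0 ≤ K ∧ ∀ (f : Space → ℝ) (G : Fin 3 → Space → ℝ),
    MemD1 f → HasL2Gradient f G →
      eLpNorm f 6 volume ≤
        ENNReal.ofReal K *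
          eLpNorm (fun x => (WithLp.toLp 2 (fun k => G k x) : Space)) 2 volume} with hS
  have hdef : sobolevConst = sInf S := rfl
  have hbdd : BddBelow S := ⟨0, fun K hK => hK.1⟩
  -- Without this the infimum could be the default value of `sInf`. The factor 3 passes from the sum
  -- of the norms of the partial derivatives to the norm of the gradient.
  have hne : S.Nonempty := by
    obtain ⟨C, hC⟩ := exists_sobolev_D1
    refine ⟨C * 3, by positivity, fun f G hf hG => (hC f G hf hG).trans ?_⟩
    rw [ENNReal.ofReal_mul (by positivity), ENNReal.ofReal_coe_nnreal, mul_assoc]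
    gcongr
    have : ∀ k, eLpNorm (G k) 2 volume ≤
        eLpNorm (fun x => (WithLp.toLp 2 (fun k => G k x) : Space)) 2 volume := fun k =>
      eLpNorm_mono fun x =>
        PiLp.norm_apply_le (WithLp.toLp 2 (fun k => G k x) : Space) k
    calc _ ≤ ∑ _k : Fin 3, _ := Finset.sum_le_sum fun k _ => this k
      _ = _ := by simp
  refine ⟨hdef ▸ le_csInf hne fun K hK => hK.1, fun f hf => ?_⟩
  have hD : MemD1 f := by
    refine ⟨hf.continuous.locallyIntegrable, fun t ht => ?_, (pdv · f), fun k =>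
      ⟨hf.hasWeakDeriv k, (hf.pdv k).memLp 2⟩⟩
    refine lt_of_le_of_lt (measure_mono fun x hx => ?_) hf.2.isCompact.measure_lt_top
    refine subset_tsupport f fun h0 => ?_
    simp only [Set.mem_ofPred_eq, h0, norm_zero] at hx
    linarith
  have hG : HasL2Gradient f (pdv · f) := fun k => ⟨hf.hasWeakDeriv k, (hf.pdv k).memLp 2⟩
  have hcont : Tendsto (fun n : ℕ => ENNReal.ofReal (sobolevConst + 1 / ((n : ℝ) + 1)) *
      eLpNorm (fun x => (WithLp.toLp 2 (fun k => pdv k f x) : Space)) 2 volume) atTop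
      (𝓝 (ENNReal.ofReal sobolevConst *
      eLpNorm (fun x => (WithLp.toLp 2 (fun k => pdv k f x) : Space)) 2 volume)) := by
    refine ENNReal.Tendsto.mul_const (ENNReal.tendsto_ofReal ?_) (Or.inr ?_)
    · simpa using (tendsto_one_div_add_atTop_nhds_zero_nat (𝕜 := ℝ)).const_add sobolevConst
    · have : MemLp (fun x => (WithLp.toLp 2 (fun k => pdv k f x) : Space)) 2 volume :=
        MemLp.of_eval_piLp fun k => (hf.pdv k).memLp 2
      exact this.2.ne
  refine ge_of_tendsto' hcont fun n => ?_
  obtain ⟨K, hK, hlt⟩ := exists_lt_of_csInf_lt hne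
    (show sInf S < sobolevConst + 1 / ((n : ℝ) + 1) by rw [hdef]; simp; positivity)
  refine (hK.2 f _ hD hG).trans ?_
  gcongr

end Sobolev

/-! ### The diamagnetic inequality for test functions -/

section GradNorm

variable {F : Type*} [NormedAddCommGroup F]

/-- The `L²` norm of a triple of functions. -/
def gradNorm (G : Fin 3 → Space → F) : ℝ := √(∑ k, lpNorm (G k) 2 volume ^ 2)

theorem gradNorm_nonneg (G : Fin 3 → Space → F) : 0 ≤ gradNorm G := Real.sqrt_nonneg _

theorem sq_gradNorm (G : Fin 3 → Space → F) : gradNorm G ^ 2 = ∑ k, lpNorm (G k) 2 volume ^ 2 :=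
  Real.sq_sqrt (by positivity)

theorem sq_gradNorm_eq_integral {G : Fin 3 → Space → F} (hG : ∀ k, MemLp (G k) 2 volume) :
    gradNorm G ^ 2 = ∫ x, ∑ k, ‖G k x‖ ^ 2 := by
  rw [sq_gradNorm, integral_finsetSum _ fun k _ => (hG k).integrable_norm_pow two_ne_zero]
  exact Finset.sum_congr rfl fun k _ => sq_lpNorm_two (hG k).1

theorem lpNorm_le_gradNorm (G : Fin 3 → Space → F) (k : Fin 3) :
    lpNorm (G k) 2 volume ≤ gradNorm G := by
  refine Real.le_sqrt_of_sq_le ?_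
  exact Finset.single_le_sum (f := fun k => lpNorm (G k) 2 volume ^ 2)
    (fun k _ => by positivity) (Finset.mem_univ k)

theorem tendsto_gradNorm {G : ℕ → Fin 3 → Space → F} {H : Fin 3 → Space → F}
    (h : ∀ k, Tendsto (fun n => lpNorm (G n k) 2 volume) atTop (𝓝 (lpNorm (H k) 2 volume))) :
    Tendsto (fun n => gradNorm (G n)) atTop (𝓝 (gradNorm H)) :=
  (Real.continuous_sqrt.tendsto _).comp (tendsto_finsetSum _ fun k _ => (h k).pow 2)

theorem gradNorm_zero : gradNorm (fun _ _ => 0 : Fin 3 → Space → F) = 0 := by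
  simp [gradNorm]

theorem eLpNorm_toLp_eq {g : Fin 3 → Space → ℝ} (hg : ∀ k, MemLp (g k) 2 volume) :
    eLpNorm (fun x => (WithLp.toLp 2 (fun k => g k x) : Space)) 2 volume =
      ENNReal.ofReal (gradNorm g) := by
  have hm : MemLp (fun x => (WithLp.toLp 2 (fun k => g k x) : Space)) 2 volume :=
    MemLp.of_eval_piLp fun k => hg k
  rw [← ofReal_lpNorm hm]
  congr 1
  rw [← sq_eq_sq₀ lpNorm_nonneg (gradNorm_nonneg _), sq_lpNorm_two hm.1, sq_gradNorm_eq_integral hg]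
  exact integral_congr_ae (Eventually.of_forall fun x => by
    simp [EuclideanSpace.norm_sq_eq])

theorem sub_lpNorm_le {p : ℝ≥0∞} (hp : 1 ≤ p) {f g : Space → F} (hf : MemLp f p volume)
    (hg : MemLp g p volume) :
    |lpNorm f p volume - lpNorm g p volume| ≤ lpNorm (fun x => f x - g x) p volume := by
  rw [abs_le]
  constructor
  · have := lpNorm_add_le (f := fun x => f x - g x) (g := fun x => -f x) (hf.sub hg) hp
    have e : ((fun x => f x - g x) + fun x => -f x) = -g := by
      ext1 x; simp only [Pi.add_apply, Pi.neg_apply]; abel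
    have e' : lpNorm (fun x => -f x) p volume = lpNorm f p volume := lpNorm_neg f p volume
    rw [e, lpNorm_neg, e'] at this
    linarith
  · have := lpNorm_add_le (f := fun x => f x - g x) (g := g) (hf.sub hg) hp
    have e : ((fun x => f x - g x) + g) = f := by ext1 x; simp
    rw [e] at this
    linarith

theorem tendsto_lpNorm_of_sub {p : ℝ≥0∞} (hp : 1 ≤ p) {f : ℕ → Space → F} {g : Space → F}
    (hf : ∀ n, MemLp (f n) p volume) (hg : MemLp g p volume)
    (h : Tendsto (fun n => lpNorm (fun x => g x - f n x) p volume) atTop (𝓝 0)) :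
    Tendsto (fun n => lpNorm (f n) p volume) atTop (𝓝 (lpNorm g p volume)) := by
  rw [tendsto_iff_dist_tendsto_zero]
  refine squeeze_zero (fun _ => dist_nonneg) (fun n => ?_) h
  rw [dist_comm, Real.dist_eq]
  exact sub_lpNorm_le hp hg (hf n)

end GradNorm

section Diamagnetic

variable {F : Type*} [NormedAddCommGroup F] [InnerProductSpace ℝ F]

/-- The regularized modulus `√(|f|² + δ²) - δ`. -/
def regNorm (δ : ℝ) (f : Space → F) : Space → ℝ := fun x => √(‖f x‖ ^ 2 + δ ^ 2) - δ

theorem regNorm_test {δ : ℝ} (hδ : 0 < δ) {f : Space → F} (hf : VTest f) :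
    VTest (regNorm δ f) := by
  refine ⟨((hf.1.norm_sq ℝ).add contDiff_const |>.sqrt fun x => by positivity).sub contDiff_const,
    ?_⟩
  refine hf.2.comp_left (g := fun y : F => √(‖y‖ ^ 2 + δ ^ 2) - δ) ?_
  simp [Real.sqrt_sq hδ.le]

theorem pdv_regNorm {δ : ℝ} (hδ : 0 < δ) {f : Space → F} (hf : VTest f) (k : Fin 3) (x : Space) :
    pdv k (regNorm δ f) x = inner ℝ (f x) (pdv k f x) / √(‖f x‖ ^ 2 + δ ^ 2) := by
  have hd := (hf.differentiable x).hasFDerivAt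
  have h1 := (((hd.norm_sq).add_const (δ ^ 2)).sqrt (by positivity)).sub_const δ
  have h2 : fderiv ℝ (regNorm δ f) x = _ := h1.fderiv
  simp only [pdv, h2]
  simp
  ring

/-- The Sobolev inequality for vector-valued test functions, with the gradient of the modulus
estimated by arbitrary functions. -/
theorem diamagnetic_test {f : Space → F} (hf : VTest f) {g : Fin 3 → Space → ℝ}
    (hg : ∀ k, MemLp (g k) 2 volume)
    (h : ∀ k x, |inner ℝ (f x) (pdv k f x)| ≤ ‖f x‖ * g k x) :
    eLpNorm f 6 volume ≤ ENNReal.ofReal (sobolevConst * gradNorm g) := by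
  -- The modulus is not smooth at zeros of `f`, so the scalar inequality is applied to `regNorm δ f`
  -- with `δ = 1/(n + 1)`. Its partial derivatives are bounded by `g k` because the denominator
  -- `√(|f|² + δ²)` is at least `|f|`.
  have hb : ∀ n : ℕ, eLpNorm (regNorm (1 / ((n : ℝ) + 1)) f) 6 volume ≤
      ENNReal.ofReal (sobolevConst * gradNorm g) := by
    intro n
    have hδ : (0 : ℝ) < 1 / ((n : ℝ) + 1) := by positivity
    refine (sobolevConst_spec.2 _ (regNorm_test hδ hf)).trans ?_
    rw [ENNReal.ofReal_mul sobolevConst_spec.1, ← eLpNorm_toLp_eq hg]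
    gcongr
    refine eLpNorm_mono fun x => ?_
    rw [EuclideanSpace.norm_eq, EuclideanSpace.norm_eq]
    refine Real.sqrt_le_sqrt (Finset.sum_le_sum fun k _ => ?_)
    have hs : 0 < √(‖f x‖ ^ 2 + (1 / ((n : ℝ) + 1)) ^ 2) := by positivity
    have hle : ‖f x‖ ≤ √(‖f x‖ ^ 2 + (1 / ((n : ℝ) + 1)) ^ 2) :=
      Real.le_sqrt_of_sq_le (by nlinarith)
    refine pow_le_pow_left₀ (norm_nonneg _) ?_ 2
    simp only [pdv_regNorm hδ hf, Real.norm_eq_abs, abs_div, abs_of_pos hs]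
    rw [div_le_iff₀ hs]
    calc _ ≤ ‖f x‖ * g k x := h k x
      _ ≤ ‖f x‖ * |g k x| := by gcongr; exact le_abs_self _
      _ ≤ _ := by rw [mul_comm]; gcongr
  have := (memLp_of_tendsto_ae (g := fun x => ‖f x‖)
    (fun n : ℕ => (regNorm_test (δ := 1 / ((n : ℝ) + 1)) (by positivity)
      hf).continuous.aestronglyMeasurable) hb tendsto_const_nhds
    (Eventually.of_forall fun x => ?_)).2
  · rwa [eLpNorm_norm] at this
  · have h0 : Tendsto (fun n : ℕ => 1 / ((n : ℝ) + 1)) atTop (𝓝 0) :=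
      tendsto_one_div_add_atTop_nhds_zero_nat
    have hc : Continuous fun δ : ℝ => √(‖f x‖ ^ 2 + δ ^ 2) - δ := by fun_prop
    have := (hc.tendsto 0).comp h0
    simpa [regNorm, Function.comp_def] using this

/-- Passing to the modulus reduces the vector-valued case to the real-valued one, so that the same
optimal constant appears. -/
theorem sobolev_test {f : Space → F} (hf : VTest f) :
    eLpNorm f 6 volume ≤ ENNReal.ofReal (sobolevConst * gradNorm (pdv · f)) := by
  have := diamagnetic_test hf (g := fun k x => ‖pdv k f x‖) (fun k => ((hf.pdv k).memLp 2).norm)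
    fun k x => abs_real_inner_le_norm _ _
  refine this.trans_eq ?_
  simp only [gradNorm]
  congr 4
  ext1 k
  rw [← lpNorm_norm ((hf.pdv k).memLp 2).1]

end Diamagnetic

/-! ### Sobolev pairs -/

section Adm

variable {F : Type*} [NormedAddCommGroup F] [NormedSpace ℝ F]

/-- `f ∈ Lᵖ` with gradient `G ∈ L²`, in the closure of the test functions. -/
def Adm (p : ℝ≥0∞) (f : Space → F) (G : Fin 3 → Space → F) : Prop :=
  MemLp f p volume ∧ (∀ k, MemLp (G k) 2 volume) ∧
    ∀ ε : ℝ, 0 < ε → ∃ φ : Space → F, VTest φ ∧ lpNorm (fun x => f x - φ x) p volume ≤ ε ∧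
      ∀ k, lpNorm (fun x => G k x - pdv k φ x) 2 volume ≤ ε

variable {p : ℝ≥0∞} {f g : Space → F} {G H : Fin 3 → Space → F}

theorem VTest.adm (hf : VTest f) (p : ℝ≥0∞) : Adm p f (MaxwellPauli.pdv · f) :=
  ⟨hf.memLp p, fun k => (hf.pdv k).memLp 2, fun ε hε => ⟨f, hf, by simpa using hε.le,
    fun k => by simpa using hε.le⟩⟩

namespace Adm

theorem exists_seq (h : Adm p f G) : ∃ φ : ℕ → Space → F, (∀ n, VTest (φ n)) ∧
    Tendsto (fun n => lpNorm (fun x => f x - φ n x) p volume) atTop (𝓝 0) ∧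
    ∀ k, Tendsto (fun n => lpNorm (fun x => G k x - pdv k (φ n) x) 2 volume) atTop (𝓝 0) := by
  choose φ h1 h2 h3 using fun n : ℕ => h.2.2 (1 / ((n : ℝ) + 1)) (by positivity)
  exact ⟨φ, h1, squeeze_zero (fun _ => lpNorm_nonneg) h2 tendsto_one_div_add_atTop_nhds_zero_nat,
    fun k => squeeze_zero (fun _ => lpNorm_nonneg) (fun n => h3 n k)
      tendsto_one_div_add_atTop_nhds_zero_nat⟩

theorem add (hp : 1 ≤ p) (hf : Adm p f G) (hg : Adm p g H) :
    Adm p (fun x => f x + g x) (fun k x => G k x + H k x) := by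
  refine ⟨hf.1.add hg.1, fun k => (hf.2.1 k).add (hg.2.1 k), fun ε hε => ?_⟩
  obtain ⟨φ, h1, h2, h3⟩ := hf.2.2 (ε / 2) (by positivity)
  obtain ⟨η, h4, h5, h6⟩ := hg.2.2 (ε / 2) (by positivity)
  refine ⟨_, h1.add h4, ?_, fun k => ?_⟩
  · have := lpNorm_fun_add_le (g := fun x => g x - η x) (memLp_fun_sub hf.1 (h1.memLp p)) hp
    refine le_trans (le_of_eq ?_) (this.trans (by linarith))
    congr 1; ext1 x; simp; abel
  · have := lpNorm_fun_add_le (g := fun x => H k x - pdv k η x) (p := 2)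
      (memLp_fun_sub (hf.2.1 k) ((h1.pdv k).memLp 2)) (by norm_num)
    refine le_trans (le_of_eq ?_) (this.trans (by linarith [h3 k, h6 k]))
    rw [pdv_add h1.differentiable h4.differentiable]
    congr 1; ext1 x; simp; abel

theorem const_smul (hf : Adm p f G) (c : ℝ) :
    Adm p (fun x => c • f x) (fun k x => c • G k x) := by
  refine ⟨hf.1.const_smul c, fun k => (hf.2.1 k).const_smul c, fun ε hε => ?_⟩
  obtain ⟨φ, h1, h2, h3⟩ := hf.2.2 (ε / (‖c‖ + 1)) (by positivity)
  have hle : ∀ t, t ≤ ε / (‖c‖ + 1) → ‖c‖ * t ≤ ε := by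
    intro t ht
    rw [le_div_iff₀ (by positivity)] at ht
    rcases le_total 0 t with h0 | h0
    · nlinarith
    · nlinarith [norm_nonneg c]
  refine ⟨_, h1.const_smul c, ?_, fun k => ?_⟩
  · simp only [← smul_sub]
    rw [lpNorm_fun_const_smul]
    exact hle _ h2
  · rw [pdv_const_smul h1.differentiable]
    simp only [← smul_sub]
    rw [lpNorm_fun_const_smul]
    exact hle _ (h3 k)

theorem sub (hp : 1 ≤ p) (hf : Adm p f G) (hg : Adm p g H) :
    Adm p (fun x => f x - g x) (fun k x => G k x - H k x) := by
  simpa [sub_eq_add_neg] using hf.add hp (hg.const_smul (-1))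

theorem lpNorm_translate {F : Type*} [NormedAddCommGroup F] {p : ℝ≥0∞} {f : Space → F}
    (hf : MemLp f p volume) (y : Space) :
    MemLp (fun x => f (x + y)) p volume ∧
      lpNorm (fun x => f (x + y)) p volume = lpNorm f p volume := by
  have hmp := measurePreserving_add_right (volume : Measure Space) y
  have hm : MemLp (fun x => f (x + y)) p volume := hf.comp_measurePreserving hmp
  refine ⟨hm, ?_⟩
  rw [← toReal_eLpNorm hm.1, ← toReal_eLpNorm hf.1]
  congr 1
  exact eLpNorm_comp_measurePreserving hf.1 hmp

theorem translate (hf : Adm p f G) (y : Space) :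
    Adm p (fun x => f (x + y)) (fun k x => G k (x + y)) := by
  refine ⟨(lpNorm_translate hf.1 y).1, fun k => (lpNorm_translate (hf.2.1 k) y).1, fun ε hε => ?_⟩
  obtain ⟨φ, h1, h2, h3⟩ := hf.2.2 ε hε
  refine ⟨_, h1.translate y, ?_, fun k => ?_⟩
  · exact (lpNorm_translate (memLp_fun_sub hf.1 (h1.memLp p)) y).2.trans_le h2
  · rw [pdv_translate]
    exact (lpNorm_translate (memLp_fun_sub (hf.2.1 k) ((h1.pdv k).memLp 2)) y).2.trans_le (h3 k)

end Adm

/-- Pairing with a fixed function in the dual space is continuous in `Lᵖ`. -/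
theorem tendsto_integral_smul_of_lpNorm (hp : 1 ≤ p) {η : Space → ℝ}
    (hη : MemLp η p.conjExponent volume) {φ : ℕ → Space → F}
    (hφ : ∀ n, MemLp (φ n) p volume) (hf : MemLp f p volume)
    (h : Tendsto (fun n => lpNorm (fun x => f x - φ n x) p volume) atTop (𝓝 0)) :
    Tendsto (fun n => ∫ x, η x • φ n x) atTop (𝓝 (∫ x, η x • f x)) := by
  have hH : ENNReal.HolderTriple p p.conjExponent 1 := ENNReal.HolderConjugate.conjExponent hp
  have hi : ∀ g : Space → F, MemLp g p volume → Integrable (fun x => η x • g x) volume :=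
    fun g hg => memLp_one_iff_integrable.1 (memLp_bilin hg hη (fun a b => b • a)
      (hη.1.smul hg.1) fun x => by rw [norm_smul, mul_comm])
  rw [tendsto_iff_norm_sub_tendsto_zero]
  have h' := h.mul_const (lpNorm η p.conjExponent volume)
  rw [zero_mul] at h'
  refine squeeze_zero (fun _ => norm_nonneg _) (fun n => ?_) h'
  rw [← integral_sub (hi _ (hφ n)) (hi _ hf)]
  refine (norm_integral_le_integral_norm _).trans ?_
  have := lpNorm_bilin_le (r := 1) (hf.sub (hφ n)) hη (fun a b => b • a)
    (fun x => by rw [norm_smul, mul_comm])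
  refine le_trans (le_of_eq ?_) this
  rw [lpNorm_one_eq_integral_norm (f := fun x => η x • (f - φ n) x)
    (hη.1.smul (hf.sub (hφ n)).1)]
  refine integral_congr_ae (Eventually.of_forall fun x => ?_)
  simp only [Pi.sub_apply]
  rw [← smul_sub, ← norm_neg, ← smul_neg, neg_sub]

namespace Adm

theorem hasWeakDeriv (hp : 1 ≤ p) (h : Adm p f G) (k : Fin 3) : HasWeakDeriv (e k) f (G k) := by
  refine ⟨h.1.locallyIntegrable hp, (h.2.1 k).locallyIntegrable (by norm_num), fun η hη => ?_⟩
  obtain ⟨φ, h1, h2, h3⟩ := h.exists_seq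
  have hη' : VTest η := hη
  have t1 := tendsto_integral_smul_of_lpNorm hp ((hη'.pdv k).memLp _) (fun n => (h1 n).memLp p)
    h.1 h2
  have t2 := tendsto_integral_smul_of_lpNorm (p := 2) (by norm_num) (hη'.memLp _)
    (fun n => ((h1 n).pdv k).memLp 2) (h.2.1 k) (h3 k)
  refine tendsto_nhds_unique t1 ((t2.neg).congr fun n => ?_)
  rw [hη'.integral_smul_pdv (h1 n).1, neg_neg]

end Adm

end Adm

/-! ### The Sobolev inequality for functions approximated by test functions -/

section AdmInner

variable {F : Type*} [NormedAddCommGroup F] [InnerProductSpace ℝ F]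
variable {p : ℝ≥0∞} {f g : Space → F} {G H : Fin 3 → Space → F}

namespace Adm

/-- The Sobolev inequality. -/
theorem sobolev (hp : 1 ≤ p) (h : Adm p f G) :
    MemLp f 6 volume ∧ lpNorm f 6 volume ≤ sobolevConst * gradNorm G := by
  obtain ⟨φ, h1, h2, h3⟩ := h.exists_seq
  obtain ⟨ns, hns, hae⟩ := exists_subseq_tendsto_ae (by positivity) (fun n => (h1 n).memLp p) h.1 h2
  have h4 : Tendsto (fun n => gradNorm (pdv · (φ (ns n)))) atTop (𝓝 (gradNorm G)) :=
    (tendsto_gradNorm fun k => tendsto_lpNorm_of_sub (by norm_num)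
      (fun n => ((h1 n).pdv k).memLp 2) (h.2.1 k) (h3 k)).comp hns.tendsto_atTop
  have := memLp_of_tendsto_ae (fun i => (h1 (ns i)).continuous.aestronglyMeasurable)
    (fun i => sobolev_test (h1 (ns i))) (h4.const_mul sobolevConst) hae
  exact ⟨this.1, lpNorm_le_of_eLpNorm_le
    (mul_nonneg sobolevConst_spec.1 (gradNorm_nonneg _)) this.2⟩

/-- The differences are again Sobolev pairs, so convergence of the gradients in `L²` already gives
convergence in `L⁶`. -/
theorem tendsto_six (hp : 1 ≤ p) (h : Adm p f G) {φ : ℕ → Space → F} (h1 : ∀ n, VTest (φ n))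
    (h3 : ∀ k, Tendsto (fun n => lpNorm (fun x => G k x - pdv k (φ n) x) 2 volume) atTop (𝓝 0)) :
    Tendsto (fun n => lpNorm (fun x => f x - φ n x) 6 volume) atTop (𝓝 0) := by
  have h4 : Tendsto (fun n => gradNorm fun k x => G k x - pdv k (φ n) x) atTop (𝓝 0) := by
    rw [← gradNorm_zero (F := F)]
    exact tendsto_gradNorm fun k => by simpa using h3 k
  have h5 := h4.const_mul sobolevConst
  rw [mul_zero] at h5
  exact squeeze_zero (fun _ => lpNorm_nonneg)
    (fun n => ((h.sub hp ((h1 n).adm p)).sobolev hp).2) h5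

theorem six (hp : 1 ≤ p) (h : Adm p f G) : Adm 6 f G := by
  refine ⟨(h.sobolev hp).1, h.2.1, fun ε hε => ?_⟩
  obtain ⟨φ, h1, h2, h3⟩ := h.exists_seq
  have h4 := h.tendsto_six hp h1 h3
  have e1 : ∀ᶠ n in atTop, lpNorm (fun x => f x - φ n x) 6 volume < ε := h4.eventually_lt_const hε
  have e2 : ∀ᶠ n in atTop, ∀ k, lpNorm (fun x => G k x - pdv k (φ n) x) 2 volume < ε :=
    eventually_all.2 fun k => (h3 k).eventually_lt_const hε
  obtain ⟨n, hn1, hn2⟩ := (e1.and e2).exists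
  exact ⟨φ n, h1 n, hn1.le, fun k => (hn2 k).le⟩

end Adm

end AdmInner

/-! ### Averages of Sobolev functions -/

section MollEstimate

variable {F : Type*} [NormedAddCommGroup F] [InnerProductSpace ℝ F]

/-- The fundamental theorem of calculus along the segment from `x` to `x - y`, Jensen's inequality
in the segment parameter, and Fubini with translation invariance. -/
theorem lintegral_translate_sub_le [CompleteSpace F] {f : Space → F} (hf : VTest f) (y : Space) :
    ∫⁻ x, ‖f x - f (x - y)‖ₑ ^ 2 ≤ ‖y‖ₑ ^ 2 * ∫⁻ x, ‖fderiv ℝ f x‖ₑ ^ 2 := by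
  have hc : Continuous (fderiv ℝ f) := hf.1.continuous_fderiv (by simp)
  let ν : Measure ℝ := volume.restrict (Set.Ioc 0 1)
  have hν : IsProbabilityMeasure ν := ⟨by simp [ν]⟩
  have h1 : ∀ x, ‖f x - f (x - y)‖ₑ ^ 2 ≤ ∫⁻ s, ‖fderiv ℝ f (x - s • y) y‖ₑ ^ 2 ∂ν := by
    intro x
    have hd : ∀ s ∈ Set.uIcc (0 : ℝ) 1, HasDerivAt (fun s : ℝ => f (x - s • y))
        (-(fderiv ℝ f (x - s • y) y)) s := by
      intro s _
      have h2 : HasDerivAt (fun s : ℝ => x - s • y) (-y) s := by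
        simpa using ((hasDerivAt_id s).smul_const y).const_sub x
      have h3 := (hf.differentiable (x - s • y)).hasFDerivAt.comp_hasDerivAt s h2
      rw [map_neg] at h3
      exact h3
    have hcont : Continuous fun s : ℝ => fderiv ℝ f (x - s • y) y := by fun_prop
    have := intervalIntegral.integral_eq_sub_of_hasDerivAt hd (hcont.neg.intervalIntegrable _ _)
    rw [intervalIntegral.integral_of_le zero_le_one] at this
    have e : ‖f x - f (x - y)‖ₑ = ‖∫ s, fderiv ℝ f (x - s • y) y ∂ν‖ₑ := by
      rw [integral_neg] at this
      have e' : ∫ s, fderiv ℝ f (x - s • y) y ∂ν = -(f (x - (1 : ℝ) • y) - f (x - (0 : ℝ) • y)) := by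
        rw [← this, neg_neg]
      rw [e']; simp
    rw [e]
    exact enorm_integral_sq_le hcont.aestronglyMeasurable
  calc _ ≤ ∫⁻ x, ∫⁻ s, ‖fderiv ℝ f (x - s • y) y‖ₑ ^ 2 ∂ν := lintegral_mono h1
    _ = ∫⁻ s, ∫⁻ x, ‖fderiv ℝ f (x - s • y) y‖ₑ ^ 2 ∂volume ∂ν := by
        refine lintegral_lintegral_swap ?_
        have : Continuous fun q : Space × ℝ => fderiv ℝ f (q.1 - q.2 • y) y := by fun_prop
        exact this.aestronglyMeasurable.enorm.pow_const 2
    _ = ∫⁻ _, ∫⁻ x, ‖fderiv ℝ f x y‖ₑ ^ 2 ∂volume ∂ν := lintegral_congr fun s =>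
        lintegral_sub_right_eq_self (fun x => ‖fderiv ℝ f x y‖ₑ ^ 2) (s • y)
    _ = ∫⁻ x, ‖fderiv ℝ f x y‖ₑ ^ 2 := by simp
    _ ≤ ∫⁻ x, ‖y‖ₑ ^ 2 * ‖fderiv ℝ f x‖ₑ ^ 2 := by
        refine lintegral_mono fun x => ?_
        rw [← mul_pow, mul_comm]
        exact pow_le_pow_left' (ContinuousLinearMap.le_opENorm _ _) 2
    _ = _ := lintegral_const_mul' _ _ (by simp)

theorem lintegral_fderiv_le {f : Space → F} (hf : VTest f) :
    ∫⁻ x, ‖fderiv ℝ f x‖ₑ ^ 2 ≤ ENNReal.ofReal (gradNorm (pdv · f) ^ 2) := by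
  have hi : Integrable (fun x => ∑ k, ‖pdv k f x‖ ^ 2) volume :=
    integrable_finsetSum _ fun k _ => ((hf.pdv k).memLp 2).integrable_norm_pow two_ne_zero
  rw [sq_gradNorm_eq_integral fun k => (hf.pdv k).memLp 2, ofReal_integral_eq_lintegral_ofReal hi
    (Eventually.of_forall fun x => by simp only [Pi.zero_apply]; positivity)]
  refine lintegral_mono fun x => ?_
  rw [← ofReal_norm, ← ENNReal.ofReal_pow (norm_nonneg _)]
  exact ENNReal.ofReal_le_ofReal (norm_clm_sq_le _)

theorem ae_norm_le_kerMeasure (n : ℕ) : ∀ᵐ y ∂kerMeasure n, ‖y‖ ≤ 1 / ((n : ℝ) + 1) := by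
  rw [kerMeasure, ae_withDensity_iff (by
    exact ((ker_test n).continuous.measurable.ennreal_ofReal))]
  refine Eventually.of_forall fun y hy => ?_
  by_contra h
  exact hy (by rw [ker_eq_zero (not_le.1 h).le, ENNReal.ofReal_zero])

/-- Jensen's inequality reduces the average to single translations, and the kernel only sees
translations of length at most `1/(n + 1)`. -/
theorem eLpNorm_sub_moll_test [CompleteSpace F] {f : Space → F} (hf : VTest f) (n : ℕ) :
    eLpNorm (fun x => f x - moll n f x) 2 volume ≤
      ENNReal.ofReal (1 / ((n : ℝ) + 1) * gradNorm (pdv · f)) := by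
  have hpos : (0 : ℝ) ≤ 1 / ((n : ℝ) + 1) := by positivity
  refine (ENNReal.pow_le_pow_left_iff two_ne_zero).1 ?_
  rw [eLpNorm_two_sq, ← ENNReal.ofReal_pow (mul_nonneg hpos (gradNorm_nonneg _)), mul_pow,
    ENNReal.ofReal_mul (by positivity)]
  have hcy : ∀ x, Continuous fun y => f (x - y) := fun x => by
    have := hf.continuous; fun_prop
  have h1 : ∀ x, ‖f x - moll n f x‖ₑ ^ 2 ≤ ∫⁻ y, ‖f x - f (x - y)‖ₑ ^ 2 ∂kerMeasure n := by
    intro x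
    have hi : Integrable (fun y => f (x - y)) (kerMeasure n) := by
      obtain ⟨C, hC⟩ := hf.continuous.bounded_above_of_compact_support hf.2
      exact Integrable.of_bound (hcy x).aestronglyMeasurable C
        (Eventually.of_forall fun y => hC _)
    have : f x - moll n f x = ∫ y, (f x - f (x - y)) ∂kerMeasure n := by
      rw [integral_sub (integrable_const _) hi]; simp [moll]
    rw [this]
    exact enorm_integral_sq_le (continuous_const.sub (hcy x)).aestronglyMeasurable
  calc _ ≤ ∫⁻ x, ∫⁻ y, ‖f x - f (x - y)‖ₑ ^ 2 ∂kerMeasure n := lintegral_mono h1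
    _ = ∫⁻ y, ∫⁻ x, ‖f x - f (x - y)‖ₑ ^ 2 ∂volume ∂kerMeasure n := by
        refine lintegral_lintegral_swap ?_
        have : Continuous fun q : Space × Space => f q.1 - f (q.1 - q.2) := by
          have := hf.continuous; fun_prop
        exact this.aestronglyMeasurable.enorm.pow_const 2
    _ ≤ ∫⁻ _, ENNReal.ofReal ((1 / ((n : ℝ) + 1)) ^ 2) *
          ENNReal.ofReal (gradNorm (pdv · f) ^ 2) ∂kerMeasure n := by
        refine lintegral_mono_ae ?_
        filter_upwards [ae_norm_le_kerMeasure n] with y hy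
        refine (lintegral_translate_sub_le hf y).trans (mul_le_mul' ?_ (lintegral_fderiv_le hf))
        rw [← ofReal_norm, ← ENNReal.ofReal_pow (norm_nonneg _)]
        exact ENNReal.ofReal_le_ofReal (pow_le_pow_left₀ (norm_nonneg _) hy 2)
    _ = _ := by simp

theorem moll_tendsto {p : ℝ≥0∞} (hp : 1 ≤ p) {f : Space → F} {φ : ℕ → Space → F}
    (hφ : ∀ n, MemLp (φ n) p volume) (hf : MemLp f p volume)
    (h : Tendsto (fun n => lpNorm (fun x => f x - φ n x) p volume) atTop (𝓝 0)) (i : ℕ)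
    (x : Space) : Tendsto (fun n => moll i (φ n) x) atTop (𝓝 (moll i f x)) := by
  simp only [moll_eq']
  refine tendsto_integral_smul_of_lpNorm hp ?_ hφ hf h
  have hτ : VTest (fun y => ker i (x - y)) := by
    have : (fun y => ker i (x - y)) = fun y => ker i (y + -x) := by
      ext1 y; rw [← ker_neg]; congr 1; abel
    rw [this]; exact (ker_test i).translate _
  exact hτ.memLp _

/-- A Sobolev function is close to its averages. -/
theorem Adm.sub_moll [CompleteSpace F] {p : ℝ≥0∞} (hp : 1 ≤ p) {f : Space → F} {G : Fin 3 → Space → F}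
    (h : Adm p f G) (n : ℕ) :
    MemLp (fun x => f x - moll n f x) 2 volume ∧
      lpNorm (fun x => f x - moll n f x) 2 volume ≤ 1 / ((n : ℝ) + 1) * gradNorm G := by
  obtain ⟨φ, h1, h2, h3⟩ := h.exists_seq
  obtain ⟨ns, hns, hae⟩ := exists_subseq_tendsto_ae (by positivity) (fun n => (h1 n).memLp p) h.1 h2
  have h4 : Tendsto (fun n => gradNorm (pdv · (φ (ns n)))) atTop (𝓝 (gradNorm G)) :=
    (tendsto_gradNorm fun k => tendsto_lpNorm_of_sub (by norm_num)
      (fun n => ((h1 n).pdv k).memLp 2) (h.2.1 k) (h3 k)).comp hns.tendsto_atTop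
  have := memLp_of_tendsto_ae
    (g := fun x => f x - moll n f x)
    (fun i => (h1 (ns i)).continuous.aestronglyMeasurable.sub (moll_aestronglyMeasurable
      (h1 (ns i)).continuous.aestronglyMeasurable n))
    (fun i => eLpNorm_sub_moll_test (h1 (ns i)) n) (h4.const_mul _) (by
      filter_upwards [hae] with x hx
      exact hx.sub ((moll_tendsto hp (fun n => (h1 n).memLp p) h.1 h2 n x).comp hns.tendsto_atTop))
  exact ⟨this.1, lpNorm_le_of_eLpNorm_le
    (mul_nonneg (by positivity) (gradNorm_nonneg _)) this.2⟩

end MollEstimate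

/-! ### Weak compactness -/

section Hilbert

variable {E : Type*} [NormedAddCommGroup E] [InnerProductSpace ℝ E] [CompleteSpace E]

/-- Bounded sequences in a closed subspace of a separable Hilbert space have weakly convergent
subsequences. -/
theorem exists_weak_limit [TopologicalSpace.SeparableSpace E] {M : Submodule ℝ E}
    (hM : IsClosed (M : Set E)) {x : ℕ → E} (hx : ∀ n, x n ∈ M) {C : ℝ} (hC : ∀ n, ‖x n‖ ≤ C) :
    ∃ y ∈ M, ∃ ns : ℕ → ℕ, StrictMono ns ∧
      ∀ h : E, Tendsto (fun n => inner ℝ h (x (ns n))) atTop (𝓝 (inner ℝ h y)) := by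
  let D := InnerProductSpace.toDual ℝ E
  have hmem : ∀ n, StrongDual.toWeakDual (D (x n)) ∈
      WeakDual.toStrongDual ⁻¹' Metric.closedBall (0 : StrongDual ℝ E) C := by
    intro n
    simp only [Set.mem_preimage, mem_closedBall_zero_iff]
    exact (D.norm_map (x n)).trans_le (hC n)
  obtain ⟨L, -, ns, hns, hlim⟩ := WeakDual.isSeqCompact_closedBall ℝ E 0 C hmem
  let y := D.symm (WeakDual.toStrongDual L)
  have hy : ∀ h : E, Tendsto (fun n => inner ℝ h (x (ns n))) atTop (𝓝 (inner ℝ h y)) := by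
    intro h
    have h1 := ((WeakDual.eval_continuous h).tendsto L).comp hlim
    have e1 : ∀ n, inner ℝ h (x (ns n)) = (StrongDual.toWeakDual (D (x (ns n)))) h := fun n => by
      rw [real_inner_comm]; rfl
    have e2 : inner ℝ h y = L h := by
      rw [real_inner_comm]
      have : D y = WeakDual.toStrongDual L := D.apply_symm_apply _
      exact DFunLike.congr_fun this h
    simp only [e1, e2]
    exact h1
  refine ⟨y, ?_, ns, hns, hy⟩
  have : CompleteSpace M := hM.completeSpace_coe
  -- A closed subspace is its own double orthogonal complement, and orthogonality to a fixed vector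
  -- passes to weak limits.
  rw [← Submodule.orthogonal_orthogonal M]
  rw [Submodule.mem_orthogonal]
  intro u hu
  refine tendsto_nhds_unique (hy u) ?_
  have : ∀ n, inner ℝ u (x (ns n)) = 0 := fun n => by
    rw [real_inner_comm]; exact (Submodule.mem_orthogonal M u).1 hu _ (hx _)
  simp [this]

end Hilbert

section WeakLimit

variable {F : Type*} [NormedAddCommGroup F] [InnerProductSpace ℝ F] [FiniteDimensional ℝ F]

/-- The Hilbert space of pairs of a function and its gradient. -/
abbrev PairSpace (F : Type*) [NormedAddCommGroup F] : Type _ :=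
  PiLp 2 fun _ : Option (Fin 3) => Lp F 2 (volume : Measure Space)

/-- The subspace of pairs `(w φ, ∇φ)` for test functions `φ`. -/
def testGraph (F : Type*) [NormedAddCommGroup F] [InnerProductSpace ℝ F] (w : Space → ℝ) :
    Submodule ℝ (PairSpace F) where
  carrier := {z | ∃ φ : Space → F, VTest φ ∧ (z none : Space → F) =ᵐ[volume] (fun x => w x • φ x) ∧
    ∀ k, (z (some k) : Space → F) =ᵐ[volume] pdv k φ}
  add_mem' := by
    rintro a b ⟨φ, h1, h2, h3⟩ ⟨η, h4, h5, h6⟩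
    refine ⟨_, h1.add h4, ?_, fun k => ?_⟩
    · have := Lp.coeFn_add (a none) (b none)
      filter_upwards [this, h2, h5] with x hx hx2 hx5
      rw [PiLp.add_apply, hx, Pi.add_apply, hx2, hx5, smul_add]
    · have := Lp.coeFn_add (a (some k)) (b (some k))
      filter_upwards [this, h3 k, h6 k] with x hx hx2 hx5
      rw [PiLp.add_apply, hx, Pi.add_apply, hx2, hx5, pdv_add h1.differentiable h4.differentiable]
  zero_mem' := by
    refine ⟨_, vtest_zero, ?_, fun k => ?_⟩
    · filter_upwards [Lp.coeFn_zero F 2 (volume : Measure Space)] with x hx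
      rw [PiLp.zero_apply, hx]; simp
    · filter_upwards [Lp.coeFn_zero F 2 (volume : Measure Space)] with x hx
      rw [PiLp.zero_apply, hx]; simp [pdv]
  smul_mem' := by
    rintro c a ⟨φ, h1, h2, h3⟩
    refine ⟨_, h1.const_smul c, ?_, fun k => ?_⟩
    · filter_upwards [Lp.coeFn_smul c (a none), h2] with x hx hx2
      rw [PiLp.smul_apply, hx, Pi.smul_apply, hx2, smul_comm]
    · filter_upwards [Lp.coeFn_smul c (a (some k)), h3 k] with x hx hx2
      rw [PiLp.smul_apply, hx, Pi.smul_apply, hx2, pdv_const_smul h1.differentiable]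

/-- The element of the pair space given by square integrable functions. -/
def pack {F : Type*} [NormedAddCommGroup F] {u : Space → F} (hu : MemLp u 2 volume) {G : Fin 3 → Space → F}
    (hG : ∀ k, MemLp (G k) 2 volume) : PairSpace F :=
  WithLp.toLp 2 fun o => Option.rec hu.toLp (fun k => (hG k).toLp) o

theorem norm_Lp_eq {F : Type*} [NormedAddCommGroup F] (z : Lp F 2 (volume : Measure Space)) : ‖z‖ = lpNorm z 2 volume := by
  rw [Lp.norm_def, toReal_eLpNorm (Lp.memLp z).1]

theorem norm_pack_sq {F : Type*} [NormedAddCommGroup F] {u : Space → F} (hu : MemLp u 2 volume) {G : Fin 3 → Space → F}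
    (hG : ∀ k, MemLp (G k) 2 volume) :
    ‖pack hu hG‖ ^ 2 = lpNorm u 2 volume ^ 2 + gradNorm G ^ 2 := by
  rw [PiLp.norm_sq_eq_of_L2, Fintype.sum_option, sq_gradNorm]
  congr 1
  · simp only [pack]; rw [norm_Lp_eq, lpNorm_congr_ae' hu.coeFn_toLp]
  · refine Finset.sum_congr rfl fun k _ => ?_
    simp only [pack]; rw [norm_Lp_eq, lpNorm_congr_ae' (hG k).coeFn_toLp]

/-- Weak compactness for pairs `(w f, ∇f)`. -/
theorem exists_weak_limit_pair {w : Space → ℝ} {f : ℕ → Space → F} {G : ℕ → Fin 3 → Space → F}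
    (hw : ∀ φ : Space → F, VTest φ → MemLp (fun x => w x • φ x) 2 volume)
    (hf : ∀ n, MemLp (fun x => w x • f n x) 2 volume) (hG : ∀ n k, MemLp (G n k) 2 volume)
    (happ : ∀ n, ∀ ε : ℝ, 0 < ε → ∃ φ : Space → F, VTest φ ∧
      lpNorm (fun x => w x • f n x - w x • φ x) 2 volume ≤ ε ∧
      ∀ k, lpNorm (fun x => G n k x - pdv k φ x) 2 volume ≤ ε)
    {C : ℝ} (h1 : ∀ n, lpNorm (fun x => w x • f n x) 2 volume ≤ C) (h2 : ∀ n, gradNorm (G n) ≤ C) :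
    ∃ (u : Space → F) (H : Fin 3 → Space → F) (ns : ℕ → ℕ), StrictMono ns ∧ MemLp u 2 volume ∧
      (∀ k, MemLp (H k) 2 volume) ∧
      (∃ φ : ℕ → Space → F, (∀ n, VTest (φ n)) ∧
        Tendsto (fun n => lpNorm (fun x => u x - w x • φ n x) 2 volume) atTop (𝓝 0) ∧
        ∀ k, Tendsto (fun n => lpNorm (fun x => H k x - pdv k (φ n) x) 2 volume) atTop (𝓝 0)) ∧
      (∀ h, MemLp h 2 volume → Tendsto (fun n => ∫ x, inner ℝ (h x) (w x • f (ns n) x)) atTop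
        (𝓝 (∫ x, inner ℝ (h x) (u x)))) ∧
      ∀ k h, MemLp h 2 volume → Tendsto (fun n => ∫ x, inner ℝ (h x) (G (ns n) k x)) atTop
        (𝓝 (∫ x, inner ℝ (h x) (H k x))) := by
  have hC0 : 0 ≤ C := (gradNorm_nonneg _).trans (h2 0)
  let x : ℕ → PairSpace F := fun n => pack (hf n) (hG n)
  -- The closure of the graph is a closed subspace, so the weak limit stays in it. Strong
  -- approximability by test functions is thus inherited by the limit without any separate density
  -- argument.
  have hmem : ∀ n, x n ∈ (testGraph F w).topologicalClosure := by
    intro n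
    rw [← SetLike.mem_coe, Submodule.topologicalClosure_coe, Metric.mem_closure_iff]
    intro ε hε
    obtain ⟨φ, hφ, ha, hb⟩ := happ n (ε / 4) (by positivity)
    refine ⟨pack (hw φ hφ) (fun k => (hφ.pdv k).memLp 2), ⟨φ, hφ, ?_, fun k => ?_⟩, ?_⟩
    · exact (hw φ hφ).coeFn_toLp
    · exact ((hφ.pdv k).memLp 2).coeFn_toLp
    · have hsub : x n - pack (hw φ hφ) (fun k => (hφ.pdv k).memLp 2) =
          pack (memLp_fun_sub (hf n) (hw φ hφ))
            (fun k => memLp_fun_sub (hG n k) ((hφ.pdv k).memLp 2)) := by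
        ext1 o
        cases o with
        | none => exact (MemLp.toLp_sub (hf n) (hw φ hφ)).symm
        | some k => exact (MemLp.toLp_sub (hG n k) ((hφ.pdv k).memLp 2)).symm
      rw [dist_eq_norm, hsub]
      refine lt_of_pow_lt_pow_left₀ 2 hε.le ?_
      rw [norm_pack_sq, sq_gradNorm, Fin.sum_univ_three]
      have hp : ∀ t, 0 ≤ t → t ≤ ε / 4 → t ^ 2 ≤ (ε / 4) ^ 2 := fun t h0 ht =>
        pow_le_pow_left₀ h0 ht 2
      have e0 := hp _ lpNorm_nonneg ha
      have e1 := hp _ lpNorm_nonneg (hb 0)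
      have e2 := hp _ lpNorm_nonneg (hb 1)
      have e3 := hp _ lpNorm_nonneg (hb 2)
      nlinarith
  have hbd : ∀ n, ‖x n‖ ≤ 2 * C := by
    intro n
    refine le_of_sq_le_sq ?_ (by positivity)
    rw [norm_pack_sq]
    have a1 := pow_le_pow_left₀ lpNorm_nonneg (h1 n) 2
    have a2 := pow_le_pow_left₀ (gradNorm_nonneg _) (h2 n) 2
    nlinarith
  have : Fact ((2 : ℝ≥0∞) ≠ ∞) := ⟨by simp⟩
  have : ProperSpace F := FiniteDimensional.proper ℝ F
  have : SecondCountableTopology (Lp F 2 (volume : Measure Space)) := inferInstance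
  have : SecondCountableTopology (PairSpace F) := inferInstance
  obtain ⟨y, hy, ns, hns, hlim⟩ := exists_weak_limit
    (Submodule.isClosed_topologicalClosure (testGraph F w)) hmem hbd
  refine ⟨y none, fun k => y (some k), ns, hns, Lp.memLp _, fun k => Lp.memLp _, ?_, ?_, ?_⟩
  · rw [← SetLike.mem_coe, Submodule.topologicalClosure_coe, mem_closure_iff_seq_limit] at hy
    obtain ⟨z, hz, hzlim⟩ := hy
    choose φ hφ hφ1 hφ2 using hz
    have hdiff : ∀ o : Option (Fin 3), Tendsto (fun n => ‖y o - z n o‖) atTop (𝓝 0) := by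
      intro o
      have : Tendsto (fun n => ‖y - z n‖) atTop (𝓝 0) := by
        have := tendsto_iff_norm_sub_tendsto_zero.1 hzlim
        simpa [norm_sub_rev] using this
      refine squeeze_zero (fun _ => norm_nonneg _) (fun n => ?_) this
      exact PiLp.norm_apply_le (y - z n) o
    refine ⟨φ, hφ, (hdiff none).congr fun n => ?_, fun k => (hdiff (some k)).congr fun n => ?_⟩
    · rw [norm_Lp_eq]
      refine lpNorm_congr_ae' ?_
      filter_upwards [Lp.coeFn_sub (y none) (z n none), hφ1 n] with t ht1 ht2
      rw [ht1, Pi.sub_apply, ht2]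
    · rw [norm_Lp_eq]
      refine lpNorm_congr_ae' ?_
      filter_upwards [Lp.coeFn_sub (y (some k)) (z n (some k)), hφ2 n k] with t ht1 ht2
      rw [ht1, Pi.sub_apply, ht2]
  · intro h hh
    have hz : ∀ k : Fin 3, MemLp (fun _ : Space => (0 : F)) 2 volume := fun _ => MemLp.zero'
    have key : ∀ v : PairSpace F, inner ℝ (pack hh hz) v = ∫ t, inner ℝ (h t) (v none t) := by
      intro v
      rw [PiLp.inner_apply, Fintype.sum_option]
      have : ∀ k : Fin 3, inner ℝ ((pack hh hz) (some k)) (v (some k)) = 0 := by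
        intro k
        have : (pack hh hz) (some k) = 0 := MemLp.toLp_zero (hz k)
        rw [this, inner_zero_left]
      simp only [this, Finset.sum_const_zero, add_zero]
      rw [L2.inner_def]
      refine integral_congr_ae ?_
      filter_upwards [hh.coeFn_toLp] with t ht
      simp only [pack]; rw [ht]
    have := hlim (pack hh hz)
    simp only [key] at this
    refine this.congr fun n => integral_congr_ae ?_
    filter_upwards [(hf (ns n)).coeFn_toLp] with t ht
    simp only [x, pack]; rw [ht]
  · intro k h hh
    let Z : PairSpace F := WithLp.toLp 2 fun o => if o = some k then hh.toLp else 0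
    have key : ∀ v : PairSpace F, inner ℝ Z v = ∫ t, inner ℝ (h t) (v (some k) t) := by
      intro v
      rw [PiLp.inner_apply, Finset.sum_eq_single (some k)]
      · have : Z (some k) = hh.toLp := by simp [Z]
        rw [this, L2.inner_def]
        refine integral_congr_ae ?_
        filter_upwards [hh.coeFn_toLp] with t ht
        rw [ht]
      · intro o _ ho
        have : Z o = 0 := by simp [Z, ho]
        rw [this, inner_zero_left]
      · simp
    have := hlim Z
    simp only [key] at this
    refine this.congr fun n => integral_congr_ae ?_
    filter_upwards [(hG (ns n) k).coeFn_toLp] with t ht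
    simp only [x, pack]; rw [ht]

/-- Weak compactness in `H¹`. -/
theorem Adm.exists_weak_limit_two {f : ℕ → Space → F} {G : ℕ → Fin 3 → Space → F}
    (h : ∀ n, Adm 2 (f n) (G n)) {C : ℝ} (h1 : ∀ n, lpNorm (f n) 2 volume ≤ C)
    (h2 : ∀ n, gradNorm (G n) ≤ C) :
    ∃ (u : Space → F) (H : Fin 3 → Space → F) (ns : ℕ → ℕ), StrictMono ns ∧ Adm 2 u H ∧
      (∀ h, MemLp h 2 volume → Tendsto (fun n => ∫ x, inner ℝ (h x) (f (ns n) x)) atTop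
        (𝓝 (∫ x, inner ℝ (h x) (u x)))) ∧
      ∀ k h, MemLp h 2 volume → Tendsto (fun n => ∫ x, inner ℝ (h x) (G (ns n) k x)) atTop
        (𝓝 (∫ x, inner ℝ (h x) (H k x))) := by
  obtain ⟨u, H, ns, hns, hu, hH, ⟨φ, hφ, hφ1, hφ2⟩, hw1, hw2⟩ :=
    exists_weak_limit_pair (w := fun _ => 1) (f := f) (G := G) (C := C)
      (fun φ hφ => by simpa using hφ.memLp 2) (fun n => by simpa using (h n).1)
      (fun n => (h n).2.1) (fun n ε hε => by simpa using (h n).2.2 ε hε) (by simpa using h1) h2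
  refine ⟨u, H, ns, hns, ⟨hu, hH, fun ε hε => ?_⟩, by simpa using hw1, hw2⟩
  simp only [one_smul] at hφ1
  have e2 : ∀ᶠ n in atTop, ∀ k, lpNorm (fun x => H k x - pdv k (φ n) x) 2 volume < ε :=
    eventually_all.2 fun k => (hφ2 k).eventually_lt_const hε
  obtain ⟨n, hn1, hn2⟩ := ((hφ1.eventually_lt_const hε).and e2).exists
  exact ⟨φ n, hφ n, hn1.le, fun k => (hn2 k).le⟩

/-- A weight in `L³`. -/
def weight (x : Space) : ℝ := (1 + ‖x‖) ^ (-2 : ℝ)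

theorem weight_pos (x : Space) : 0 < weight x := Real.rpow_pos_of_pos (by positivity) _

theorem weight_continuous : Continuous weight := by
  unfold weight
  exact (continuous_const.add continuous_norm).rpow_const fun x =>
    Or.inl (ne_of_gt (by positivity : (0 : ℝ) < 1 + ‖x‖))

theorem weight_memLp : MemLp weight 3 volume := by
  refine (integrable_norm_rpow_iff weight_continuous.aestronglyMeasurable (by norm_num)
    (by norm_num)).1 ?_
  have : (fun x : Space => ‖weight x‖ ^ (3 : ℝ≥0∞).toReal) = fun x => (1 + ‖x‖) ^ (-6 : ℝ) := by
    ext1 x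
    rw [Real.norm_of_nonneg (weight_pos x).le, weight,
      ← Real.rpow_mul (x := 1 + ‖x‖) (by positivity)]
    norm_num
  rw [this]
  exact integrable_one_add_norm (by simp; norm_num)

theorem lpNorm_smul_two_le {F : Type*} [NormedAddCommGroup F] [NormedSpace ℝ F]
    {η : Space → ℝ} (hη : MemLp η 3 volume) {f : Space → F}
    (hf : MemLp f 6 volume) : MemLp (fun x => η x • f x) 2 volume ∧
      lpNorm (fun x => η x • f x) 2 volume ≤ lpNorm η 3 volume * lpNorm f 6 volume :=
  ⟨memLp_bilin hη hf (fun a b => a • b) (hη.1.smul hf.1) fun x => by rw [norm_smul],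
    lpNorm_bilin_le hη hf (fun a b => a • b) fun x => by rw [norm_smul]⟩

/-- Weak compactness in `D¹`. -/
theorem Adm.exists_weak_limit_six {f : ℕ → Space → F} {G : ℕ → Fin 3 → Space → F}
    (h : ∀ n, Adm 6 (f n) (G n)) {C : ℝ} (h2 : ∀ n, gradNorm (G n) ≤ C) :
    ∃ (u : Space → F) (H : Fin 3 → Space → F) (ns : ℕ → ℕ), StrictMono ns ∧ Adm 6 u H ∧
      (∀ h : Space → F, Continuous h → HasCompactSupport h →
        Tendsto (fun n => ∫ x, inner ℝ (h x) (f (ns n) x)) atTop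
          (𝓝 (∫ x, inner ℝ (h x) (u x)))) ∧
      ∀ k h, MemLp h 2 volume → Tendsto (fun n => ∫ x, inner ℝ (h x) (G (ns n) k x)) atTop
        (𝓝 (∫ x, inner ℝ (h x) (H k x))) := by
  have hK : 0 ≤ sobolevConst := sobolevConst_spec.1
  set W := lpNorm weight 3 volume with hW
  have hW0 : 0 ≤ W := lpNorm_nonneg
  obtain ⟨u, H, ns, hns, hu, hH, ⟨φ, hφ, hφ1, hφ2⟩, hw1, hw2⟩ :=
    exists_weak_limit_pair (w := weight) (f := f) (G := G)
      (C := max C (W * (sobolevConst * C)))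
      (fun φ hφ => (lpNorm_smul_two_le weight_memLp (hφ.memLp 6)).1)
      (fun n => (lpNorm_smul_two_le weight_memLp (h n).1).1) (fun n => (h n).2.1)
      (fun n ε hε => by
        obtain ⟨φ, a1, a2, a3⟩ := (h n).2.2 (min ε (ε / (W + 1))) (by positivity)
        refine ⟨φ, a1, ?_, fun k => (a3 k).trans (min_le_left _ _)⟩
        simp only [← smul_sub]
        refine (lpNorm_smul_two_le weight_memLp (memLp_fun_sub (h n).1 (a1.memLp 6))).2.trans ?_
        calc _ ≤ W * (ε / (W + 1)) := by
              gcongr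
              exact a2.trans (min_le_right _ _)
          _ ≤ ε := by
              rw [mul_div_assoc', div_le_iff₀ (by positivity)]
              nlinarith)
      (fun n => le_max_of_le_right <|
        (lpNorm_smul_two_le weight_memLp (h n).1).2.trans (by
          gcongr
          exact ((h n).sobolev (by norm_num)).2.trans (by gcongr; exact h2 n)))
      (fun n => (h2 n).trans (le_max_left _ _))
  -- Functions in `D¹` need not be square integrable. Multiplication by a weight in `L³` moves them
  -- from `L⁶` to `L²`, where weak compactness is available, and division by the weight recovers the
  -- limit.
  set f0 : Space → F := fun x => (weight x)⁻¹ • u x with hf0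
  have hf0u : ∀ x, weight x • f0 x = u x := fun x => by
    simp only [hf0, smul_smul]; rw [mul_inv_cancel₀ (weight_pos x).ne', one_smul]
  obtain ⟨ms, hms, hae⟩ := exists_subseq_tendsto_ae (by norm_num)
    (fun n => (lpNorm_smul_two_le weight_memLp ((hφ n).memLp 6)).1) hu hφ1
  have hae' : ∀ᵐ x, Tendsto (fun i => φ (ms i) x) atTop (𝓝 (f0 x)) := by
    filter_upwards [hae] with x hx
    refine (hx.const_smul (weight x)⁻¹).congr fun i => ?_
    rw [smul_smul, inv_mul_cancel₀ (weight_pos x).ne', one_smul]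
  have hgr : ∀ m, Tendsto (fun i => gradNorm (pdv · (fun x => φ (ms i) x - φ m x))) atTop
      (𝓝 (gradNorm fun k x => H k x - pdv k (φ m) x)) := by
    intro m
    refine tendsto_gradNorm fun k => ?_
    refine tendsto_lpNorm_of_sub (by norm_num)
      (fun i => (((hφ (ms i)).sub (hφ m)).pdv k).memLp 2)
      (memLp_fun_sub (hH k) (((hφ m).pdv k).memLp 2)) ?_
    refine ((hφ2 k).comp hms.tendsto_atTop).congr fun i => ?_
    simp only [Function.comp_apply]
    congr 1; ext1 x
    simp only [pdv_sub (hφ _).differentiable (hφ _).differentiable]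
    abel
  -- Fatou's lemma along the almost everywhere convergent subsequence, combined with the Sobolev
  -- inequality, upgrades the weighted `L²` approximation to an `L⁶` approximation.
  have hest : ∀ m, MemLp (fun x => f0 x - φ m x) 6 volume ∧
      eLpNorm (fun x => f0 x - φ m x) 6 volume ≤
        ENNReal.ofReal (sobolevConst * gradNorm fun k x => H k x - pdv k (φ m) x) := by
    intro m
    refine memLp_of_tendsto_ae (f := fun i x => φ (ms i) x - φ m x)
      (fun i => ((hφ _).sub (hφ m)).continuous.aestronglyMeasurable)
      (fun i => sobolev_test ((hφ (ms i)).sub (hφ m))) ((hgr m).const_mul _) ?_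
    filter_upwards [hae'] with x hx using hx.sub_const _
  have h60 : Tendsto (fun m => lpNorm (fun x => f0 x - φ m x) 6 volume) atTop (𝓝 0) := by
    have h4 : Tendsto (fun n => gradNorm fun k x => H k x - pdv k (φ n) x) atTop (𝓝 0) := by
      rw [← gradNorm_zero (F := F)]
      exact tendsto_gradNorm fun k => by simpa using hφ2 k
    have h5 := h4.const_mul sobolevConst
    rw [mul_zero] at h5
    exact squeeze_zero (fun _ => lpNorm_nonneg) (fun n => lpNorm_le_of_eLpNorm_le
      (mul_nonneg hK (gradNorm_nonneg _)) (hest n).2) h5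
  refine ⟨f0, H, ns, hns, ⟨?_, hH, fun ε hε => ?_⟩, ?_, hw2⟩
  · have := memLp_fun_add (hest 0).1 ((hφ 0).memLp 6)
    simpa using this
  · have e2 : ∀ᶠ n in atTop, ∀ k, lpNorm (fun x => H k x - pdv k (φ n) x) 2 volume < ε :=
      eventually_all.2 fun k => (hφ2 k).eventually_lt_const hε
    obtain ⟨n, hn1, hn2⟩ := ((h60.eventually_lt_const hε).and e2).exists
    exact ⟨φ n, hφ n, hn1.le, fun k => (hn2 k).le⟩
  · intro η hc hs
    have hm : MemLp (fun x => (weight x)⁻¹ • η x) 2 volume := by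
      refine Continuous.memLp_of_hasCompactSupport ?_ hs.smul_left
      exact (weight_continuous.inv₀ fun x => (weight_pos x).ne').smul hc
    have := hw1 _ hm
    have e : ∀ (x : Space) (z : F), inner ℝ ((weight x)⁻¹ • η x) (weight x • z) =
        inner ℝ (η x) z := by
      intro x z
      rw [real_inner_smul_left, real_inner_smul_right, ← mul_assoc,
        inv_mul_cancel₀ (weight_pos x).ne', one_mul]
    simp only [← hf0u, e] at this
    exact this

end WeakLimit

/-! ### Local compactness -/

section Rellich

variable {F : Type*} [NormedAddCommGroup F] [InnerProductSpace ℝ F] [FiniteDimensional ℝ F]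

theorem ker_sub_test (i : ℕ) (x : Space) : VTest (fun y => ker i (x - y)) := by
  have : (fun y => ker i (x - y)) = fun y => ker i (y + -x) := by
    ext1 y; rw [← ker_neg]; congr 1; abel
  rw [this]; exact (ker_test i).translate _

theorem integrable_smul_conj {F : Type*} [NormedAddCommGroup F] [NormedSpace ℝ F]
    {p : ℝ≥0∞} (hp : 1 ≤ p) {η : Space → ℝ} (hη : MemLp η p.conjExponent volume)
    {g : Space → F} (hg : MemLp g p volume) : Integrable (fun x => η x • g x) volume := by
  have hH : ENNReal.HolderTriple p p.conjExponent 1 := ENNReal.HolderConjugate.conjExponent hp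
  exact memLp_one_iff_integrable.1 (memLp_bilin hg hη (fun a b => b • a)
      (hη.1.smul hg.1) fun x => by rw [norm_smul, mul_comm])

theorem norm_moll_le {F : Type*} [NormedAddCommGroup F] [NormedSpace ℝ F]
    {p : ℝ≥0∞} (hp : 1 ≤ p) {f : Space → F} (hf : MemLp f p volume) (i : ℕ) (x : Space) :
    ‖moll i f x‖ ≤ lpNorm f p volume * lpNorm (ker i) p.conjExponent volume := by
  have hH : ENNReal.HolderTriple p p.conjExponent 1 := ENNReal.HolderConjugate.conjExponent hp
  rw [moll_eq']
  refine (norm_integral_le_integral_norm _).trans ?_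
  have hm := (ker_sub_test i x).memLp p.conjExponent
  have := lpNorm_bilin_le (r := 1) hf hm (fun a b => b • a)
    (fun x => by rw [norm_smul, mul_comm])
  rw [lpNorm_one_eq_integral_norm (f := fun y => ker i (x - y) • f y) (hm.1.smul hf.1)] at this
  refine this.trans (le_of_eq ?_)
  congr 1
  have e : (fun y => ker i (x - y)) = fun y => ker i (y + -x) := by
    ext1 y; rw [← ker_neg]; congr 1; abel
  rw [e]
  exact (Adm.lpNorm_translate ((ker_test i).memLp _) (-x)).2

theorem moll_tendsto_of_weak {p : ℝ≥0∞} (hp : 1 ≤ p) {f : ℕ → Space → F} {u : Space → F}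
    (hf : ∀ n, MemLp (f n) p volume) (hu : MemLp u p volume)
    (h : ∀ h : Space → F, Continuous h → HasCompactSupport h →
        Tendsto (fun n => ∫ x, inner ℝ (h x) (f n x)) atTop (𝓝 (∫ x, inner ℝ (h x) (u x))))
    (i : ℕ) (x : Space) : Tendsto (fun n => moll i (f n) x) atTop (𝓝 (moll i u x)) := by
  have hk := ker_sub_test i x
  have key : ∀ (g : Space → F) (b : F), MemLp g p volume →
      inner ℝ b (moll i g x) = ∫ y, inner ℝ (ker i (x - y) • b) (g y) := by
    intro g b hg
    rw [moll_eq', ← integral_inner (integrable_smul_conj hp (hk.memLp _) hg)]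
    refine integral_congr_ae (Eventually.of_forall fun y => ?_)
    simp only [real_inner_smul_left, real_inner_smul_right]
  let B := stdOrthonormalBasis ℝ F
  have hrep : ∀ v : F, v = ∑ j, inner ℝ (B j) v • B j := fun v => (B.sum_repr' v).symm
  rw [hrep (moll i u x)]
  refine Tendsto.congr (fun n => (hrep (moll i (f n) x)).symm) ?_
  refine tendsto_finsetSum _ fun j _ => Tendsto.smul_const ?_ _
  simp only [key _ _ hu, fun n => key _ (B j) (hf n)]
  exact h _ (hk.continuous.smul continuous_const) hk.2.smul_right

/-- Rellich's theorem: weakly null bounded sequences are locally strongly null. -/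
theorem rellich {p : ℝ≥0∞} (hp : 1 ≤ p) {f : ℕ → Space → F} {G : ℕ → Fin 3 → Space → F}
    (h : ∀ n, Adm p (f n) (G n)) {C : ℝ} (h1 : ∀ n, lpNorm (f n) p volume ≤ C)
    (h2 : ∀ n, gradNorm (G n) ≤ C)
    (h0 : ∀ i x, Tendsto (fun n => moll i (f n) x) atTop (𝓝 0))
    {g : Space → ℝ} (hg : Continuous g) (hgs : HasCompactSupport g) :
    Tendsto (fun n => lpNorm (fun x => g x • f n x) 2 volume) atTop (𝓝 0) := by
  have hC0 : 0 ≤ C := (gradNorm_nonneg _).trans (h2 0)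
  obtain ⟨B, hB⟩ := hg.bounded_above_of_compact_support hgs
  have hB0 : 0 ≤ B := (norm_nonneg _).trans (hB 0)
  have hmm : ∀ i n, AEStronglyMeasurable (moll i (f n)) volume := fun i n =>
    moll_aestronglyMeasurable (h n).1.1 i
  -- the averages converge
  have hav : ∀ i, Tendsto (fun n => lpNorm (fun x => g x • moll i (f n) x) 2 volume) atTop
      (𝓝 0) := by
    intro i
    set M := C * lpNorm (ker i) p.conjExponent volume
    have hbd : ∀ n x, ‖moll i (f n) x‖ ≤ M := fun n x =>
      (norm_moll_le hp (h n).1 i x).trans (mul_le_mul_of_nonneg_right (h1 n) lpNorm_nonneg)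
    have hsq : Tendsto (fun n => ∫ x, ‖g x • moll i (f n) x‖ ^ 2) atTop (𝓝 (∫ _ : Space, (0 : ℝ))) := by
      refine tendsto_integral_of_dominated_convergence (fun x => ‖g x‖ ^ 2 * M ^ 2)
        (fun n => ((hg.aestronglyMeasurable.smul (hmm i n)).norm.pow 2)) ?_ ?_ ?_
      · exact ((hg.memLp_of_hasCompactSupport (p := 2) (μ := volume)
          hgs).integrable_norm_pow two_ne_zero).mul_const _
      · intro n
        refine Eventually.of_forall fun x => ?_
        rw [norm_smul, mul_pow, Real.norm_of_nonneg (by positivity)]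
        gcongr
        exact hbd n x
      · refine Eventually.of_forall fun x => ?_
        have := ((h0 i x).const_smul (g x)).norm.pow 2
        simpa using this
    have := (Real.continuous_sqrt.tendsto _).comp hsq
    simp only [integral_zero, Real.sqrt_zero] at this
    refine this.congr fun n => ?_
    have e := sq_lpNorm_two (μ := volume) (f := fun x => g x • moll i (f n) x)
      (hg.aestronglyMeasurable.smul (hmm i n))
    simp only [Function.comp_apply, ← e]
    exact Real.sqrt_sq lpNorm_nonneg
  rw [Metric.tendsto_atTop]
  intro ε hε
  -- The averaging scale is fixed first, so that `f n` differs from its average by at most `ε/2`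
  -- after multiplication by `g`, uniformly in `n`; only then is `n` taken large.
  obtain ⟨i, hi⟩ := exists_nat_one_div_lt (show 0 < ε / (2 * (B * C + 1)) by positivity)
  obtain ⟨N, hN⟩ := (Metric.tendsto_atTop.1 (hav i)) (ε / 2) (by positivity)
  refine ⟨N, fun n hn => ?_⟩
  have hNn := hN n hn
  rw [Real.dist_eq, sub_zero, abs_of_nonneg lpNorm_nonneg] at hNn ⊢
  have hs := (h n).sub_moll hp i
  have hgd : MemLp (fun x => B • (f n x - moll i (f n) x)) 2 volume := hs.1.const_smul B
  have hb : ∀ x, ‖g x • (f n x - moll i (f n) x)‖ ≤ ‖B • (f n x - moll i (f n) x)‖ := fun x => by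
    rw [norm_smul, norm_smul, Real.norm_of_nonneg hB0]
    gcongr
    exact hB x
  have m1 : MemLp (fun x => g x • (f n x - moll i (f n) x)) 2 volume :=
    hgd.mono (hg.aestronglyMeasurable.smul hs.1.1) (Eventually.of_forall hb)
  have e1 : lpNorm (fun x => g x • (f n x - moll i (f n) x)) 2 volume ≤
      B * (1 / ((i : ℝ) + 1) * C) := by
    refine (lpNorm_mono_norm hgd (Eventually.of_forall hb)).trans ?_
    rw [lpNorm_fun_const_smul, abs_of_nonneg hB0]
    gcongr
    exact hs.2.trans (by gcongr; exact h2 n)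
  have e2 := lpNorm_fun_add_le (g := fun x => g x • moll i (f n) x) m1 (by norm_num)
  have e3 : (fun x => g x • (f n x - moll i (f n) x) + g x • moll i (f n) x) =
      fun x => g x • f n x := by
    ext1 x; rw [← smul_add, sub_add_cancel]
  rw [e3] at e2
  have e4 : B * (1 / ((i : ℝ) + 1) * C) < ε / 2 := by
    have : 1 / ((i : ℝ) + 1) * (2 * (B * C + 1)) < ε := by
      rwa [← lt_div_iff₀ (by positivity)]
    have h5 : 0 < 1 / ((i : ℝ) + 1) := by positivity
    nlinarith
  linarith

/-- If all averages tend to zero uniformly, then the sequence tends to zero in `L³`. -/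
theorem tendsto_three_of_vanishing {f : ℕ → Space → F} {G : ℕ → Fin 3 → Space → F}
    (h : ∀ n, Adm 2 (f n) (G n)) {C : ℝ} (h1 : ∀ n, lpNorm (f n) 2 volume ≤ C)
    (h2 : ∀ n, gradNorm (G n) ≤ C)
    (h0 : ∀ i, ∀ δ > 0, ∀ᶠ n in atTop, ∀ x, ‖moll i (f n) x‖ ≤ δ) :
    Tendsto (fun n => lpNorm (f n) 3 volume) atTop (𝓝 0) := by
  have hC0 : 0 ≤ C := (gradNorm_nonneg _).trans (h2 0)
  have hK : 0 ≤ sobolevConst := sobolevConst_spec.1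
  set M := √(C * (sobolevConst * C)) with hM
  set Q := M * (sobolevConst * C) with hQ
  have hQ0 : 0 ≤ Q := by positivity
  have h6 : ∀ n, MemLp (f n) 6 volume := fun n => ((h n).sobolev (by norm_num)).1
  have h6' : ∀ n, lpNorm (f n) 6 volume ≤ sobolevConst * C := fun n =>
    ((h n).sobolev (by norm_num)).2.trans (by gcongr; exact h2 n)
  have h3 : ∀ n, MemLp (f n) 3 volume := fun n => memLp_three (h n).1 (h6 n)
  have h3' : ∀ n, lpNorm (f n) 3 volume ≤ M := fun n => by
    refine Real.le_sqrt_of_sq_le ((sq_lpNorm_three_le (h n).1 (h6 n)).trans ?_)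
    exact mul_le_mul (h1 n) (h6' n) lpNorm_nonneg hC0
  have hq : ∀ n, MemLp (fun x => ‖f n x‖ * ‖f n x‖) 2 volume := fun n =>
    memLp_bilin (h3 n) (h6 n) (fun a b => ‖a‖ * ‖b‖) ((h n).1.1.norm.mul (h n).1.1.norm)
      fun x => by simp
  have hq' : ∀ n, lpNorm (fun x => ‖f n x‖ * ‖f n x‖) 2 volume ≤ Q := fun n =>
    (lpNorm_bilin_le (h3 n) (h6 n) (fun a b => ‖a‖ * ‖b‖) fun x => by simp).trans
      (mul_le_mul (h3' n) (h6' n) lpNorm_nonneg (by positivity))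
  -- Splitting one factor into average and remainder gives `|f|³ ≤ |f|² |f - moll i f| + δ |f|²`.
  -- Here `|f|²` is bounded in `L²` by Hölder with exponents 3 and 6.
  have key : ∀ i n δ, 0 ≤ δ → (∀ x, ‖moll i (f n) x‖ ≤ δ) →
      lpNorm (f n) 3 volume ^ 3 ≤ Q * (1 / ((i : ℝ) + 1) * C) + δ * C ^ 2 := by
    intro i n δ hδ hx
    have hs := (h n).sub_moll (by norm_num) i
    rw [cube_lpNorm_three (h n).1.1]
    have i1 := integrable_mul_norm (hq n) hs.1
    have i2 : Integrable (fun x => δ * ‖f n x‖ ^ 2) volume :=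
      ((h n).1.integrable_norm_pow two_ne_zero).const_mul δ
    calc ∫ x, ‖f n x‖ ^ 3 ≤ ∫ x, (‖‖f n x‖ * ‖f n x‖‖ * ‖f n x - moll i (f n) x‖ +
          δ * ‖f n x‖ ^ 2) := by
          refine integral_mono_of_nonneg (Eventually.of_forall fun x => by positivity)
            (i1.add i2) (Eventually.of_forall fun x => ?_)
          simp only
          rw [Real.norm_of_nonneg (by positivity)]
          have e1 : ‖f n x‖ ≤ ‖f n x - moll i (f n) x‖ + ‖moll i (f n) x‖ := by
            simpa using norm_add_le (f n x - moll i (f n) x) (moll i (f n) x)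
          have e2 := hx x
          have e3 : 0 ≤ ‖f n x‖ ^ 2 := by positivity
          nlinarith
      _ = (∫ x, ‖‖f n x‖ * ‖f n x‖‖ * ‖f n x - moll i (f n) x‖) + δ * ∫ x, ‖f n x‖ ^ 2 := by
          rw [integral_add i1 i2, integral_const_mul]
      _ ≤ _ := by
          rw [← sq_lpNorm_two (h n).1.1]
          refine add_le_add ((integral_mul_norm_le (hq n) hs.1).trans ?_) ?_
          · refine mul_le_mul (hq' n) (hs.2.trans ?_) lpNorm_nonneg hQ0
            gcongr
            exact h2 n
          · gcongr
            · exact lpNorm_nonneg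
            · exact h1 n
  rw [Metric.tendsto_atTop]
  intro ε hε
  obtain ⟨i, hi⟩ := exists_nat_one_div_lt (show 0 < ε ^ 3 / (2 * (Q * C + 1)) by positivity)
  set δ := ε ^ 3 / (2 * (C ^ 2 + 1)) with hδ
  have hδ0 : 0 < δ := by positivity
  obtain ⟨N, hN⟩ := eventually_atTop.1 (h0 i δ hδ0)
  refine ⟨N, fun n hn => ?_⟩
  rw [Real.dist_eq, sub_zero, abs_of_nonneg lpNorm_nonneg]
  refine lt_of_pow_lt_pow_left₀ 3 hε.le ((key i n δ hδ0.le (hN n hn)).trans_lt ?_)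
  have a1 : 1 / ((i : ℝ) + 1) * (2 * (Q * C + 1)) < ε ^ 3 := by
    rwa [← lt_div_iff₀ (by positivity)]
  have a2 : δ * (2 * (C ^ 2 + 1)) = ε ^ 3 := div_mul_cancel₀ _ (by positivity)
  have a3 : 0 < 1 / ((i : ℝ) + 1) := by positivity
  nlinarith

end Rellich

/-! ### Pauli matrices -/

section Pauli

/-- Only real parts of spinor products enter the energy and the current, so spinors are treated as a
real inner product space on which the imaginary unit acts as an operator. -/
theorem inner_spinor (a b : Spinor) : inner ℝ a b = (inner ℂ a b).re := by
  simp [PiLp.inner_apply]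

/-- A matrix as a real-linear map on spinors. -/
def actL (M : Matrix (Fin 2) (Fin 2) ℂ) : Spinor →L[ℝ] Spinor :=
  LinearMap.toContinuousLinearMap
    { toFun := act M
      map_add' := fun a b => by ext i; fin_cases i <;> simp [act] <;> ring
      map_smul' := fun c a => by
        ext i; fin_cases i <;> simp [act] <;> ring }

@[simp] theorem actL_apply (M : Matrix (Fin 2) (Fin 2) ℂ) (w : Spinor) : actL M w = act M w := rfl

/-- Multiplication by the imaginary unit as a real-linear map. -/
def imL : Spinor →L[ℝ] Spinor :=
  LinearMap.toContinuousLinearMap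
    { toFun := fun w => Complex.I • w
      map_add' := fun _ _ => smul_add _ _ _
      map_smul' := fun _ _ => smul_comm _ _ _ }

@[simp] theorem imL_apply (w : Spinor) : imL w = Complex.I • w := rfl

theorem inner_im_self (w : Spinor) : inner ℝ w (Complex.I • w) = 0 := by
  simp [PiLp.inner_apply, Fin.sum_univ_two]
  ring

theorem inner_im_left (a b : Spinor) : inner ℝ (Complex.I • a) b = -inner ℝ a (Complex.I • b) := by
  simp [PiLp.inner_apply, Fin.sum_univ_two]
  ring

theorem inner_im_im (a b : Spinor) : inner ℝ (Complex.I • a) (Complex.I • b) = inner ℝ a b := by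
  rw [inner_im_left, smul_smul, Complex.I_mul_I]; simp

theorem norm_im (a : Spinor) : ‖Complex.I • a‖ = ‖a‖ := by rw [norm_smul]; simp

theorem act_zero_eq (w : Spinor) : act (pauli 0) w = !₂[w 1, w 0] := by
  ext i; fin_cases i <;> simp [act, pauli, dotProduct, Fin.sum_univ_two]

theorem act_one_eq (w : Spinor) :
    act (pauli 1) w = !₂[-Complex.I * w 1, Complex.I * w 0] := by
  ext i; fin_cases i <;> simp [act, pauli, dotProduct, Fin.sum_univ_two]

theorem act_two_eq (w : Spinor) : act (pauli 2) w = !₂[w 0, -w 1] := by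
  ext i; fin_cases i <;> simp [act, pauli, dotProduct, Fin.sum_univ_two]

theorem inner_act_left (k : Fin 3) (a b : Spinor) :
    inner ℝ (act (pauli k) a) b = inner ℝ a (act (pauli k) b) := by
  fin_cases k
  · simp only [Fin.zero_eta, act_zero_eq]
    simp [PiLp.inner_apply, Fin.sum_univ_two]; ring
  · simp only [Fin.mk_one, act_one_eq]
    simp [PiLp.inner_apply, Fin.sum_univ_two]; ring
  · simp only [Fin.reduceFinMk, act_two_eq]
    simp [PiLp.inner_apply, Fin.sum_univ_two]

theorem act_im (k : Fin 3) (a : Spinor) :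
    act (pauli k) (Complex.I • a) = Complex.I • act (pauli k) a := by
  ext i; fin_cases i <;> simp [act] <;> ring

theorem act_act_self (k : Fin 3) (a : Spinor) : act (pauli k) (act (pauli k) a) = a := by
  fin_cases k
  · simp only [Fin.zero_eta, act_zero_eq]
    ext i; fin_cases i <;> simp
  · simp only [Fin.mk_one, act_one_eq]
    ext i; fin_cases i <;> simp [← mul_assoc]
  · simp only [Fin.reduceFinMk, act_two_eq]
    ext i; fin_cases i <;> simp

theorem act_zero_one (a : Spinor) :
    act (pauli 0) (act (pauli 1) a) = Complex.I • act (pauli 2) a := by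
  simp only [act_zero_eq, act_one_eq, act_two_eq]
  ext i; fin_cases i <;> simp

theorem act_one_zero (a : Spinor) :
    act (pauli 1) (act (pauli 0) a) = -(Complex.I • act (pauli 2) a) := by
  simp only [act_zero_eq, act_one_eq, act_two_eq]
  ext i; fin_cases i <;> simp

theorem act_one_two (a : Spinor) :
    act (pauli 1) (act (pauli 2) a) = Complex.I • act (pauli 0) a := by
  simp only [act_zero_eq, act_one_eq, act_two_eq]
  ext i; fin_cases i <;> simp

theorem act_two_one (a : Spinor) :
    act (pauli 2) (act (pauli 1) a) = -(Complex.I • act (pauli 0) a) := by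
  simp only [act_zero_eq, act_one_eq, act_two_eq]
  ext i; fin_cases i <;> simp

theorem act_two_zero (a : Spinor) :
    act (pauli 2) (act (pauli 0) a) = Complex.I • act (pauli 1) a := by
  simp only [act_zero_eq, act_one_eq, act_two_eq]
  ext i; fin_cases i <;> simp [← mul_assoc]

theorem act_zero_two (a : Spinor) :
    act (pauli 0) (act (pauli 2) a) = -(Complex.I • act (pauli 1) a) := by
  simp only [act_zero_eq, act_one_eq, act_two_eq]
  ext i; fin_cases i <;> simp [← mul_assoc]

theorem norm_act (k : Fin 3) (a : Spinor) : ‖act (pauli k) a‖ = ‖a‖ := by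
  rw [← sq_eq_sq₀ (norm_nonneg _) (norm_nonneg _), ← real_inner_self_eq_norm_sq,
    ← real_inner_self_eq_norm_sq, inner_act_left, act_act_self]

/-- The anticommutation relations, in the form of a scalar product. -/
theorem anticomm (k l : Fin 3) (a b : Spinor) :
    inner ℝ a (act (pauli k) (act (pauli l) b)) + inner ℝ a (act (pauli l) (act (pauli k) b)) =
      if k = l then 2 * inner ℝ a b else 0 := by
  rw [← inner_add_right]
  fin_cases k <;> fin_cases l <;>
    simp only [Fin.zero_eta, Fin.mk_one, Fin.reduceFinMk, act_act_self, act_zero_one,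
      act_one_zero, act_one_two, act_two_one, act_two_zero, act_zero_two, add_neg_cancel,
      neg_add_cancel, inner_zero_right] <;> simp [inner_add_right, two_mul]

/-- The spin density is bounded by the density. -/
theorem spin_density_le (b : Fin 3 → ℝ) (w : Spinor) :
    |∑ n, b n * inner ℝ w (act (pauli n) w)| ≤ √(∑ n, b n ^ 2) * ‖w‖ ^ 2 := by
  set z : Spinor := ∑ n, b n • act (pauli n) w with hz
  have h1 : ∑ n, b n * inner ℝ w (act (pauli n) w) = inner ℝ w z := by
    rw [hz, inner_sum]; simp [inner_smul_right]
  -- Anticommutation removes the mixed terms, so `Σ bₙ σₙ` acts as `|b|` times an isometry.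
  have h2 : ‖z‖ ^ 2 = (∑ n, b n ^ 2) * ‖w‖ ^ 2 := by
    have hsq : ∀ n, inner ℝ (act (pauli n) w) (act (pauli n) w) = ‖w‖ ^ 2 := fun n => by
      rw [real_inner_self_eq_norm_sq, norm_act]
    have hx : ∀ k l : Fin 3, k ≠ l → inner ℝ (act (pauli k) w) (act (pauli l) w) +
        inner ℝ (act (pauli l) w) (act (pauli k) w) = 0 := fun k l hkl => by
      rw [inner_act_left, inner_act_left, anticomm, if_neg hkl]
    rw [← real_inner_self_eq_norm_sq, hz]
    simp only [Fin.sum_univ_three, inner_add_left, inner_add_right, real_inner_smul_left,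
      real_inner_smul_right, hsq]
    linear_combination b 0 * b 1 * hx 0 1 (by decide) + b 0 * b 2 * hx 0 2 (by decide) +
      b 1 * b 2 * hx 1 2 (by decide)
  have h3 : ‖z‖ = √(∑ n, b n ^ 2) * ‖w‖ := by
    rw [← Real.sqrt_sq (norm_nonneg z), h2, Real.sqrt_mul (by positivity),
      Real.sqrt_sq (norm_nonneg w)]
  rw [h1]
  calc _ ≤ ‖w‖ * ‖z‖ := abs_real_inner_le_norm _ _
    _ = _ := by rw [h3]; ring

/-- The matrix acting on covariant derivatives: the identity for `j = S`, and `σₖ (σ · )` for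
`j = P`. -/
def spinOp (j : Model) (X : Fin 3 → Spinor) (k : Fin 3) : Spinor :=
  match j with
  | .S => X k
  | .P => act (pauli k) (∑ l, act (pauli l) (X l))

theorem cov_eq_spinOp (ħ c Q : ℝ) (j : Model) (w : Spinor) (Dw : Fin 3 → Spinor) (a : Space)
    (k : Fin 3) : cov ħ c Q j w Dw a k = spinOp j (covS ħ c Q w Dw a) k := by
  cases j <;> rfl

/-- The kinetic form at a point. -/
def spinForm (j : Model) (X Y : Fin 3 → Spinor) : ℝ := ∑ k, inner ℝ (X k) (spinOp j Y k)

/-- Self-adjointness of `σₖ` exhibits the Pauli form as a scalar product of two vectors `σ · X` and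
`σ · Y`; symmetry and positivity follow. -/
theorem spinForm_P (X Y : Fin 3 → Spinor) :
    spinForm .P X Y = inner ℝ (∑ l, act (pauli l) (X l)) (∑ l, act (pauli l) (Y l)) := by
  rw [spinForm, sum_inner]
  exact Finset.sum_congr rfl fun k _ => by rw [inner_act_left]; rfl

theorem spinForm_comm (j : Model) (X Y : Fin 3 → Spinor) : spinForm j X Y = spinForm j Y X := by
  cases j
  · exact Finset.sum_congr rfl fun k _ => real_inner_comm _ _
  · rw [spinForm_P, spinForm_P, real_inner_comm]

theorem spinForm_self_nonneg (j : Model) (X : Fin 3 → Spinor) : 0 ≤ spinForm j X X := by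
  cases j
  · exact Finset.sum_nonneg fun k _ => real_inner_self_nonneg
  · rw [spinForm_P]; exact real_inner_self_nonneg

theorem spinOp_add (j : Model) (X Y : Fin 3 → Spinor) (k : Fin 3) :
    spinOp j (fun l => X l + Y l) k = spinOp j X k + spinOp j Y k := by
  cases j
  · rfl
  · simp only [spinOp, ← actL_apply, map_add, Finset.sum_add_distrib]

theorem spinOp_smul (j : Model) (c : ℝ) (X : Fin 3 → Spinor) (k : Fin 3) :
    spinOp j (fun l => c • X l) k = c • spinOp j X k := by
  cases j
  · rfl
  · simp only [spinOp, ← actL_apply, map_smul, ← Finset.smul_sum]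

theorem spinOp_im (j : Model) (X : Fin 3 → Spinor) (k : Fin 3) :
    spinOp j (fun l => Complex.I • X l) k = Complex.I • spinOp j X k := by
  cases j
  · rfl
  · simp only [spinOp, act_im, ← Finset.smul_sum]

theorem norm_spinOp_le (j : Model) (X : Fin 3 → Spinor) (k : Fin 3) :
    ‖spinOp j X k‖ ≤ ∑ l, ‖X l‖ := by
  cases j
  · exact Finset.single_le_sum (f := fun l => ‖X l‖) (fun l _ => norm_nonneg _) (Finset.mem_univ k)
  · simp only [spinOp, norm_act]
    exact (norm_sum_le _ _).trans_eq (by simp only [norm_act])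

theorem spinOp_memLp (j : Model) {X : Fin 3 → Space → Spinor}
    (hX : ∀ k, MemLp (X k) 2 volume) (k : Fin 3) :
    MemLp (fun x => spinOp j (X · x) k) 2 volume := by
  cases j
  · exact hX k
  · simp only [spinOp, ← actL_apply]
    exact (actL _).comp_memLp' (memLp_finsetSum _ fun l _ => (actL _).comp_memLp' (hX l))

end Pauli

/-! ### The kinetic form -/

section Kinetic

/-- The kinetic form. -/
def kin (j : Model) (X Y : Fin 3 → Space → Spinor) : ℝ := ∫ x, spinForm j (X · x) (Y · x)

variable {j : Model} {X Y Z : Fin 3 → Space → Spinor}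

theorem kin_integrable (hX : ∀ k, MemLp (X k) 2 volume) (hY : ∀ k, MemLp (Y k) 2 volume) :
    Integrable (fun x => spinForm j (X · x) (Y · x)) volume :=
  integrable_finsetSum _ fun k _ => integrable_inner (hX k) (spinOp_memLp j hY k)

/-- With the matrices moved to the first argument, the form becomes a pairing of `Y` with fixed
square integrable functions, as needed for weak limits and for the variational equations. -/
theorem kin_eq_sum (hX : ∀ k, MemLp (X k) 2 volume) (hY : ∀ k, MemLp (Y k) 2 volume) :
    kin j X Y = ∑ k, ∫ x, inner ℝ (spinOp j (X · x) k) (Y k x) := by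
  have : ∀ x, spinForm j (X · x) (Y · x) = ∑ k, inner ℝ (spinOp j (X · x) k) (Y k x) := by
    intro x
    rw [spinForm_comm]
    exact Finset.sum_congr rfl fun k _ => real_inner_comm _ _
  simp only [kin, this]
  exact integral_finsetSum _ fun k _ => integrable_inner (spinOp_memLp j hX k) (hY k)

theorem kin_comm : kin j X Y = kin j Y X := by simp only [kin, spinForm_comm]

theorem kin_self_nonneg : 0 ≤ kin j X X := integral_nonneg fun _ => spinForm_self_nonneg _ _

theorem kin_add_right (hX : ∀ k, MemLp (X k) 2 volume) (hY : ∀ k, MemLp (Y k) 2 volume)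
    (hZ : ∀ k, MemLp (Z k) 2 volume) :
    kin j X (fun k x => Y k x + Z k x) = kin j X Y + kin j X Z := by
  rw [kin, kin, kin, ← integral_add (kin_integrable hX hY) (kin_integrable hX hZ)]
  refine integral_congr_ae (Eventually.of_forall fun x => ?_)
  simp only [spinForm, spinOp_add j (Y · x) (Z · x), inner_add_right, Finset.sum_add_distrib]

theorem kin_smul_right (c : ℝ) : kin j X (fun k x => c • Y k x) = c * kin j X Y := by
  rw [kin, kin, ← integral_const_mul]
  refine integral_congr_ae (Eventually.of_forall fun x => ?_)
  simp only [spinForm, spinOp_smul j c (Y · x), inner_smul_right, Finset.mul_sum]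

theorem kin_add_self (hX : ∀ k, MemLp (X k) 2 volume) (hY : ∀ k, MemLp (Y k) 2 volume) :
    kin j (fun k x => X k x + Y k x) (fun k x => X k x + Y k x) =
      kin j X X + 2 * kin j X Y + kin j Y Y := by
  have hXY : ∀ k, MemLp (fun x => X k x + Y k x) 2 volume := fun k => memLp_fun_add (hX k) (hY k)
  rw [kin_add_right hXY hX hY, kin_comm (Y := X), kin_comm (Y := Y), kin_add_right hX hX hY,
    kin_add_right hY hX hY, kin_comm (X := Y) (Y := X)]
  ring

/-- The constants 9 here and 27 in `abs_kin_le` are crude; only their finiteness matters later. -/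
theorem gradNorm_spinOp_le (hX : ∀ k, MemLp (X k) 2 volume) :
    gradNorm (fun k x => spinOp j (X · x) k) ≤ 9 * gradNorm X := by
  have h1 : ∀ k, lpNorm (fun x => spinOp j (X · x) k) 2 volume ≤ 3 * gradNorm X := by
    intro k
    have hm : MemLp (fun x => ∑ l, ‖X l x‖) 2 volume := memLp_finsetSum _ fun l _ => (hX l).norm
    refine (lpNorm_mono_norm hm (Eventually.of_forall fun x => ?_)).trans ?_
    · rw [Real.norm_of_nonneg (by positivity)]; exact norm_spinOp_le j _ k
    · have e : (fun x => ∑ l, ‖X l x‖) = ∑ l, fun x => ‖X l x‖ := by ext1 x; simp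
      rw [e]
      refine (lpNorm_sum_le (fun l _ => (hX l).norm) (by norm_num)).trans ?_
      calc _ ≤ ∑ _l : Fin 3, gradNorm X := Finset.sum_le_sum fun l _ => by
            have : lpNorm (fun x => ‖X l x‖) 2 volume = lpNorm (X l) 2 volume :=
              lpNorm_norm (hX l).1 2
            rw [this]; exact lpNorm_le_gradNorm X l
        _ = _ := by simp
  have h0 := gradNorm_nonneg X
  refine le_of_sq_le_sq ?_ (by positivity)
  rw [sq_gradNorm, Fin.sum_univ_three]
  have h2 : ∀ k, lpNorm (fun x => spinOp j (X · x) k) 2 volume ^ 2 ≤ (3 * gradNorm X) ^ 2 :=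
    fun k => pow_le_pow_left₀ lpNorm_nonneg (h1 k) 2
  nlinarith [h2 0, h2 1, h2 2]

theorem abs_kin_le (hX : ∀ k, MemLp (X k) 2 volume) (hY : ∀ k, MemLp (Y k) 2 volume) :
    |kin j X Y| ≤ 27 * gradNorm X * gradNorm Y := by
  rw [kin_eq_sum hX hY]
  refine (Finset.abs_sum_le_sum_abs _ _).trans ?_
  calc _ ≤ ∑ _k : Fin 3, 9 * gradNorm X * gradNorm Y := Finset.sum_le_sum fun k _ => by
        refine (abs_integral_inner_le (spinOp_memLp j hX k) (hY k)).trans ?_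
        refine mul_le_mul ?_ (lpNorm_le_gradNorm Y k) lpNorm_nonneg
          (mul_nonneg (by norm_num) (gradNorm_nonneg _))
        exact (lpNorm_le_gradNorm (fun k x => spinOp j (X · x) k) k).trans (gradNorm_spinOp_le hX)
    _ = _ := by simp; ring

theorem kin_S_self (hX : ∀ k, MemLp (X k) 2 volume) : kin .S X X = gradNorm X ^ 2 := by
  rw [sq_gradNorm_eq_integral hX]
  refine integral_congr_ae (Eventually.of_forall fun x => ?_)
  exact Finset.sum_congr rfl fun k _ => real_inner_self_eq_norm_sq _

end Kinetic

/-! ### Integration by parts for the Pauli term -/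

section PauliIBP

theorem inner_test {F : Type*} [NormedAddCommGroup F] [InnerProductSpace ℝ F] {f g : Space → F}
    (hf : VTest f) (hg : ContDiff ℝ (⊤ : ℕ∞) g) : VTest fun x => inner ℝ (f x) (g x) := by
  refine ⟨hf.1.inner ℝ hg, ?_⟩
  refine hf.2.mono fun x hx h0 => hx ?_
  simp only [h0, inner_zero_left]

theorem pdv_inner {F : Type*} [NormedAddCommGroup F] [InnerProductSpace ℝ F] {f g : Space → F}
    (hf : Differentiable ℝ f) (hg : Differentiable ℝ g) (k : Fin 3) (x : Space) :
    pdv k (fun x => inner ℝ (f x) (g x)) x =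
      inner ℝ (f x) (pdv k g x) + inner ℝ (pdv k f x) (g x) := by
  simp only [pdv]
  rw [fderiv_inner_apply ℝ (hf x) (hg x)]

theorem integral_inner_pdv {F : Type*} [NormedAddCommGroup F] [InnerProductSpace ℝ F]
    {f g : Space → F} (hf : VTest f) (hg : VTest g) (k : Fin 3) :
    ∫ x, inner ℝ (pdv k f x) (g x) = -∫ x, inner ℝ (f x) (pdv k g x) := by
  have h := integral_pdv_eq_zero (inner_test hf hg.1) k
  simp only [pdv_inner hf.differentiable hg.differentiable] at h
  rw [integral_add (integrable_inner (hf.memLp 2) ((hg.pdv k).memLp 2))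
    (integrable_inner ((hf.pdv k).memLp 2) (hg.memLp 2))] at h
  linarith

/-- For a real-linear antisymmetric `τ` commuting with `i`, the mixed term of two covariant
derivatives integrates to a curl. -/
theorem integral_mixed_term {ħ : ℝ} {τ : Spinor →L[ℝ] Spinor}
    (hτ : ∀ a b, inner ℝ (τ a) b = -inner ℝ a (τ b))
    (hτi : ∀ a, τ (Complex.I • a) = Complex.I • τ a)
    {ψ : Space → Spinor} (hψ : VTest ψ) {r : Fin 3 → Space → ℝ}
    (hr : ∀ k, ContDiff ℝ (⊤ : ℕ∞) (r k)) (k l : Fin 3) :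
    2 * ∫ x, inner ℝ (ħ • (Complex.I • pdv k ψ x) + r k x • ψ x)
        (τ (ħ • (Complex.I • pdv l ψ x) + r l x • ψ x)) =
      ħ * ∫ x, (pdv k (r l) x - pdv l (r k) x) * inner ℝ (ψ x) (Complex.I • τ (ψ x)) := by
  set q : Space → ℝ := fun x => inner ℝ (ψ x) (Complex.I • τ (ψ x)) with hq
  have hN : VTest fun x => Complex.I • τ (ψ x) := (hψ.clm τ).clm imL
  have hqt : VTest q := inner_test hψ hN.1
  -- `i τ` is symmetric, so both factors of the product contribute equally to the derivative.
  have hdq : ∀ n x, pdv n q x = 2 * inner ℝ (ψ x) (Complex.I • τ (pdv n ψ x)) := by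
    intro n x
    have e1 : pdv n (fun x => Complex.I • τ (ψ x)) x = Complex.I • τ (pdv n ψ x) := by
      have e := pdv_clm (hψ.clm τ).differentiable imL n
      have e' := pdv_clm hψ.differentiable τ n
      simp only [imL_apply, e'] at e
      rw [e]
    rw [hq, pdv_inner hψ.differentiable hN.differentiable, e1]
    have : inner ℝ (pdv n ψ x) (Complex.I • τ (ψ x)) =
        inner ℝ (ψ x) (Complex.I • τ (pdv n ψ x)) := by
      have h1 := inner_im_left (pdv n ψ x) (τ (ψ x))
      have h2 := hτ (Complex.I • pdv n ψ x) (ψ x)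
      rw [hτi, real_inner_comm] at h2
      linarith
    rw [this]; ring
  have hττ : ∀ a, inner ℝ a (τ a) = 0 := fun a => by
    have := hτ a a; rw [real_inner_comm] at this; linarith
  -- the pointwise expansion
  have hpt : ∀ x, 2 * inner ℝ (ħ • (Complex.I • pdv k ψ x) + r k x • ψ x)
        (τ (ħ • (Complex.I • pdv l ψ x) + r l x • ψ x)) =
      2 * ħ ^ 2 * inner ℝ (pdv k ψ x) (τ (pdv l ψ x)) +
        (ħ * (r k x * pdv l q x) - ħ * (r l x * pdv k q x)) := by
    intro x
    rw [hdq, hdq]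
    simp only [map_add, map_smul, hτi, inner_add_left, inner_add_right, real_inner_smul_left,
      real_inner_smul_right, inner_im_im, hττ]
    have h1 := inner_im_left (pdv k ψ x) (τ (ψ x))
    have h2 := hτ (pdv k ψ x) (Complex.I • ψ x)
    have h3 : inner ℝ (Complex.I • pdv k ψ x) (τ (ψ x)) =
        -inner ℝ (ψ x) (Complex.I • τ (pdv k ψ x)) := by
      have h5 := hτ (ψ x) (Complex.I • pdv k ψ x)
      rw [hτi, real_inner_comm] at h5
      linarith
    rw [h3]; ring
  -- Integrating by parts on either factor yields the same second-order term with opposite signs,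
  -- since second derivatives commute and `τ` is antisymmetric.
  have hz : ∫ x, inner ℝ (pdv k ψ x) (τ (pdv l ψ x)) = 0 := by
    have a1 := integral_inner_pdv hψ ((hψ.pdv l).clm τ) k
    have a2 := integral_inner_pdv (hψ.clm τ) (hψ.pdv k) l
    have e1 : ∀ x, pdv k (fun x => τ (pdv l ψ x)) x = τ (pdv k (pdv l ψ) x) := fun x => by
      rw [pdv_clm (hψ.pdv l).differentiable]
    have e2 : ∀ x, pdv l (fun x => τ (ψ x)) x = τ (pdv l ψ x) := fun x => by
      rw [pdv_clm hψ.differentiable]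
    simp only [e1] at a1
    simp only [e2] at a2
    have e3 : ∀ x, inner ℝ (τ (ψ x)) (pdv l (pdv k ψ) x) =
        -inner ℝ (ψ x) (τ (pdv k (pdv l ψ) x)) := fun x => by
      rw [hτ, pdv_comm hψ.1 l k]
    have e4 : ∀ x, inner ℝ (τ (pdv l ψ x)) (pdv k ψ x) = inner ℝ (pdv k ψ x) (τ (pdv l ψ x)) :=
      fun x => real_inner_comm _ _
    simp only [e3, e4, integral_neg, neg_neg] at a2
    linarith
  have hib : ∀ a b : Fin 3, ∫ x, r a x * pdv b q x = -∫ x, pdv b (r a) x * q x := by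
    intro a b
    have := VTest.integral_smul_pdv hqt (hr a) b
    simp only [smul_eq_mul] at this
    have e1 : ∀ x, q x * pdv b (r a) x = pdv b (r a) x * q x := fun x => mul_comm _ _
    have e2 : ∀ x, pdv b q x * r a x = r a x * pdv b q x := fun x => mul_comm _ _
    simp only [e1, e2] at this
    linarith
  have hir : ∀ a b : Fin 3, Integrable (fun x => r a x * pdv b q x) volume := fun a b =>
    ((hr a).continuous.mul (hqt.pdv b).continuous).integrable_of_hasCompactSupport
      (hqt.pdv b).2.mul_left
  have hir' : ∀ a b : Fin 3, Integrable (fun x => pdv b (r a) x * q x) volume := fun a b => by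
    have hc : Continuous (pdv b (r a)) :=
      ((hr a).continuous_fderiv (by simp)).clm_apply continuous_const
    exact (hc.mul hqt.continuous).integrable_of_hasCompactSupport hqt.2.mul_left
  rw [← integral_const_mul]
  simp only [hpt]
  have hi1 : Integrable (fun x => inner ℝ (pdv k ψ x) (τ (pdv l ψ x))) volume :=
    integrable_inner ((hψ.pdv k).memLp 2) (((hψ.pdv l).clm τ).memLp 2)
  have hi2 : Integrable (fun x => ħ * (r k x * pdv l q x) - ħ * (r l x * pdv k q x)) volume :=
    ((hir k l).const_mul ħ).sub ((hir l k).const_mul ħ)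
  rw [integral_add (hi1.const_mul _) hi2,
    integral_sub ((hir k l).const_mul ħ) ((hir l k).const_mul ħ), integral_const_mul,
    integral_const_mul, integral_const_mul, hz, hib, hib]
  simp only [sub_mul]
  rw [integral_sub (hir' l k) (hir' k l)]
  ring

end PauliIBP

/-! ### Configurations and the energy functional -/

/-- The parameters of the travelling wave problem. -/
structure Params where
  ħ : ℝ
  c : ℝ
  m : ℝ
  Q : ℝ
  j : Model
  v : Space
  hħ : 0 < ħ
  hc : 0 < c
  hm : 0 < m
  hQ : Q ≠ 0
  hv : ‖v‖ < c

/-- A pair `(ψ, A)` of finite energy together with the weak gradients `D` and `G`. -/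
@[ext]
structure Conf where
  ψ : Space → Spinor
  D : Fin 3 → Space → Spinor
  A : Space → Space
  G : Fin 3 → Space → Space
  hψ : Adm 2 ψ D
  hA : Adm 6 A G

namespace Conf

variable (u w : Conf)

theorem ψ6 : MemLp u.ψ 6 volume := (u.hψ.sobolev (by norm_num)).1
theorem ψ2 : MemLp u.ψ 2 volume := u.hψ.1
theorem ψ3 : MemLp u.ψ 3 volume := memLp_three u.ψ2 u.ψ6
theorem A6 : MemLp u.A 6 volume := u.hA.1
theorem D2 (k : Fin 3) : MemLp (u.D k) 2 volume := u.hψ.2.1 k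
theorem G2 (k : Fin 3) : MemLp (u.G k) 2 volume := u.hA.2.1 k

theorem A6_le : lpNorm u.A 6 volume ≤ sobolevConst * gradNorm u.G := (u.hA.sobolev (by norm_num)).2
theorem ψ6_le : lpNorm u.ψ 6 volume ≤ sobolevConst * gradNorm u.D :=
  (u.hψ.sobolev (by norm_num)).2

/-- The sum of two configurations. -/
def add : Conf where
  ψ := fun x => u.ψ x + w.ψ x
  D := fun k x => u.D k x + w.D k x
  A := fun x => u.A x + w.A x
  G := fun k x => u.G k x + w.G k x
  hψ := u.hψ.add (by norm_num) w.hψ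
  hA := u.hA.add (by norm_num) w.hA

/-- The difference of two configurations. -/
def sub : Conf where
  ψ := fun x => u.ψ x - w.ψ x
  D := fun k x => u.D k x - w.D k x
  A := fun x => u.A x - w.A x
  G := fun k x => u.G k x - w.G k x
  hψ := u.hψ.sub (by norm_num) w.hψ
  hA := u.hA.sub (by norm_num) w.hA

theorem add_sub : u.add (w.sub u) = w := by
  ext <;> simp [add, sub]

/-- Translation of a configuration. -/
def translate (y : Space) : Conf where
  ψ := fun x => u.ψ (x + y)
  D := fun k x => u.D k (x + y)
  A := fun x => u.A (x + y)
  G := fun k x => u.G k (x + y)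
  hψ := u.hψ.translate y
  hA := u.hA.translate y

/-- Multiplication of the two components by real numbers. -/
def scale (s t : ℝ) : Conf where
  ψ := fun x => s • u.ψ x
  D := fun k x => s • u.D k x
  A := fun x => t • u.A x
  G := fun k x => t • u.G k x
  hψ := u.hψ.const_smul s
  hA := u.hA.const_smul t

/-- The configuration given by smooth functions of compact support. -/
def ofTest {ψ : Space → Spinor} {A : Space → Space} (hψ : VTest ψ) (hA : VTest A) : Conf where
  ψ := ψ
  D := (pdv · ψ)
  A := A
  G := (pdv · A)
  hψ := hψ.adm 2
  hA := hA.adm 6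

/-- The total mass. -/
def mass : ℝ := ∫ x, ‖u.ψ x‖ ^ 2

theorem mass_eq : u.mass = lpNorm u.ψ 2 volume ^ 2 := (sq_lpNorm_two u.ψ2.1).symm

theorem mass_nonneg : 0 ≤ u.mass := by rw [mass_eq]; positivity

/-- The vector potential is divergence free. -/
def DivFree : Prop := ∀ᵐ x, ∑ k, u.G k x k = 0

end Conf

/-! ### Products of an `L⁶` vector field with an `L³` function -/

section Products

variable {F : Type*} [NormedAddCommGroup F] [NormedSpace ℝ F]

/-- Hölder's inequality for the product of a coordinate of a vector field and a function. -/
theorem memLp_coord_smul {A : Space → Space} (hA : MemLp A 6 volume) {f : Space → F}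
    (hf : MemLp f 3 volume) (k : Fin 3) :
    MemLp (fun x => A x k • f x) 2 volume ∧
      lpNorm (fun x => A x k • f x) 2 volume ≤ lpNorm A 6 volume * lpNorm f 3 volume := by
  have hb : ∀ x, ‖A x k • f x‖ ≤ ‖A x‖ * ‖f x‖ := fun x => by
    rw [norm_smul]; gcongr; exact PiLp.norm_apply_le _ _
  have hm : AEStronglyMeasurable (fun x => A x k • f x) volume :=
    ((EuclideanSpace.proj (𝕜 := ℝ) k).continuous.comp_aestronglyMeasurable hA.1).smul hf.1
  exact ⟨memLp_bilin (r := 2) hA hf (fun a w => a k • w) hm hb,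
    lpNorm_bilin_le (r := 2) hA hf (fun a w => a k • w) hb⟩

theorem memLp_inner_smul (v : Space) {A : Space → Space} (hA : MemLp A 6 volume) {f : Space → F}
    (hf : MemLp f 3 volume) :
    MemLp (fun x => inner ℝ v (A x) • f x) 2 volume ∧
      lpNorm (fun x => inner ℝ v (A x) • f x) 2 volume ≤
        ‖v‖ * (lpNorm A 6 volume * lpNorm f 3 volume) := by
  have hvA : MemLp (fun x => ‖v‖ • A x) 6 volume := hA.const_smul ‖v‖
  have hb : ∀ x, ‖inner ℝ v (A x) • f x‖ ≤ ‖‖v‖ • A x‖ * ‖f x‖ := fun x => by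
    rw [norm_smul, norm_smul, norm_norm]; gcongr; exact norm_inner_le_norm _ _
  have hm : AEStronglyMeasurable (fun x => inner ℝ v (A x) • f x) volume :=
    (aestronglyMeasurable_const.inner hA.1).smul hf.1
  have hm2 : MemLp (fun x => ‖A x‖ * ‖f x‖) 2 volume :=
    memLp_bilin (r := 2) hA hf (fun a w => ‖a‖ * ‖w‖) (hA.1.norm.mul hf.1.norm)
      fun x => by simp
  constructor
  · refine (hm2.const_mul ‖v‖).mono hm (Eventually.of_forall fun x => ?_)
    refine (hb x).trans_eq ?_
    simp [norm_smul, mul_assoc]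
  · have hm3 : MemLp (fun x => ‖v‖ • (‖A x‖ * ‖f x‖)) 2 volume := hm2.const_smul ‖v‖
    refine (lpNorm_mono_norm hm3 (Eventually.of_forall fun x => ?_)).trans ?_
    · refine (hb x).trans_eq ?_
      simp [norm_smul, mul_assoc]
    · rw [lpNorm_fun_const_smul, abs_of_nonneg (norm_nonneg v)]
      gcongr
      exact lpNorm_bilin_le (r := 2) hA hf (fun a w => ‖a‖ * ‖w‖) fun x => by simp

end Products

/-! ### The energy functional -/

namespace Params

variable (P : Params) (u w : Conf)

/-- The covariant derivative in the moving frame. -/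
def cd (k : Fin 3) (x : Space) : Spinor :=
  P.ħ • (Complex.I • u.D k x) + (P.Q / P.c * u.A x k + P.m * P.v k) • u.ψ x

/-- The cross terms `(Q/c) (A_u ψ_w + A_w ψ_u)`. -/
def cross (k : Fin 3) (x : Space) : Spinor :=
  (P.Q / P.c) • (w.A x k • u.ψ x + u.A x k • w.ψ x)

/-- The covariant derivative is a linear map plus a quadratic one in the pair `(ψ, A)`; `cross` is
the polarization of the quadratic part. -/
theorem cd_add (k : Fin 3) (x : Space) :
    P.cd (u.add w) k x = (P.cd u k x + P.cd w k x) + P.cross u w k x := by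
  simp only [cd, Conf.add, cross, PiLp.add_apply]
  module

theorem cd_memLp (k : Fin 3) : MemLp (P.cd u k) 2 volume := by
  have h1 : MemLp (fun x => P.ħ • (Complex.I • u.D k x)) 2 volume :=
    ((u.D2 k).const_smul Complex.I).const_smul P.ħ
  have h2 : MemLp (fun x => (P.Q / P.c) • (u.A x k • u.ψ x)) 2 volume :=
    (memLp_coord_smul u.A6 u.ψ3 k).1.const_smul (P.Q / P.c)
  have h3 : MemLp (fun x => (P.m * P.v k) • u.ψ x) 2 volume := u.ψ2.const_smul (P.m * P.v k)
  refine (memLp_congr_ae (Eventually.of_forall fun x => ?_)).mp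
    (memLp_fun_add h1 (memLp_fun_add h2 h3))
  simp only [cd]; module

theorem lpNorm_cd_le (k : Fin 3) : lpNorm (P.cd u k) 2 volume ≤
    P.ħ * lpNorm (u.D k) 2 volume + (|P.Q / P.c| * (lpNorm u.A 6 volume * lpNorm u.ψ 3 volume) +
      |P.m * P.v k| * lpNorm u.ψ 2 volume) := by
  have h1 : MemLp (fun x => P.ħ • (Complex.I • u.D k x)) 2 volume :=
    ((u.D2 k).const_smul Complex.I).const_smul P.ħ
  have h2 : MemLp (fun x => (P.Q / P.c) • (u.A x k • u.ψ x)) 2 volume :=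
    (memLp_coord_smul u.A6 u.ψ3 k).1.const_smul (P.Q / P.c)
  have e : P.cd u k = fun x => P.ħ • (Complex.I • u.D k x) +
      ((P.Q / P.c) • (u.A x k • u.ψ x) + (P.m * P.v k) • u.ψ x) := by
    ext1 x; simp only [cd]; module
  rw [e]
  refine (lpNorm_fun_add_le h1 (by norm_num)).trans ?_
  refine add_le_add ?_ ((lpNorm_fun_add_le h2 (by norm_num)).trans (add_le_add ?_ ?_))
  · rw [lpNorm_fun_const_smul, abs_of_pos P.hħ]
    refine mul_le_mul_of_nonneg_left (le_of_eq ?_) P.hħ.le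
    exact lpNorm_congr_norm ((u.D2 k).1.const_smul Complex.I) (u.D2 k).1
      (Eventually.of_forall fun x => norm_im _)
  · rw [lpNorm_fun_const_smul]
    exact mul_le_mul_of_nonneg_left (memLp_coord_smul u.A6 u.ψ3 k).2 (abs_nonneg _)
  · rw [lpNorm_fun_const_smul]

theorem cross_memLp (k : Fin 3) : MemLp (P.cross u w k) 2 volume :=
  (memLp_fun_add (memLp_coord_smul w.A6 u.ψ3 k).1 (memLp_coord_smul u.A6 w.ψ3 k).1).const_smul
    (P.Q / P.c)

theorem lpNorm_cross_le (k : Fin 3) : lpNorm (P.cross u w k) 2 volume ≤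
    |P.Q / P.c| * (lpNorm (fun x => w.A x k • u.ψ x) 2 volume +
      lpNorm (fun x => u.A x k • w.ψ x) 2 volume) := by
  have := lpNorm_fun_const_smul (μ := volume) (P.Q / P.c)
    (fun x => w.A x k • u.ψ x + u.A x k • w.ψ x) 2
  rw [show P.cross u w k = fun x => (P.Q / P.c) • (w.A x k • u.ψ x + u.A x k • w.ψ x) from rfl,
    this]
  exact mul_le_mul_of_nonneg_left
    (lpNorm_fun_add_le (memLp_coord_smul w.A6 u.ψ3 k).1 (by norm_num)) (abs_nonneg _)

/-- The kinetic energy, up to the factor `1 / 2m`. -/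
def kinetic : ℝ := kin P.j (P.cd u) (P.cd u)

theorem kinetic_nonneg : 0 ≤ P.kinetic u := kin_self_nonneg

/-- The integral `∫ v · A |ψ|²`. -/
def flux : ℝ := ∫ x, inner ℝ P.v (u.A x) * ‖u.ψ x‖ ^ 2

/-- The bilinear form of the field energy in the moving frame. -/
def fieldForm (G H : Fin 3 → Space → Space) : ℝ :=
  1 / (8 * Real.pi) * ∫ x, (∑ k, inner ℝ (G k x) (H k x) -
    1 / P.c ^ 2 * inner ℝ (∑ k, P.v k • G k x) (∑ k, P.v k • H k x))

/-- The energy functional of travelling waves. -/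
def energy : ℝ := 1 / (2 * P.m) * P.kinetic u - P.Q / P.c * P.flux u + P.fieldForm u.G u.G

/-- Hölder with `1/6 + 1/3 + 1/2 = 1`. -/
theorem flux_integrable_aux {A : Space → Space} (hA : MemLp A 6 volume)
    {f g : Space → Spinor} (hf : MemLp f 3 volume) (hg : MemLp g 2 volume) :
    Integrable (fun x => inner ℝ P.v (A x) * inner ℝ (f x) (g x)) volume := by
  have := integrable_inner (memLp_inner_smul P.v hA hf).1 hg
  refine this.congr (Eventually.of_forall fun x => ?_)
  simp [real_inner_smul_left]

theorem flux_abs_le_aux {A : Space → Space} (hA : MemLp A 6 volume)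
    {f g : Space → Spinor} (hf : MemLp f 3 volume) (hg : MemLp g 2 volume) :
    |∫ x, inner ℝ P.v (A x) * inner ℝ (f x) (g x)| ≤
      lpNorm (fun x => inner ℝ P.v (A x) • f x) 2 volume * lpNorm g 2 volume := by
  have := abs_integral_inner_le (memLp_inner_smul P.v hA hf).1 hg
  simpa only [real_inner_smul_left] using this

theorem flux_eq : P.flux u = ∫ x, inner ℝ P.v (u.A x) * inner ℝ (u.ψ x) (u.ψ x) := by
  simp only [flux, real_inner_self_eq_norm_sq]

theorem abs_flux_le : |P.flux u| ≤
    ‖P.v‖ * (lpNorm u.A 6 volume * lpNorm u.ψ 3 volume) * lpNorm u.ψ 2 volume := by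
  rw [flux_eq]
  refine (P.flux_abs_le_aux u.A6 u.ψ3 u.ψ2).trans ?_
  exact mul_le_mul_of_nonneg_right (memLp_inner_smul P.v u.A6 u.ψ3).2 lpNorm_nonneg

section Field

variable {P} {G H : Fin 3 → Space → Space} (hG : ∀ k, MemLp (G k) 2 volume)
  (hH : ∀ k, MemLp (H k) 2 volume)

theorem sum_smul_memLp (hG : ∀ k, MemLp (G k) 2 volume) (v : Space) :
    MemLp (fun x => ∑ k, v k • G k x) 2 volume :=
  memLp_finsetSum _ fun k _ => (hG k).const_smul (v k)

include hG hH in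
theorem fieldForm_integrable : Integrable (fun x => ∑ k, inner ℝ (G k x) (H k x) -
    1 / P.c ^ 2 * inner ℝ (∑ k, P.v k • G k x) (∑ k, P.v k • H k x)) volume :=
  (integrable_finsetSum _ fun k _ => integrable_inner (hG k) (hH k)).sub
    ((integrable_inner (sum_smul_memLp hG P.v) (sum_smul_memLp hH P.v)).const_mul _)

theorem fieldForm_comm : P.fieldForm G H = P.fieldForm H G := by
  simp only [fieldForm, real_inner_comm]

include hG hH in
theorem fieldForm_add_right {H' : Fin 3 → Space → Space} (hH' : ∀ k, MemLp (H' k) 2 volume) :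
    P.fieldForm G (fun k x => H k x + H' k x) = P.fieldForm G H + P.fieldForm G H' := by
  rw [fieldForm, fieldForm, fieldForm, ← mul_add,
    ← integral_add (fieldForm_integrable hG hH) (fieldForm_integrable hG hH')]
  congr 2
  ext1 x
  simp only [inner_add_right, smul_add, Finset.sum_add_distrib]
  ring

theorem fieldForm_smul_right (t : ℝ) :
    P.fieldForm G (fun k x => t • H k x) = t * P.fieldForm G H := by
  have e : ∀ x, ∑ k, inner ℝ (G k x) (t • H k x) -
      1 / P.c ^ 2 * inner ℝ (∑ k, P.v k • G k x) (∑ k, P.v k • t • H k x) =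
      t * (∑ k, inner ℝ (G k x) (H k x) -
        1 / P.c ^ 2 * inner ℝ (∑ k, P.v k • G k x) (∑ k, P.v k • H k x)) := fun x => by
    simp only [inner_smul_right, smul_comm _ t, ← Finset.smul_sum, ← Finset.mul_sum]
    ring
  simp only [fieldForm, e, integral_const_mul]
  ring

include hG hH in
theorem fieldForm_add_self :
    P.fieldForm (fun k x => G k x + H k x) (fun k x => G k x + H k x) =
      P.fieldForm G G + 2 * P.fieldForm G H + P.fieldForm H H := by
  have hGH : ∀ k, MemLp (fun x => G k x + H k x) 2 volume := fun k => memLp_fun_add (hG k) (hH k)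
  rw [fieldForm_add_right hGH hG hH, fieldForm_comm (H := G), fieldForm_comm (H := H),
    fieldForm_add_right hG hG hH, fieldForm_add_right hH hG hH, fieldForm_comm (G := H) (H := G)]
  ring

variable (P) in
/-- The ellipticity constant of the field energy. -/
def fieldConst : ℝ := 1 / (8 * Real.pi) * (1 - ‖P.v‖ ^ 2 / P.c ^ 2)

variable (P) in
theorem fieldConst_pos : 0 < P.fieldConst := by
  have h1 : ‖P.v‖ ^ 2 < P.c ^ 2 := by have := P.hv; gcongr
  have h2 : ‖P.v‖ ^ 2 / P.c ^ 2 < 1 := (div_lt_one (pow_pos P.hc 2)).mpr h1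
  have := Real.pi_pos
  exact mul_pos (by positivity) (by linarith)

theorem norm_sum_smul_sq_le (v : Space) (g : Fin 3 → Space) :
    ‖∑ k, v k • g k‖ ^ 2 ≤ ‖v‖ ^ 2 * ∑ k, ‖g k‖ ^ 2 := by
  have h1 : ‖∑ k, v k • g k‖ ≤ ∑ k, |v k| * ‖g k‖ :=
    (norm_sum_le _ _).trans_eq (Finset.sum_congr rfl fun k _ => by rw [norm_smul, Real.norm_eq_abs])
  calc _ ≤ (∑ k, |v k| * ‖g k‖) ^ 2 := by gcongr
    _ ≤ (∑ k, |v k| ^ 2) * ∑ k, ‖g k‖ ^ 2 := Finset.sum_mul_sq_le_sq_mul_sq _ _ _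
    _ = _ := by rw [EuclideanSpace.norm_sq_eq]; simp

-- By Cauchy–Schwarz the velocity term takes away at most the fraction `|v|²/c²` of `|∇A|²`,
-- pointwise; a speed below `c` leaves a positive multiple.
include hG in
theorem fieldForm_self_ge : P.fieldConst * gradNorm G ^ 2 ≤ P.fieldForm G G := by
  have hpi := Real.pi_pos
  rw [sq_gradNorm_eq_integral hG, fieldConst, fieldForm, mul_assoc, ← integral_const_mul]
  refine mul_le_mul_of_nonneg_left (integral_mono ?_ (fieldForm_integrable hG hG) fun x => ?_)
    (by positivity)
  · exact (integrable_finsetSum _ fun k _ => (memLp_two_iff_integrable_sq_norm (hG k).1).mp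
      (hG k)).const_mul _
  · have h := norm_sum_smul_sq_le P.v (G · x)
    simp only [real_inner_self_eq_norm_sq]
    have hc := pow_pos P.hc 2
    have h2 := mul_le_mul_of_nonneg_left h (show 0 ≤ 1 / P.c ^ 2 by positivity)
    have e : 1 / P.c ^ 2 * (‖P.v‖ ^ 2 * ∑ k, ‖G k x‖ ^ 2) =
      ‖P.v‖ ^ 2 / P.c ^ 2 * ∑ k, ‖G k x‖ ^ 2 := by ring
    rw [e] at h2
    linarith

include hG in
theorem fieldForm_self_nonneg : 0 ≤ P.fieldForm G G :=
  (mul_nonneg P.fieldConst_pos.le (sq_nonneg _)).trans (fieldForm_self_ge hG)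

end Field

/-! ### Approximation by test configurations -/

/-- Estimates that rely on integration by parts or pointwise differentiation are proved for smooth
compactly supported configurations and carried over to all configurations by continuity. -/
theorem exists_test_approx : ∃ w : ℕ → Conf,
    (∀ n, ∃ (ψ : Space → Spinor) (A : Space → Space) (hψ : VTest ψ) (hA : VTest A),
      u.add (w n) = Conf.ofTest hψ hA) ∧
    Tendsto (fun n => lpNorm (w n).ψ 2 volume) atTop (𝓝 0) ∧
    Tendsto (fun n => gradNorm (w n).D) atTop (𝓝 0) ∧
    Tendsto (fun n => gradNorm (w n).G) atTop (𝓝 0) := by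
  obtain ⟨φ, hφ, hφ1, hφ2⟩ := u.hψ.exists_seq
  obtain ⟨B, hB, hB1, hB2⟩ := u.hA.exists_seq
  refine ⟨fun n => (Conf.ofTest (hφ n) (hB n)).sub u, fun n => ⟨φ n, B n, hφ n, hB n,
    Conf.add_sub _ _⟩, ?_, ?_, ?_⟩
  · refine hφ1.congr fun n => ?_
    refine lpNorm_congr_norm (u.ψ2.sub ((hφ n).memLp 2)).1 (((hφ n).memLp 2).sub u.ψ2).1
      (Eventually.of_forall fun x => ?_)
    exact norm_sub_rev _ _
  · rw [← gradNorm_zero (F := Spinor)]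
    refine tendsto_gradNorm fun k => ?_
    rw [show lpNorm (fun _ => (0 : Spinor)) 2 (volume : Measure Space) = 0 from lpNorm_zero _ _]
    refine (hφ2 k).congr fun n => ?_
    refine lpNorm_congr_norm ((u.D2 k).sub (((hφ n).pdv k).memLp 2)).1
      ((((hφ n).pdv k).memLp 2).sub (u.D2 k)).1 (Eventually.of_forall fun x => ?_)
    exact norm_sub_rev _ _
  · rw [← gradNorm_zero (F := Space)]
    refine tendsto_gradNorm fun k => ?_
    rw [show lpNorm (fun _ => (0 : Space)) 2 (volume : Measure Space) = 0 from lpNorm_zero _ _]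
    refine (hB2 k).congr fun n => ?_
    refine lpNorm_congr_norm ((u.G2 k).sub (((hB n).pdv k).memLp 2)).1
      ((((hB n).pdv k).memLp 2).sub (u.G2 k)).1 (Eventually.of_forall fun x => ?_)
    exact norm_sub_rev _ _

end Params

/-! ### Continuity of the covariant derivative -/

theorem sobolevConst_nonneg : 0 ≤ sobolevConst := sobolevConst_spec.1

theorem gradNorm_add_le {F : Type*} [NormedAddCommGroup F] {G H : Fin 3 → Space → F}
    (hG : ∀ k, MemLp (G k) 2 volume) :
    gradNorm (fun k x => G k x + H k x) ≤ ∑ k, (lpNorm (G k) 2 volume + lpNorm (H k) 2 volume) := by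
  have h1 : ∀ k, lpNorm (fun x => G k x + H k x) 2 volume ≤
      lpNorm (G k) 2 volume + lpNorm (H k) 2 volume := fun k =>
    lpNorm_fun_add_le (hG k) (by norm_num)
  have h0 : ∀ k, 0 ≤ lpNorm (fun x => G k x + H k x) 2 volume := fun k => lpNorm_nonneg
  refine le_trans ?_ (Finset.sum_le_sum fun k _ => h1 k)
  rw [gradNorm, Real.sqrt_le_iff]
  refine ⟨Finset.sum_nonneg fun k _ => h0 k, ?_⟩
  exact Finset.sum_sq_le_sq_sum_of_nonneg fun k _ => h0 k

theorem gradNorm_le_sum {F : Type*} [NormedAddCommGroup F] (G : Fin 3 → Space → F) :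
    gradNorm G ≤ ∑ k, lpNorm (G k) 2 volume := by
  rw [gradNorm, Real.sqrt_le_iff]
  exact ⟨Finset.sum_nonneg fun k _ => lpNorm_nonneg,
    Finset.sum_sq_le_sq_sum_of_nonneg fun k _ => lpNorm_nonneg⟩

namespace Conf

/-- Convergence to zero in the energy norm. -/
structure Null (w : ℕ → Conf) : Prop where
  ψ : Tendsto (fun n => lpNorm (w n).ψ 2 volume) atTop (𝓝 0)
  D : Tendsto (fun n => gradNorm (w n).D) atTop (𝓝 0)
  G : Tendsto (fun n => gradNorm (w n).G) atTop (𝓝 0)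

variable {w : ℕ → Conf} (h : Null w)
include h

theorem Null.ψ6 : Tendsto (fun n => lpNorm (w n).ψ 6 volume) atTop (𝓝 0) :=
  squeeze_zero (fun n => lpNorm_nonneg) (fun n => (w n).ψ6_le) (by simpa using h.D.const_mul _)

theorem Null.A6 : Tendsto (fun n => lpNorm (w n).A 6 volume) atTop (𝓝 0) :=
  squeeze_zero (fun n => lpNorm_nonneg) (fun n => (w n).A6_le) (by simpa using h.G.const_mul _)

theorem Null.ψ3 : Tendsto (fun n => lpNorm (w n).ψ 3 volume) atTop (𝓝 0) := by
  have h1 : Tendsto (fun n => √(lpNorm (w n).ψ 2 volume * lpNorm (w n).ψ 6 volume)) atTop (𝓝 0) := by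
    simpa using (h.ψ.mul h.ψ6).sqrt
  exact squeeze_zero (fun n => lpNorm_nonneg)
    (fun n => Real.le_sqrt_of_sq_le (sq_lpNorm_three_le (w n).ψ2 (w n).ψ6)) h1

end Conf

namespace Params

variable (P : Params) (u : Conf)

theorem cross_le_of_norms (w : Conf) (k : Fin 3) : lpNorm (P.cross u w k) 2 volume ≤
    |P.Q / P.c| * (lpNorm w.A 6 volume * lpNorm u.ψ 3 volume +
      lpNorm u.A 6 volume * lpNorm w.ψ 3 volume) := by
  refine (P.lpNorm_cross_le u w k).trans (mul_le_mul_of_nonneg_left ?_ (abs_nonneg _))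
  exact add_le_add (memLp_coord_smul w.A6 u.ψ3 k).2 (memLp_coord_smul u.A6 w.ψ3 k).2

/-- The change of the covariant derivative under a perturbation. -/
def cdDiff (w : Conf) (k : Fin 3) (x : Space) : Spinor := P.cd w k x + P.cross u w k x

theorem cdDiff_memLp (w : Conf) (k : Fin 3) : MemLp (P.cdDiff u w k) 2 volume :=
  memLp_fun_add (P.cd_memLp w k) (P.cross_memLp u w k)

theorem cd_add_eq (w : Conf) : P.cd (u.add w) = fun k x => P.cd u k x + P.cdDiff u w k x := by
  ext1 k; ext1 x
  rw [P.cd_add, cdDiff, add_assoc]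

theorem tendsto_cdDiff {w : ℕ → Conf} (h : Conf.Null w) :
    Tendsto (fun n => gradNorm (P.cdDiff u (w n))) atTop (𝓝 0) := by
  have hk : ∀ k, Tendsto (fun n => lpNorm (P.cd (w n) k) 2 volume +
      lpNorm (P.cross u (w n) k) 2 volume) atTop (𝓝 0) := by
    intro k
    have hD : Tendsto (fun n => lpNorm ((w n).D k) 2 volume) atTop (𝓝 0) :=
      squeeze_zero (fun n => lpNorm_nonneg) (fun n => lpNorm_le_gradNorm _ k) h.D
    have h1 : Tendsto (fun n => lpNorm (P.cd (w n) k) 2 volume) atTop (𝓝 0) := by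
      refine squeeze_zero (fun n => lpNorm_nonneg) (fun n => P.lpNorm_cd_le (w n) k) ?_
      simpa using (hD.const_mul P.ħ).add (((h.A6.mul h.ψ3).const_mul |P.Q / P.c|).add
        (h.ψ.const_mul |P.m * P.v k|))
    have h2 : Tendsto (fun n => lpNorm (P.cross u (w n) k) 2 volume) atTop (𝓝 0) := by
      refine squeeze_zero (fun n => lpNorm_nonneg) (fun n => P.cross_le_of_norms u (w n) k) ?_
      simpa using ((h.A6.mul_const (lpNorm u.ψ 3 volume)).add
        (h.ψ3.const_mul (lpNorm u.A 6 volume))).const_mul |P.Q / P.c|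
    simpa using h1.add h2
  refine squeeze_zero (fun n => gradNorm_nonneg _) (fun n => gradNorm_add_le
    (fun k => P.cd_memLp (w n) k)) ?_
  simpa using tendsto_finsetSum Finset.univ fun k _ => hk k

theorem tendsto_gradNorm_cd {w : ℕ → Conf} (h : Conf.Null w) :
    Tendsto (fun n => gradNorm (P.cd (u.add (w n)))) atTop (𝓝 (gradNorm (P.cd u))) := by
  refine tendsto_gradNorm fun k => ?_
  refine tendsto_lpNorm_of_sub (by norm_num) (fun n => P.cd_memLp _ k) (P.cd_memLp u k) ?_
  refine squeeze_zero (fun n => lpNorm_nonneg) (fun n => ?_) (P.tendsto_cdDiff u h)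
  refine le_trans (le_of_eq ?_) (lpNorm_le_gradNorm (P.cdDiff u (w n)) k)
  rw [cd_add_eq]
  refine lpNorm_congr_norm ((P.cd_memLp u k).1.sub (memLp_fun_add (P.cd_memLp u k)
    (P.cdDiff_memLp u (w n) k)).1) (P.cdDiff_memLp u (w n) k).1 (Eventually.of_forall fun x => ?_)
  simp

theorem tendsto_kinetic {w : ℕ → Conf} (h : Conf.Null w) :
    Tendsto (fun n => P.kinetic (u.add (w n))) atTop (𝓝 (P.kinetic u)) := by
  have hd := P.tendsto_cdDiff u h
  have h1 : Tendsto (fun n => kin P.j (P.cd u) (P.cdDiff u (w n))) atTop (𝓝 0) := by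
    refine squeeze_zero_norm (fun n => abs_kin_le (P.cd_memLp u) (P.cdDiff_memLp u (w n))) ?_
    simpa using hd.const_mul (27 * gradNorm (P.cd u))
  have h2 : Tendsto (fun n => kin P.j (P.cdDiff u (w n)) (P.cdDiff u (w n))) atTop (𝓝 0) := by
    refine squeeze_zero_norm (fun n => abs_kin_le (P.cdDiff_memLp u (w n))
      (P.cdDiff_memLp u (w n))) ?_
    simpa using (hd.const_mul 27).mul hd
  have h3 := ((h1.const_mul 2).const_add (P.kinetic u)).add h2
  simp only [mul_zero, add_zero] at h3
  refine h3.congr fun n => ?_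
  rw [kinetic, kinetic, cd_add_eq, kin_add_self (P.cd_memLp u) (P.cdDiff_memLp u (w n))]

theorem tendsto_lpNorm_ψ {p : ℝ≥0∞} (hp : 1 ≤ p) (hp' : ∀ u : Conf, MemLp u.ψ p volume)
    {w : ℕ → Conf} (h : Tendsto (fun n => lpNorm (w n).ψ p volume) atTop (𝓝 0)) :
    Tendsto (fun n => lpNorm (u.add (w n)).ψ p volume) atTop (𝓝 (lpNorm u.ψ p volume)) := by
  refine tendsto_lpNorm_of_sub hp (fun n => hp' _) (hp' u) (h.congr fun n => ?_)
  refine lpNorm_congr_norm (hp' _).1 ((hp' u).sub (hp' (u.add (w n)))).1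
    (Eventually.of_forall fun x => ?_)
  simp [Conf.add]

theorem tendsto_gradNorm_G {w : ℕ → Conf} (h : Conf.Null w) :
    Tendsto (fun n => gradNorm (u.add (w n)).G) atTop (𝓝 (gradNorm u.G)) := by
  refine tendsto_gradNorm fun k => ?_
  refine tendsto_lpNorm_of_sub (by norm_num) (fun n => (u.add (w n)).G2 k) (u.G2 k) ?_
  refine squeeze_zero (fun n => lpNorm_nonneg) (fun n => ?_) h.G
  refine le_trans (le_of_eq ?_) (lpNorm_le_gradNorm (w n).G k)
  refine lpNorm_congr_norm ((u.G2 k).sub ((u.add (w n)).G2 k)).1 ((w n).G2 k).1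
    (Eventually.of_forall fun x => ?_)
  simp [Conf.add]

/-! ### The diamagnetic inequality -/

/-- Pairing `i` times the covariant derivative with `ψ` removes the real potential, because `⟨ψ, iψ⟩
= 0` in the real inner product. What remains bounds `ħ |⟨ψ, ∂ₖψ⟩|`, the input of `diamagnetic_test`.
-/
theorem diamagnetic_of_test {ψ : Space → Spinor} {A : Space → Space} (hψ : VTest ψ)
    (hA : VTest A) : lpNorm ψ 6 volume ≤
      sobolevConst / P.ħ * gradNorm (P.cd (Conf.ofTest hψ hA)) := by
  set X := P.cd (Conf.ofTest hψ hA) with hX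
  have hXm : ∀ k, MemLp (X k) 2 volume := P.cd_memLp _
  have hg : ∀ k, MemLp (fun x => P.ħ⁻¹ • ‖X k x‖) 2 volume := fun k => (hXm k).norm.const_smul P.ħ⁻¹
  have hħ := P.hħ
  have hd := diamagnetic_test hψ (g := fun k x => P.ħ⁻¹ • ‖X k x‖) hg fun k x => by
    have h1 : inner ℝ (ψ x) (Complex.I • X k x) = -(P.ħ * inner ℝ (ψ x) (pdv k ψ x)) := by
      have e : Complex.I • X k x = -(P.ħ • pdv k ψ x) +
          (P.Q / P.c * A x k + P.m * P.v k) • (Complex.I • ψ x) := by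
        rw [hX]
        simp only [cd, Conf.ofTest]
        rw [smul_add, smul_comm Complex.I P.ħ, smul_comm Complex.I (_ : ℝ) (ψ x),
          smul_smul Complex.I Complex.I, Complex.I_mul_I, neg_one_smul, smul_neg]
      rw [e, inner_add_right, inner_neg_right, inner_smul_right, inner_smul_right, inner_im_self]
      simp
    have h2 := abs_real_inner_le_norm (ψ x) (Complex.I • X k x)
    rw [h1, norm_im, abs_neg, abs_mul, abs_of_pos hħ] at h2
    rw [smul_eq_mul, mul_left_comm, ← div_eq_inv_mul, le_div_iff₀ hħ, mul_comm]
    exact h2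
  have hge : gradNorm (fun k x => P.ħ⁻¹ • ‖X k x‖) = P.ħ⁻¹ * gradNorm X := by
    have : ∀ k, lpNorm (fun x => P.ħ⁻¹ • ‖X k x‖) 2 volume = P.ħ⁻¹ * lpNorm (X k) 2 volume := by
      intro k
      rw [lpNorm_fun_const_smul, abs_of_pos (inv_pos.mpr hħ)]
      congr 1
      exact lpNorm_norm (hXm k).1 2
    rw [gradNorm, gradNorm]
    simp only [this, mul_pow, ← Finset.mul_sum]
    rw [Real.sqrt_mul (by positivity), Real.sqrt_sq (by positivity)]
  refine (lpNorm_le_of_eLpNorm_le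
    (mul_nonneg sobolevConst_nonneg (gradNorm_nonneg _)) hd).trans_eq ?_
  rw [hge]; ring

theorem diamagnetic : lpNorm u.ψ 6 volume ≤ sobolevConst / P.ħ * gradNorm (P.cd u) := by
  obtain ⟨w, hw, h1, h2, h3⟩ := exists_test_approx u
  have hn : Conf.Null w := ⟨h1, h2, h3⟩
  refine le_of_tendsto_of_tendsto' (tendsto_lpNorm_ψ u (by norm_num) (fun u => u.ψ6) hn.ψ6)
    ((P.tendsto_gradNorm_cd u hn).const_mul (sobolevConst / P.ħ)) fun n => ?_
  obtain ⟨ψ, A, hψ, hA, he⟩ := hw n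
  rw [he]
  exact P.diamagnetic_of_test hψ hA

/-! ### The Pauli term -/

/-- Each component obeys `(a - b)² ≤ 2a² + 2b²`. The resulting `√2`, together with the `√2` in the
hypothesis of `coercive_aux`, gives the constant in the critical speed. -/
theorem norm_curl_sq_le (Da : Fin 3 → Space) : ‖curl Da‖ ^ 2 ≤ 2 * ∑ k, ‖Da k‖ ^ 2 := by
  simp only [EuclideanSpace.norm_sq_eq, Fin.sum_univ_three, curl]
  simp only [Real.norm_eq_abs, sq_abs]
  simp
  nlinarith [sq_nonneg (Da 1 2 + Da 2 1), sq_nonneg (Da 2 0 + Da 0 2),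
    sq_nonneg (Da 0 1 + Da 1 0), sq_nonneg (Da 0 0), sq_nonneg (Da 1 1), sq_nonneg (Da 2 2)]

/-- The relations `σₖ σₗ = i εₖₗₙ σₙ` for `k ≠ l` separate the Schrödinger form from mixed terms,
which after integration become the magnetic term. -/
theorem spinForm_P_self (X : Fin 3 → Spinor) : spinForm .P X X =
    ∑ k, ‖X k‖ ^ 2 + (2 * inner ℝ (X 0) (Complex.I • act (pauli 2) (X 1)) -
      2 * inner ℝ (X 0) (Complex.I • act (pauli 1) (X 2)) +
      2 * inner ℝ (X 1) (Complex.I • act (pauli 0) (X 2))) := by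
  have hsq : ∀ n, inner ℝ (act (pauli n) (X n)) (act (pauli n) (X n)) = ‖X n‖ ^ 2 := fun n => by
    rw [real_inner_self_eq_norm_sq, norm_act]
  have h01 := inner_act_left 0 (X 0) (act (pauli 1) (X 1))
  have h02 := inner_act_left 0 (X 0) (act (pauli 2) (X 2))
  have h12 := inner_act_left 1 (X 1) (act (pauli 2) (X 2))
  rw [act_zero_one] at h01
  rw [act_zero_two, inner_neg_right] at h02
  rw [act_one_two] at h12
  rw [spinForm_P]
  simp only [Fin.sum_univ_three, inner_add_left, inner_add_right, hsq]
  rw [real_inner_comm (act (pauli 0) (X 0)) (act (pauli 1) (X 1)),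
    real_inner_comm (act (pauli 0) (X 0)) (act (pauli 2) (X 2)),
    real_inner_comm (act (pauli 1) (X 1)) (act (pauli 2) (X 2)), h01, h02, h12]
  ring

/-- This is `integral_mixed_term` with `τ = i σₙ`. The constant `m v` in the covariant derivative
has no curl and disappears. -/
theorem integral_spin_mixed {ψ : Space → Spinor} {A : Space → Space} (hψ : VTest ψ)
    (hA : VTest A) (n k l : Fin 3) :
    2 * ∫ x, inner ℝ (P.cd (Conf.ofTest hψ hA) k x)
        (Complex.I • act (pauli n) (P.cd (Conf.ofTest hψ hA) l x)) =
      -(P.ħ * (P.Q / P.c)) *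
        ∫ x, (pdv k A x l - pdv l A x k) * inner ℝ (ψ x) (act (pauli n) (ψ x)) := by
  have hr : ∀ k : Fin 3, ContDiff ℝ (⊤ : ℕ∞) fun x => P.Q / P.c * A x k + P.m * P.v k := fun k =>
    (contDiff_const.mul ((EuclideanSpace.proj (𝕜 := ℝ) k).contDiff.comp hA.1)).add contDiff_const
  have h := integral_mixed_term (ħ := P.ħ) (τ := imL.comp (actL (pauli n)))
    (fun a b => by simp [inner_im_left, inner_act_left, act_im])
    (fun a => by simp [act_im]) hψ hr k l
  have hp : ∀ (k l : Fin 3) x, pdv k (fun x => P.Q / P.c * A x l + P.m * P.v l) x =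
      P.Q / P.c * pdv k A x l := by
    intro k l x
    have hd : Differentiable ℝ fun x => A x l :=
      (EuclideanSpace.proj (𝕜 := ℝ) l).differentiable.comp hA.differentiable
    have e1 : pdv k (fun x => A x l) x = pdv k A x l :=
      congrFun (pdv_clm hA.differentiable (EuclideanSpace.proj (𝕜 := ℝ) l) k) x
    rw [← e1]
    simp only [pdv]
    rw [fderiv_add_const, fderiv_const_mul (hd x)]
    simp
  simp only [hp] at h
  have e2 : ∀ x, (P.Q / P.c * pdv k A x l - P.Q / P.c * pdv l A x k) *
      inner ℝ (ψ x) (Complex.I • (imL.comp (actL (pauli n))) (ψ x)) = -(P.Q / P.c) *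
      ((pdv k A x l - pdv l A x k) * inner ℝ (ψ x) (act (pauli n) (ψ x))) := by
    intro x
    simp only [ContinuousLinearMap.comp_apply, actL_apply, imL_apply, smul_smul, Complex.I_mul_I]
    simp
    ring
  simp only [e2, integral_const_mul] at h
  rw [show -(P.ħ * (P.Q / P.c)) = P.ħ * -(P.Q / P.c) by ring, mul_assoc, ← h]
  rfl

/-- Pauli's identity: the two kinetic forms differ by `ħ (Q/c) ∫ curl A · ⟨ψ, σψ⟩`. This is
estimated by Hölder with exponents 2, 3 and 6. -/
theorem gradNorm_sq_le_of_test {ψ : Space → Spinor} {A : Space → Space} (hψ : VTest ψ)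
    (hA : VTest A) : gradNorm (P.cd (Conf.ofTest hψ hA)) ^ 2 ≤
      kin .P (P.cd (Conf.ofTest hψ hA)) (P.cd (Conf.ofTest hψ hA)) +
        P.ħ * |P.Q / P.c| * (√2 * gradNorm (pdv · A) * (lpNorm ψ 3 volume * lpNorm ψ 6 volume)) := by
  set X := P.cd (Conf.ofTest hψ hA) with hX
  have hXm : ∀ k, MemLp (X k) 2 volume := P.cd_memLp _
  have hσ : ∀ n l, MemLp (fun x => Complex.I • act (pauli n) (X l x)) 2 volume := fun n l =>
    (imL.comp (actL (pauli n))).comp_memLp' (hXm l)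
  have hi : ∀ k n l, Integrable (fun x => 2 * inner ℝ (X k x)
      (Complex.I • act (pauli n) (X l x))) volume := fun k n l =>
    (integrable_inner (hXm k) (hσ n l)).const_mul 2
  have hi0 : Integrable (fun x => ∑ k, ‖X k x‖ ^ 2) volume := integrable_finsetSum _ fun k _ =>
    (memLp_two_iff_integrable_sq_norm (hXm k).1).mp (hXm k)
  have hs : ∀ n, VTest fun x => inner ℝ (ψ x) (act (pauli n) (ψ x)) := fun n =>
    inner_test hψ (hψ.clm (actL (pauli n))).1
  have hj : ∀ k l n, Integrable (fun x => (pdv k A x l - pdv l A x k) *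
      inner ℝ (ψ x) (act (pauli n) (ψ x))) volume := fun k l n => by
    have hc : ∀ k l : Fin 3, Continuous fun x => pdv k A x l := fun k l =>
      (EuclideanSpace.proj (𝕜 := ℝ) l).continuous.comp (hA.pdv k).continuous
    exact (((hc k l).sub (hc l k)).mul (hs n).continuous).integrable_of_hasCompactSupport
      (hs n).2.mul_left
  have hkin : kin .P X X = gradNorm X ^ 2 - P.ħ * (P.Q / P.c) *
      ∫ x, ∑ n, curl (fun k => pdv k A x) n * inner ℝ (ψ x) (act (pauli n) (ψ x)) := by
    have e0 : ∀ x, ∑ n, curl (fun k => pdv k A x) n * inner ℝ (ψ x) (act (pauli n) (ψ x)) =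
        ((pdv 1 A x 2 - pdv 2 A x 1) * inner ℝ (ψ x) (act (pauli 0) (ψ x)) -
        (pdv 0 A x 2 - pdv 2 A x 0) * inner ℝ (ψ x) (act (pauli 1) (ψ x))) +
        (pdv 0 A x 1 - pdv 1 A x 0) * inner ℝ (ψ x) (act (pauli 2) (ψ x)) := fun x => by
      simp only [Fin.sum_univ_three, curl]; simp; ring
    have i1 : Integrable (fun x => (pdv 1 A x 2 - pdv 2 A x 1) *
        inner ℝ (ψ x) (act (pauli 0) (ψ x)) - (pdv 0 A x 2 - pdv 2 A x 0) *
        inner ℝ (ψ x) (act (pauli 1) (ψ x))) volume := (hj 1 2 0).sub (hj 0 2 1)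
    have i2 : Integrable (fun x => 2 * inner ℝ (X 0 x) (Complex.I • act (pauli 2) (X 1 x)) -
      2 * inner ℝ (X 0 x) (Complex.I • act (pauli 1) (X 2 x))) volume := (hi 0 2 1).sub (hi 0 1 2)
    have i3 : Integrable (fun x => 2 * inner ℝ (X 0 x) (Complex.I • act (pauli 2) (X 1 x)) -
      2 * inner ℝ (X 0 x) (Complex.I • act (pauli 1) (X 2 x)) +
      2 * inner ℝ (X 1 x) (Complex.I • act (pauli 0) (X 2 x))) volume := i2.add (hi 1 0 2)
    have m1 := P.integral_spin_mixed hψ hA 2 0 1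
    have m2 := P.integral_spin_mixed hψ hA 1 0 2
    have m3 := P.integral_spin_mixed hψ hA 0 1 2
    rw [← hX] at m1 m2 m3
    rw [kin]
    simp only [spinForm_P_self, e0]
    rw [integral_add hi0 i3, integral_add i2 (hi 1 0 2), integral_sub (hi 0 2 1) (hi 0 1 2),
      integral_const_mul, integral_const_mul, integral_const_mul, m1, m2, m3,
      integral_add i1 (hj 0 1 2), integral_sub (hj 1 2 0) (hj 0 2 1), sq_gradNorm_eq_integral hXm]
    ring
  set g : Space → ℝ := fun x => √(∑ k, ‖pdv k A x‖ ^ 2) with hg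
  have hgc : Continuous g := Real.continuous_sqrt.comp
    (continuous_finsetSum _ fun k _ => (hA.pdv k).continuous.norm.pow 2)
  have hg2 : ∀ x, ‖g x‖ ^ 2 = ∑ k, ‖pdv k A x‖ ^ 2 := fun x => by
    rw [Real.norm_eq_abs, sq_abs, hg, Real.sq_sqrt (by positivity)]
  have hgm : MemLp g 2 volume := by
    refine (memLp_two_iff_integrable_sq_norm hgc.aestronglyMeasurable).mpr ?_
    simp only [hg2]
    exact integrable_finsetSum _ fun k _ =>
      (memLp_two_iff_integrable_sq_norm ((hA.pdv k).memLp 2).1).mp ((hA.pdv k).memLp 2)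
  have hgn : lpNorm g 2 volume = gradNorm (pdv · A) := by
    refine (sq_eq_sq₀ lpNorm_nonneg (gradNorm_nonneg _)).mp ?_
    rw [sq_lpNorm_two hgm.1, sq_gradNorm_eq_integral fun k => (hA.pdv k).memLp 2]
    simp only [hg2]
  have hψψ : MemLp (fun x => ‖ψ x‖ * ‖ψ x‖) 2 volume :=
    memLp_bilin (r := 2) (hψ.memLp 3) (hψ.memLp 6) (fun a b => ‖a‖ * ‖b‖)
      (hψ.continuous.norm.mul hψ.continuous.norm).aestronglyMeasurable fun x => by simp
  have hψn : lpNorm (fun x => ‖ψ x‖ * ‖ψ x‖) 2 volume ≤ lpNorm ψ 3 volume * lpNorm ψ 6 volume :=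
    lpNorm_bilin_le (r := 2) (hψ.memLp 3) (hψ.memLp 6) (fun a b => ‖a‖ * ‖b‖) fun x => by simp
  have hbound : |∫ x, ∑ n, curl (fun k => pdv k A x) n * inner ℝ (ψ x) (act (pauli n) (ψ x))| ≤
      √2 * gradNorm (pdv · A) * (lpNorm ψ 3 volume * lpNorm ψ 6 volume) := by
    calc _ ≤ ∫ x, √2 * (‖g x‖ * ‖‖ψ x‖ * ‖ψ x‖‖) := by
          refine norm_integral_le_of_norm_le (G := ℝ) ((integrable_mul_norm hgm hψψ).const_mul _)
            (Eventually.of_forall fun x => ?_)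
          refine (spin_density_le _ _).trans ?_
          rw [Real.norm_of_nonneg (by positivity : 0 ≤ ‖ψ x‖ * ‖ψ x‖), ← pow_two, ← mul_assoc]
          refine mul_le_mul_of_nonneg_right ?_ (by positivity)
          rw [Real.norm_of_nonneg (Real.sqrt_nonneg _), ← Real.sqrt_mul (by norm_num)]
          refine Real.sqrt_le_sqrt ?_
          refine le_trans (le_of_eq ?_) (norm_curl_sq_le fun k => pdv k A x)
          simp [EuclideanSpace.norm_sq_eq]
      _ ≤ √2 * (gradNorm (pdv · A) * (lpNorm ψ 3 volume * lpNorm ψ 6 volume)) := by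
          rw [integral_const_mul]
          gcongr
          refine (integral_mul_norm_le hgm hψψ).trans ?_
          rw [hgn]
          exact mul_le_mul_of_nonneg_left hψn (gradNorm_nonneg _)
      _ = _ := by ring
  have hfin := mul_le_mul_of_nonneg_left hbound
    (mul_nonneg P.hħ.le (abs_nonneg (P.Q / P.c)))
  have habs : P.ħ * (P.Q / P.c) * ∫ x, ∑ n, curl (fun k => pdv k A x) n *
      inner ℝ (ψ x) (act (pauli n) (ψ x)) ≤ P.ħ * |P.Q / P.c| * |∫ x, ∑ n,
        curl (fun k => pdv k A x) n * inner ℝ (ψ x) (act (pauli n) (ψ x))| := by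
    refine (le_abs_self _).trans_eq ?_
    rw [abs_mul, abs_mul, abs_of_pos P.hħ]
  linarith [hkin]

theorem gradNorm_sq_le : gradNorm (P.cd u) ^ 2 ≤ P.kinetic u +
    match P.j with
    | .S => 0
    | .P => P.ħ * |P.Q / P.c| *
        (√2 * gradNorm u.G * (lpNorm u.ψ 3 volume * lpNorm u.ψ 6 volume)) := by
  rcases hj : P.j with _ | _
  · rw [kinetic, hj, kin_S_self (P.cd_memLp u)]; simp
  · obtain ⟨w, hw, h1, h2, h3⟩ := exists_test_approx u
    have hn : Conf.Null w := ⟨h1, h2, h3⟩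
    refine le_of_tendsto_of_tendsto' ((P.tendsto_gradNorm_cd u hn).pow 2)
      ((P.tendsto_kinetic u hn).add ((((tendsto_gradNorm_G u hn).const_mul √2).mul
      ((tendsto_lpNorm_ψ u (by norm_num) (fun u => u.ψ3) hn.ψ3).mul
        (tendsto_lpNorm_ψ u (by norm_num) (fun u => u.ψ6) hn.ψ6))).const_mul
        (P.ħ * |P.Q / P.c|))) fun n => ?_
    obtain ⟨ψ, A, hψ, hA, he⟩ := hw n
    rw [he, kinetic, hj]
    exact P.gradNorm_sq_le_of_test hψ hA

end Params

/-! ### Coercivity of the energy -/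

/-- Here `T²` stands for the kinetic energy, `b` for `‖∇A‖` and `y²` for the norm of the covariant
derivative. If `y ≤ √2 C₁ b`, the coupling is at most `√2 C₁ C₂ b²`, which is less than the field
energy. If `y` is larger, the magnetic term is a fraction of `y⁴`, so that the kinetic energy
controls `y⁴` and absorbs the quadratic terms in `y`. -/
theorem coercive_aux {m κ C₁ C₂ : ℝ} (hm : 0 < m) (hκ : 0 < κ) (h1 : 0 ≤ C₁) (h2 : 0 ≤ C₂)
    (h : √2 * C₁ * C₂ < κ) : ∃ δ > 0, ∃ C : ℝ, ∀ T b y : ℝ, 0 ≤ T → 0 ≤ b → 0 ≤ y →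
      y ^ 4 ≤ T ^ 2 + C₁ * b * y ^ 3 →
      δ * (y ^ 2 + b ^ 2) - C ≤ 1 / (2 * m) * T ^ 2 - C₂ * b * y + κ * b ^ 2 := by
  have hs : √2 ^ 2 = 2 := Real.sq_sqrt (by norm_num)
  have hs0 : 0 < √2 := by positivity
  have hs1 : 4 / 3 ≤ √2 := Real.le_sqrt_of_sq_le (by norm_num)
  set ε := κ - √2 * C₁ * C₂ with hε
  have hε0 : 0 < ε := by linarith
  set δ := min (ε / (2 * C₁ ^ 2 + 1)) (κ / 2) with hδ
  have hδ0 : 0 < δ := lt_min (by positivity) (by positivity)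
  have hδ1 : δ * (2 * C₁ ^ 2 + 1) ≤ ε := by
    rw [← le_div_iff₀ (by positivity)]; exact min_le_left _ _
  have hδ2 : δ ≤ κ / 2 := min_le_right _ _
  -- The two entries of the minimum defining `δ` serve the two cases. The two summands of the
  -- constant come from completing squares in the second case: one for the coupling against `T²`,
  -- one for `δ y²` against `y⁴`.
  refine ⟨δ, hδ0, m * C₂ ^ 4 / κ ^ 2 + 4 * m * δ ^ 2, fun T b y hT hb hy hyT => ?_⟩
  have hC0 : 0 ≤ m * C₂ ^ 4 / κ ^ 2 + 4 * m * δ ^ 2 := by positivity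
  rcases le_or_gt y (√2 * C₁ * b) with hc | hc
  · have e1 : y ^ 2 ≤ 2 * C₁ ^ 2 * b ^ 2 := by
      calc y ^ 2 ≤ (√2 * C₁ * b) ^ 2 := by gcongr
        _ = √2 ^ 2 * C₁ ^ 2 * b ^ 2 := by ring
        _ = _ := by rw [hs]
    have e2 : C₂ * b * y ≤ C₂ * b * (√2 * C₁ * b) := by gcongr
    have e3 : δ * (y ^ 2 + b ^ 2) ≤ ε * b ^ 2 := by
      calc δ * (y ^ 2 + b ^ 2) ≤ δ * (2 * C₁ ^ 2 * b ^ 2 + b ^ 2) := by gcongr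
        _ = δ * (2 * C₁ ^ 2 + 1) * b ^ 2 := by ring
        _ ≤ _ := by gcongr
    have e4 : 0 ≤ 1 / (2 * m) * T ^ 2 := by positivity
    have e5 : ε * b ^ 2 = κ * b ^ 2 - C₂ * b * (√2 * C₁ * b) := by rw [hε]; ring
    linarith
  -- Since `1/√2 ≤ 3/4`, the magnetic term is at most `(3/4) y⁴`, whence `y⁴ ≤ 4 T²`. Half of the
  -- kinetic energy is then spent on the coupling and half on `δ y²`.
  · have e1 : C₁ * b * y ^ 3 * √2 ≤ y ^ 4 := by
      calc C₁ * b * y ^ 3 * √2 = √2 * C₁ * b * y ^ 3 := by ring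
        _ ≤ y * y ^ 3 := by gcongr
        _ = _ := by ring
    have e2 : C₁ * b * y ^ 3 ≤ 3 / 4 * y ^ 4 := by
      have h0 : 0 ≤ C₁ * b * y ^ 3 := by positivity
      nlinarith
    have e3 : y ^ 4 ≤ 4 * T ^ 2 := by linarith
    have e4 : y ^ 2 ≤ 2 * T := by
      refine le_of_sq_le_sq ?_ (by positivity)
      calc (y ^ 2) ^ 2 = y ^ 4 := by ring
        _ ≤ 4 * T ^ 2 := e3
        _ = _ := by ring
    have e5 : C₂ * b * y ≤ κ / 2 * b ^ 2 + C₂ ^ 2 * y ^ 2 / (2 * κ) := by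
      have : κ / 2 * b ^ 2 + C₂ ^ 2 * y ^ 2 / (2 * κ) - C₂ * b * y =
          (κ * b - C₂ * y) ^ 2 / (2 * κ) := by field_simp; ring
      have h0 : 0 ≤ (κ * b - C₂ * y) ^ 2 / (2 * κ) := by positivity
      linarith
    have e6 : C₂ ^ 2 * y ^ 2 / (2 * κ) ≤ C₂ ^ 2 * T / κ := by
      rw [div_le_div_iff₀ (by positivity) hκ]
      have : 0 ≤ C₂ ^ 2 * κ := by positivity
      nlinarith
    have e7 : C₂ ^ 2 * T / κ ≤ 1 / (4 * m) * T ^ 2 + m * C₂ ^ 4 / κ ^ 2 := by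
      have : 1 / (4 * m) * T ^ 2 + m * C₂ ^ 4 / κ ^ 2 - C₂ ^ 2 * T / κ =
          (T * κ - 2 * m * C₂ ^ 2) ^ 2 / (4 * m * κ ^ 2) := by field_simp; ring
      have h0 : 0 ≤ (T * κ - 2 * m * C₂ ^ 2) ^ 2 / (4 * m * κ ^ 2) := by positivity
      linarith
    have e8 : δ * y ^ 2 - 4 * m * δ ^ 2 ≤ 1 / (16 * m) * y ^ 4 := by
      have : 1 / (16 * m) * y ^ 4 - (δ * y ^ 2 - 4 * m * δ ^ 2) =
          (y ^ 2 - 8 * m * δ) ^ 2 / (16 * m) := by field_simp; ring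
      have h0 : 0 ≤ (y ^ 2 - 8 * m * δ) ^ 2 / (16 * m) := by positivity
      linarith
    have e9 : 1 / (16 * m) * y ^ 4 ≤ 1 / (4 * m) * T ^ 2 := by
      calc 1 / (16 * m) * y ^ 4 ≤ 1 / (16 * m) * (4 * T ^ 2) := by gcongr
        _ = _ := by field_simp; norm_num
    have e10 : δ * b ^ 2 ≤ κ / 2 * b ^ 2 := by gcongr
    have e11 : 1 / (2 * m) * T ^ 2 = 1 / (4 * m) * T ^ 2 + 1 / (4 * m) * T ^ 2 := by
      ring
    linarith

theorem lt_of_lt_criticalSpeed {ħ c Q lam s : ℝ} (hħ : 0 < ħ) (hc : 0 < c)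
    (hlam : 0 < lam) {j : Model} (h : s < criticalSpeed ħ c Q j lam) : s < c := by
  cases j with
  | S => exact h
  | P =>
    have hK := sobolevConst_nonneg
    have hpi := Real.pi_pos
    set a := 8 * Real.pi * sobolevConst ^ 3 * Q ^ 2 * lam / ħ with ha
    have ha0 : 0 ≤ a := by positivity
    have e : (8 * Real.pi) ^ 2 * sobolevConst ^ 6 * Q ^ 4 * lam ^ 2 / ħ ^ 2 = a ^ 2 := by
      rw [ha]; ring
    simp only [criticalSpeed, e, ← ha] at h
    have : √(a ^ 2 + c ^ 2) ≤ a + c := Real.sqrt_le_iff.mpr ⟨by positivity, by nlinarith⟩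
    linarith

/-- The critical speed is the nonnegative root of `s² + 2as = c²` with `a = 8π K³ Q² λ / ħ`, `K`
being the Sobolev constant; coercivity needs the condition in this polynomial form. -/
theorem criticalSpeed_ineq {ħ c Q lam s : ℝ} (hħ : 0 < ħ) (hlam : 0 < lam) (hs : 0 ≤ s)
    (h : s < criticalSpeed ħ c Q .P lam) :
    s ^ 2 + 16 * Real.pi * sobolevConst ^ 3 * Q ^ 2 * lam / ħ * s < c ^ 2 := by
  have hK := sobolevConst_nonneg
  have hpi := Real.pi_pos
  set a := 8 * Real.pi * sobolevConst ^ 3 * Q ^ 2 * lam / ħ with ha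
  have ha0 : 0 ≤ a := by positivity
  have e : (8 * Real.pi) ^ 2 * sobolevConst ^ 6 * Q ^ 4 * lam ^ 2 / ħ ^ 2 = a ^ 2 := by
    rw [ha]; ring
  have e2 : 16 * Real.pi * sobolevConst ^ 3 * Q ^ 2 * lam / ħ = 2 * a := by rw [ha]; ring
  simp only [criticalSpeed, e, ← ha] at h
  have h1 : s + a < √(a ^ 2 + c ^ 2) := by linarith
  rw [Real.lt_sqrt (by positivity)] at h1
  rw [e2]; nlinarith

namespace Params

variable (P : Params) (u : Conf)

theorem coercive {lam : ℝ} (hlam : 0 < lam) (hth : ‖P.v‖ < criticalSpeed P.ħ P.c P.Q P.j lam) :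
    ∃ δ > 0, ∃ C : ℝ, ∀ u : Conf, u.mass = lam →
      δ * (gradNorm (P.cd u) + gradNorm u.G ^ 2) - C ≤ P.energy u := by
  have hK := sobolevConst_nonneg
  have hħ := P.hħ
  have hc := P.hc
  set q := |P.Q / P.c| with hq
  have hq0 : 0 ≤ q := abs_nonneg _
  set l := √(√lam) with hl
  have hl2 : l ^ 2 = √lam := Real.sq_sqrt (Real.sqrt_nonneg _)
  have hl4 : l ^ 4 = lam := by
    rw [show l ^ 4 = (l ^ 2) ^ 2 by ring, hl2, Real.sq_sqrt hlam.le]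
  have hl0 : 0 ≤ l := Real.sqrt_nonneg _
  set h := √(sobolevConst / P.ħ) with hh
  have hh2 : h ^ 2 = sobolevConst / P.ħ := Real.sq_sqrt (by positivity)
  have hh0 : 0 ≤ h := Real.sqrt_nonneg _
  set C₂ := q * ‖P.v‖ * sobolevConst * h * l ^ 3 with hC₂
  have hC₂0 : 0 ≤ C₂ := by positivity
  -- the two models differ in the first constant only
  obtain ⟨C₁, hC₁0, hC, hx⟩ : ∃ C₁ : ℝ, 0 ≤ C₁ ∧ √2 * C₁ * C₂ < P.fieldConst ∧
      ∀ u : Conf, u.mass = lam → ∀ y : ℝ, 0 ≤ y → lpNorm u.ψ 6 volume ≤ h ^ 2 * y ^ 2 →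
        lpNorm u.ψ 3 volume ≤ l * h * y →
        gradNorm (P.cd u) ^ 2 ≤ P.kinetic u + C₁ * gradNorm u.G * y ^ 3 := by
    rcases hj : P.j with _ | _
    · refine ⟨0, le_rfl, by simpa using P.fieldConst_pos, fun u hu y hy h6 h3 => ?_⟩
      have := P.gradNorm_sq_le u
      rw [hj] at this
      simpa using this
    · refine ⟨P.ħ * q * √2 * l * h ^ 3, by positivity, ?_, fun u hu y hy h6 h3 => ?_⟩
      · rw [hj] at hth
        have hcs := criticalSpeed_ineq hħ hlam (norm_nonneg P.v) hth
        have hs : √2 ^ 2 = 2 := Real.sq_sqrt (by norm_num)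
        have hqq : q ^ 2 = P.Q ^ 2 / P.c ^ 2 := by rw [hq, sq_abs, div_pow]
        -- The square roots recombine into `2 Q² |v| K³ λ / (c² ħ)`. That this is below `fieldConst`
        -- is equivalent to `criticalSpeed_ineq`.
        have e : √2 * (P.ħ * q * √2 * l * h ^ 3) * C₂ =
            2 * (P.Q ^ 2 / P.c ^ 2) * ‖P.v‖ * sobolevConst ^ 3 * lam / P.ħ := by
          calc _ = √2 ^ 2 * q ^ 2 * P.ħ * ‖P.v‖ * sobolevConst * (h ^ 2) ^ 2 * l ^ 4 := by
                rw [hC₂]; ring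
            _ = _ := by rw [hs, hqq, hh2, hl4]; field_simp
        rw [e, fieldConst]
        have hpi := Real.pi_pos
        have e2 : 1 / (8 * Real.pi) * (1 - ‖P.v‖ ^ 2 / P.c ^ 2) -
            2 * (P.Q ^ 2 / P.c ^ 2) * ‖P.v‖ * sobolevConst ^ 3 * lam / P.ħ =
            1 / (8 * Real.pi * P.c ^ 2) * (P.c ^ 2 - (‖P.v‖ ^ 2 +
              16 * Real.pi * sobolevConst ^ 3 * P.Q ^ 2 * lam / P.ħ * ‖P.v‖)) := by
          field_simp; ring
        have e3 : 0 < 1 / (8 * Real.pi * P.c ^ 2) * (P.c ^ 2 - (‖P.v‖ ^ 2 +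
              16 * Real.pi * sobolevConst ^ 3 * P.Q ^ 2 * lam / P.ħ * ‖P.v‖)) :=
          mul_pos (by positivity) (by linarith)
        linarith
      · have := P.gradNorm_sq_le u
        rw [hj] at this
        refine this.trans (add_le_add_right ?_ _)
        have hg := gradNorm_nonneg u.G
        calc P.ħ * |P.Q / P.c| * (√2 * gradNorm u.G * (lpNorm u.ψ 3 volume * lpNorm u.ψ 6 volume))
            ≤ P.ħ * q * (√2 * gradNorm u.G * (l * h * y * (h ^ 2 * y ^ 2))) := by
              have := lpNorm_nonneg (f := u.ψ) (p := 6) (μ := volume)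
              gcongr
          _ = _ := by ring
  obtain ⟨δ, hδ, C, hδC⟩ := coercive_aux P.hm P.fieldConst_pos hC₁0 hC₂0 hC
  refine ⟨δ, hδ, C, fun u hu => ?_⟩
  set y := √(gradNorm (P.cd u)) with hy
  have hy2 : y ^ 2 = gradNorm (P.cd u) := Real.sq_sqrt (gradNorm_nonneg _)
  have hy0 : 0 ≤ y := Real.sqrt_nonneg _
  have hψ2 : lpNorm u.ψ 2 volume = l ^ 2 := by
    rw [hl2, ← hu, Conf.mass_eq, Real.sqrt_sq lpNorm_nonneg]
  have h6 : lpNorm u.ψ 6 volume ≤ h ^ 2 * y ^ 2 := by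
    rw [hh2, hy2]; exact P.diamagnetic u
  have h3 : lpNorm u.ψ 3 volume ≤ l * h * y := by
    refine le_of_sq_le_sq ?_ (by positivity)
    refine (sq_lpNorm_three_le u.ψ2 u.ψ6).trans ?_
    calc _ ≤ l ^ 2 * (h ^ 2 * y ^ 2) := by rw [hψ2]; gcongr
      _ = _ := by ring
  have hg := gradNorm_nonneg u.G
  have hT : √(P.kinetic u) ^ 2 = P.kinetic u := Real.sq_sqrt (P.kinetic_nonneg u)
  have key := hδC (√(P.kinetic u)) (gradNorm u.G) y (Real.sqrt_nonneg _) hg hy0 (by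
    rw [hT, show y ^ 4 = (y ^ 2) ^ 2 by ring, hy2]
    exact hx u hu y hy0 h6 h3)
  rw [hy2, hT] at key
  refine key.trans ?_
  have hfl : P.Q / P.c * P.flux u ≤ C₂ * gradNorm u.G * y := by
    refine (le_abs_self _).trans ?_
    rw [abs_mul]
    calc q * |P.flux u| ≤ q * (‖P.v‖ * (lpNorm u.A 6 volume * lpNorm u.ψ 3 volume) *
          lpNorm u.ψ 2 volume) := by gcongr; exact P.abs_flux_le u
      _ ≤ q * (‖P.v‖ * (sobolevConst * gradNorm u.G * (l * h * y)) * l ^ 2) := by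
          rw [hψ2]
          have := u.A6_le
          have := lpNorm_nonneg (f := u.ψ) (p := 3) (μ := volume)
          gcongr
      _ = _ := by rw [hC₂]; ring
  have hF := fieldForm_self_ge (P := P) u.G2
  rw [energy]
  linarith

theorem lpNorm_D_le (k : Fin 3) : P.ħ * lpNorm (u.D k) 2 volume ≤ gradNorm (P.cd u) +
    (|P.Q / P.c| * (lpNorm u.A 6 volume * lpNorm u.ψ 3 volume) +
      |P.m * P.v k| * lpNorm u.ψ 2 volume) := by
  have h2 : MemLp (fun x => (-(P.Q / P.c)) • (u.A x k • u.ψ x)) 2 volume :=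
    (memLp_coord_smul u.A6 u.ψ3 k).1.const_smul (-(P.Q / P.c))
  have e : (fun x => P.ħ • (Complex.I • u.D k x)) = fun x => P.cd u k x +
      ((-(P.Q / P.c)) • (u.A x k • u.ψ x) + (-(P.m * P.v k)) • u.ψ x) := by
    ext1 x; simp only [cd]; module
  have e1 : lpNorm (fun x => P.ħ • (Complex.I • u.D k x)) 2 volume =
      P.ħ * lpNorm (u.D k) 2 volume := by
    rw [lpNorm_fun_const_smul, abs_of_pos P.hħ]
    congr 1
    exact lpNorm_congr_norm ((u.D2 k).1.const_smul Complex.I) (u.D2 k).1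
      (Eventually.of_forall fun x => norm_im _)
  rw [← e1, e]
  refine (lpNorm_fun_add_le (P.cd_memLp u k) (by norm_num)).trans ?_
  refine add_le_add (lpNorm_le_gradNorm _ k)
    ((lpNorm_fun_add_le h2 (by norm_num)).trans (add_le_add ?_ ?_))
  · rw [lpNorm_fun_const_smul, abs_neg]
    exact mul_le_mul_of_nonneg_left (memLp_coord_smul u.A6 u.ψ3 k).2 (abs_nonneg _)
  · rw [lpNorm_fun_const_smul, abs_neg]

/-! ### Symmetries and scaling of the energy -/

theorem mass_translate (y : Space) : (u.translate y).mass = u.mass :=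
  integral_add_right_eq_self (fun x => ‖u.ψ x‖ ^ 2) y

theorem divFree_translate (hu : u.DivFree) (y : Space) : (u.translate y).DivFree :=
  (measurePreserving_add_right volume y).quasiMeasurePreserving.ae hu

theorem energy_translate (y : Space) : P.energy (u.translate y) = P.energy u := by
  have h1 : P.kinetic (u.translate y) = P.kinetic u :=
    integral_add_right_eq_self (fun x => spinForm P.j (P.cd u · x) (P.cd u · x)) y
  have h2 : P.flux (u.translate y) = P.flux u :=
    integral_add_right_eq_self (fun x => inner ℝ P.v (u.A x) * ‖u.ψ x‖ ^ 2) y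
  have h3 : P.fieldForm (u.translate y).G (u.translate y).G = P.fieldForm u.G u.G := by
    rw [fieldForm, fieldForm]
    congr 1
    exact integral_add_right_eq_self (fun x => ∑ k, inner ℝ (u.G k x) (u.G k x) -
      1 / P.c ^ 2 * inner ℝ (∑ k, P.v k • u.G k x) (∑ k, P.v k • u.G k x)) y
  rw [energy, energy, h1, h2, h3]

theorem mass_scale (s t : ℝ) : (u.scale s t).mass = s ^ 2 * u.mass := by
  rw [Conf.mass, Conf.mass, ← integral_const_mul]
  refine integral_congr_ae (Eventually.of_forall fun x => ?_)
  simp [Conf.scale, norm_smul, mul_pow]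

/-- Kinetic energy and coupling are quadratic in `ψ`, while the field energy does not see `ψ`. -/
theorem energy_scale (s : ℝ) : P.energy (u.scale s 1) =
    s ^ 2 * P.energy u - (s ^ 2 - 1) * P.fieldForm u.G u.G := by
  have h0 : P.cd (u.scale s 1) = fun k x => s • P.cd u k x := by
    ext1 k; ext1 x
    simp only [cd, Conf.scale, one_smul]
    rw [smul_comm Complex.I s, smul_add, smul_comm s P.ħ, smul_comm s (_ : ℝ) (u.ψ x)]
  have h1 : P.kinetic (u.scale s 1) = s ^ 2 * P.kinetic u := by
    rw [kinetic, h0, kin_smul_right, kin_comm, kin_smul_right, kinetic]; ring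
  have h2 : P.flux (u.scale s 1) = s ^ 2 * P.flux u := by
    rw [flux, flux, ← integral_const_mul]
    refine integral_congr_ae (Eventually.of_forall fun x => ?_)
    simp [Conf.scale, norm_smul, mul_pow]; ring
  have h3 : (u.scale s 1).G = u.G := by simp [Conf.scale]
  rw [energy, energy, h1, h2, h3]; ring

/-- Rescaling `ψ` to mass `lam` at fixed potential makes the configuration a competitor. The excess
multiple of the field energy plays the role of strict subadditivity in the compactness argument, and
the inequality also yields the spinor equation. -/
theorem energy_ge_of_inf {lam I : ℝ} (hlam : 0 < lam)
    (hI : ∀ u : Conf, u.DivFree → u.mass = lam → I ≤ P.energy u) (hu : u.DivFree) :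
    u.mass / lam * I + (1 - u.mass / lam) * P.fieldForm u.G u.G ≤ P.energy u := by
  rcases u.mass_nonneg.eq_or_lt with h | h
  · have hψ : lpNorm u.ψ 2 volume = 0 := by
      rw [Conf.mass_eq] at h; exact pow_eq_zero_iff (two_ne_zero) |>.mp h.symm
    have hL : P.flux u = 0 := by
      have := P.abs_flux_le u
      rw [hψ, mul_zero] at this
      exact abs_nonpos_iff.mp this
    have hm := P.hm
    have hk : 0 ≤ 1 / (2 * P.m) * P.kinetic u := mul_nonneg (by positivity) (P.kinetic_nonneg u)
    rw [energy, hL, ← h]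
    simp; simpa using hk
  · have hs : 0 < lam / u.mass := by positivity
    have hsq : √(lam / u.mass) ^ 2 = lam / u.mass := Real.sq_sqrt hs.le
    have := hI (u.scale (√(lam / u.mass)) 1) (by simpa [Conf.DivFree, Conf.scale] using hu)
      (by rw [mass_scale, hsq]; field_simp)
    rw [energy_scale, hsq] at this
    have h2 := mul_le_mul_of_nonneg_left this (show 0 ≤ u.mass / lam by positivity)
    have e : u.mass / lam * (lam / u.mass * P.energy u - (lam / u.mass - 1) *
        P.fieldForm u.G u.G) = P.energy u - (1 - u.mass / lam) * P.fieldForm u.G u.G := by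
      field_simp
    linarith

/-! ### Splitting of the energy -/

theorem lpNorm_inner_smul_le_sum {A : Space → Space} (hA : MemLp A 6 volume)
    {f : Space → Spinor} (hf : MemLp f 3 volume) :
    lpNorm (fun x => inner ℝ P.v (A x) • f x) 2 volume ≤
      ∑ k, |P.v k| * lpNorm (fun x => A x k • f x) 2 volume := by
  have hm : ∀ k : Fin 3, MemLp (fun x => P.v k • (A x k • f x)) 2 volume := fun k =>
    (memLp_coord_smul hA hf k).1.const_smul (P.v k)
  have e : (fun x => inner ℝ P.v (A x) • f x) = ∑ k, fun x => P.v k • (A x k • f x) := by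
    ext1 x
    rw [PiLp.inner_apply, Finset.sum_smul, Finset.sum_apply]
    refine Finset.sum_congr rfl fun k _ => ?_
    rw [smul_smul]; simp [mul_comm]
  rw [e]
  refine (lpNorm_sum_le (fun k _ => hm k) (by norm_num)).trans_eq ?_
  exact Finset.sum_congr rfl fun k _ => lpNorm_fun_const_smul _ _ _

theorem flux_add (w : Conf) : P.flux (u.add w) - P.flux u - P.flux w =
    2 * (∫ x, inner ℝ P.v (u.A x) * inner ℝ (w.ψ x) (u.ψ x)) +
    (∫ x, inner ℝ P.v (u.A x) * inner ℝ (w.ψ x) (w.ψ x)) +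
    (∫ x, inner ℝ P.v (w.A x) * inner ℝ (u.ψ x) (u.ψ x)) +
    2 * (∫ x, inner ℝ P.v (w.A x) * inner ℝ (u.ψ x) (w.ψ x)) := by
  have i := fun (a b c : Conf) => P.flux_integrable_aux a.A6 b.ψ3 c.ψ2
  have e : ∀ x, inner ℝ P.v ((u.add w).A x) * inner ℝ ((u.add w).ψ x) ((u.add w).ψ x) =
      ((inner ℝ P.v (u.A x) * inner ℝ (u.ψ x) (u.ψ x) +
        inner ℝ P.v (w.A x) * inner ℝ (w.ψ x) (w.ψ x)) +
      (2 * (inner ℝ P.v (u.A x) * inner ℝ (w.ψ x) (u.ψ x)) +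
        inner ℝ P.v (u.A x) * inner ℝ (w.ψ x) (w.ψ x))) +
      (inner ℝ P.v (w.A x) * inner ℝ (u.ψ x) (u.ψ x) +
        2 * (inner ℝ P.v (w.A x) * inner ℝ (u.ψ x) (w.ψ x))) := fun x => by
    simp only [Conf.add, inner_add_left, inner_add_right, real_inner_comm (u.ψ x) (w.ψ x)]
    ring
  have i1 : Integrable (fun x => inner ℝ P.v (u.A x) * inner ℝ (u.ψ x) (u.ψ x) +
      inner ℝ P.v (w.A x) * inner ℝ (w.ψ x) (w.ψ x)) volume := (i u u u).add (i w w w)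
  have i2 : Integrable (fun x => 2 * (inner ℝ P.v (u.A x) * inner ℝ (w.ψ x) (u.ψ x)) +
      inner ℝ P.v (u.A x) * inner ℝ (w.ψ x) (w.ψ x)) volume :=
    ((i u w u).const_mul 2).add (i u w w)
  have i3 : Integrable (fun x => inner ℝ P.v (w.A x) * inner ℝ (u.ψ x) (u.ψ x) +
      2 * (inner ℝ P.v (w.A x) * inner ℝ (u.ψ x) (w.ψ x))) volume :=
    (i w u u).add ((i w u w).const_mul 2)
  have i12 : Integrable (fun x => (inner ℝ P.v (u.A x) * inner ℝ (u.ψ x) (u.ψ x) +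
      inner ℝ P.v (w.A x) * inner ℝ (w.ψ x) (w.ψ x)) +
      (2 * (inner ℝ P.v (u.A x) * inner ℝ (w.ψ x) (u.ψ x)) +
      inner ℝ P.v (u.A x) * inner ℝ (w.ψ x) (w.ψ x))) volume := i1.add i2
  rw [flux_eq, flux_eq, flux_eq]
  simp only [e]
  rw [integral_add i12 i3, integral_add i1 i2, integral_add (i u u u) (i w w w),
    integral_add ((i u w u).const_mul 2) (i u w w),
    integral_add (i w u u) ((i w u w).const_mul 2), integral_const_mul, integral_const_mul]
  ring

theorem tendsto_flux_split {w : ℕ → Conf} {C : ℝ} (hC : ∀ n, lpNorm (w n).ψ 2 volume ≤ C)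
    (h1 : ∀ k, Tendsto (fun n => lpNorm (fun x => (w n).A x k • u.ψ x) 2 volume) atTop (𝓝 0))
    (h2 : ∀ k, Tendsto (fun n => lpNorm (fun x => u.A x k • (w n).ψ x) 2 volume) atTop (𝓝 0)) :
    Tendsto (fun n => P.flux (u.add (w n)) - P.flux u - P.flux (w n)) atTop (𝓝 0) := by
  have hC0 : 0 ≤ C := lpNorm_nonneg.trans (hC 0)
  have a1 : Tendsto (fun n => lpNorm (fun x => inner ℝ P.v ((w n).A x) • u.ψ x) 2 volume) atTop
      (𝓝 0) :=
    squeeze_zero (fun n => lpNorm_nonneg) (fun n => P.lpNorm_inner_smul_le_sum (w n).A6 u.ψ3)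
      (by simpa using tendsto_finsetSum Finset.univ fun k _ => (h1 k).const_mul |P.v k|)
  have a2 : Tendsto (fun n => lpNorm (fun x => inner ℝ P.v (u.A x) • (w n).ψ x) 2 volume) atTop
      (𝓝 0) :=
    squeeze_zero (fun n => lpNorm_nonneg) (fun n => P.lpNorm_inner_smul_le_sum u.A6 (w n).ψ3)
      (by simpa using tendsto_finsetSum Finset.univ fun k _ => (h2 k).const_mul |P.v k|)
  have b1 : Tendsto (fun n => ∫ x, inner ℝ P.v (u.A x) * inner ℝ ((w n).ψ x) (u.ψ x)) atTop
      (𝓝 0) :=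
    squeeze_zero_norm (fun n => P.flux_abs_le_aux u.A6 (w n).ψ3 u.ψ2)
      (by simpa using a2.mul_const (lpNorm u.ψ 2 volume))
  have b2 : Tendsto (fun n => ∫ x, inner ℝ P.v (u.A x) * inner ℝ ((w n).ψ x) ((w n).ψ x)) atTop
      (𝓝 0) :=
    squeeze_zero_norm (fun n => (P.flux_abs_le_aux u.A6 (w n).ψ3 (w n).ψ2).trans
      (mul_le_mul_of_nonneg_left (hC n) lpNorm_nonneg)) (by simpa using a2.mul_const C)
  have b3 : Tendsto (fun n => ∫ x, inner ℝ P.v ((w n).A x) * inner ℝ (u.ψ x) (u.ψ x)) atTop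
      (𝓝 0) :=
    squeeze_zero_norm (fun n => P.flux_abs_le_aux (w n).A6 u.ψ3 u.ψ2)
      (by simpa using a1.mul_const (lpNorm u.ψ 2 volume))
  have b4 : Tendsto (fun n => ∫ x, inner ℝ P.v ((w n).A x) * inner ℝ (u.ψ x) ((w n).ψ x)) atTop
      (𝓝 0) :=
    squeeze_zero_norm (fun n => (P.flux_abs_le_aux (w n).A6 u.ψ3 (w n).ψ2).trans
      (mul_le_mul_of_nonneg_left (hC n) lpNorm_nonneg)) (by simpa using a1.mul_const C)
  simp only [flux_add]
  simpa using (((b1.const_mul 2).add b2).add b3).add (b4.const_mul 2)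

/-- The products of `u` with the remainder vanish strongly in `L²`, so the only other contribution
is the pairing of the two covariant derivatives, which vanishes by weak convergence. -/
theorem tendsto_kinetic_split {w : ℕ → Conf} {C : ℝ} (hC : ∀ n, gradNorm (P.cd (w n)) ≤ C)
    (h1 : ∀ k, Tendsto (fun n => lpNorm (fun x => (w n).A x k • u.ψ x) 2 volume) atTop (𝓝 0))
    (h2 : ∀ k, Tendsto (fun n => lpNorm (fun x => u.A x k • (w n).ψ x) 2 volume) atTop (𝓝 0))
    (h3 : Tendsto (fun n => kin P.j (P.cd u) (P.cd (w n))) atTop (𝓝 0)) :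
    Tendsto (fun n => P.kinetic (u.add (w n)) - P.kinetic u - P.kinetic (w n)) atTop (𝓝 0) := by
  have hR : Tendsto (fun n => gradNorm (P.cross u (w n))) atTop (𝓝 0) := by
    refine squeeze_zero (fun n => gradNorm_nonneg _) (fun n => (gradNorm_le_sum _).trans
      (Finset.sum_le_sum fun k _ => P.lpNorm_cross_le u (w n) k)) ?_
    simpa using tendsto_finsetSum Finset.univ fun k _ =>
      ((h1 k).add (h2 k)).const_mul |P.Q / P.c|
  set Z : ℕ → Fin 3 → Space → Spinor := fun n k x => P.cd u k x + P.cd (w n) k x with hZ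
  have hZm : ∀ n k, MemLp (Z n k) 2 volume := fun n k =>
    memLp_fun_add (P.cd_memLp u k) (P.cd_memLp (w n) k)
  have hZb : ∀ n, gradNorm (Z n) ≤ 3 * (gradNorm (P.cd u) + C) := by
    intro n
    refine (gradNorm_add_le (P.cd_memLp u)).trans ?_
    calc _ ≤ ∑ _k : Fin 3, (gradNorm (P.cd u) + C) := Finset.sum_le_sum fun k _ =>
          add_le_add (lpNorm_le_gradNorm _ k) ((lpNorm_le_gradNorm _ k).trans (hC n))
      _ = _ := by simp; ring
  have c1 : Tendsto (fun n => kin P.j (Z n) (P.cross u (w n))) atTop (𝓝 0) := by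
    refine squeeze_zero_norm (fun n => (abs_kin_le (hZm n) (P.cross_memLp u (w n))).trans
      (mul_le_mul_of_nonneg_right (mul_le_mul_of_nonneg_left (hZb n) (by norm_num))
        (gradNorm_nonneg _))) ?_
    simpa using hR.const_mul (27 * (3 * (gradNorm (P.cd u) + C)))
  have c2 : Tendsto (fun n => kin P.j (P.cross u (w n)) (P.cross u (w n))) atTop (𝓝 0) := by
    refine squeeze_zero_norm (fun n => abs_kin_le (P.cross_memLp u (w n))
      (P.cross_memLp u (w n))) ?_
    simpa using (hR.const_mul 27).mul hR
  have key := ((h3.const_mul 2).add (c1.const_mul 2)).add c2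
  simp only [mul_zero, add_zero] at key
  refine key.congr fun n => ?_
  have e : P.cd (u.add (w n)) = fun k x => Z n k x + P.cross u (w n) k x := by
    ext1 k; ext1 x; exact P.cd_add u (w n) k x
  rw [kinetic, e, kin_add_self (hZm n) (P.cross_memLp u (w n)),
    kin_add_self (P.cd_memLp u) (P.cd_memLp (w n)), kinetic, kinetic]
  ring

theorem tendsto_energy_split {w : ℕ → Conf} {C : ℝ} (hC : ∀ n, gradNorm (P.cd (w n)) ≤ C)
    (hC' : ∀ n, lpNorm (w n).ψ 2 volume ≤ C)
    (h1 : ∀ k, Tendsto (fun n => lpNorm (fun x => (w n).A x k • u.ψ x) 2 volume) atTop (𝓝 0))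
    (h2 : ∀ k, Tendsto (fun n => lpNorm (fun x => u.A x k • (w n).ψ x) 2 volume) atTop (𝓝 0))
    (h3 : Tendsto (fun n => kin P.j (P.cd u) (P.cd (w n))) atTop (𝓝 0))
    (h4 : Tendsto (fun n => P.fieldForm u.G (w n).G) atTop (𝓝 0)) :
    Tendsto (fun n => P.energy (u.add (w n)) - P.energy u - P.energy (w n)) atTop (𝓝 0) := by
  have key := (((P.tendsto_kinetic_split u hC h1 h2 h3).const_mul (1 / (2 * P.m))).sub
    ((P.tendsto_flux_split u hC' h1 h2).const_mul (P.Q / P.c))).add (h4.const_mul 2)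
  simp only [mul_zero, sub_zero, add_zero] at key
  refine key.congr fun n => ?_
  have : P.fieldForm (u.add (w n)).G (u.add (w n)).G = P.fieldForm u.G u.G +
      2 * P.fieldForm u.G (w n).G + P.fieldForm (w n).G (w n).G :=
    fieldForm_add_self u.G2 (w n).G2
  rw [energy, energy, energy, this]
  ring

end Params

/-! ### Configurations of negative energy -/

section Dilation

variable {F : Type*} [NormedAddCommGroup F] [NormedSpace ℝ F]

theorem pdv_comp_smul {f : Space → F} (hf : Differentiable ℝ f) (r : ℝ) (k : Fin 3) :
    pdv k (fun x => f (r • x)) = fun x => r • pdv k f (r • x) := by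
  ext1 x
  have h1 : HasFDerivAt (fun x : Space => r • x) (r • ContinuousLinearMap.id ℝ Space) x :=
    (hasFDerivAt_id x).const_smul r
  have h2 := (hf (r • x)).hasFDerivAt.comp x h1
  simp only [pdv]
  rw [show (fun x => f (r • x)) = f ∘ fun x => r • x from rfl, h2.fderiv]
  simp

theorem VTest.comp_smul {f : Space → F} (hf : VTest f) {r : ℝ} (hr : r ≠ 0) :
    VTest fun x => f (r • x) :=
  ⟨hf.1.comp (contDiff_const_smul r), hf.2.comp_smul hr⟩

theorem integral_comp_inv_smul_space (f : Space → ℝ) {R : ℝ} (hR : 0 < R) :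
    ∫ x, f (R⁻¹ • x) = R ^ 3 * ∫ x, f x := by
  rw [Measure.integral_comp_inv_smul_of_nonneg volume f hR.le]
  simp

end Dilation

/-! ### A divergence free trial field, constant near the origin -/

section TrialField

variable (v : Space)

/-- The antisymmetric potential of the trial field. -/
def trialPotential (k : Fin 3) (y : Space) : Space := spaceBump y • (y k • v - v k • y)

theorem trialPotential_test (k : Fin 3) : VTest (trialPotential v k) := by
  refine VTest.smul_right ⟨spaceBump.contDiff, spaceBump.hasCompactSupport⟩ ?_
  exact (((EuclideanSpace.proj (𝕜 := ℝ) k).contDiff).smul contDiff_const).sub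
    (contDiff_const_smul (v k))

/-- A divergence free field of compact support that equals `2 v` on the unit ball. -/
def trialField (x : Space) : Space := ∑ k, pdv k (trialPotential v k) x

theorem trialField_test : VTest (trialField v) := by
  have : trialField v = fun x => (pdv 0 (trialPotential v 0) x + pdv 1 (trialPotential v 1) x) +
      pdv 2 (trialPotential v 2) x := by
    ext1 x; rw [trialField, Fin.sum_univ_three]
  rw [this]
  exact ((((trialPotential_test v 0).pdv 0).add ((trialPotential_test v 1).pdv 1)).add
    ((trialPotential_test v 2).pdv 2))

theorem pdv_coord {f : Space → Space} (hf : Differentiable ℝ f) (k i : Fin 3) (x : Space) :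
    pdv k f x i = pdv k (fun y => f y i) x :=
  (congrFun (pdv_clm hf (EuclideanSpace.proj (𝕜 := ℝ) i) k) x).symm

/-- The field is the divergence of a potential antisymmetric in its two indices, so its own
divergence pairs symmetric second derivatives with an antisymmetric array. -/
theorem trialField_div (x : Space) : ∑ i, pdv i (trialField v) x i = 0 := by
  have hW := trialPotential_test v
  have hc : ∀ k i, ContDiff ℝ (⊤ : ℕ∞) fun y => trialPotential v k y i := fun k i =>
    (EuclideanSpace.proj (𝕜 := ℝ) i).contDiff.comp (hW k).1
  have h1 : ∀ i, pdv i (trialField v) x i = ∑ k, pdv i (pdv k fun y => trialPotential v k y i) x := by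
    intro i
    have e : trialField v = fun x => (pdv 0 (trialPotential v 0) x +
        pdv 1 (trialPotential v 1) x) + pdv 2 (trialPotential v 2) x := by
      ext1 x; rw [trialField, Fin.sum_univ_three]
    have e2 : ∀ k, pdv i (pdv k (trialPotential v k)) x i =
        pdv i (pdv k fun y => trialPotential v k y i) x := fun k => by
      rw [pdv_coord ((hW k).pdv k).differentiable]
      congr 1
      ext1 y
      exact pdv_coord (hW k).differentiable k i y
    rw [e, pdv_add (((hW 0).pdv 0).add ((hW 1).pdv 1)).differentiable
      ((hW 2).pdv 2).differentiable, pdv_add ((hW 0).pdv 0).differentiable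
      ((hW 1).pdv 1).differentiable, Fin.sum_univ_three, ← e2, ← e2, ← e2]
    simp
  simp only [h1]
  have hanti : ∀ k i, pdv i (pdv k fun y => trialPotential v k y i) x =
      -pdv k (pdv i fun y => trialPotential v i y k) x := by
    intro k i
    have e : (fun y => trialPotential v k y i) = fun y => (-1 : ℝ) • trialPotential v i y k := by
      ext1 y; simp [trialPotential]; ring
    rw [e, pdv_const_smul ((hc i k).differentiable (by simp)), pdv_const_smul]
    · rw [pdv_comm (hc i k)]; simp
    · exact (((EuclideanSpace.proj (𝕜 := ℝ) k).contDiff.comp (hW i).1).fderiv_right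
        (m := (⊤ : ℕ∞)) (by simp)).clm_apply contDiff_const |>.differentiable (by simp)
  have h2 : ∑ i, ∑ k, pdv i (pdv k fun y => trialPotential v k y i) x =
      -∑ i, ∑ k, pdv i (pdv k fun y => trialPotential v k y i) x := by
    conv_lhs => rw [Finset.sum_comm]
    rw [← Finset.sum_neg_distrib]
    refine Finset.sum_congr rfl fun k _ => ?_
    rw [← Finset.sum_neg_distrib]
    exact Finset.sum_congr rfl fun i _ => hanti k i
  linarith

/-- On the unit ball the cutoff is one and `∂ₖ (yₖ v - vₖ y) = v - vₖ eₖ`; the sum over `k` is `3v -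
v`. -/
theorem trialField_eq {x : Space} (hx : ‖x‖ < 1) : trialField v x = (2 : ℝ) • v := by
  have h1 : ∀ k, pdv k (trialPotential v k) x = v - v k • e k := by
    intro k
    have hev : trialPotential v k =ᶠ[𝓝 x] fun y => y k • v - v k • y := by
      have : Metric.ball (0 : Space) 1 ∈ 𝓝 x := Metric.isOpen_ball.mem_nhds (by simpa using hx)
      filter_upwards [this] with y hy
      rw [trialPotential, spaceBump.one_of_mem_closedBall, one_smul]
      exact Metric.ball_subset_closedBall hy
    have hd : HasFDerivAt (fun y : Space => y k • v - v k • y)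
        ((EuclideanSpace.proj (𝕜 := ℝ) k).smulRight v - v k • ContinuousLinearMap.id ℝ Space) x :=
      ((EuclideanSpace.proj (𝕜 := ℝ) k).smulRight v - v k • ContinuousLinearMap.id ℝ Space).hasFDerivAt
    rw [pdv, hev.fderiv_eq, hd.fderiv]
    simp [e]
  rw [trialField]
  simp only [h1, Finset.sum_sub_distrib, ← space_eq_sum]
  simp only [Finset.sum_const, Finset.card_univ, Fintype.card_fin]
  module

end TrialField

/-! ### The energy of the trial configuration -/

namespace Params

variable (P : Params)

/-- The plane wave with values in the first component that compensates for the motion. -/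
def wave (x : Space) : Spinor :=
  Complex.exp (Complex.I * ((P.m / P.ħ * inner ℝ P.v x : ℝ) : ℂ)) • EuclideanSpace.single 0 1

theorem wave_contDiff : ContDiff ℝ (⊤ : ℕ∞) P.wave := by
  refine ContDiff.smul (ContDiff.cexp ?_) contDiff_const
  refine contDiff_const.mul (Complex.ofRealCLM.contDiff.comp ?_)
  exact contDiff_const.mul (contDiff_const.inner ℝ contDiff_id)

theorem norm_wave (x : Space) : ‖P.wave x‖ = 1 := by
  rw [wave, norm_smul, mul_comm Complex.I, Complex.norm_exp_ofReal_mul_I]; simp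

theorem pdv_wave (k : Fin 3) (x : Space) :
    pdv k P.wave x = (P.m / P.ħ * P.v k) • (Complex.I • P.wave x) := by
  have h1 : HasFDerivAt (fun x : Space => P.m / P.ħ * inner ℝ P.v x)
      ((P.m / P.ħ) • innerSL ℝ P.v) x := (innerSL ℝ P.v).hasFDerivAt.const_mul _
  have h2 := (Complex.ofRealCLM.hasFDerivAt.comp x h1).const_mul Complex.I
  have h3 := h2.cexp.smul_const (EuclideanSpace.single (0 : Fin 2) (1 : ℂ) : Spinor)
  have h4 : HasFDerivAt P.wave _ x := h3
  rw [pdv, h4.fderiv]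
  have hv : inner ℝ P.v (e k) = P.v k := by
    rw [e, EuclideanSpace.inner_single_right]; simp
  simp only [ContinuousLinearMap.smulRight_apply, _root_.smul_apply,
    ContinuousLinearMap.comp_apply, innerSL_apply_apply, hv, wave, smul_eq_mul,
    Complex.ofRealCLM_apply, Function.comp]
  rw [smul_smul, ← Complex.coe_smul, smul_smul]
  congr 1
  push_cast
  ring

/-- The trial spinor. -/
def trialSpinor (s R : ℝ) (x : Space) : Spinor := (s • ker 0 (R⁻¹ • x)) • P.wave x

theorem trialSpinor_test (s : ℝ) {R : ℝ} (hR : 0 < R) : VTest (P.trialSpinor s R) :=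
  VTest.smul_right (((ker_test 0).comp_smul (inv_pos.mpr hR).ne').const_smul s) P.wave_contDiff

theorem trialPot_test (t : ℝ) {R : ℝ} (hR : 0 < R) :
    VTest fun x => t • trialField P.v (R⁻¹ • x) :=
  ((trialField_test P.v).comp_smul (inv_pos.mpr hR).ne').const_smul t

/-- The trial configuration. -/
def trial (s t : ℝ) {R : ℝ} (hR : 0 < R) : Conf :=
  Conf.ofTest (P.trialSpinor_test s hR) (P.trialPot_test t hR)

theorem pdv_trialPot (t : ℝ) (R : ℝ) (k : Fin 3) (x : Space) :
    pdv k (fun x => t • trialField P.v (R⁻¹ • x)) x =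
      (t * R⁻¹) • pdv k (trialField P.v) (R⁻¹ • x) := by
  have h := (trialField_test P.v).differentiable
  have hd : Differentiable ℝ fun x => trialField P.v (R⁻¹ • x) :=
    h.comp ((contDiff_const_smul (n := 1) R⁻¹).differentiable (by simp))
  rw [pdv_const_smul hd, pdv_comp_smul h]
  exact smul_smul _ _ _

theorem trial_divFree (s t : ℝ) {R : ℝ} (hR : 0 < R) : (P.trial s t hR).DivFree := by
  refine Eventually.of_forall fun x => ?_
  simp only [trial, Conf.ofTest, pdv_trialPot, PiLp.smul_apply, smul_eq_mul, ← Finset.mul_sum,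
    trialField_div, mul_zero]

theorem norm_trialSpinor (s R : ℝ) (x : Space) :
    ‖P.trialSpinor s R x‖ ^ 2 = s ^ 2 * ker 0 (R⁻¹ • x) ^ 2 := by
  rw [trialSpinor, norm_smul, norm_wave, mul_one, smul_eq_mul, Real.norm_eq_abs, sq_abs, mul_pow]

theorem trial_mass (s t : ℝ) {R : ℝ} (hR : 0 < R) :
    (P.trial s t hR).mass = s ^ 2 * R ^ 3 * ∫ x, ker 0 x ^ 2 := by
  simp only [Conf.mass, trial, Conf.ofTest, norm_trialSpinor]
  rw [integral_const_mul, integral_comp_inv_smul_space (fun x => ker 0 x ^ 2) hR, mul_assoc]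

/-- The envelope lives on the ball where the trial field is constant, so wherever the potential
meets the spinor it is the constant `2 t v`. -/
theorem trial_eq_on_support (s t R : ℝ) (x : Space) :
    P.trialSpinor s R x = 0 ∨ t • trialField P.v (R⁻¹ • x) = (2 * t) • P.v := by
  rcases lt_or_ge ‖R⁻¹ • x‖ 1 with h | h
  · right; rw [trialField_eq P.v h, smul_smul, mul_comm]
  · left; rw [trialSpinor, ker_eq_zero (by simpa using h)]; simp

theorem trial_flux (s t : ℝ) {R : ℝ} (hR : 0 < R) :
    P.flux (P.trial s t hR) = 2 * t * ‖P.v‖ ^ 2 * (P.trial s t hR).mass := by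
  rw [flux, Conf.mass, ← integral_const_mul]
  refine integral_congr_ae (Eventually.of_forall fun x => ?_)
  simp only [trial, Conf.ofTest]
  rcases P.trial_eq_on_support s t R x with h | h
  · simp [h]
  · rw [h, inner_smul_right, real_inner_self_eq_norm_sq]

theorem trial_field (s t : ℝ) {R : ℝ} (hR : 0 < R) :
    P.fieldForm (P.trial s t hR).G (P.trial s t hR).G =
      t ^ 2 * R * P.fieldForm (pdv · (trialField P.v)) (pdv · (trialField P.v)) := by
  set f : Space → ℝ := fun x => ∑ k, inner ℝ (pdv k (trialField P.v) x) (pdv k (trialField P.v) x) -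
    1 / P.c ^ 2 * inner ℝ (∑ k, P.v k • pdv k (trialField P.v) x)
      (∑ k, P.v k • pdv k (trialField P.v) x) with hf
  have e : ∀ x, ∑ k, inner ℝ ((P.trial s t hR).G k x) ((P.trial s t hR).G k x) -
      1 / P.c ^ 2 * inner ℝ (∑ k, P.v k • (P.trial s t hR).G k x)
        (∑ k, P.v k • (P.trial s t hR).G k x) = (t * R⁻¹) ^ 2 * f (R⁻¹ • x) := fun x => by
    simp only [trial, Conf.ofTest, pdv_trialPot, hf, smul_comm (_ : ℝ) (t * R⁻¹),
      ← Finset.smul_sum, real_inner_smul_left, real_inner_smul_right, ← Finset.mul_sum]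
    ring
  have e2 : P.fieldForm (pdv · (trialField P.v)) (pdv · (trialField P.v)) =
      1 / (8 * Real.pi) * ∫ x, f x := rfl
  rw [e2, fieldForm]
  simp only [e]
  rw [integral_const_mul, integral_comp_inv_smul_space f hR]
  field_simp

/-- Differentiating the plane wave produces exactly `-m vₖ`, which cancels the velocity in the
covariant derivative. Only the envelope's gradient and the small potential remain. -/
theorem trial_cd (s t : ℝ) {R : ℝ} (hR : 0 < R) (k : Fin 3) (x : Space) :
    P.cd (P.trial s t hR) k x = (P.ħ * (s * R⁻¹ * pdv k (ker 0) (R⁻¹ • x))) •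
        (Complex.I • P.wave x) + (P.Q / P.c * (2 * t * P.v k)) • P.trialSpinor s R x := by
  have hk := (ker_test 0).differentiable
  have hd : Differentiable ℝ fun x => ker 0 (R⁻¹ • x) :=
    hk.comp ((contDiff_const_smul (n := 1) R⁻¹).differentiable (by simp))
  have hd' : Differentiable ℝ fun x => s • ker 0 (R⁻¹ • x) := hd.const_smul s
  have hw := P.wave_contDiff.differentiable (by simp)
  have h1 : pdv k (P.trialSpinor s R) x = (s • ker 0 (R⁻¹ • x)) • pdv k P.wave x +
      (s * R⁻¹ * pdv k (ker 0) (R⁻¹ • x)) • P.wave x := by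
    have := congrFun (pdv_smul hd' hw k) x
    rw [pdv_const_smul hd, pdv_comp_smul hk] at this
    simp only [smul_eq_mul, ← mul_assoc] at this
    exact this
  have hħ := P.hħ.ne'
  have h2 : P.cd (P.trial s t hR) k x = P.ħ • (Complex.I • pdv k (P.trialSpinor s R) x) +
      (P.Q / P.c * (t • trialField P.v (R⁻¹ • x)) k + P.m * P.v k) • P.trialSpinor s R x := rfl
  have h3 : (t • trialField P.v (R⁻¹ • x)) k • P.trialSpinor s R x =
      (2 * t * P.v k) • P.trialSpinor s R x := by
    rcases P.trial_eq_on_support s t R x with h | h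
    · simp [h]
    · rw [h]; simp
  have h4 : P.ħ • (Complex.I • pdv k (P.trialSpinor s R) x) =
      (P.ħ * (s * R⁻¹ * pdv k (ker 0) (R⁻¹ • x))) • (Complex.I • P.wave x) -
      (P.m * P.v k) • P.trialSpinor s R x := by
    rw [h1, pdv_wave, trialSpinor, smul_add, smul_comm Complex.I (_ : ℝ) (P.wave x),
      smul_comm Complex.I (_ : ℝ) ((P.m / P.ħ * P.v k) • Complex.I • P.wave x),
      smul_comm Complex.I (_ : ℝ) (Complex.I • P.wave x), smul_smul Complex.I Complex.I,
      Complex.I_mul_I, neg_one_smul]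
    generalize Complex.I • P.wave x = w
    match_scalars
    · field_simp
    · field_simp
  rw [h2, h4, add_smul, mul_smul (P.Q / P.c), h3]
  module

theorem trial_kinetic_le (s t : ℝ) {R : ℝ} (hR : 0 < R) :
    P.kinetic (P.trial s t hR) ≤ 27 * (2 * (P.ħ ^ 2 * (s ^ 2 * R) * gradNorm (pdv · (ker 0)) ^ 2 +
      (P.Q / P.c) ^ 2 * (2 * t) ^ 2 * ‖P.v‖ ^ 2 * (P.trial s t hR).mass)) := by
  have h0 := abs_kin_le (j := P.j) (P.cd_memLp (P.trial s t hR)) (P.cd_memLp (P.trial s t hR))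
  refine (le_abs_self _).trans (h0.trans ?_)
  rw [mul_assoc, ← pow_two]
  refine mul_le_mul_of_nonneg_left ?_ (by norm_num)
  have hkm : ∀ k, MemLp (pdv k (ker 0)) 2 volume := fun k => ((ker_test 0).pdv k).memLp 2
  set f : Space → ℝ := fun x => ∑ k, ‖pdv k (ker 0) x‖ ^ 2 with hf
  have hfi : Integrable f volume := integrable_finsetSum _ fun k _ =>
    (memLp_two_iff_integrable_sq_norm (hkm k).1).mp (hkm k)
  have hψi : Integrable (fun x => ‖(P.trial s t hR).ψ x‖ ^ 2) volume :=
    (memLp_two_iff_integrable_sq_norm (P.trial s t hR).ψ2.1).mp (P.trial s t hR).ψ2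
  have hfR : Integrable (fun x => f (R⁻¹ • x)) volume := hfi.comp_smul (inv_pos.mpr hR).ne'
  rw [sq_gradNorm_eq_integral (P.cd_memLp (P.trial s t hR)), sq_gradNorm_eq_integral hkm, Conf.mass]
  have hb : ∀ x, ∑ k, ‖P.cd (P.trial s t hR) k x‖ ^ 2 ≤
      2 * (P.ħ ^ 2 * (s * R⁻¹) ^ 2 * f (R⁻¹ • x) +
        (P.Q / P.c) ^ 2 * (2 * t) ^ 2 * ‖P.v‖ ^ 2 * ‖(P.trial s t hR).ψ x‖ ^ 2) := by
    intro x
    have hk : ∀ k, ‖P.cd (P.trial s t hR) k x‖ ^ 2 ≤ 2 * (P.ħ ^ 2 * (s * R⁻¹) ^ 2 *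
        ‖pdv k (ker 0) (R⁻¹ • x)‖ ^ 2) + 2 * ((P.Q / P.c) ^ 2 * (2 * t) ^ 2 * (P.v k) ^ 2 *
          ‖(P.trial s t hR).ψ x‖ ^ 2) := by
      intro k
      rw [trial_cd]
      set a := (P.ħ * (s * R⁻¹ * pdv k (ker 0) (R⁻¹ • x))) • (Complex.I • P.wave x)
      set b := (P.Q / P.c * (2 * t * P.v k)) • P.trialSpinor s R x
      have ha : ‖a‖ ^ 2 = P.ħ ^ 2 * (s * R⁻¹) ^ 2 * ‖pdv k (ker 0) (R⁻¹ • x)‖ ^ 2 := by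
        rw [norm_smul, norm_im, norm_wave, mul_one, Real.norm_eq_abs, Real.norm_eq_abs, sq_abs,
          sq_abs]
        ring
      have hb : ‖b‖ ^ 2 = (P.Q / P.c) ^ 2 * (2 * t) ^ 2 * (P.v k) ^ 2 *
          ‖(P.trial s t hR).ψ x‖ ^ 2 := by
        rw [norm_smul, mul_pow, Real.norm_eq_abs, sq_abs]
        rw [show (P.trial s t hR).ψ x = P.trialSpinor s R x from rfl]
        ring
      rw [← ha, ← hb]
      have h1 : ‖a + b‖ ^ 2 ≤ (‖a‖ + ‖b‖) ^ 2 := by gcongr; exact norm_add_le a b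
      nlinarith [sq_nonneg (‖a‖ - ‖b‖)]
    refine (Finset.sum_le_sum fun k _ => hk k).trans_eq ?_
    rw [Finset.sum_add_distrib, ← Finset.mul_sum, ← Finset.mul_sum, ← Finset.mul_sum,
      ← Finset.sum_mul, ← Finset.mul_sum, EuclideanSpace.real_norm_sq_eq]
    ring
  have hi1 : Integrable (fun x => P.ħ ^ 2 * (s * R⁻¹) ^ 2 * f (R⁻¹ • x)) volume :=
    hfR.const_mul _
  have hi2 : Integrable (fun x => (P.Q / P.c) ^ 2 * (2 * t) ^ 2 * ‖P.v‖ ^ 2 *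
      ‖(P.trial s t hR).ψ x‖ ^ 2) volume := hψi.const_mul _
  refine (integral_mono (integrable_finsetSum _ fun k _ =>
    (memLp_two_iff_integrable_sq_norm (P.cd_memLp _ k).1).mp (P.cd_memLp _ k))
    ((hi1.add hi2).const_mul 2) hb).trans_eq ?_
  simp only [Pi.add_apply]
  rw [integral_const_mul, integral_add hi1 hi2, integral_const_mul, integral_const_mul,
    integral_comp_inv_smul_space f hR]
  congr 2
  field_simp
  rfl

/-- There is a divergence free configuration of given mass with negative energy. -/
theorem exists_energy_neg {lam : ℝ} (hlam : 0 < lam) (hv0 : 0 < ‖P.v‖) :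
    ∃ u : Conf, u.DivFree ∧ u.mass = lam ∧ P.energy u < 0 := by
  have hc := P.hc
  have hm := P.hm
  have hQ2 : 0 < P.Q ^ 2 := by have := P.hQ; positivity
  set N := ∫ x, ker 0 x ^ 2 with hN
  have hN0 : 0 < N := by
    have hcont := (ker_test 0).continuous
    refine (hcont.pow 2).integral_pos_of_hasCompactSupport_nonneg_nonzero
      ((ker_test 0).2.comp_left (g := fun t : ℝ => t ^ 2) (by simp)) (fun x => sq_nonneg _)
      (x := 0) ?_
    have : (0 : Space) ∈ Function.support (ker 0) := by
      rw [ker, ContDiffBump.support_normed_eq]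
      exact Metric.mem_ball_self (bumpAt 0).rOut_pos
    exact pow_ne_zero 2 this
  set F₁ := P.fieldForm (pdv · (trialField P.v)) (pdv · (trialField P.v)) with hF₁
  have hF₁0 : 0 ≤ F₁ := fieldForm_self_nonneg fun k => ((trialField_test P.v).pdv k).memLp 2
  set M := gradNorm (pdv · (ker 0)) ^ 2 with hM
  have hM0 : 0 ≤ M := sq_nonneg _
  -- The potential has amplitude `Qτ/R`; the factor `Q` makes the coupling favourable for either
  -- sign of the charge. The coupling gains `2d/R`, and `τ` is so small that the field costs at most
  -- `d/R`. The kinetic energy is at most `B/R²`, hence smaller than the remaining `d/R` once `R`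
  -- exceeds `B/d`.
  set τ := ‖P.v‖ ^ 2 * lam / (P.c * (F₁ + 1)) with hτ
  have hτ0 : 0 < τ := by positivity
  set d := P.Q ^ 2 * τ * (‖P.v‖ ^ 2 * lam / P.c) with hd
  have hd0 : 0 < d := by positivity
  set B := 1 / (2 * P.m) * (27 * (2 * (P.ħ ^ 2 * (lam / N) * M +
    (P.Q / P.c) ^ 2 * (2 * (P.Q * τ)) ^ 2 * ‖P.v‖ ^ 2 * lam))) with hB
  have hB0 : 0 ≤ B := by positivity
  set R := B / d + 1 with hR
  have hR0 : 0 < R := by positivity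
  set s := √(lam / (R ^ 3 * N)) with hs
  have hs2 : s ^ 2 = lam / (R ^ 3 * N) := Real.sq_sqrt (by positivity)
  have hmass : (P.trial s (P.Q * τ / R) hR0).mass = lam := by
    rw [trial_mass, hs2, ← hN]; field_simp
  refine ⟨P.trial s (P.Q * τ / R) hR0, P.trial_divFree _ _ _, hmass, ?_⟩
  have hk := P.trial_kinetic_le s (P.Q * τ / R) hR0
  have hk' : 1 / (2 * P.m) * P.kinetic (P.trial s (P.Q * τ / R) hR0) ≤ B / R ^ 2 := by
    refine (mul_le_mul_of_nonneg_left hk (by positivity)).trans_eq ?_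
    rw [hmass, hs2, hB, ← hM]
    field_simp
  rw [energy, trial_flux, trial_field, hmass, ← hF₁]
  have e1 : P.Q / P.c * (2 * (P.Q * τ / R) * ‖P.v‖ ^ 2 * lam) = 2 * d / R := by
    rw [hd]; field_simp
  have e2 : (P.Q * τ / R) ^ 2 * R * F₁ ≤ d / R := by
    have : τ * F₁ ≤ ‖P.v‖ ^ 2 * lam / P.c := by
      rw [hτ, div_mul_eq_mul_div, div_le_div_iff₀ (by positivity) hc]
      have : 0 ≤ ‖P.v‖ ^ 2 * lam * P.c := by positivity
      nlinarith
    calc (P.Q * τ / R) ^ 2 * R * F₁ = P.Q ^ 2 * τ * (τ * F₁) / R := by field_simp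
      _ ≤ P.Q ^ 2 * τ * (‖P.v‖ ^ 2 * lam / P.c) / R := by gcongr
      _ = _ := by rw [hd]
  have e3 : B / R ^ 2 < d / R := by
    have : B < d * R := by rw [hR]; field_simp; linarith
    rw [div_lt_div_iff₀ (by positivity) hR0]
    nlinarith
  rw [e1]
  have e4 : 2 * d / R = d / R + d / R := by ring
  linarith

end Params

/-! ### Products of weakly and strongly converging sequences -/

section WeakProducts

/-- Used for density arguments: a factor is replaced by a compactly supported one up to `ε`, and the
rest `g`, which may depend on `ε`, tends to zero. -/
theorem tendsto_zero_of_le_add {f : ℕ → ℝ} {C : ℝ} (h0 : ∀ n, 0 ≤ f n) (hC : 0 ≤ C)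
    (h : ∀ ε > 0, ∃ g : ℕ → ℝ, Tendsto g atTop (𝓝 0) ∧ ∀ n, f n ≤ C * ε + g n) :
    Tendsto f atTop (𝓝 0) := by
  rw [Metric.tendsto_atTop]
  intro δ hδ
  obtain ⟨g, hg, hfg⟩ := h (δ / (2 * (C + 1))) (by positivity)
  obtain ⟨N, hN⟩ := (Metric.tendsto_atTop.mp hg) (δ / 2) (by positivity)
  refine ⟨N, fun n hn => ?_⟩
  rw [Real.dist_0_eq_abs, abs_of_nonneg (h0 n)]
  have h1 := hN n hn
  rw [Real.dist_0_eq_abs] at h1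
  have h2 : C * (δ / (2 * (C + 1))) ≤ δ / 2 := by
    rw [mul_div_assoc', div_le_div_iff₀ (by positivity) (by norm_num)]
    nlinarith
  linarith [hfg n, le_abs_self (g n)]

variable {F : Type*} [NormedAddCommGroup F]

theorem exists_compact_approx {p : ℝ≥0∞} (hp : p ≠ ⊤) [NormedSpace ℝ F] {f : Space → F}
    (hf : MemLp f p volume) {ε : ℝ} (hε : 0 < ε) : ∃ g : Space → F, Continuous g ∧
      HasCompactSupport g ∧ MemLp g p volume ∧ lpNorm (fun x => f x - g x) p volume ≤ ε := by
  obtain ⟨g, hg1, hg2, hg3, hg4⟩ := hf.exists_hasCompactSupport_eLpNorm_sub_le hp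
    (ε := ENNReal.ofReal ε) (by simpa using hε)
  exact ⟨g, hg3, hg1, hg4, lpNorm_le_of_eLpNorm_le hε.le hg2⟩

/-- If `Aₙ` is bounded in `L⁶` and converges to zero in `L²` locally, then `Aₙ f` converges to zero
in `L²` for every `f ∈ L³`. -/
theorem tendsto_coord_smul_left [NormedSpace ℝ F] {A : ℕ → Space → Space} {C : ℝ}
    (hA : ∀ n, MemLp (A n) 6 volume)
    (hC : ∀ n, lpNorm (A n) 6 volume ≤ C) {f : Space → F} (hf : MemLp f 3 volume)
    (h : ∀ g : Space → ℝ, Continuous g → HasCompactSupport g →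
      Tendsto (fun n => lpNorm (fun x => g x • A n x) 2 volume) atTop (𝓝 0)) (k : Fin 3) :
    Tendsto (fun n => lpNorm (fun x => A n x k • f x) 2 volume) atTop (𝓝 0) := by
  have hC0 : 0 ≤ C := lpNorm_nonneg.trans (hC 0)
  refine tendsto_zero_of_le_add (C := C) (fun n => lpNorm_nonneg) hC0 fun ε hε => ?_
  obtain ⟨g, hg1, hg2, hg3, hg4⟩ := exists_compact_approx (by norm_num) hf hε
  refine ⟨_, h (fun x => ‖g x‖) hg1.norm hg2.norm, fun n => ?_⟩
  have e : (fun x => A n x k • f x) = fun x => A n x k • (f x - g x) + A n x k • g x := by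
    ext1 x; rw [← smul_add, sub_add_cancel]
  have hfg : MemLp (fun x => f x - g x) 3 volume := hf.sub hg3
  rw [e]
  refine (lpNorm_fun_add_le (memLp_coord_smul (hA n) hfg k).1 (by norm_num)).trans
    (add_le_add ?_ ?_)
  · refine (memLp_coord_smul (hA n) hfg k).2.trans ?_
    have := lpNorm_nonneg (f := fun x => f x - g x) (p := 3) (μ := (volume : Measure Space))
    exact mul_le_mul (hC n) hg4 this hC0
  · have hm : MemLp (fun x => ‖g x‖ • A n x) 2 volume :=
      memLp_bilin (r := 2) hg3 (hA n) (fun a b => ‖a‖ • b) (hg1.norm.aestronglyMeasurable.smul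
        (hA n).1) fun x => by rw [norm_smul, norm_norm]
    refine lpNorm_mono_norm hm (Eventually.of_forall fun x => ?_)
    rw [norm_smul, norm_smul, norm_norm, mul_comm]
    gcongr
    exact PiLp.norm_apply_le _ _

theorem tendsto_coord_smul_right [NormedSpace ℝ F] {A : Space → Space} (hA : MemLp A 6 volume)
    {f : ℕ → Space → F}
    {C : ℝ} (hf : ∀ n, MemLp (f n) 3 volume) (hC : ∀ n, lpNorm (f n) 3 volume ≤ C)
    (h : ∀ g : Space → ℝ, Continuous g → HasCompactSupport g →
      Tendsto (fun n => lpNorm (fun x => g x • f n x) 2 volume) atTop (𝓝 0)) (k : Fin 3) :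
    Tendsto (fun n => lpNorm (fun x => A x k • f n x) 2 volume) atTop (𝓝 0) := by
  have hC0 : 0 ≤ C := lpNorm_nonneg.trans (hC 0)
  refine tendsto_zero_of_le_add (C := C) (fun n => lpNorm_nonneg) hC0 fun ε hε => ?_
  obtain ⟨g, hg1, hg2, hg3, hg4⟩ := exists_compact_approx (by norm_num) hA hε
  refine ⟨_, h (fun x => ‖g x‖) hg1.norm hg2.norm, fun n => ?_⟩
  have hAg : MemLp (fun x => A x - g x) 6 volume := hA.sub hg3
  have e : (fun x => A x k • f n x) = fun x => (A x - g x) k • f n x + g x k • f n x := by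
    ext1 x; rw [← add_smul]; simp
  rw [e]
  refine (lpNorm_fun_add_le (memLp_coord_smul hAg (hf n) k).1 (by norm_num)).trans
    (add_le_add ?_ ?_)
  · refine (memLp_coord_smul hAg (hf n) k).2.trans ?_
    rw [mul_comm]
    exact mul_le_mul (hC n) hg4 lpNorm_nonneg hC0
  · have hm : MemLp (fun x => ‖g x‖ • f n x) 2 volume :=
      memLp_bilin (r := 2) hg3 (hf n) (fun a b => ‖a‖ • b) (hg1.norm.aestronglyMeasurable.smul
        (hf n).1) fun x => by rw [norm_smul, norm_norm]
    refine lpNorm_mono_norm hm (Eventually.of_forall fun x => ?_)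
    rw [norm_smul, norm_smul, norm_norm]
    gcongr
    exact PiLp.norm_apply_le _ _

/-- The product of two bounded sequences, one of which converges to zero locally, converges
weakly to zero. -/
theorem tendsto_inner_coord_smul [InnerProductSpace ℝ F] {A : ℕ → Space → Space}
    {f : ℕ → Space → F} {C : ℝ}
    (hA : ∀ n, MemLp (A n) 6 volume) (hAC : ∀ n, lpNorm (A n) 6 volume ≤ C)
    (hf : ∀ n, MemLp (f n) 2 volume) (hf3 : ∀ n, MemLp (f n) 3 volume)
    (hfC : ∀ n, lpNorm (f n) 2 volume ≤ C) (hf3C : ∀ n, lpNorm (f n) 3 volume ≤ C)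
    (h : ∀ g : Space → ℝ, Continuous g → HasCompactSupport g →
      Tendsto (fun n => lpNorm (fun x => g x • A n x) 2 volume) atTop (𝓝 0))
    {u : Space → F} (hu : MemLp u 2 volume) (k : Fin 3) :
    Tendsto (fun n => ∫ x, inner ℝ (u x) (A n x k • f n x)) atTop (𝓝 0) := by
  have hC0 : 0 ≤ C := lpNorm_nonneg.trans (hAC 0)
  rw [tendsto_zero_iff_norm_tendsto_zero]
  refine tendsto_zero_of_le_add (C := C * C) (fun n => norm_nonneg _) (by positivity)
    fun ε hε => ?_
  obtain ⟨g, hg1, hg2, hg3, hg4⟩ := exists_compact_approx (by norm_num) hu hε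
  refine ⟨_, by simpa using (h (fun x => ‖g x‖) hg1.norm hg2.norm).mul_const C, fun n => ?_⟩
  have hug : MemLp (fun x => u x - g x) 2 volume := hu.sub hg3
  have hp := memLp_coord_smul (hA n) (hf3 n) k
  have hm : MemLp (fun x => ‖g x‖ • A n x) 2 volume := by
    have hg3' : MemLp g 3 volume := hg1.memLp_of_hasCompactSupport hg2
    exact memLp_bilin (r := 2) hg3' (hA n) (fun a b => ‖a‖ • b)
      (hg1.norm.aestronglyMeasurable.smul (hA n).1) fun x => by rw [norm_smul, norm_norm]
  have e : ∀ x, inner ℝ (u x) (A n x k • f n x) =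
      inner ℝ (u x - g x) (A n x k • f n x) + inner ℝ (g x) (A n x k • f n x) := fun x => by
    rw [← inner_add_left, sub_add_cancel]
  simp only [e]
  rw [integral_add (integrable_inner hug hp.1) (integrable_inner hg3 hp.1)]
  refine (norm_add_le _ _).trans (add_le_add ?_ ?_)
  · refine (abs_integral_inner_le hug hp.1).trans ?_
    rw [mul_comm]
    refine mul_le_mul (hp.2.trans ?_) hg4 lpNorm_nonneg (by positivity)
    exact mul_le_mul (hAC n) (hf3C n) lpNorm_nonneg hC0
  · calc _ ≤ ∫ x, ‖‖g x‖ • A n x‖ * ‖f n x‖ := by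
          refine norm_integral_le_of_norm_le (integrable_mul_norm hm (hf n))
            (Eventually.of_forall fun x => ?_)
          refine (norm_inner_le_norm _ _).trans ?_
          rw [norm_smul, norm_smul, norm_norm, mul_assoc]
          gcongr
          exact PiLp.norm_apply_le _ _
      _ ≤ lpNorm (fun x => ‖g x‖ • A n x) 2 volume * lpNorm (f n) 2 volume :=
          integral_mul_norm_le hm (hf n)
      _ ≤ _ := mul_le_mul_of_nonneg_left (hfC n) lpNorm_nonneg

end WeakProducts

/-! ### Existence of a minimizer -/

namespace Params

variable (P : Params) (u : Conf)

/-- Coercivity bounds the covariant derivative and `∇A`. The diamagnetic and interpolation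
inequalities then bound `ψ` in `L⁶` and `L³`, and subtracting the coupling from the covariant
derivative recovers the gradient of `ψ`. -/
theorem exists_bound {lam : ℝ} (hlam : 0 < lam)
    (hth : ‖P.v‖ < criticalSpeed P.ħ P.c P.Q P.j lam) (M : ℝ) :
    ∃ C : ℝ, ∀ u : Conf, u.mass = lam → P.energy u ≤ M →
      gradNorm (P.cd u) ≤ C ∧ gradNorm u.G ≤ C ∧ lpNorm u.ψ 2 volume ≤ C ∧
      lpNorm u.ψ 3 volume ≤ C ∧ gradNorm u.D ≤ C ∧ lpNorm u.A 6 volume ≤ C := by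
  obtain ⟨δ, hδ, C, hC⟩ := P.coercive hlam hth
  have hK := sobolevConst_nonneg
  have hħ := P.hħ
  set X := max ((M + C) / δ) 0 with hX
  have hX0 : 0 ≤ X := le_max_right _ _
  set a2 := √lam
  set a6 := sobolevConst / P.ħ * X
  set a3 := √(a2 * a6)
  set b := √X
  set A6 := sobolevConst * b
  set d : Fin 3 → ℝ := fun k => (X + (|P.Q / P.c| * (A6 * a3) + |P.m * P.v k| * a2)) / P.ħ
  have hd0 : ∀ k, 0 ≤ d k := fun k => by positivity
  refine ⟨X + b + a2 + a3 + (∑ k, d k) + A6, fun u hu hE => ?_⟩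
  have h1 := hC u hu
  have hg0 := gradNorm_nonneg (P.cd u)
  have h2 : gradNorm (P.cd u) + gradNorm u.G ^ 2 ≤ X := by
    refine le_trans ?_ (le_max_left _ _)
    rw [le_div_iff₀ hδ]; linarith
  have hx : gradNorm (P.cd u) ≤ X := by nlinarith [sq_nonneg (gradNorm u.G)]
  have hb : gradNorm u.G ≤ b := Real.le_sqrt_of_sq_le (by linarith)
  have hψ2 : lpNorm u.ψ 2 volume ≤ a2 := by
    refine Real.le_sqrt_of_sq_le ?_
    rw [← Conf.mass_eq, hu]
  have hψ6 : lpNorm u.ψ 6 volume ≤ a6 :=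
    (P.diamagnetic u).trans (mul_le_mul_of_nonneg_left hx (by positivity))
  have hψ3 : lpNorm u.ψ 3 volume ≤ a3 := by
    refine Real.le_sqrt_of_sq_le ((sq_lpNorm_three_le u.ψ2 u.ψ6).trans ?_)
    exact mul_le_mul hψ2 hψ6 lpNorm_nonneg (by positivity)
  have hA : lpNorm u.A 6 volume ≤ A6 := u.A6_le.trans (mul_le_mul_of_nonneg_left hb hK)
  have hD : gradNorm u.D ≤ ∑ k, d k := by
    refine (gradNorm_le_sum _).trans (Finset.sum_le_sum fun k _ => ?_)
    rw [le_div_iff₀ hħ, mul_comm]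
    refine (P.lpNorm_D_le u k).trans ?_
    have := lpNorm_nonneg (f := u.ψ) (p := 3) (μ := volume)
    gcongr
  have p1 : 0 ≤ b := Real.sqrt_nonneg _
  have p2 : 0 ≤ a2 := Real.sqrt_nonneg _
  have p3 : 0 ≤ a3 := Real.sqrt_nonneg _
  have p4 : 0 ≤ ∑ k, d k := Finset.sum_nonneg fun k _ => hd0 k
  have p5 : 0 ≤ A6 := by positivity
  refine ⟨?_, ?_, ?_, ?_, ?_, ?_⟩ <;> linarith

theorem energy_ge_flux : -(P.Q / P.c * P.flux u) ≤ P.energy u := by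
  have h1 := P.kinetic_nonneg u
  have h2 : 0 ≤ P.fieldForm u.G u.G := fieldForm_self_nonneg u.G2
  have hm := P.hm
  have h3 : 0 ≤ 1 / (2 * P.m) * P.kinetic u := by positivity
  rw [energy]; linarith

/-- Kinetic and field energies are nonnegative, so a negative limit of the energy must come from the
coupling. This is the only use of `I < 0`: it excludes vanishing and, later, loss of mass. -/
theorem not_tendsto_flux {u : ℕ → Conf} {I : ℝ} (hI : I < 0)
    (hE : Tendsto (fun n => P.energy (u n)) atTop (𝓝 I)) :
    ¬Tendsto (fun n => P.flux (u n)) atTop (𝓝 0) := fun h => by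
  have h1 := (h.const_mul (P.Q / P.c)).neg
  simp only [mul_zero, neg_zero] at h1
  exact absurd (le_of_tendsto_of_tendsto' h1 hE fun n => P.energy_ge_flux (u n)) (not_le.mpr hI)

theorem moll_translate {F : Type*} [NormedAddCommGroup F] [NormedSpace ℝ F] (i : ℕ)
    (f : Space → F) (y x : Space) : moll i (fun x => f (x + y)) x = moll i f (x + y) := by
  simp only [moll]
  congr 1
  ext1 z
  congr 1
  abel

/-- Isolates the one nonlinear term in the pairing. The other two pass to weak limits directly, the
product through `tendsto_inner_coord_smul`. -/
theorem integral_inner_cd {h : Space → Spinor} (hh : MemLp h 2 volume) (k : Fin 3) :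
    ∫ x, inner ℝ (h x) (P.cd u k x) = -P.ħ * (∫ x, inner ℝ (Complex.I • h x) (u.D k x)) +
      P.Q / P.c * (∫ x, inner ℝ (h x) (u.A x k • u.ψ x)) +
      P.m * P.v k * ∫ x, inner ℝ (h x) (u.ψ x) := by
  have hIh : MemLp (fun x => Complex.I • h x) 2 volume := imL.comp_memLp' hh
  have i1 := (integrable_inner hIh (u.D2 k)).const_mul (-P.ħ)
  have i2 := (integrable_inner hh (memLp_coord_smul u.A6 u.ψ3 k).1).const_mul (P.Q / P.c)
  have i3 := (integrable_inner hh u.ψ2).const_mul (P.m * P.v k)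
  have i12 : Integrable (fun x => -P.ħ * inner ℝ (Complex.I • h x) (u.D k x) +
    P.Q / P.c * inner ℝ (h x) (u.A x k • u.ψ x)) volume := i1.add i2
  rw [← integral_const_mul, ← integral_const_mul, ← integral_const_mul, ← integral_add i1 i2,
    ← integral_add i12 i3]
  refine integral_congr_ae (Eventually.of_forall fun x => ?_)
  simp only [cd, inner_add_right, inner_smul_right, inner_im_left]
  ring

/-- Weak convergence of a sequence of configurations to zero. -/
structure WeaklyNull (w : ℕ → Conf) : Prop where
  ψ : ∀ h, MemLp h 2 volume → Tendsto (fun n => ∫ x, inner ℝ (h x) ((w n).ψ x)) atTop (𝓝 0)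
  D : ∀ k h, MemLp h 2 volume → Tendsto (fun n => ∫ x, inner ℝ (h x) ((w n).D k x)) atTop (𝓝 0)
  A : ∀ h : Space → Space, Continuous h → HasCompactSupport h →
    Tendsto (fun n => ∫ x, inner ℝ (h x) ((w n).A x)) atTop (𝓝 0)
  G : ∀ k h, MemLp h 2 volume → Tendsto (fun n => ∫ x, inner ℝ (h x) ((w n).G k x)) atTop (𝓝 0)

section Bounded

variable {w : ℕ → Conf} (hw : WeaklyNull w) {C : ℝ} (hD : ∀ n, gradNorm (w n).D ≤ C)
  (hG : ∀ n, gradNorm (w n).G ≤ C) (hψ : ∀ n, lpNorm (w n).ψ 2 volume ≤ C)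
  (hψ3 : ∀ n, lpNorm (w n).ψ 3 volume ≤ C) (hA : ∀ n, lpNorm (w n).A 6 volume ≤ C)

theorem moll_zero {F : Type*} [NormedAddCommGroup F] [NormedSpace ℝ F] (i : ℕ) (x : Space) :
    moll i (fun _ => 0 : Space → F) x = 0 := by simp [moll]

include hw hD hψ in
theorem WeaklyNull.local_ψ {g : Space → ℝ} (hg : Continuous g) (hgs : HasCompactSupport g) :
    Tendsto (fun n => lpNorm (fun x => g x • (w n).ψ x) 2 volume) atTop (𝓝 0) := by
  refine rellich (by norm_num) (fun n => (w n).hψ) hψ hD (fun i x => ?_) hg hgs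
  have := moll_tendsto_of_weak (p := 2) (by norm_num) (fun n => (w n).ψ2)
    (u := fun _ => (0 : Spinor)) MemLp.zero (fun h h1 h2 => by
      simpa using hw.ψ h (h1.memLp_of_hasCompactSupport h2)) i x
  rwa [moll_zero] at this

include hw hG hA in
theorem WeaklyNull.local_A {g : Space → ℝ} (hg : Continuous g) (hgs : HasCompactSupport g) :
    Tendsto (fun n => lpNorm (fun x => g x • (w n).A x) 2 volume) atTop (𝓝 0) := by
  refine rellich (by norm_num) (fun n => (w n).hA) hA hG (fun i x => ?_) hg hgs
  have := moll_tendsto_of_weak (p := 6) (by norm_num) (fun n => (w n).A6)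
    (u := fun _ => (0 : Space)) MemLp.zero (fun h h1 h2 => by simpa using hw.A h h1 h2) i x
  rwa [moll_zero] at this

include hw hG hψ hψ3 hA in
theorem WeaklyNull.kin : Tendsto (fun n => kin P.j (P.cd u) (P.cd (w n))) atTop (𝓝 0) := by
  have hS : ∀ k, MemLp (fun x => spinOp P.j (P.cd u · x) k) 2 volume :=
    spinOp_memLp P.j (P.cd_memLp u)
  have hk : ∀ k, Tendsto (fun n => ∫ x, inner ℝ (spinOp P.j (P.cd u · x) k) (P.cd (w n) k x))
      atTop (𝓝 0) := by
    intro k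
    set h : Space → Spinor := fun x => spinOp P.j (P.cd u · x) k with hh
    have hIh : MemLp (fun x => Complex.I • h x) 2 volume := imL.comp_memLp' (hS k)
    have t1 := (hw.D k _ hIh).const_mul (-P.ħ)
    have t2 := (tendsto_inner_coord_smul (fun n => (w n).A6) hA (fun n => (w n).ψ2)
      (fun n => (w n).ψ3) hψ hψ3 (fun g h1 h2 => hw.local_A hG hA h1 h2) (hS k) k).const_mul
      (P.Q / P.c)
    have t3 := (hw.ψ h (hS k)).const_mul (P.m * P.v k)
    have t := (t1.add t2).add t3
    simp only [mul_zero, add_zero] at t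
    exact t.congr fun n => (P.integral_inner_cd (w n) (hS k) k).symm
  have := tendsto_finsetSum Finset.univ fun k _ => hk k
  simp only [Finset.sum_const_zero] at this
  refine this.congr fun n => ?_
  rw [kin_eq_sum (P.cd_memLp u) (P.cd_memLp (w n))]

include hw in
theorem WeaklyNull.field : Tendsto (fun n => P.fieldForm u.G (w n).G) atTop (𝓝 0) := by
  have hv := sum_smul_memLp u.G2 P.v
  have t1 := tendsto_finsetSum Finset.univ fun k _ => hw.G k (u.G k) (u.G2 k)
  have t2 := tendsto_finsetSum Finset.univ fun k _ => (hw.G k _ hv).const_mul (P.v k)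
  have t := (t1.sub (t2.const_mul (1 / P.c ^ 2))).const_mul (1 / (8 * Real.pi))
  simp only [mul_zero, Finset.sum_const_zero, sub_zero] at t
  refine t.congr fun n => ?_
  rw [fieldForm, integral_sub, integral_finsetSum, integral_const_mul]
  · congr 3
    have : ∀ x, inner ℝ (∑ k, P.v k • u.G k x) (∑ k, P.v k • (w n).G k x) =
        ∑ k, P.v k * inner ℝ (∑ k, P.v k • u.G k x) ((w n).G k x) := fun x => by
      rw [inner_sum]; simp only [inner_smul_right]
    simp only [this]
    rw [integral_finsetSum]
    · simp only [integral_const_mul]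
    · exact fun k _ => (integrable_inner hv ((w n).G2 k)).const_mul _
  · exact fun k _ => integrable_inner (u.G2 k) ((w n).G2 k)
  · exact integrable_finsetSum _ fun k _ => integrable_inner (u.G2 k) ((w n).G2 k)
  · exact (integrable_inner hv (sum_smul_memLp (w n).G2 P.v)).const_mul _

include hw in
theorem WeaklyNull.mass : Tendsto (fun n => (u.add (w n)).mass - u.mass - (w n).mass) atTop
    (𝓝 0) := by
  have t := (hw.ψ u.ψ u.ψ2).const_mul 2
  simp only [mul_zero] at t
  refine t.congr fun n => ?_
  have i1 := (memLp_two_iff_integrable_sq_norm u.ψ2.1).mp u.ψ2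
  have i2 := (memLp_two_iff_integrable_sq_norm (w n).ψ2.1).mp (w n).ψ2
  have i3 := (integrable_inner u.ψ2 (w n).ψ2).const_mul 2
  have e : ∀ x, ‖(u.add (w n)).ψ x‖ ^ 2 = ‖u.ψ x‖ ^ 2 + 2 * inner ℝ (u.ψ x) ((w n).ψ x) +
      ‖(w n).ψ x‖ ^ 2 := fun x => norm_add_sq_real _ _
  have i13 : Integrable (fun x => ‖u.ψ x‖ ^ 2 + 2 * inner ℝ (u.ψ x) ((w n).ψ x)) volume := i1.add i3
  simp only [Conf.mass, e]
  rw [integral_add i13 i2, integral_add i1 i3, integral_const_mul]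
  ring

end Bounded

/-! ### The minimizing sequence -/

theorem divFree_sub {u w : Conf} (hu : u.DivFree) (hw : w.DivFree) : (u.sub w).DivFree := by
  filter_upwards [hu, hw] with x h1 h2
  simp only [Conf.sub, PiLp.sub_apply, Finset.sum_sub_distrib, h1, h2, sub_zero]

theorem coord_memLp {f : Space → Space} {p : ℝ≥0∞} (hf : MemLp f p volume) (k : Fin 3) :
    MemLp (fun x => f x k) p volume := (EuclideanSpace.proj (𝕜 := ℝ) k).comp_memLp' hf

/-- The divergence constraint is preserved under weak limits. -/
theorem divFree_of_weak {u : Conf} {w : ℕ → Conf} (hw : ∀ n, (w n).DivFree)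
    (h : ∀ k h, MemLp h 2 volume → Tendsto (fun n => ∫ x, inner ℝ (h x) ((w n).G k x)) atTop
      (𝓝 (∫ x, inner ℝ (h x) (u.G k x)))) : u.DivFree := by
  -- The constraint is tested with the divergence of the limit itself, which gives `∫ d² = 0`.
  set d : Space → ℝ := fun x => ∑ k, u.G k x k with hd
  have hdm : MemLp d 2 volume := memLp_finsetSum _ fun k _ => coord_memLp (u.G2 k) k
  have hdk : ∀ k, MemLp (fun x => d x • e k) 2 volume := fun k =>
    ((ContinuousLinearMap.id ℝ ℝ).smulRight (e k)).comp_memLp' hdm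
  have hin : ∀ (G : Fin 3 → Space → Space) (k : Fin 3) x,
      inner ℝ (d x • e k) (G k x) = d x * G k x k := fun G k x => by
    rw [real_inner_smul_left, e, EuclideanSpace.inner_single_left]; simp
  have hi : ∀ (G : Fin 3 → Space → Space), (∀ k, MemLp (G k) 2 volume) →
      ∑ k, ∫ x, inner ℝ (d x • e k) (G k x) = ∫ x, d x * ∑ k, G k x k := fun G hG => by
    rw [← integral_finsetSum _ fun k _ => integrable_inner (hdk k) (hG k)]
    simp only [hin, Finset.mul_sum]
  have t := tendsto_finsetSum Finset.univ fun k _ => h k _ (hdk k)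
  rw [hi u.G u.G2] at t
  have h0 : ∀ n, ∑ k, ∫ x, inner ℝ (d x • e k) ((w n).G k x) = 0 := fun n => by
    rw [hi _ (w n).G2, ← integral_zero Space ℝ]
    refine integral_congr_ae ?_
    filter_upwards [hw n] with x hx
    rw [hx, mul_zero]
  simp only [h0] at t
  have hz : ∫ x, ‖d x‖ ^ 2 = 0 := by
    have := tendsto_nhds_unique t tendsto_const_nhds
    rw [← this]
    refine integral_congr_ae (Eventually.of_forall fun x => ?_)
    simp only [Real.norm_eq_abs, sq_abs]
    exact pow_two (d x)
  rw [integral_eq_zero_iff_of_nonneg (fun x => by positivity)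
    ((memLp_two_iff_integrable_sq_norm hdm.1).mp hdm)] at hz
  filter_upwards [hz] with x hx
  simpa using hx

theorem flux_tendsto_of_three {u : ℕ → Conf} {C : ℝ} (hA : ∀ n, lpNorm (u n).A 6 volume ≤ C)
    (hψ : ∀ n, lpNorm (u n).ψ 2 volume ≤ C)
    (h : Tendsto (fun n => lpNorm (u n).ψ 3 volume) atTop (𝓝 0)) :
    Tendsto (fun n => P.flux (u n)) atTop (𝓝 0) := by
  have hC0 : 0 ≤ C := lpNorm_nonneg.trans (hψ 0)
  refine squeeze_zero_norm (fun n => (P.abs_flux_le (u n)).trans ?_)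
    (by simpa using (h.const_mul (‖P.v‖ * C)).mul_const C)
  rw [← mul_assoc]
  have := lpNorm_nonneg (f := (u n).ψ) (p := 3) (μ := volume)
  have := lpNorm_nonneg (f := (u n).ψ) (p := 2) (μ := volume)
  have h1 := hA n
  have h2 := hψ n
  gcongr

/-- By ellipticity `∇A` tends to zero in `L²`, so `A` tends to zero in `L⁶` by the Sobolev
inequality. -/
theorem flux_tendsto_of_field {u : ℕ → Conf} {C : ℝ} (hψ : ∀ n, lpNorm (u n).ψ 2 volume ≤ C)
    (hψ3 : ∀ n, lpNorm (u n).ψ 3 volume ≤ C)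
    (h : Tendsto (fun n => P.fieldForm (u n).G (u n).G) atTop (𝓝 0)) :
    Tendsto (fun n => P.flux (u n)) atTop (𝓝 0) := by
  have hC0 : 0 ≤ C := lpNorm_nonneg.trans (hψ 0)
  have hκ := P.fieldConst_pos
  have hg : Tendsto (fun n => √(P.fieldForm (u n).G (u n).G / P.fieldConst)) atTop (𝓝 0) := by
    simpa using (h.div_const P.fieldConst).sqrt
  refine squeeze_zero_norm (fun n => (P.abs_flux_le (u n)).trans ?_)
    (by simpa using (hg.const_mul sobolevConst).const_mul (‖P.v‖ * C * C))
  have h1 : gradNorm (u n).G ≤ √(P.fieldForm (u n).G (u n).G / P.fieldConst) := by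
    refine Real.le_sqrt_of_sq_le ?_
    rw [le_div_iff₀ hκ, mul_comm]
    exact fieldForm_self_ge (u n).G2
  have h2 := (u n).A6_le.trans (mul_le_mul_of_nonneg_left h1 sobolevConst_nonneg)
  have := lpNorm_nonneg (f := (u n).ψ) (p := 3) (μ := volume)
  have := lpNorm_nonneg (f := (u n).ψ) (p := 2) (μ := volume)
  have h3 := hψ n
  have h4 := hψ3 n
  have h5 : 0 ≤ sobolevConst * √(P.fieldForm (u n).G (u n).G / P.fieldConst) :=
    lpNorm_nonneg.trans h2
  calc ‖P.v‖ * (lpNorm (u n).A 6 volume * lpNorm (u n).ψ 3 volume) * lpNorm (u n).ψ 2 volume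
      ≤ ‖P.v‖ * (sobolevConst * √(P.fieldForm (u n).G (u n).G / P.fieldConst) * C) * C := by
        gcongr
    _ = _ := by ring

/-- A minimizing sequence converges weakly, after translations and passing to a subsequence, to a
configuration of positive mass. -/
theorem exists_weak_minimizing {lam : ℝ} (hlam : 0 < lam)
    (hth : ‖P.v‖ < criticalSpeed P.ħ P.c P.Q P.j lam) {I : ℝ} (hI : I < 0) {u : ℕ → Conf}
    (hdiv : ∀ n, (u n).DivFree) (hmass : ∀ n, (u n).mass = lam)
    (hE : Tendsto (fun n => P.energy (u n)) atTop (𝓝 I)) :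
    ∃ (w : ℕ → Conf) (v : Conf) (C : ℝ), v.DivFree ∧ 0 < v.mass ∧ (∀ n, (w n).DivFree) ∧
      (∀ n, (v.add (w n)).mass = lam) ∧
      Tendsto (fun n => P.energy (v.add (w n))) atTop (𝓝 I) ∧ WeaklyNull w ∧
      (∀ n, gradNorm (P.cd (v.add (w n))) ≤ C ∧ gradNorm (v.add (w n)).G ≤ C ∧
        lpNorm (v.add (w n)).ψ 2 volume ≤ C ∧ lpNorm (v.add (w n)).ψ 3 volume ≤ C ∧
        gradNorm (v.add (w n)).D ≤ C ∧ lpNorm (v.add (w n)).A 6 volume ≤ C) := by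
  obtain ⟨M, hM⟩ := hE.bddAbove_range
  have hM' : ∀ n, P.energy (u n) ≤ M := fun n => hM ⟨n, rfl⟩
  obtain ⟨C, hC⟩ := P.exists_bound hlam hth M
  have hCu := fun n => hC (u n) (hmass n) (hM' n)
  -- Vanishing is excluded: if at every scale the averages tended to zero uniformly in space, `ψ`
  -- would tend to zero in `L³` and the coupling with it.
  obtain ⟨i, δ, hδ, hfr⟩ : ∃ i, ∃ δ > 0, ∃ᶠ n in atTop, ∃ x, δ < ‖moll i (u n).ψ x‖ := by
    by_contra! hcon
    refine P.not_tendsto_flux hI hE (P.flux_tendsto_of_three (fun n => (hCu n).2.2.2.2.2)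
      (fun n => (hCu n).2.2.1) ?_)
    refine tendsto_three_of_vanishing (fun n => (u n).hψ) (fun n => (hCu n).2.2.1)
      (fun n => (hCu n).2.2.2.2.1) fun i δ hδ => ?_
    exact hcon i δ hδ
  obtain ⟨ns, hns, hx⟩ := extraction_of_frequently_atTop hfr
  choose y hy using hx
  set u1 : ℕ → Conf := fun n => (u (ns n)).translate (y n) with hu1
  have hE1 : Tendsto (fun n => P.energy (u1 n)) atTop (𝓝 I) := by
    simp only [hu1, energy_translate]
    exact hE.comp hns.tendsto_atTop
  have hm1 : ∀ n, (u1 n).mass = lam := fun n => by simp only [hu1, mass_translate, hmass]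
  have hd1 : ∀ n, (u1 n).DivFree := fun n => divFree_translate _ (hdiv _) _
  have hC1 := fun n => hC (u1 n) (hm1 n) (by simp only [hu1, energy_translate]; exact hM' _)
  obtain ⟨ψ, D, ms, hms, hψ, hw1, hw2⟩ := Adm.exists_weak_limit_two (fun n => (u1 n).hψ)
    (fun n => (hC1 n).2.2.1) (fun n => (hC1 n).2.2.2.2.1)
  obtain ⟨A, G, ls, hls, hA, hw3, hw4⟩ := Adm.exists_weak_limit_six (fun n => (u1 (ms n)).hA)
    (fun n => (hC1 (ms n)).2.1)
  set u2 : ℕ → Conf := fun n => u1 (ms (ls n)) with hu2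
  set v : Conf := ⟨ψ, D, A, G, hψ, hA⟩ with hv
  have hlt := hls.tendsto_atTop
  have hC2 := fun n => hC1 (ms (ls n))
  have c1 : ∀ h, MemLp h 2 volume → Tendsto (fun n => ∫ x, inner ℝ (h x) ((u2 n).ψ x)) atTop
      (𝓝 (∫ x, inner ℝ (h x) (v.ψ x))) := fun h hh => (hw1 h hh).comp hlt
  have c2 : ∀ k h, MemLp h 2 volume → Tendsto (fun n => ∫ x, inner ℝ (h x) ((u2 n).D k x)) atTop
      (𝓝 (∫ x, inner ℝ (h x) (v.D k x))) := fun k h hh => (hw2 k h hh).comp hlt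
  have c3 : ∀ h : Space → Space, Continuous h → HasCompactSupport h →
      Tendsto (fun n => ∫ x, inner ℝ (h x) ((u2 n).A x)) atTop (𝓝 (∫ x, inner ℝ (h x) (v.A x))) :=
    hw3
  have c4 : ∀ k h, MemLp h 2 volume → Tendsto (fun n => ∫ x, inner ℝ (h x) ((u2 n).G k x)) atTop
      (𝓝 (∫ x, inner ℝ (h x) (v.G k x))) := hw4
  have hvd : v.DivFree := divFree_of_weak (fun n => hd1 _) c4
  have hvm : 0 < v.mass := by
    have ht := moll_tendsto_of_weak (p := 2) (by norm_num) (fun n => (u2 n).ψ2) v.ψ2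
      (fun h h1 h2 => c1 h (h1.memLp_of_hasCompactSupport h2)) i 0
    -- The translations put the point with a large average at the origin. The average at a fixed
    -- point is weakly continuous, so the lower bound survives in the limit.
    have hge : δ ≤ ‖moll i v.ψ 0‖ := by
      refine ge_of_tendsto' ht.norm fun n => ?_
      have : moll i (u2 n).ψ 0 = moll i (u (ns (ms (ls n)))).ψ (y (ms (ls n))) := by
        have := moll_translate i (u (ns (ms (ls n)))).ψ (y (ms (ls n))) 0
        rw [zero_add] at this
        exact this
      rw [this]
      exact (hy _).le
    rcases v.mass_nonneg.eq_or_lt with h | h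
    · exfalso
      rw [Conf.mass_eq] at h
      have h0 : lpNorm v.ψ 2 volume = 0 := (pow_eq_zero_iff two_ne_zero).mp h.symm
      have := norm_moll_le (p := 2) (by norm_num) v.ψ2 i 0
      rw [h0, zero_mul] at this
      linarith
    · exact h
  have hadd : ∀ n, v.add ((u2 n).sub v) = u2 n := fun n => Conf.add_sub _ _
  refine ⟨fun n => (u2 n).sub v, v, C, hvd, hvm, fun n => divFree_sub (hd1 _) hvd, ?_, ?_, ?_, ?_⟩
  · intro n; rw [hadd]; exact hm1 _
  · simp only [hadd]
    exact hE1.comp (hms.tendsto_atTop.comp hlt)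
  · refine ⟨fun h hh => ?_, fun k h hh => ?_, fun h h1 h2 => ?_, fun k h hh => ?_⟩
    · have t := (c1 h hh).sub_const (∫ x, inner ℝ (h x) (v.ψ x))
      rw [sub_self] at t
      refine t.congr fun n => ?_
      rw [← integral_sub (integrable_inner hh (u2 n).ψ2) (integrable_inner hh v.ψ2)]
      simp only [Conf.sub, inner_sub_right]
    · have t := (c2 k h hh).sub_const (∫ x, inner ℝ (h x) (v.D k x))
      rw [sub_self] at t
      refine t.congr fun n => ?_
      rw [← integral_sub (integrable_inner hh ((u2 n).D2 k)) (integrable_inner hh (v.D2 k))]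
      simp only [Conf.sub, inner_sub_right]
    · have t := (c3 h h1 h2).sub_const (∫ x, inner ℝ (h x) (v.A x))
      rw [sub_self] at t
      refine t.congr fun n => ?_
      have hBi : ∀ B : Space → Space, MemLp B 6 volume →
          Integrable (fun x => inner ℝ (h x) (B x)) volume := fun B hB =>
        (integrable_smul_conj (p := 6) (by norm_num)
          (h1.norm.memLp_of_hasCompactSupport h2.norm) hB).mono
          (h1.aestronglyMeasurable.inner hB.1) (Eventually.of_forall fun x => by
            rw [norm_smul, norm_norm]; exact norm_inner_le_norm (h x) (B x))
      rw [← integral_sub (hBi _ (u2 n).A6) (hBi _ v.A6)]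
      simp only [Conf.sub, inner_sub_right]
    · have t := (c4 k h hh).sub_const (∫ x, inner ℝ (h x) (v.G k x))
      rw [sub_self] at t
      refine t.congr fun n => ?_
      rw [← integral_sub (integrable_inner hh ((u2 n).G2 k)) (integrable_inner hh (v.G2 k))]
      simp only [Conf.sub, inner_sub_right]
  · intro n
    rw [hadd]
    exact hC2 n

end Params

/-! ### No mass is lost in the weak limit -/

namespace Params

variable (P : Params)

theorem lpNorm_sub_bound {F : Type*} [NormedAddCommGroup F] {p : ℝ≥0∞} (hp : 1 ≤ p)
    {f g : Space → F} (hf : MemLp f p volume) (hg : MemLp g p volume) {C : ℝ}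
    (h : lpNorm (fun x => f x + g x) p volume ≤ C) :
    lpNorm g p volume ≤ C + lpNorm f p volume := by
  have h2 := lpNorm_fun_add_le (g := fun x => -f x) (memLp_fun_add hf hg) hp
  have e : (fun x => f x + g x + -f x) = g := by ext1 x; abel
  have e2 : lpNorm (fun x => -f x) p volume = lpNorm f p volume :=
    lpNorm_congr_norm hf.1.neg hf.1 (Eventually.of_forall fun x => norm_neg _)
  rw [e, e2] at h2
  linarith

theorem gradNorm_sub_bound {F : Type*} [NormedAddCommGroup F] {G H : Fin 3 → Space → F}
    (hG : ∀ k, MemLp (G k) 2 volume) (hH : ∀ k, MemLp (H k) 2 volume) {C : ℝ}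
    (h : gradNorm (fun k x => G k x + H k x) ≤ C) : gradNorm H ≤ 3 * (C + gradNorm G) := by
  refine (gradNorm_le_sum H).trans ?_
  calc _ ≤ ∑ _k : Fin 3, (C + gradNorm G) := Finset.sum_le_sum fun k _ =>
        (lpNorm_sub_bound (by norm_num) (hG k) (hH k)
          ((lpNorm_le_gradNorm (fun k x => G k x + H k x) k).trans h)).trans
          (add_le_add_right (lpNorm_le_gradNorm G k) C)
    _ = _ := by simp; ring

/-- The weak limit of a translated minimizing sequence and the remainder each satisfy
`energy_ge_of_inf`, with mass fractions adding up to one in the limit. Since their energies add up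
to the infimum, both inequalities are sharp, and the field energies they contain must vanish unless
all the mass is in the limit. -/
theorem exists_minimizer {lam : ℝ} (hlam : 0 < lam) (hv0 : 0 < ‖P.v‖)
    (hth : ‖P.v‖ < criticalSpeed P.ħ P.c P.Q P.j lam) :
    ∃ u : Conf, u.DivFree ∧ u.mass = lam ∧
      ∀ w : Conf, w.DivFree → w.mass = lam → P.energy u ≤ P.energy w := by
  set S : Set ℝ := {E | ∃ u : Conf, u.DivFree ∧ u.mass = lam ∧ P.energy u = E} with hS
  obtain ⟨u₀, hu₀d, hu₀m, hu₀E⟩ := P.exists_energy_neg hlam hv0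
  have hne : S.Nonempty := ⟨_, u₀, hu₀d, hu₀m, rfl⟩
  have hbdd : BddBelow S := by
    obtain ⟨δ, hδ, C, hC⟩ := P.coercive hlam hth
    refine ⟨-C, ?_⟩
    rintro E ⟨u, -, hm, rfl⟩
    have h1 := hC u hm
    have h2 : 0 ≤ δ * (gradNorm (P.cd u) + gradNorm u.G ^ 2) :=
      mul_nonneg hδ.le (add_nonneg (gradNorm_nonneg _) (sq_nonneg _))
    linarith
  set I := sInf S with hI
  have hI0 : I < 0 := (csInf_le hbdd ⟨u₀, hu₀d, hu₀m, rfl⟩).trans_lt hu₀E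
  have hIle : ∀ u : Conf, u.DivFree → u.mass = lam → I ≤ P.energy u := fun u hd hm =>
    csInf_le hbdd ⟨u, hd, hm, rfl⟩
  obtain ⟨Es, -, hEs, hEsS⟩ := exists_seq_tendsto_sInf hne hbdd
  choose us hus1 hus2 hus3 using hEsS
  obtain ⟨w, v, C, hvd, hvm, hwd, hmass, hE, hw, hC⟩ := P.exists_weak_minimizing hlam hth hI0
    hus1 hus2 (by simpa only [hus3] using hEs)
  -- bounds for the remainder
  set C' := 3 * (C + gradNorm v.G) + 3 * (C + gradNorm v.D) + (C + lpNorm v.ψ 2 volume) +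
    (C + lpNorm v.ψ 3 volume) + (C + lpNorm v.A 6 volume) with hC'
  have hC0 : 0 ≤ C := (gradNorm_nonneg _).trans (hC 0).1
  have p1 := gradNorm_nonneg v.G
  have p2 := gradNorm_nonneg v.D
  have p3 := lpNorm_nonneg (f := v.ψ) (p := 2) (μ := volume)
  have p4 := lpNorm_nonneg (f := v.ψ) (p := 3) (μ := volume)
  have p5 := lpNorm_nonneg (f := v.A) (p := 6) (μ := volume)
  have bG : ∀ n, gradNorm (w n).G ≤ C' := fun n => by
    have := gradNorm_sub_bound v.G2 (w n).G2 (hC n).2.1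
    linarith
  have bD : ∀ n, gradNorm (w n).D ≤ C' := fun n => by
    have := gradNorm_sub_bound v.D2 (w n).D2 (hC n).2.2.2.2.1
    linarith
  have bψ : ∀ n, lpNorm (w n).ψ 2 volume ≤ C' := fun n => by
    have := lpNorm_sub_bound (by norm_num) v.ψ2 (w n).ψ2 (hC n).2.2.1
    linarith
  have bψ3 : ∀ n, lpNorm (w n).ψ 3 volume ≤ C' := fun n => by
    have := lpNorm_sub_bound (by norm_num) v.ψ3 (w n).ψ3 (hC n).2.2.2.1
    linarith
  have bA : ∀ n, lpNorm (w n).A 6 volume ≤ C' := fun n => by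
    have := lpNorm_sub_bound (by norm_num) v.A6 (w n).A6 (hC n).2.2.2.2.2
    linarith
  have hC'0 : 0 ≤ C' := (gradNorm_nonneg _).trans (bG 0)
  set B := ∑ k, (P.ħ * C' + (|P.Q / P.c| * (C' * C') + |P.m * P.v k| * C')) with hB
  have bX : ∀ n, gradNorm (P.cd (w n)) ≤ B := fun n => by
    refine (gradNorm_le_sum _).trans (Finset.sum_le_sum fun k _ => ?_)
    refine (P.lpNorm_cd_le (w n) k).trans ?_
    have hħ := P.hħ
    have h1 := (lpNorm_le_gradNorm (w n).D k).trans (bD n)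
    have h2 := bA n
    have h3 := bψ3 n
    have h4 := bψ n
    have := lpNorm_nonneg (f := (w n).ψ) (p := 3) (μ := volume)
    gcongr
  -- splitting
  have s1 := tendsto_coord_smul_left (fun n => (w n).A6) bA v.ψ3
    fun g h1 h2 => hw.local_A bG bA h1 h2
  have s2 := tendsto_coord_smul_right v.A6 (fun n => (w n).ψ3) bψ3
    fun g h1 h2 => hw.local_ψ bD bψ h1 h2
  have s3 := hw.kin P v bG bψ bψ3 bA
  have s4 := hw.field P v
  have sE := P.tendsto_energy_split v (C := max B C') (fun n => (bX n).trans (le_max_left _ _))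
    (fun n => (bψ n).trans (le_max_right _ _)) s1 s2 s3 s4
  have sM := hw.mass v
  have sF := P.tendsto_flux_split v bψ s1 s2
  have hEw : Tendsto (fun n => P.energy (w n)) atTop (𝓝 (I - P.energy v)) := by
    have := (hE.sub_const (P.energy v)).sub sE
    rw [sub_zero] at this
    exact this.congr fun n => by ring
  have hMw : Tendsto (fun n => (w n).mass) atTop (𝓝 (lam - v.mass)) := by
    have := (tendsto_const_nhds (x := lam - v.mass)).sub sM
    rw [sub_zero] at this
    exact this.congr fun n => by rw [hmass n]; ring
  have hvle : v.mass ≤ lam := by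
    have := ge_of_tendsto' hMw fun n => (w n).mass_nonneg
    linarith
  set μ := v.mass / lam with hμ
  have hμ0 : 0 < μ := by positivity
  have hμ1 : μ ≤ 1 := (div_le_one hlam).mpr hvle
  have hMw' : Tendsto (fun n => (w n).mass / lam) atTop (𝓝 (1 - μ)) := by
    have := hMw.div_const lam
    rwa [sub_div, div_self hlam.ne'] at this
  have hEv := P.energy_ge_of_inf v hlam hIle hvd
  have hEwn := fun n => P.energy_ge_of_inf (w n) hlam hIle (hwd n)
  have hFv : 0 ≤ P.fieldForm v.G v.G := fieldForm_self_nonneg v.G2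
  have hFw : ∀ n, 0 ≤ P.fieldForm (w n).G (w n).G := fun n => fieldForm_self_nonneg (w n).G2
  rw [← hμ] at hEv
  -- the field energy of the remainder vanishes in the limit
  have hpos : ∀ᶠ n in atTop, 0 < 1 - (w n).mass / lam := by
    have : Tendsto (fun n => 1 - (w n).mass / lam) atTop (𝓝 μ) := by
      simpa using (tendsto_const_nhds (x := (1 : ℝ))).sub hMw'
    exact this.eventually (lt_mem_nhds hμ0)
  have hq : Tendsto (fun n => (P.energy (w n) - (w n).mass / lam * I) / (1 - (w n).mass / lam))
      atTop (𝓝 ((I - P.energy v - (1 - μ) * I) / (1 - (1 - μ)))) :=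
    (hEw.sub (hMw'.mul_const I)).div ((tendsto_const_nhds).sub hMw') (by linarith)
  have hle : ∀ᶠ n in atTop, P.fieldForm (w n).G (w n).G ≤
      (P.energy (w n) - (w n).mass / lam * I) / (1 - (w n).mass / lam) := by
    filter_upwards [hpos] with n hn
    rw [le_div_iff₀ hn]
    linarith [hEwn n]
  -- The value is nonnegative as a limit of upper bounds for nonnegative field energies. It is
  -- nonpositive because `energy v ≥ μ I`. So equality holds throughout.
  have hlim0 : (I - P.energy v - (1 - μ) * I) / (1 - (1 - μ)) = 0 := by
    refine le_antisymm ?_ (ge_of_tendsto hq (hle.mono fun n hn => (hFw n).trans hn))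
    refine div_nonpos_of_nonpos_of_nonneg ?_ (by linarith)
    have : 0 ≤ (1 - μ) * P.fieldForm v.G v.G := mul_nonneg (by linarith) hFv
    linarith
  rw [hlim0] at hq
  have hFw0 : Tendsto (fun n => P.fieldForm (w n).G (w n).G) atTop (𝓝 0) :=
    squeeze_zero' (Eventually.of_forall hFw) hle hq
  have hEvI : P.energy v = μ * I := by
    have : I - P.energy v - (1 - μ) * I = 0 := by
      rcases div_eq_zero_iff.mp hlim0 with h | h
      · exact h
      · exfalso; linarith
    linarith
  -- If part of the mass escaped, the field energies of the limit and of the remainder would both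
  -- vanish asymptotically. Then the coupling of the whole sequence would tend to zero, contrary to
  -- the negative infimum.
  have hμeq : μ = 1 := by
    by_contra hne1
    have hlt : 0 < 1 - μ := by
      have := lt_of_le_of_ne hμ1 hne1
      linarith
    have hFv0 : P.fieldForm v.G v.G = 0 := by
      have : (1 - μ) * P.fieldForm v.G v.G ≤ 0 := by linarith
      nlinarith
    have f1 := P.flux_tendsto_of_field bψ bψ3 hFw0
    have f2 : P.flux v = 0 := by
      have := P.flux_tendsto_of_field (u := fun _ => v)
        (C := max (lpNorm v.ψ 2 volume) (lpNorm v.ψ 3 volume))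
        (fun _ => le_max_left _ _) (fun _ => le_max_right _ _) (by rw [hFv0]; exact tendsto_const_nhds)
      exact tendsto_nhds_unique tendsto_const_nhds this
    refine P.not_tendsto_flux hI0 hE ?_
    have := sF.add f1
    rw [add_zero] at this
    refine this.congr fun n => ?_
    rw [f2]; ring
  refine ⟨v, hvd, ?_, fun u hud hum => ?_⟩
  · rw [hμ, div_eq_one_iff_eq hlam.ne'] at hμeq; exact hμeq
  · rw [hEvI, hμeq, one_mul]; exact hIle u hud hum

end Params

/-! ### The Euler–Lagrange equations -/

/-- The energy is a quadratic polynomial in `t` along lines in either unknown alone, so the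
variational equations are read off from a coefficient without differentiating any functional. -/
theorem eq_zero_of_quadratic_nonneg {b c : ℝ} (h : ∀ t : ℝ, 0 ≤ 2 * t * b + t ^ 2 * c) : b = 0 := by
  by_contra hb
  have hd : 0 < |c| + 1 := by positivity
  -- The denominator makes the step so short that the linear term outweighs the quadratic one.
  have h1 := h (-b / (|c| + 1))
  have h2 : 2 * (-b / (|c| + 1)) * b + (-b / (|c| + 1)) ^ 2 * c =
      b ^ 2 / (|c| + 1) ^ 2 * (c - 2 * (|c| + 1)) := by field_simp; ring
  rw [h2] at h1
  have h3 : c - 2 * (|c| + 1) < 0 := by linarith [le_abs_self c, abs_nonneg c]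
  have h4 : 0 < b ^ 2 / (|c| + 1) ^ 2 := by positivity
  nlinarith

namespace Conf

variable (u : Conf)

/-- Replacement of the spinor. -/
def withSpinor {χ : Space → Spinor} {E : Fin 3 → Space → Spinor} (h : Adm 2 χ E) : Conf :=
  ⟨χ, E, u.A, u.G, h, u.hA⟩

/-- Replacement of the vector potential. -/
def withPotential {B : Space → Space} {H : Fin 3 → Space → Space} (h : Adm 6 B H) : Conf :=
  ⟨u.ψ, u.D, B, H, u.hψ, h⟩

end Conf

/-! ### Variations of the spinor and of the potential -/

namespace Params

variable (P : Params) (u : Conf)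

section Spinor

variable {χ : Space → Spinor} {E : Fin 3 → Space → Spinor} (h : Adm 2 χ E) (t : ℝ)

theorem cd_withSpinor :
    P.cd (u.withSpinor (u.hψ.add (by norm_num) (h.const_smul t))) =
      fun k x => P.cd u k x + t • P.cd (u.withSpinor h) k x := by
  ext1 k; ext1 x
  simp only [cd, Conf.withSpinor]
  rw [smul_add Complex.I, smul_comm Complex.I t]
  module

theorem kinetic_withSpinor :
    P.kinetic (u.withSpinor (u.hψ.add (by norm_num) (h.const_smul t))) = P.kinetic u +
      2 * t * kin P.j (P.cd u) (P.cd (u.withSpinor h)) + t ^ 2 * P.kinetic (u.withSpinor h) := by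
  have hm : ∀ k, MemLp (fun x => t • P.cd (u.withSpinor h) k x) 2 volume := fun k =>
    (P.cd_memLp (u.withSpinor h) k).const_smul t
  rw [kinetic, P.cd_withSpinor u h t, kin_add_self (P.cd_memLp u) hm, kin_smul_right, kin_smul_right,
    kin_comm (X := fun k x => t • P.cd (u.withSpinor h) k x), kin_smul_right, kinetic, kinetic]
  ring

theorem flux_withSpinor :
    P.flux (u.withSpinor (u.hψ.add (by norm_num) (h.const_smul t))) = P.flux u +
      2 * t * (∫ x, inner ℝ P.v (u.A x) * inner ℝ (u.ψ x) (χ x)) +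
        t ^ 2 * P.flux (u.withSpinor h) := by
  have i1 := P.flux_integrable_aux u.A6 u.ψ3 u.ψ2
  have i2 := (P.flux_integrable_aux u.A6 u.ψ3 (u.withSpinor h).ψ2).const_mul (2 * t)
  have i3 := (P.flux_integrable_aux u.A6 (u.withSpinor h).ψ3 (u.withSpinor h).ψ2).const_mul (t ^ 2)
  have i12 : Integrable (fun x => inner ℝ P.v (u.A x) * inner ℝ (u.ψ x) (u.ψ x) +
    2 * t * (inner ℝ P.v (u.A x) * inner ℝ (u.ψ x) ((u.withSpinor h).ψ x))) volume := i1.add i2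
  rw [flux_eq, flux_eq, flux_eq, ← integral_const_mul, ← integral_const_mul]
  change _ = _ + (∫ x, 2 * t * (inner ℝ P.v (u.A x) * inner ℝ (u.ψ x) ((u.withSpinor h).ψ x))) +
    ∫ x, t ^ 2 * (inner ℝ P.v (u.A x) * inner ℝ ((u.withSpinor h).ψ x) ((u.withSpinor h).ψ x))
  rw [← integral_add i1 i2, ← integral_add i12 i3]
  refine integral_congr_ae (Eventually.of_forall fun x => ?_)
  simp only [Conf.withSpinor, inner_add_left, inner_add_right, real_inner_smul_left,
    real_inner_smul_right, real_inner_comm (u.ψ x) (χ x)]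
  ring

theorem mass_withSpinor :
    (u.withSpinor (u.hψ.add (by norm_num) (h.const_smul t))).mass = u.mass +
      2 * t * (∫ x, inner ℝ (u.ψ x) (χ x)) + t ^ 2 * (u.withSpinor h).mass := by
  have i1 := (memLp_two_iff_integrable_sq_norm u.ψ2.1).mp u.ψ2
  have i2 := (integrable_inner u.ψ2 h.1).const_mul (2 * t)
  have i3 := ((memLp_two_iff_integrable_sq_norm (u.withSpinor h).ψ2.1).mp
    (u.withSpinor h).ψ2).const_mul (t ^ 2)
  have i12 : Integrable (fun x => ‖u.ψ x‖ ^ 2 + 2 * t * inner ℝ (u.ψ x) (χ x)) volume := i1.add i2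
  rw [Conf.mass, Conf.mass, Conf.mass, ← integral_const_mul, ← integral_const_mul,
    ← integral_add i1 i2, ← integral_add i12 i3]
  refine integral_congr_ae (Eventually.of_forall fun x => ?_)
  simp only [Conf.withSpinor]
  rw [norm_add_sq_real, inner_smul_right, norm_smul, mul_pow, Real.norm_eq_abs, sq_abs]
  ring

/-- The equation for the spinor. -/
theorem spinor_equation {lam : ℝ} (hlam : 0 < lam) (hd : u.DivFree) (hm : u.mass = lam)
    (hmin : ∀ w : Conf, w.DivFree → w.mass = lam → P.energy u ≤ P.energy w) :
    ∃ ν : ℝ, ∀ (χ : Space → Spinor) (E : Fin 3 → Space → Spinor) (h : Adm 2 χ E),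
      1 / (2 * P.m) * kin P.j (P.cd u) (P.cd (u.withSpinor h)) -
        P.Q / P.c * (∫ x, inner ℝ P.v (u.A x) * inner ℝ (u.ψ x) (χ x)) =
      ν * ∫ x, inner ℝ (u.ψ x) (χ x) := by
  -- At fixed potential, `energy_ge_of_inf` says that `energy w - F - ν · mass w` is nonnegative for
  -- spinors of any mass, with equality at the minimizer. The variation therefore needs no
  -- normalization, and `ν` is the multiplier.
  refine ⟨(P.energy u - P.fieldForm u.G u.G) / lam, fun χ E h => ?_⟩
  set F := P.fieldForm u.G u.G with hF
  set ν := (P.energy u - F) / lam with hν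
  set a := 1 / (2 * P.m) * kin P.j (P.cd u) (P.cd (u.withSpinor h)) -
        P.Q / P.c * (∫ x, inner ℝ P.v (u.A x) * inner ℝ (u.ψ x) (χ x)) with ha
  set s := ∫ x, inner ℝ (u.ψ x) (χ x) with hs
  rw [← sub_eq_zero]
  refine eq_zero_of_quadratic_nonneg (c := P.energy (u.withSpinor h) - F -
    ν * (u.withSpinor h).mass) fun t => ?_
  set w := u.withSpinor (u.hψ.add (by norm_num) (h.const_smul t)) with hw
  have key := P.energy_ge_of_inf w hlam hmin hd
  have hFw : P.fieldForm w.G w.G = F := rfl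
  have e1 : P.energy w = P.energy u + 2 * t * a + t ^ 2 * (P.energy (u.withSpinor h) - F) := by
    rw [energy, energy, energy, hFw, hw, P.kinetic_withSpinor u h t, P.flux_withSpinor u h t, ha,
      ← hF,
      show P.fieldForm (u.withSpinor h).G (u.withSpinor h).G = F from rfl]
    ring
  have e2 : w.mass = lam + 2 * t * s + t ^ 2 * (u.withSpinor h).mass := by
    rw [hw, mass_withSpinor u h t, hm]
  have e3 : w.mass / lam * P.energy u + (1 - w.mass / lam) * F = w.mass * ν + F := by
    rw [hν]; ring
  have e4 : lam * ν = P.energy u - F := by rw [hν]; field_simp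
  rw [hFw, e3, e1, e2] at key
  linear_combination key - e4

end Spinor

section Potential

variable {B : Space → Space} {H : Fin 3 → Space → Space} (h : Adm 6 B H) (t : ℝ)

include h in
theorem coupling_memLp (k : Fin 3) : MemLp (fun x => B x k • u.ψ x) 2 volume :=
  (memLp_coord_smul h.1 u.ψ3 k).1

theorem cd_withPotential :
    P.cd (u.withPotential (u.hA.add (by norm_num) (h.const_smul t))) =
      fun k x => P.cd u k x + (t * (P.Q / P.c)) • (B x k • u.ψ x) := by
  ext1 k; ext1 x
  simp only [cd, Conf.withPotential, PiLp.add_apply, PiLp.smul_apply, smul_eq_mul]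
  module

include h in
/-- The equation for the vector potential, tested with divergence free fields. -/
theorem potential_equation {lam : ℝ} (hd : u.DivFree) (hm : u.mass = lam)
    (hmin : ∀ w : Conf, w.DivFree → w.mass = lam → P.energy u ≤ P.energy w)
    (hdiv : ∀ᵐ x, ∑ k, H k x k = 0) :
    1 / P.m * (P.Q / P.c) * kin P.j (P.cd u) (fun k x => B x k • u.ψ x) -
      P.Q / P.c * (∫ x, inner ℝ P.v (B x) * ‖u.ψ x‖ ^ 2) + 2 * P.fieldForm u.G H = 0 := by
  have hc := coupling_memLp u h
  set a := 1 / P.m * (P.Q / P.c) * kin P.j (P.cd u) (fun k x => B x k • u.ψ x) -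
      P.Q / P.c * (∫ x, inner ℝ P.v (B x) * ‖u.ψ x‖ ^ 2) + 2 * P.fieldForm u.G H with ha
  have : a / 2 = 0 := by
    refine eq_zero_of_quadratic_nonneg (c := 1 / (2 * P.m) * ((P.Q / P.c) ^ 2 *
      kin P.j (fun k x => B x k • u.ψ x) (fun k x => B x k • u.ψ x)) + P.fieldForm H H) fun t => ?_
    set w := u.withPotential (u.hA.add (by norm_num) (h.const_smul t)) with hw
    have hmw : w.mass = lam := hm
    have hdw : w.DivFree := by
      filter_upwards [hd, hdiv] with x h1 h2
      simp only [hw, Conf.withPotential, PiLp.add_apply, PiLp.smul_apply, smul_eq_mul,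
        Finset.sum_add_distrib, h1, ← Finset.mul_sum, h2, mul_zero, add_zero]
    have key := hmin w hdw hmw
    have hm1 : ∀ k, MemLp (fun x => (t * (P.Q / P.c)) • (B x k • u.ψ x)) 2 volume := fun k =>
      (hc k).const_smul (t * (P.Q / P.c))
    have hk : P.kinetic w = P.kinetic u + 2 * (t * (P.Q / P.c)) *
        kin P.j (P.cd u) (fun k x => B x k • u.ψ x) + (t * (P.Q / P.c)) ^ 2 *
        kin P.j (fun k x => B x k • u.ψ x) (fun k x => B x k • u.ψ x) := by
      rw [kinetic, hw, P.cd_withPotential u h t, kin_add_self (P.cd_memLp u) hm1, kin_smul_right,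
        kin_smul_right, kin_comm (X := fun k x => (t * (P.Q / P.c)) • (B x k • u.ψ x)),
        kin_smul_right, kinetic]
      ring
    have hf : P.flux w = P.flux u + t * ∫ x, inner ℝ P.v (B x) * ‖u.ψ x‖ ^ 2 := by
      have i1 := P.flux_integrable_aux u.A6 u.ψ3 u.ψ2
      have i2 := (P.flux_integrable_aux h.1 u.ψ3 u.ψ2).const_mul t
      simp only [← real_inner_self_eq_norm_sq]
      rw [flux_eq, flux_eq, ← integral_const_mul, ← integral_add i1 i2]
      refine integral_congr_ae (Eventually.of_forall fun x => ?_)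
      simp only [hw, Conf.withPotential, inner_add_right, inner_smul_right]
      ring
    have hF : P.fieldForm w.G w.G = P.fieldForm u.G u.G + 2 * t * P.fieldForm u.G H +
        t ^ 2 * P.fieldForm H H := by
      have hHt : ∀ k, MemLp (fun x => t • H k x) 2 volume := fun k => (h.2.1 k).const_smul t
      have : P.fieldForm w.G w.G = P.fieldForm (fun k x => u.G k x + t • H k x)
        (fun k x => u.G k x + t • H k x) := rfl
      rw [this, fieldForm_add_self u.G2 hHt, fieldForm_smul_right, fieldForm_smul_right,
        fieldForm_comm (G := fun k x => t • H k x), fieldForm_smul_right]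
      ring
    rw [energy, energy, hk, hf, hF] at key
    have hmne := P.hm.ne'
    rw [ha]
    have e : 1 / (2 * P.m) = 1 / P.m / 2 := by field_simp
    rw [e] at key ⊢
    linear_combination key
  linarith

end Potential

end Params

/-! ### Pairing with test functions -/

section Pairing

variable {F F' : Type*} [NormedAddCommGroup F] [NormedSpace ℝ F] [NormedAddCommGroup F']
  [NormedSpace ℝ F'] {η : Space → ℝ} {f g : Space → F}

/-- The pairing of a test function with a locally integrable function. -/
def pair (η : Space → ℝ) (f : Space → F) : F := ∫ x, η x • f x

theorem pair_integrable (hη : VTest η) (hf : LocallyIntegrable f) :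
    Integrable (fun x => η x • f x) volume :=
  hf.integrable_smul_left_of_hasCompactSupport hη.continuous hη.2

theorem pair_add (hη : VTest η) (hf : LocallyIntegrable f) (hg : LocallyIntegrable g) :
    pair η (fun x => f x + g x) = pair η f + pair η g := by
  simp only [pair, smul_add]
  exact integral_add (pair_integrable hη hf) (pair_integrable hη hg)

theorem pair_smul (c : ℝ) : pair η (fun x => c • f x) = c • pair η f := by
  simp only [pair, smul_comm _ c]
  exact integral_smul c _

theorem pair_sum (hη : VTest η) {ι : Type*} (s : Finset ι) {f : ι → Space → F}
    (hf : ∀ i ∈ s, LocallyIntegrable (f i)) :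
    pair η (fun x => ∑ i ∈ s, f i x) = ∑ i ∈ s, pair η (f i) := by
  simp only [pair, Finset.smul_sum]
  exact integral_finsetSum _ fun i hi => pair_integrable hη (hf i hi)

theorem pair_clm [CompleteSpace F] [CompleteSpace F'] (hη : VTest η) (hf : LocallyIntegrable f)
    (L : F →L[ℝ] F') :
    pair η (fun x => L (f x)) = L (pair η f) := by
  simp only [pair, ← map_smul]
  exact L.integral_comp_comm (pair_integrable hη hf)

theorem pair_weakDeriv {k : Fin 3} (hη : VTest η) (h : HasWeakDeriv (e k) f g) :
    pair (pdv k η) f = -pair η g := h.2.2 η hη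

/-- On compact sets `L⁶` is contained in `L²`. No integrability of `f` beyond `L²` is available,
since `f` will be a covariant derivative. -/
theorem locallyIntegrable_coord_smul {A : Space → Space} (hA : MemLp A 6 volume)
    (hf : MemLp f 2 volume) (k : Fin 3) : LocallyIntegrable (fun x => A x k • f x) := by
  rw [locallyIntegrable_iff]
  intro s hs
  have : IsFiniteMeasure (volume.restrict s : Measure Space) :=
    ⟨by simpa using hs.measure_lt_top⟩
  have h1 : MemLp (fun x => A x k) 2 (volume.restrict s) :=
    ((Params.coord_memLp hA k).restrict s).mono_exponent (by norm_num)
  exact (h1.integrable_mul (hf.restrict s).norm).mono (h1.1.smul (hf.restrict s).1)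
    (Eventually.of_forall fun x => by simp [norm_smul])

end Pairing

/-! ### Algebra of the velocity terms -/

section Velocity

theorem anticomm_apply (k l : Fin 3) (b : Spinor) :
    act (pauli k) (act (pauli l) b) + act (pauli l) (act (pauli k) b) =
      if k = l then (2 : ℝ) • b else 0 := by
  refine ext_inner_left ℝ fun a => ?_
  rw [inner_add_right, anticomm]
  split_ifs
  · rw [inner_smul_right]
  · rw [inner_zero_right]

/-- The action of the velocity on spinors. -/
def velL (j : Model) (v : Space) (k : Fin 3) : Spinor →L[ℝ] Spinor :=
  match j with
  | .S => v k • ContinuousLinearMap.id ℝ Spinor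
  | .P => (actL (pauli k)).comp (∑ l, v l • actL (pauli l))

theorem velL_apply (j : Model) (v : Space) (k : Fin 3) (w : Spinor) :
    velL j v k w = spinOp j (fun l => v l • w) k := by
  cases j
  · simp [velL, spinOp]
  · simp only [velL, spinOp, ContinuousLinearMap.comp_apply, _root_.sum_apply,
      ← actL_apply, map_smul, _root_.smul_apply]

theorem velL_im (j : Model) (v : Space) (k : Fin 3) (w : Spinor) :
    velL j v k (Complex.I • w) = Complex.I • velL j v k w := by
  rw [velL_apply, velL_apply, ← spinOp_im]
  simp only [smul_comm Complex.I]

/-- The symmetrized product of the velocity with a vector of spinors. -/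
theorem velocity_anticomm (j : Model) (v : Space) (Y : Fin 3 → Spinor) :
    ∑ k, v k • spinOp j Y k + ∑ k, velL j v k (Y k) = (2 : ℝ) • ∑ k, v k • Y k := by
  cases j
  · simp [velL, spinOp, two_smul]
  · have e1 : ∀ k, v k • spinOp .P Y k = ∑ l, v k • act (pauli k) (act (pauli l) (Y l)) := fun k => by
      simp only [spinOp, ← actL_apply, map_sum, Finset.smul_sum]
    have e2 : ∀ k, velL .P v k (Y k) = ∑ l, v l • act (pauli k) (act (pauli l) (Y k)) := fun k => by
      rw [velL_apply]
      simp only [spinOp, ← actL_apply, map_sum, map_smul]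
    simp only [e1, e2]
    rw [Finset.sum_comm (f := fun k l => v l • act (pauli k) (act (pauli l) (Y k))),
      ← Finset.sum_add_distrib]
    simp only [← Finset.sum_add_distrib, ← smul_add, anticomm_apply, Finset.smul_sum]
    refine Finset.sum_congr rfl fun k _ => ?_
    simp only [smul_ite, smul_zero, Finset.sum_ite_eq, Finset.mem_univ, if_true, smul_comm (v k)]

/-- In `velocity_anticomm` with `Yₖ = vₖ w` both sums coincide; for the Pauli model this is `(σ ·
v)² = |v|²`. -/
theorem sum_velL_self (j : Model) (v : Space) (w : Spinor) :
    ∑ k, v k • velL j v k w = ‖v‖ ^ 2 • w := by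
  have h := velocity_anticomm j v fun k => v k • w
  have e : ∀ k, spinOp j (fun l => v l • w) k = velL j v k w := fun k => (velL_apply j v k w).symm
  have e3 : ∑ k, v k • v k • w = ‖v‖ ^ 2 • w := by
    rw [EuclideanSpace.real_norm_sq_eq, Finset.sum_smul]
    simp only [smul_smul, pow_two]
  simp only [e, map_smul, ← two_smul ℝ, e3] at h
  exact smul_right_injective _ (two_ne_zero (α := ℝ)) h

/-- For `k ≠ l` the operators `σₖ σₗ` are antisymmetric in the real inner product, so only `l = k`
contributes. This lets the velocity part of the current cancel against the coupling term in both
models. -/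
theorem inner_velL_self (j : Model) (v : Space) (k : Fin 3) (w : Spinor) :
    inner ℝ (velL j v k w) w = v k * ‖w‖ ^ 2 := by
  cases j
  · simp only [velL, _root_.smul_apply, ContinuousLinearMap.id_apply, real_inner_smul_left,
      real_inner_self_eq_norm_sq]
  · have hs : ∀ l, inner ℝ w (act (pauli k) (act (pauli l) w)) = if k = l then ‖w‖ ^ 2 else 0 := by
      intro l
      have h1 := anticomm k l w w
      have h2 : inner ℝ w (act (pauli l) (act (pauli k) w)) =
          inner ℝ w (act (pauli k) (act (pauli l) w)) := by
        rw [← inner_act_left, ← inner_act_left k w, real_inner_comm]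
      rw [h2, real_inner_self_eq_norm_sq] at h1
      split_ifs at h1 ⊢ <;> linarith
    rw [velL_apply, real_inner_comm]
    simp only [spinOp, ← actL_apply, map_sum, map_smul, inner_sum, inner_smul_right]
    simp only [actL_apply, hs]
    simp

end Velocity

/-! ### The stationary spinor equation -/

namespace Params

variable (P : Params) (u : Conf)

/-- The covariant derivative `∇_{S,A}ψ`. -/
def mom (k : Fin 3) (x : Space) : Spinor :=
  P.ħ • (Complex.I • u.D k x) + (P.Q / P.c * u.A x k) • u.ψ x

/-- The covariant derivative `cov_j`. -/
def covK (k : Fin 3) (x : Space) : Spinor := spinOp P.j (P.mom u · x) k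

theorem covS_eq (ħ c Q : ℝ) (w : Spinor) (Dw : Fin 3 → Spinor) (a : Space) (k : Fin 3) :
    covS ħ c Q w Dw a k = ħ • (Complex.I • Dw k) + (Q / c * a k) • w := by
  rw [covS, mul_comm, mul_smul, Complex.coe_smul, Complex.coe_smul]

theorem cov_eq (k : Fin 3) (x : Space) :
    cov P.ħ P.c P.Q P.j (u.ψ x) (fun l => u.D l x) (u.A x) k = P.covK u k x := by
  rw [cov_eq_spinOp, covK]
  congr 1
  ext1 l
  exact covS_eq _ _ _ _ _ _ _

theorem cd_eq_mom (k : Fin 3) (x : Space) : P.cd u k x = P.mom u k x + (P.m * P.v k) • u.ψ x := by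
  simp only [cd, mom]; module

theorem spinOp_cd (k : Fin 3) (x : Space) :
    spinOp P.j (P.cd u · x) k = P.covK u k x + P.m • velL P.j P.v k (u.ψ x) := by
  rw [show (fun l => P.cd u l x) = fun l => P.mom u l x + P.m • (P.v l • u.ψ x) by
    ext1 l; rw [cd_eq_mom, smul_smul], spinOp_add, spinOp_smul, velL_apply, covK]

theorem mom_memLp (k : Fin 3) : MemLp (P.mom u k) 2 volume := by
  have := memLp_fun_sub (P.cd_memLp u k) (u.ψ2.const_smul (P.m * P.v k))
  refine (memLp_congr_ae (Eventually.of_forall fun x => ?_)).mp this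
  simp [cd_eq_mom]

theorem covK_memLp (k : Fin 3) : MemLp (P.covK u k) 2 volume := spinOp_memLp P.j (P.mom_memLp u) k

variable {u}

theorem li {F : Type*} [NormedAddCommGroup F] {f : Space → F} (hf : MemLp f 2 volume) :
    LocallyIntegrable f := hf.locallyIntegrable (by norm_num)

/-- The spinor equation, tested with `η w`. -/
theorem spinor_equation_test {ν : ℝ}
    (hν : ∀ (χ : Space → Spinor) (E : Fin 3 → Space → Spinor) (h : Adm 2 χ E),
      1 / (2 * P.m) * kin P.j (P.cd u) (P.cd (u.withSpinor h)) -
        P.Q / P.c * (∫ x, inner ℝ P.v (u.A x) * inner ℝ (u.ψ x) (χ x)) =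
      ν * ∫ x, inner ℝ (u.ψ x) (χ x)) {η : Space → ℝ} (hη : VTest η) :
    (1 / (2 * P.m)) • ∑ k, (-(P.ħ • (Complex.I • pair (pdv k η) fun x => spinOp P.j (P.cd u · x) k)) +
      (P.Q / P.c) • pair η (fun x => u.A x k • spinOp P.j (P.cd u · x) k) +
      (P.m * P.v k) • pair η (fun x => spinOp P.j (P.cd u · x) k)) =
    (P.Q / P.c) • (∑ k, P.v k • pair η (fun x => u.A x k • u.ψ x)) + ν • pair η u.ψ := by
  -- Both sides are compared after pairing with an arbitrary constant spinor `w`, which corresponds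
  -- to the variation `χ = η w`.
  refine ext_inner_right ℝ fun w => ?_
  have hχ : VTest fun x => η x • w := hη.smul_right contDiff_const
  have key := hν _ _ (hχ.adm 2)
  have hS : ∀ k, MemLp (fun x => spinOp P.j (P.cd u · x) k) 2 volume := spinOp_memLp P.j (P.cd_memLp u)
  have hp : ∀ {f : Space → Spinor} {η : Space → ℝ}, VTest η → LocallyIntegrable f →
      ∫ x, η x * inner ℝ (f x) w = inner ℝ (pair η f) w := by
    intro f η hη hf
    rw [real_inner_comm, pair, ← integral_inner (pair_integrable hη hf)]
    refine integral_congr_ae (Eventually.of_forall fun x => ?_)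
    simp only [inner_smul_right, real_inner_comm w]
  have hpi : ∀ {f : Space → Spinor} {η : Space → ℝ}, VTest η → LocallyIntegrable f →
      Integrable (fun x => η x * inner ℝ (f x) w) volume := by
    intro f η hη hf
    refine ((pair_integrable hη hf).const_inner w).congr (Eventually.of_forall fun x => ?_)
    simp only [inner_smul_right, real_inner_comm w]
  have hcd : ∀ k x, P.cd (u.withSpinor (hχ.adm 2)) k x = (P.ħ * pdv k η x) • (Complex.I • w) +
      ((P.Q / P.c * u.A x k + P.m * P.v k) * η x) • w := by
    intro k x
    have : pdv k (fun x => η x • w) x = pdv k η x • w := by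
      have h1 := congrFun (pdv_smul hη.differentiable (differentiable_const w) k) x
      rw [h1]; simp [pdv]
    simp only [cd, Conf.withSpinor, this]
    rw [smul_comm Complex.I, smul_smul, smul_smul]
  have hk : kin P.j (P.cd u) (P.cd (u.withSpinor (hχ.adm 2))) =
      inner ℝ (∑ k, (-(P.ħ • (Complex.I • pair (pdv k η) fun x => spinOp P.j (P.cd u · x) k)) +
      (P.Q / P.c) • pair η (fun x => u.A x k • spinOp P.j (P.cd u · x) k) +
      (P.m * P.v k) • pair η (fun x => spinOp P.j (P.cd u · x) k))) w := by
    rw [kin_eq_sum (P.cd_memLp u) (P.cd_memLp _), sum_inner]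
    refine Finset.sum_congr rfl fun k _ => ?_
    have hIS : LocallyIntegrable fun x => Complex.I • spinOp P.j (P.cd u · x) k :=
      li (imL.comp_memLp' (hS k))
    have hAS := locallyIntegrable_coord_smul u.A6 (hS k) k
    have e : ∀ x, inner ℝ (spinOp P.j (P.cd u · x) k) (P.cd (u.withSpinor (hχ.adm 2)) k x) =
        -P.ħ * (pdv k η x * inner ℝ (Complex.I • spinOp P.j (P.cd u · x) k) w) +
        P.Q / P.c * (η x * inner ℝ (u.A x k • spinOp P.j (P.cd u · x) k) w) +
        P.m * P.v k * (η x * inner ℝ (spinOp P.j (P.cd u · x) k) w) := fun x => by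
      rw [hcd, inner_add_right, inner_smul_right, inner_smul_right, inner_im_left,
        real_inner_smul_left]
      ring
    have i1 := (hpi (hη.pdv k) hIS).const_mul (-P.ħ)
    have i2 := (hpi hη hAS).const_mul (P.Q / P.c)
    have i3 := (hpi hη (li (hS k))).const_mul (P.m * P.v k)
    have i12 : Integrable (fun x =>
      -P.ħ * (pdv k η x * inner ℝ (Complex.I • spinOp P.j (P.cd u · x) k) w) +
        P.Q / P.c * (η x * inner ℝ (u.A x k • spinOp P.j (P.cd u · x) k) w)) volume := i1.add i2
    simp only [e]
    rw [integral_add i12 i3, integral_add i1 i2, integral_const_mul, integral_const_mul,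
      integral_const_mul, hp (hη.pdv k) hIS, hp hη hAS, hp hη (li (hS k))]
    have e2 : pair (pdv k η) (fun x => Complex.I • spinOp P.j (P.cd u · x) k) =
        Complex.I • pair (pdv k η) fun x => spinOp P.j (P.cd u · x) k :=
      pair_clm (hη.pdv k) (li (hS k)) imL
    rw [e2]
    simp only [inner_add_left, inner_neg_left, real_inner_smul_left]
    ring
  have hf : ∫ x, inner ℝ P.v (u.A x) * inner ℝ (u.ψ x) (η x • w) =
      inner ℝ (∑ k, P.v k • pair η (fun x => u.A x k • u.ψ x)) w := by
    have hA := fun k => locallyIntegrable_coord_smul u.A6 u.ψ2 k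
    have e : ∀ x, inner ℝ P.v (u.A x) * inner ℝ (u.ψ x) (η x • w) =
        ∑ k, P.v k * (η x * inner ℝ (u.A x k • u.ψ x) w) := fun x => by
      rw [PiLp.inner_apply, Finset.sum_mul]
      refine Finset.sum_congr rfl fun k _ => ?_
      rw [inner_smul_right, real_inner_smul_left]
      simp; ring
    simp only [e]
    rw [integral_finsetSum _ fun k _ => (hpi hη (hA k)).const_mul _, sum_inner]
    refine Finset.sum_congr rfl fun k _ => ?_
    rw [integral_const_mul, hp hη (hA k), real_inner_smul_left]
  have hm : ∫ x, inner ℝ (u.ψ x) (η x • w) = inner ℝ (pair η u.ψ) w := by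
    rw [← hp hη (li u.ψ2)]
    simp only [inner_smul_right]
  rw [hk, hf, hm] at key
  rw [real_inner_smul_left, inner_add_left, real_inner_smul_left, real_inner_smul_left]
  linarith

variable (u) in
theorem pair_mom {η : Space → ℝ} (hη : VTest η) (k : Fin 3) :
    pair η (P.mom u k) = P.ħ • (Complex.I • pair η (u.D k)) +
      (P.Q / P.c) • pair η (fun x => u.A x k • u.ψ x) := by
  have hAψ := locallyIntegrable_coord_smul u.A6 u.ψ2 k
  have i1 : MemLp (fun x => P.ħ • (Complex.I • u.D k x)) 2 volume :=
    (imL.comp_memLp' (u.D2 k)).const_smul P.ħ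
  have i2 : LocallyIntegrable fun x => (P.Q / P.c) • (u.A x k • u.ψ x) := by
    exact hAψ.smul (P.Q / P.c)
  have : P.mom u k = fun x => P.ħ • (Complex.I • u.D k x) + (P.Q / P.c) • (u.A x k • u.ψ x) := by
    ext1 x; simp only [mom]; rw [smul_smul]
  rw [this, pair_add hη (li i1) i2, pair_smul, pair_smul]
  congr 2
  exact pair_clm hη (li (u.D2 k)) imL

variable (u) in
theorem pair_covK {η : Space → ℝ} (hη : VTest η) (k : Fin 3) :
    pair η (P.covK u k) = spinOp P.j (fun l => pair η (P.mom u l)) k := by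
  have hj : ∀ j : Model, pair η (fun x => spinOp j (P.mom u · x) k) =
      spinOp j (fun l => pair η (P.mom u l)) k := by
    intro j
    cases j
    · rfl
    · have hl : ∀ l, MemLp (fun x => actL (pauli l) (P.mom u l x)) 2 volume := fun l =>
        (actL (pauli l)).comp_memLp' (P.mom_memLp u l)
      have hs : LocallyIntegrable fun x => ∑ l, actL (pauli l) (P.mom u l x) :=
        li (memLp_finsetSum _ fun l _ => hl l)
      have h1 := pair_clm hη hs (actL (pauli k))
      have h2 := pair_sum hη Finset.univ fun l _ => li (hl l)
      have h3 : ∀ l, pair η (fun x => actL (pauli l) (P.mom u l x)) =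
          actL (pauli l) (pair η (P.mom u l)) := fun l => pair_clm hη (li (P.mom_memLp u l)) _
      simp only [h2, h3] at h1
      exact h1
  exact hj P.j

/-- Removes the velocity from the square. The terms linear in `m` are collected by `hanti`: their
potential part cancels the coupling term and their derivative part is the transport term. The terms
quadratic in `m` give, through `hself`, the shift `m V / 2`. Stated for abstract vectors so that
both models are covered at once. -/
theorem stationary_algebra {E : Type*} [AddCommGroup E] [Module ℝ E] {ħ q m ν V : ℝ}
    {v : Fin 3 → ℝ} {p t b s κ z d f : Fin 3 → E} {ψ : E}
    (key : ∑ k, (-(ħ • (p k - m • t k)) + q • (b k + m • s k) + (m * v k) • (κ k + m • z k)) =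
      (2 * m) • (q • (∑ k, v k • f k) + ν • ψ))
    (hanti : ∑ k, v k • κ k + ∑ k, (ħ • t k + q • s k) =
      (2 : ℝ) • ∑ k, v k • (ħ • d k + q • f k))
    (hself : ∑ k, v k • z k = V • ψ) :
    ∑ k, (-(ħ • p k) + q • b k) = (2 * m) • ((ν - m * V / 2) • ψ - ħ • ∑ k, v k • d k) := by
  simp only [Fin.sum_univ_three] at *
  linear_combination (norm := module) key - m • hanti - (m ^ 2) • hself

/-- The spinor equation in the laboratory frame. -/
theorem stationary_spinor {ν : ℝ}
    (hν : ∀ (χ : Space → Spinor) (E : Fin 3 → Space → Spinor) (h : Adm 2 χ E),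
      1 / (2 * P.m) * kin P.j (P.cd u) (P.cd (u.withSpinor h)) -
        P.Q / P.c * (∫ x, inner ℝ P.v (u.A x) * inner ℝ (u.ψ x) (χ x)) =
      ν * ∫ x, inner ℝ (u.ψ x) (χ x)) {η : Space → ℝ} (hη : VTest η) :
    (1 / (2 * P.m)) • ∑ k, (-(P.ħ • (Complex.I • pair (pdv k η) (P.covK u k))) +
      (P.Q / P.c) • pair η (fun x => u.A x k • P.covK u k x)) =
    (ν - P.m * ‖P.v‖ ^ 2 / 2) • pair η u.ψ +
      P.ħ • (Complex.I • ∑ k, P.v k • pair (pdv k η) u.ψ) := by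
  have key := P.spinor_equation_test hν hη
  have hK := fun k => li (P.covK_memLp u k)
  have hTm : ∀ k, MemLp (fun x => velL P.j P.v k (u.ψ x)) 2 volume := fun k =>
    (velL P.j P.v k).comp_memLp' u.ψ2
  have hmT : ∀ k, MemLp (fun x => P.m • velL P.j P.v k (u.ψ x)) 2 volume := fun k =>
    (hTm k).const_smul P.m
  have hAK := fun k => locallyIntegrable_coord_smul u.A6 (P.covK_memLp u k) k
  have hAT := fun k => locallyIntegrable_coord_smul u.A6 (hTm k) k
  have hAmT := fun k => locallyIntegrable_coord_smul u.A6 (hmT k) k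
  have hAψ := fun k => locallyIntegrable_coord_smul u.A6 u.ψ2 k
  have e1 : ∀ k, pair (pdv k η) (fun x => spinOp P.j (P.cd u · x) k) =
      pair (pdv k η) (P.covK u k) - P.m • velL P.j P.v k (pair η (u.D k)) := fun k => by
    simp only [spinOp_cd]
    rw [pair_add (hη.pdv k) (hK k) (li (hmT k)), pair_smul, pair_clm (hη.pdv k) (li u.ψ2),
      pair_weakDeriv hη (u.hψ.hasWeakDeriv (by norm_num) k), map_neg, smul_neg, sub_eq_add_neg]
  have e2 : ∀ k, pair η (fun x => u.A x k • spinOp P.j (P.cd u · x) k) =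
      pair η (fun x => u.A x k • P.covK u k x) +
        P.m • velL P.j P.v k (pair η fun x => u.A x k • u.ψ x) := fun k => by
    simp only [spinOp_cd, smul_add]
    rw [pair_add hη (hAK k) (hAmT k)]
    congr 1
    rw [← pair_clm hη (hAψ k), ← pair_smul]
    simp only [map_smul, smul_comm P.m]
  have e3 : ∀ k, pair η (fun x => spinOp P.j (P.cd u · x) k) =
      pair η (P.covK u k) + P.m • velL P.j P.v k (pair η u.ψ) := fun k => by
    simp only [spinOp_cd]
    rw [pair_add hη (hK k) (li (hmT k)), pair_smul, pair_clm hη (li u.ψ2)]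
  have e4 := P.pair_mom u hη
  have e5 := P.pair_covK u hη
  have hanti := velocity_anticomm P.j P.v fun k => pair η (P.mom u k)
  simp only [← e5] at hanti
  have hself := sum_velL_self P.j P.v (pair η u.ψ)
  have e6 : ∀ k, velL P.j P.v k (pair η (P.mom u k)) =
      P.ħ • (Complex.I • velL P.j P.v k (pair η (u.D k))) +
      (P.Q / P.c) • velL P.j P.v k (pair η fun x => u.A x k • u.ψ x) := fun k => by
    rw [e4, map_add, map_smul _ P.ħ, map_smul _ (P.Q / P.c), velL_im]
  have e7 : ∑ k, P.v k • pair (pdv k η) u.ψ = -∑ k, P.v k • pair η (u.D k) := by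
    rw [← Finset.sum_neg_distrib]
    exact Finset.sum_congr rfl fun k _ => by
      rw [pair_weakDeriv hη (u.hψ.hasWeakDeriv (by norm_num) k), smul_neg]
  have e8 : Complex.I • ∑ k, P.v k • pair η (u.D k) = ∑ k, P.v k • (Complex.I • pair η (u.D k)) := by
    rw [Finset.smul_sum]
    exact Finset.sum_congr rfl fun k _ => smul_comm _ _ _
  simp only [e6] at hanti
  simp only [e4] at hanti
  simp only [e1, e2, e3] at key
  have hm := P.hm.ne'
  have h2m : (2 * P.m) * (1 / (2 * P.m)) = 1 := by field_simp
  have key2 := congrArg ((2 * P.m) • ·) key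
  simp only [smul_smul (2 * P.m) (1 / (2 * P.m)), h2m, one_smul] at key2
  have e9 : ∀ k, Complex.I • (pair (pdv k η) (P.covK u k) -
      P.m • velL P.j P.v k (pair η (u.D k))) = Complex.I • pair (pdv k η) (P.covK u k) -
      P.m • (Complex.I • velL P.j P.v k (pair η (u.D k))) := fun k => by
    rw [smul_sub, smul_comm Complex.I P.m]
  simp only [e9] at key2
  have fin := stationary_algebra key2 hanti hself
  rw [fin, smul_smul, mul_comm (1 / (2 * P.m)), h2m, one_smul, e7, smul_neg, e8, smul_neg,
    sub_eq_add_neg]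

end Params

/-! ### The Newtonian potential of a test function -/

section Newton

/-- In polar coordinates the integrand is `r² · r⁻¹ = r`. -/
theorem integrableOn_inv_norm (r : ℝ) :
    IntegrableOn (fun x : Space => ‖x‖⁻¹) (Metric.ball 0 r) volume := by
  refine (integrableOn_fun_norm_addHaar (volume : Measure Space) (f := fun s => s⁻¹)).2 ?_
  refine IntegrableOn.congr_fun (f := fun s : ℝ => s) ?_ (fun s hs => ?_) measurableSet_Ioo
  · exact (continuous_id.integrableOn_Icc).mono_set Set.Ioo_subset_Icc_self
  · have : s ≠ 0 := hs.1.ne'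
    simp only [finrank_euclideanSpace, Fintype.card_fin, smul_eq_mul]
    norm_num
    field_simp

theorem locallyIntegrable_inv_norm : LocallyIntegrable (fun x : Space => ‖x‖⁻¹) := by
  intro x
  refine ⟨Metric.ball 0 (‖x‖ + 1), Metric.isOpen_ball.mem_nhds ?_, integrableOn_inv_norm _⟩
  simp

/-- The Newtonian potential `Δ⁻¹ f` of a test function. -/
def newt (f : Space → ℝ) (x : Space) : ℝ := -(1 / (4 * Real.pi)) * ∫ y, ‖y‖⁻¹ * f (x - y)

variable {f : Space → ℝ}

theorem newt_eq_convolution (f : Space → ℝ) : newt f = fun x => -(1 / (4 * Real.pi)) •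
    MeasureTheory.convolution (fun x : Space => ‖x‖⁻¹) f (ContinuousLinearMap.lsmul ℝ ℝ) volume x := by
  ext1 x
  rw [newt, convolution_def]; rfl

theorem newt_eq (f : Space → ℝ) (x : Space) :
    newt f x = -(1 / (4 * Real.pi)) * ∫ y, ‖x - y‖⁻¹ * f y := by
  rw [newt, ← integral_sub_left_eq_self _ volume x]
  simp

theorem newt_contDiff (hf : VTest f) : ContDiff ℝ (⊤ : ℕ∞) (newt f) := by
  rw [newt_eq_convolution]
  exact (hf.2.contDiff_convolution_right _ locallyIntegrable_inv_norm hf.1).const_smul _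

theorem newt_integrable (hf : VTest f) (x : Space) :
    Integrable (fun y => ‖y‖⁻¹ * f (x - y)) volume :=
  hf.2.convolutionExists_right (ContinuousLinearMap.lsmul ℝ ℝ) locallyIntegrable_inv_norm
    hf.continuous x

theorem newt_integrable' (hf : VTest f) (x : Space) :
    Integrable (fun y => ‖x - y‖⁻¹ * f y) volume := by
  simpa using (newt_integrable hf x).comp_sub_left x

theorem pdv_newt (hf : VTest f) (k : Fin 3) : pdv k (newt f) = newt (pdv k f) := by
  ext1 x
  have hd := hf.2.hasFDerivAt_convolution_right (ContinuousLinearMap.lsmul ℝ ℝ)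
    locallyIntegrable_inv_norm (hf.1.of_le (by simp)) x
  rw [pdv, newt_eq_convolution, HasFDerivAt.fderiv (hd.fun_const_smul _), newt_eq_convolution]
  simp only [_root_.smul_apply]
  rw [convolution_precompR_apply _ locallyIntegrable_inv_norm (hf.2.fderiv ℝ)
    (hf.1.continuous_fderiv (by simp))]
  rfl

theorem newt_sum {ι : Type*} (s : Finset ι) {f : ι → Space → ℝ} (hf : ∀ i, VTest (f i))
    (x : Space) : newt (fun x => ∑ i ∈ s, f i x) x = ∑ i ∈ s, newt (f i) x := by
  simp only [newt, Finset.mul_sum]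
  rw [integral_finsetSum _ fun i _ => newt_integrable (hf i) x, Finset.mul_sum]

theorem weight_memLp_two : MemLp weight 2 volume := by
  refine (memLp_two_iff_integrable_sq weight_continuous.aestronglyMeasurable).2 ?_
  have h := integrable_one_add_norm (E := Space) (μ := volume) (r := 4) (by simp; norm_num)
  refine h.congr (Eventually.of_forall fun x => ?_)
  simp only [weight]
  rw [← Real.rpow_natCast, ← Real.rpow_mul (by positivity)]
  norm_num

/-- The Newtonian potential of a function with mean zero decays quadratically. -/
theorem newt_memLp (hf : VTest f) (h0 : ∫ x, f x = 0) : MemLp (newt f) 2 volume := by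
  have hc : Continuous (newt f) := (newt_contDiff hf).continuous
  obtain ⟨R, hR⟩ := hf.2.isCompact.isBounded.subset_closedBall 0
  set S := max R 1
  have hS : 1 ≤ S := le_max_right _ _
  have hsupp : ∀ y, f y ≠ 0 → ‖y‖ ≤ S := fun y hy => by
    have := hR (subset_tsupport f hy)
    rw [mem_closedBall_zero_iff] at this
    exact this.trans (le_max_left _ _)
  set M := 1 / (4 * Real.pi) * (2 * S * ∫ y, |f y|)
  have hf0 : 0 ≤ ∫ y, |f y| := integral_nonneg fun _ => abs_nonneg _
  have hM : 0 ≤ M := by positivity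
  have hfar : ∀ x, 2 * S ≤ ‖x‖ → |newt f x| ≤ M * (‖x‖ ^ 2)⁻¹ := by
    intro x hx
    have hx0 : 0 < ‖x‖ := by linarith
    -- The mean of `f` is zero, so the kernel may be replaced by its difference from `1/|x|`, which
    -- gains one power of decay. Decay of order two is square integrable in dimension three.
    have e1 : ∫ y, ‖x - y‖⁻¹ * f y = ∫ y, (‖x - y‖⁻¹ - ‖x‖⁻¹) * f y := by
      simp only [sub_mul]
      rw [integral_sub (newt_integrable' hf x)
        ((hf.continuous.integrable_of_hasCompactSupport hf.2).const_mul _), integral_const_mul, h0]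
      simp
    rw [newt_eq, e1, abs_mul, abs_neg, abs_of_nonneg (by positivity), mul_assoc]
    refine mul_le_mul_of_nonneg_left ?_ (by positivity)
    have hfi : Integrable (fun y => |f y|) volume :=
      (hf.continuous.integrable_of_hasCompactSupport hf.2).abs
    rw [mul_right_comm, ← integral_const_mul]
    refine abs_integral_le_integral_abs.trans
      (integral_mono_of_nonneg (Eventually.of_forall fun _ => abs_nonneg _) (hfi.const_mul _)
        (Eventually.of_forall fun y => ?_))
    simp only [abs_mul]
    by_cases hy : f y = 0
    · simp [hy]
    have hy1 := hsupp y hy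
    refine mul_le_mul_of_nonneg_right ?_ (abs_nonneg _)
    have h1 : ‖x‖ / 2 ≤ ‖x - y‖ := by
      have := norm_sub_norm_le x y; linarith
    have h2 : 0 < ‖x - y‖ := by linarith
    rw [inv_sub_inv h2.ne' hx0.ne', abs_div, abs_of_pos (mul_pos h2 hx0), div_le_iff₀ (by positivity)]
    have h3 : |‖x‖ - ‖x - y‖| ≤ S := by
      refine (abs_norm_sub_norm_le _ _).trans ?_
      simpa using hy1
    refine h3.trans ?_
    rw [show 2 * S * (‖x‖ ^ 2)⁻¹ * (‖x - y‖ * ‖x‖) = S * (2 * ‖x - y‖ / ‖x‖) by field_simp]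
    refine le_mul_of_one_le_right (by linarith) ?_
    rw [le_div_iff₀ hx0]; linarith
  obtain ⟨N, hN⟩ := (isCompact_closedBall (0 : Space) (2 * S)).exists_bound_of_continuousOn
    hc.continuousOn
  have hw : ∀ x, weight x = ((1 + ‖x‖) ^ 2)⁻¹ := fun x => by
    rw [weight, Real.rpow_neg (by positivity)]; norm_num
  refine (weight_memLp_two.const_mul (4 * M + (1 + 2 * S) ^ 2 * |N|)).mono
    hc.aestronglyMeasurable (Eventually.of_forall fun x => ?_)
  rw [Real.norm_eq_abs, Real.norm_of_nonneg (by rw [hw]; positivity), hw, ← div_eq_mul_inv,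
    le_div_iff₀ (by positivity)]
  rcases le_total (2 * S) ‖x‖ with hx | hx
  · have hx0 : 0 < ‖x‖ := by linarith
    have h1 := hfar x hx
    rw [← div_eq_mul_inv, le_div_iff₀ (by positivity)] at h1
    have h2 : (1 + ‖x‖) ^ 2 ≤ 4 * ‖x‖ ^ 2 := by nlinarith
    calc _ ≤ |newt f x| * (4 * ‖x‖ ^ 2) := by gcongr
      _ ≤ 4 * M := by linarith
      _ ≤ _ := le_add_of_nonneg_right (by positivity)
  · have h1 := hN x (by simpa using hx)
    rw [Real.norm_eq_abs] at h1
    calc |newt f x| * (1 + ‖x‖) ^ 2 ≤ |N| * (1 + 2 * S) ^ 2 :=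
          mul_le_mul (h1.trans (le_abs_self _)) (by gcongr) (by positivity) (abs_nonneg _)
      _ ≤ _ := by nlinarith

/-- A derivative of a test function has mean zero. -/
theorem newt_pdv_memLp (hf : VTest f) (k : Fin 3) : MemLp (newt (pdv k f)) 2 volume :=
  newt_memLp (hf.pdv k) (integral_pdv_eq_zero hf k)

/-- A smooth function that is square integrable together with its gradient can be approximated
by test functions. -/
theorem adm_of_contDiff {F : Type*} [NormedAddCommGroup F] [InnerProductSpace ℝ F] {f : Space → F}
    (hf : ContDiff ℝ (⊤ : ℕ∞) f) (h2 : MemLp f 2 volume)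
    (hd : ∀ k, MemLp (pdv k f) 2 volume) : Adm 2 f (pdv · f) := by
  have key : ∀ {g : Space → F}, MemLp g 2 volume →
      Tendsto (fun n => lpNorm (fun x => (1 - cutoff n x) • g x) 2 volume) atTop (𝓝 0) := by
    intro g hg
    have hle : ∀ n x, ‖(1 - cutoff n x) • g x‖ ≤ ‖g x‖ := fun n x => by
      rw [norm_smul, Real.norm_of_nonneg (sub_nonneg.2 (cutoff_le_one n x))]
      exact mul_le_of_le_one_left (norm_nonneg _) (by linarith [cutoff_nonneg n x])
    have hm : ∀ n, AEStronglyMeasurable (fun x => (1 - cutoff n x) • g x) volume := fun n =>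
      (continuous_const.sub (cutoff_test n).continuous).aestronglyMeasurable.smul hg.1
    have hL : ∀ n, MemLp (fun x => (1 - cutoff n x) • g x) 2 volume := fun n =>
      hg.mono (hm n) (Eventually.of_forall (hle n))
    have h : Tendsto (fun n => ∫ x, ‖(1 - cutoff n x) • g x‖ ^ 2) atTop (𝓝 (∫ _ : Space, (0 : ℝ))) := by
      refine tendsto_integral_of_dominated_convergence (fun x => ‖g x‖ ^ 2)
        (fun n => (hm n).norm.pow 2) ((memLp_two_iff_integrable_sq_norm hg.1).1 hg)
        (fun n => Eventually.of_forall fun x => ?_) (Eventually.of_forall fun x => ?_)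
      · rw [Real.norm_of_nonneg (by positivity)]
        exact pow_le_pow_left₀ (norm_nonneg _) (hle n x) 2
      · have := ((((cutoff_tendsto x).const_sub 1).smul_const (g x)).norm.pow 2)
        simpa using this
    rw [integral_zero] at h
    have h' := (Real.continuous_sqrt.tendsto 0).comp h
    rw [Real.sqrt_zero] at h'
    refine h'.congr fun n => ?_
    simp only [Function.comp]
    rw [← sq_lpNorm_two (hL n).1, Real.sqrt_sq lpNorm_nonneg]
  obtain ⟨C, hC0, hC⟩ := exists_fderiv_cutoff_le
  have hfd : Differentiable ℝ f := hf.differentiable (by simp)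
  refine ⟨h2, hd, fun ε hε => ?_⟩
  have e1 := (key h2).eventually_lt_const hε
  have e2 : ∀ᶠ n in atTop, ∀ k, lpNorm (fun x => (1 - cutoff n x) • pdv k f x) 2 volume < ε / 2 :=
    eventually_all.2 fun k => (key (hd k)).eventually_lt_const (by positivity)
  have e3 : ∀ᶠ n : ℕ in atTop, C / ((n : ℝ) + 1) * lpNorm f 2 volume < ε / 2 := by
    have : Tendsto (fun n : ℕ => C * (1 / ((n : ℝ) + 1)) * lpNorm f 2 volume) atTop
        (𝓝 (C * 0 * lpNorm f 2 volume)) :=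
      (tendsto_one_div_add_atTop_nhds_zero_nat.const_mul C).mul_const _
    rw [mul_zero, zero_mul] at this
    filter_upwards [this.eventually_lt_const (half_pos hε)] with n hn
    rwa [div_eq_mul_one_div]
  obtain ⟨n, h3, h4, h5⟩ := (e1.and (e2.and e3)).exists
  refine ⟨fun x => cutoff n x • f x, (cutoff_test n).smul_right hf, ?_, fun k => ?_⟩
  · refine (le_of_eq ?_).trans h3.le
    simp only [sub_smul, one_smul]
  · have hb : ∀ x, |pdv k (cutoff n) x| ≤ C / ((n : ℝ) + 1) := fun x =>
      (((fderiv ℝ (cutoff n) x).le_opNorm (e k)).trans (by simp)).trans (hC n x)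
    have hm1 : MemLp (fun x => (1 - cutoff n x) • pdv k f x) 2 volume :=
      (hd k).mono ((continuous_const.sub (cutoff_test n).continuous).aestronglyMeasurable.smul
        (hd k).1) (Eventually.of_forall fun x => by
          rw [norm_smul, Real.norm_of_nonneg (sub_nonneg.2 (cutoff_le_one n x))]
          exact mul_le_of_le_one_left (norm_nonneg _) (by linarith [cutoff_nonneg n x]))
    have e5 : (fun x => pdv k f x - pdv k (fun x => cutoff n x • f x) x) =
        fun x => (1 - cutoff n x) • pdv k f x + (-pdv k (cutoff n) x) • f x := by
      ext1 x
      rw [pdv_smul (cutoff_test n).differentiable hfd]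
      module
    rw [e5]
    have h6 : lpNorm (fun x => (-pdv k (cutoff n) x) • f x) 2 volume ≤
        C / ((n : ℝ) + 1) * lpNorm f 2 volume := by
      rw [← abs_of_nonneg (show 0 ≤ C / ((n : ℝ) + 1) by positivity), ← lpNorm_fun_const_smul]
      refine lpNorm_mono_norm (h2.const_smul _) (Eventually.of_forall fun x => ?_)
      rw [norm_smul, norm_smul, norm_neg, Real.norm_of_nonneg (show 0 ≤ C / ((n : ℝ) + 1) by positivity)]
      exact mul_le_mul_of_nonneg_right (hb x) (norm_nonneg _)
    refine (lpNorm_fun_add_le hm1 (by norm_num)).trans ?_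
    linarith [h4 k]

/-- Makes the gradient part of the Helmholtz projection of a test field an admissible variation of
the potential: each further derivative again falls on a derivative of a test function, so all
functions involved are square integrable. -/
theorem newt_adm (hf : VTest f) (k : Fin 3) :
    Adm 6 (newt (pdv k f)) (fun l => newt (pdv l (pdv k f))) := by
  have h := (adm_of_contDiff (newt_contDiff (hf.pdv k)) (newt_pdv_memLp hf k) fun l => by
    rw [pdv_newt (hf.pdv k), pdv_comm hf.1]
    exact newt_pdv_memLp (hf.pdv l) k).six (by norm_num)
  simpa only [pdv_newt (hf.pdv k)] using h

end Newton

/-! ### The Newtonian potential inverts the Laplacian -/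

section Poisson

theorem regSq_pos {ε : ℝ} (hε : 0 < ε) (x : Space) : 0 < ε ^ 2 + ‖x‖ ^ 2 := by positivity

theorem contDiff_regSq_rpow {ε : ℝ} (hε : 0 < ε) (a : ℝ) :
    ContDiff ℝ (⊤ : ℕ∞) fun x : Space => (ε ^ 2 + ‖x‖ ^ 2) ^ a :=
  (contDiff_const.add (contDiff_norm_sq ℝ)).rpow_const_of_ne fun x => (regSq_pos hε x).ne'

theorem pdv_regSq_rpow {ε : ℝ} (hε : 0 < ε) (a : ℝ) (k : Fin 3) :
    pdv k (fun x : Space => (ε ^ 2 + ‖x‖ ^ 2) ^ a) =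
      fun x => x k * (2 * a * (ε ^ 2 + ‖x‖ ^ 2) ^ (a - 1)) := by
  ext1 x
  have h1 : HasFDerivAt (fun x : Space => ε ^ 2 + ‖x‖ ^ 2) (2 • innerSL ℝ x) x :=
    ((hasStrictFDerivAt_norm_sq x).hasFDerivAt).const_add _
  have h2 := h1.rpow_const (p := a) (Or.inl (regSq_pos hε x).ne')
  rw [pdv, h2.fderiv]
  have h3 : inner ℝ x (e k) = x k := by simp [e, EuclideanSpace.inner_single_right]
  simp [h3]
  ring

theorem pdv_coord_self (k : Fin 3) (x : Space) : pdv k (fun x : Space => x k) x = 1 := by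
  have : HasFDerivAt (fun x : Space => x k) (EuclideanSpace.proj k : Space →L[ℝ] ℝ) x :=
    (EuclideanSpace.proj k : Space →L[ℝ] ℝ).hasFDerivAt
  rw [pdv, this.fderiv]
  simp [e]

/-- The kernel `1/|x|` is replaced by a smooth one whose Laplacian is an explicit multiple of an
approximate identity. -/
theorem laplacian_regInv {ε : ℝ} (hε : 0 < ε) (x : Space) :
    ∑ k, pdv k (pdv k fun x : Space => (ε ^ 2 + ‖x‖ ^ 2) ^ (-1 / 2 : ℝ)) x =
      -3 * ε ^ 2 * (ε ^ 2 + ‖x‖ ^ 2) ^ (-5 / 2 : ℝ) := by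
  have hs := regSq_pos hε x
  have h : ∀ k, pdv k (pdv k fun x : Space => (ε ^ 2 + ‖x‖ ^ 2) ^ (-1 / 2 : ℝ)) x =
      3 * x k ^ 2 * (ε ^ 2 + ‖x‖ ^ 2) ^ (-5 / 2 : ℝ) - (ε ^ 2 + ‖x‖ ^ 2) ^ (-3 / 2 : ℝ) := by
    intro k
    have e1 : pdv k (fun x : Space => (ε ^ 2 + ‖x‖ ^ 2) ^ (-1 / 2 : ℝ)) =
        fun x => x k * (-1 * (ε ^ 2 + ‖x‖ ^ 2) ^ (-3 / 2 : ℝ)) := by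
      rw [pdv_regSq_rpow hε]; norm_num
    have hd : Differentiable ℝ fun x : Space => (ε ^ 2 + ‖x‖ ^ 2) ^ (-3 / 2 : ℝ) :=
      (contDiff_regSq_rpow hε _).differentiable (by simp)
    have hk : Differentiable ℝ fun x : Space => x k :=
      (EuclideanSpace.proj k : Space →L[ℝ] ℝ).differentiable
    rw [e1, pdv_mul hk (hd.const_mul _)]
    simp only [pdv_coord_self]
    have e2 := congrFun (pdv_const_smul hd (-1) k) x
    simp only [smul_eq_mul] at e2
    rw [e2, pdv_regSq_rpow hε]
    norm_num
    ring
  have e3 : (ε ^ 2 + ‖x‖ ^ 2) ^ (-3 / 2 : ℝ) =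
      (ε ^ 2 + ‖x‖ ^ 2) * (ε ^ 2 + ‖x‖ ^ 2) ^ (-5 / 2 : ℝ) := by
    rw [mul_comm, ← Real.rpow_add_one hs.ne']; norm_num
  simp only [h, e3]
  rw [EuclideanSpace.real_norm_sq_eq x]
  simp only [Fin.sum_univ_three]
  ring

/-- The radial integrand `r² (1 + r²)^{-5/2}` has the primitive `r³ (1 + r²)^{-3/2} / 3`, which
tends to `1/3`. -/
theorem integral_radial_kernel :
    ∫ x : Space, (1 + ‖x‖ ^ 2) ^ (-5 / 2 : ℝ) = 4 * Real.pi / 3 := by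
  rw [integral_fun_norm_addHaar (volume : Measure Space) (fun r => (1 + r ^ 2) ^ (-5 / 2 : ℝ))]
  have h : ∫ r in Set.Ioi (0 : ℝ), r ^ 2 * (1 + r ^ 2) ^ (-5 / 2 : ℝ) = 1 / 3 - 0 := by
    have hd : ∀ r : ℝ, HasDerivAt (fun r : ℝ => r ^ 3 * (1 + r ^ 2) ^ (-3 / 2 : ℝ) / 3)
        (r ^ 2 * (1 + r ^ 2) ^ (-5 / 2 : ℝ)) r := by
      intro r
      have hp : 0 < 1 + r ^ 2 := by positivity
      have h1 : HasDerivAt (fun r : ℝ => 1 + r ^ 2) (2 * r) r := by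
        simpa using (hasDerivAt_pow 2 r).const_add 1
      have h2 := ((hasDerivAt_pow 3 r).mul (h1.rpow_const (p := -3 / 2) (Or.inl hp.ne'))).div_const 3
      refine h2.congr_deriv ?_
      have e3 : (1 + r ^ 2) ^ (-3 / 2 : ℝ) = (1 + r ^ 2) * (1 + r ^ 2) ^ (-5 / 2 : ℝ) := by
        rw [mul_comm, ← Real.rpow_add_one hp.ne']; norm_num
      rw [e3, show (-3 / 2 - 1 : ℝ) = -5 / 2 by norm_num]
      norm_num
      ring
    have h0 : (0 : ℝ) = (fun r : ℝ => r ^ 3 * (1 + r ^ 2) ^ (-3 / 2 : ℝ) / 3) 0 := by simp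
    conv_rhs => rw [h0]
    refine integral_Ioi_of_hasDerivAt_of_nonneg (hd 0).continuousAt.continuousWithinAt
      (fun r _ => hd r) (fun r _ => by positivity) ?_
    have t1 : Tendsto (fun r : ℝ => 1 - (1 + r ^ 2)⁻¹) atTop (𝓝 (1 - 0)) :=
      (tendsto_inv_atTop_zero.comp
        (tendsto_atTop_add_const_left _ _ (tendsto_pow_atTop two_ne_zero))).const_sub 1
    rw [sub_zero] at t1
    have t2 := (t1.rpow_const (p := 3 / 2) (Or.inl one_ne_zero)).div_const 3
    rw [Real.one_rpow] at t2
    refine t2.congr' ?_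
    filter_upwards [eventually_gt_atTop 0] with r hr
    have hp : 0 < 1 + r ^ 2 := by positivity
    have : 1 - (1 + r ^ 2)⁻¹ = r ^ 2 * (1 + r ^ 2)⁻¹ := by field_simp; ring
    rw [this, Real.mul_rpow (by positivity) (by positivity), Real.inv_rpow hp.le,
      ← Real.rpow_neg hp.le, ← Real.rpow_natCast r 2, ← Real.rpow_mul hr.le,
      ← Real.rpow_natCast r 3]
    norm_num
  simp only [finrank_euclideanSpace, Fintype.card_fin, smul_eq_mul, Measure.real,
    EuclideanSpace.volume_ball_fin_three]
  norm_num at h ⊢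
  rw [h, ENNReal.toReal_ofReal (by positivity)]
  ring

theorem integrable_radial_kernel :
    Integrable (fun x : Space => (1 + ‖x‖ ^ 2) ^ (-5 / 2 : ℝ)) volume :=
  integrable_rpow_neg_one_add_norm_sq (r := 5) (by simp; norm_num)

variable {ζ : Space → ℝ}

theorem integral_regInv_mul_laplacian {ε : ℝ} (hε : 0 < ε) (hζ : VTest ζ) :
    ∫ x, (ε ^ 2 + ‖x‖ ^ 2) ^ (-1 / 2 : ℝ) * ∑ k, pdv k (pdv k ζ) x =
      -3 * ∫ x : Space, (1 + ‖x‖ ^ 2) ^ (-5 / 2 : ℝ) * ζ (ε • x) := by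
  set h : Space → ℝ := fun x => (ε ^ 2 + ‖x‖ ^ 2) ^ (-1 / 2 : ℝ)
  have hh : ContDiff ℝ (⊤ : ℕ∞) h := contDiff_regSq_rpow hε _
  have hhp : ∀ k, ContDiff ℝ (⊤ : ℕ∞) (pdv k h) := fun k => by
    simp only [h, pdv_regSq_rpow hε]
    exact (EuclideanSpace.proj k : Space →L[ℝ] ℝ).contDiff.mul
      (contDiff_const.mul (contDiff_regSq_rpow hε _))
  have hhpp : ∀ k, Continuous (pdv k (pdv k h)) := fun k =>
    ((hhp k).continuous_fderiv (by simp)).clm_apply continuous_const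
  have e1 : ∀ k, ∫ x, h x * pdv k (pdv k ζ) x = ∫ x, ζ x * pdv k (pdv k h) x := by
    intro k
    have i1 := hζ.integral_smul_pdv (hhp k) k
    have i2 := (hζ.pdv k).integral_smul_pdv hh k
    simp only [smul_eq_mul] at i1 i2
    rw [i1, i2, neg_neg]
    exact integral_congr_ae (Eventually.of_forall fun x => mul_comm _ _)
  have i1 : ∀ k, Integrable (fun x => h x * pdv k (pdv k ζ) x) volume := fun k => (hh.continuous.mul
    ((hζ.pdv k).pdv k).continuous).integrable_of_hasCompactSupport ((hζ.pdv k).pdv k).2.mul_left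
  have i2 : ∀ k, Integrable (fun x => ζ x * pdv k (pdv k h) x) volume := fun k =>
    (hζ.continuous.mul (hhpp k)).integrable_of_hasCompactSupport hζ.2.mul_right
  have e0 : ∫ x, h x * ∑ k, pdv k (pdv k ζ) x = ∫ x, ζ x * ∑ k, pdv k (pdv k h) x := by
    simp only [Finset.mul_sum]
    rw [integral_finsetSum _ fun k _ => i1 k, integral_finsetSum _ fun k _ => i2 k]
    exact Finset.sum_congr rfl fun k _ => e1 k
  rw [e0]
  simp only [h, laplacian_regInv hε]
  have e2 := Measure.integral_comp_smul (volume : Measure Space)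
    (fun x => ζ x * (-3 * ε ^ 2 * (ε ^ 2 + ‖x‖ ^ 2) ^ (-5 / 2 : ℝ))) ε
  rw [finrank_euclideanSpace, Fintype.card_fin, abs_of_pos (by positivity), smul_eq_mul,
    eq_comm, inv_mul_eq_iff_eq_mul₀ (by positivity)] at e2
  rw [e2, ← integral_const_mul, ← integral_const_mul]
  refine integral_congr_ae (Eventually.of_forall fun x => ?_)
  have e3 : ε ^ 2 + ‖ε • x‖ ^ 2 = ε ^ 2 * (1 + ‖x‖ ^ 2) := by
    rw [norm_smul, Real.norm_of_nonneg hε.le]; ring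
  have e4 : (ε ^ 2) ^ (-5 / 2 : ℝ) = (ε ^ 5)⁻¹ := by
    rw [← Real.rpow_natCast ε 2, ← Real.rpow_mul hε.le, ← Real.rpow_natCast ε 5,
      ← Real.rpow_neg hε.le]
    norm_num
  simp only [e3]
  rw [Real.mul_rpow (by positivity) (by positivity), e4]
  field_simp

/-- Let `ε → 0` in `integral_regInv_mul_laplacian`: the left side is dominated by `|x|⁻¹ |Δζ|`, and
on the right `ζ (ε x)` tends to `ζ 0` under an integrable kernel. The constant is `-3 · 4π/3`. -/
theorem integral_inv_norm_mul_laplacian (hζ : VTest ζ) :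
    ∫ x : Space, ‖x‖⁻¹ * ∑ k, pdv k (pdv k ζ) x = -(4 * Real.pi) * ζ 0 := by
  set ε : ℕ → ℝ := fun n => 1 / ((n : ℝ) + 1)
  have hε : ∀ n, 0 < ε n := fun n => by positivity
  have hε0 : Tendsto ε atTop (𝓝 0) := tendsto_one_div_add_atTop_nhds_zero_nat
  set L : Space → ℝ := fun x => ∑ k, pdv k (pdv k ζ) x
  have hLc : Continuous L := continuous_finsetSum _ fun k _ => ((hζ.pdv k).pdv k).continuous
  have hLi : Integrable (fun x => ‖x‖⁻¹ * L x) volume := by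
    simp only [L, Finset.mul_sum]
    exact integrable_finsetSum _ fun k _ => by simpa using newt_integrable' ((hζ.pdv k).pdv k) 0
  have hne : ∀ᵐ x : Space, x ≠ 0 := by
    simp [ae_iff, measure_singleton]
  have t1 : Tendsto (fun n => ∫ x : Space, (ε n ^ 2 + ‖x‖ ^ 2) ^ (-1 / 2 : ℝ) * L x) atTop
      (𝓝 (∫ x : Space, ‖x‖⁻¹ * L x)) := by
    refine tendsto_integral_of_dominated_convergence (fun x => ‖‖x‖⁻¹ * L x‖)
      (fun n => ((contDiff_regSq_rpow (hε n) _).continuous.mul hLc).aestronglyMeasurable)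
      hLi.norm (fun n => ?_) ?_
    · filter_upwards [hne] with x hx
      have hx0 : 0 < ‖x‖ := norm_pos_iff.2 hx
      rw [norm_mul, norm_mul]
      refine mul_le_mul_of_nonneg_right ?_ (norm_nonneg _)
      rw [Real.norm_of_nonneg (by positivity), Real.norm_of_nonneg (by positivity)]
      calc _ ≤ (‖x‖ ^ 2) ^ (-1 / 2 : ℝ) :=
            Real.rpow_le_rpow_of_nonpos (by positivity) (le_add_of_nonneg_left (by positivity))
              (by norm_num)
        _ = ‖x‖⁻¹ := by
            rw [← Real.rpow_natCast, ← Real.rpow_mul hx0.le, ← Real.rpow_neg_one]; norm_num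
    · filter_upwards [hne] with x hx
      have hx0 : 0 < ‖x‖ := norm_pos_iff.2 hx
      refine Tendsto.mul_const _ ?_
      have := (((hε0.pow 2).add_const (‖x‖ ^ 2)).rpow_const (p := (-1 / 2 : ℝ))
        (Or.inl (by positivity)))
      convert this using 2
      rw [zero_pow two_ne_zero, zero_add, ← Real.rpow_natCast, ← Real.rpow_mul hx0.le,
        ← Real.rpow_neg_one]
      norm_num
  obtain ⟨C, hC⟩ := hζ.continuous.bounded_above_of_compact_support hζ.2
  have t2 : Tendsto (fun n => -3 * ∫ x : Space, (1 + ‖x‖ ^ 2) ^ (-5 / 2 : ℝ) * ζ (ε n • x)) atTop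
      (𝓝 (-3 * ∫ x : Space, (1 + ‖x‖ ^ 2) ^ (-5 / 2 : ℝ) * ζ 0)) := by
    refine Tendsto.const_mul _ (tendsto_integral_of_dominated_convergence
      (fun x => (1 + ‖x‖ ^ 2) ^ (-5 / 2 : ℝ) * C) (fun n => ?_)
      (integrable_radial_kernel.mul_const C) (fun n => Eventually.of_forall fun x => ?_)
      (Eventually.of_forall fun x => ?_))
    · exact integrable_radial_kernel.1.mul
        (hζ.continuous.comp (continuous_const_smul _)).aestronglyMeasurable
    · rw [norm_mul, Real.norm_of_nonneg (by positivity)]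
      exact mul_le_mul_of_nonneg_left (hC _) (by positivity)
    · refine Tendsto.const_mul _ ((hζ.continuous.tendsto 0).comp ?_)
      simpa using hε0.smul_const x
  have h := tendsto_nhds_unique t1 (t2.congr fun n => (integral_regInv_mul_laplacian (hε n) hζ).symm)
  rw [h, integral_mul_const, integral_radial_kernel]
  ring

/-- This identity makes the projected test field in `stationary_maxwell` exactly divergence free. -/
theorem sum_newt_pdv_pdv (hζ : VTest ζ) (x : Space) : ∑ k, newt (pdv k (pdv k ζ)) x = ζ x := by
  rw [← newt_sum _ (fun k => (hζ.pdv k).pdv k), newt_eq,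
    ← integral_add_right_eq_self _ x]
  have h := integral_inv_norm_mul_laplacian (hζ.translate x)
  simp only [pdv_translate, zero_add] at h
  have e1 : ∀ y : Space, ‖x - (y + x)‖ = ‖y‖ := fun y => by rw [← norm_neg y]; congr 1; abel
  simp only [e1, h]
  field_simp

end Poisson

/-! ### The Newtonian potential of an integrable field -/

section InvLaplace

variable {f : Space → ℝ} {F : Type*} [NormedAddCommGroup F] [NormedSpace ℝ F]

/-- The kernel is integrable on the unit ball around `y` and at most one outside. The bound is
uniform in `y`, which is what Fubini needs for a current that is merely integrable. -/
theorem exists_bound_integral_kernel (hf : VTest f) :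
    ∃ C : ℝ, ∀ y, ∫ x, |f x| * ‖x - y‖⁻¹ ≤ C := by
  obtain ⟨M, hM⟩ := hf.continuous.bounded_above_of_compact_support hf.2
  set g : Space → ℝ := (Metric.ball 0 1).indicator fun x => ‖x‖⁻¹
  have hg : Integrable g volume := (integrable_indicator_iff measurableSet_ball).2
    (integrableOn_inv_norm 1)
  have hfi : Integrable (fun x => |f x|) volume :=
    (hf.continuous.integrable_of_hasCompactSupport hf.2).abs
  refine ⟨(∫ x, |f x|) + M * ∫ x, g x, fun y => ?_⟩
  rw [← integral_sub_right_eq_self g y, ← integral_const_mul,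
    ← integral_add hfi ((hg.comp_sub_right y).const_mul M)]
  refine integral_mono_of_nonneg (Eventually.of_forall fun x => by positivity)
    (hfi.add ((hg.comp_sub_right y).const_mul M)) (Eventually.of_forall fun x => ?_)
  have hM0 : 0 ≤ M := (norm_nonneg _).trans (hM 0)
  simp only [g, Set.indicator]
  split_ifs with hx
  · have := mul_le_mul_of_nonneg_right (hM x) (inv_nonneg.2 (norm_nonneg (x - y)))
    rw [Real.norm_eq_abs] at this
    exact this.trans (le_add_of_nonneg_left (abs_nonneg _))
  · rw [mul_zero, add_zero]
    refine mul_le_of_le_one_right (abs_nonneg _) (inv_le_one_of_one_le₀ ?_)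
    simpa using hx

theorem integrable_kernel_prod (hf : VTest f) {J : Space → F} (hJ : Integrable J volume) :
    Integrable (fun p : Space × Space => (f p.1 * ‖p.1 - p.2‖⁻¹) • J p.2)
      ((volume : Measure Space).prod volume) := by
  have hm : AEStronglyMeasurable (fun p : Space × Space => (f p.1 * ‖p.1 - p.2‖⁻¹) • J p.2)
      ((volume : Measure Space).prod volume) := by
    refine AEStronglyMeasurable.smul (Measurable.aestronglyMeasurable ?_) hJ.1.comp_snd
    exact (hf.continuous.measurable.comp measurable_fst).mul
      (measurable_fst.sub measurable_snd).norm.inv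
  have hi : ∀ y, Integrable (fun x => f x * ‖x - y‖⁻¹) volume := fun y => by
    simpa only [mul_comm, norm_sub_rev] using newt_integrable' hf y
  obtain ⟨C, hC⟩ := exists_bound_integral_kernel hf
  rw [integrable_prod_iff' hm]
  refine ⟨Eventually.of_forall fun y => (hi y).smul_const (J y), ?_⟩
  refine (hJ.norm.const_mul C).mono hm.norm.prod_swap.integral_prod_right' (Eventually.of_forall fun y => ?_)
  have h0 : 0 ≤ ∫ x, ‖(f x * ‖x - y‖⁻¹) • J y‖ := integral_nonneg fun _ => norm_nonneg _
  have h1 : ∫ x, ‖(f x * ‖x - y‖⁻¹) • J y‖ = (∫ x, |f x| * ‖x - y‖⁻¹) * ‖J y‖ := by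
    rw [← integral_mul_const]
    simp only [norm_smul, norm_mul, norm_inv, norm_norm]
    rfl
  rw [Real.norm_of_nonneg h0, h1]
  exact (mul_le_mul_of_nonneg_right (hC y) (norm_nonneg _)).trans (le_abs_self _)

variable {J : Space → Space}

theorem invLaplace_smul_eq (f : Space → ℝ) (J : Space → Space) (x : Space) :
    f x • invLaplace J x = -(1 / (4 * Real.pi)) • ∫ y, (f x * ‖x - y‖⁻¹) • J y := by
  simp only [invLaplace, mul_smul, integral_smul]
  module

theorem locallyIntegrable_invLaplace (hJ : Integrable J volume) :
    LocallyIntegrable (invLaplace J) := by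
  intro x
  set n := ⌈‖x‖⌉₊
  refine ⟨Metric.ball 0 ((n : ℝ) + 1), Metric.isOpen_ball.mem_nhds ?_, ?_⟩
  · rw [mem_ball_zero_iff]
    linarith [Nat.le_ceil ‖x‖]
  · have h := ((integrable_kernel_prod (cutoff_test n) hJ).integral_prod_left).smul
      (-(1 / (4 * Real.pi)))
    refine (h.integrableOn (s := Metric.ball 0 ((n : ℝ) + 1))).congr_fun (fun z hz => ?_)
      measurableSet_ball
    have h1 : cutoff n z = 1 := cutoff_eq_one (mem_ball_zero_iff.1 hz).le
    have h2 := invLaplace_smul_eq (cutoff n) J z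
    rw [h1, one_smul] at h2
    simp only [Pi.smul_apply]
    rw [h2]
    simp only [h1]

theorem newt_smul_eq (f : Space → ℝ) (J : Space → Space) (y : Space) :
    newt f y • J y = -(1 / (4 * Real.pi)) • ∫ x, (f x * ‖x - y‖⁻¹) • J y := by
  rw [integral_smul_const, newt_eq, mul_smul]
  simp only [mul_comm, norm_sub_rev]

/-- The Newtonian potential is symmetric. -/
theorem pair_invLaplace (hf : VTest f) (hJ : Integrable J volume) :
    pair f (invLaplace J) = ∫ y, newt f y • J y := by
  simp only [pair, invLaplace_smul_eq]
  rw [integral_smul, integral_integral_swap (integrable_kernel_prod hf hJ), ← integral_smul]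
  simp only [newt_smul_eq]

theorem integrable_newt_smul (hf : VTest f) (hJ : Integrable J volume) :
    Integrable (fun y => newt f y • J y) volume := by
  have h := ((integrable_kernel_prod hf hJ).integral_prod_right).smul (-(1 / (4 * Real.pi)))
  exact h.congr (Eventually.of_forall fun y => (newt_smul_eq f J y).symm)

end InvLaplace

/-! ### Vector fields given by their coordinates -/

section Coordinates

theorem sum_smul_e_apply (b : Fin 3 → ℝ) (i : Fin 3) : (∑ l, b l • e l : Space) i = b i := by
  fin_cases i <;> simp [Fin.sum_univ_three, e]

theorem inner_sum_smul_e (w : Space) (b : Fin 3 → ℝ) :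
    inner ℝ w (∑ l, b l • e l) = ∑ l, w l * b l := by
  simp [inner_sum, inner_smul_right, e, EuclideanSpace.inner_single_right, mul_comm]

theorem integral_apply_coord {f : Space → Space} (hf : Integrable f volume) (k : Fin 3) :
    (∫ x, f x) k = ∫ x, f x k :=
  ((EuclideanSpace.proj k : Space →L[ℝ] ℝ).integral_comp_comm hf).symm

theorem pair_apply {η : Space → ℝ} {f : Space → Space} (hη : VTest η) (hf : LocallyIntegrable f)
    (k : Fin 3) : pair η f k = ∫ x, η x * f x k :=
  integral_apply_coord (pair_integrable hη hf) k

variable {p : ℝ≥0∞}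

theorem Adm.smul_e {f : Space → ℝ} {g : Fin 3 → Space → ℝ} (h : Adm p f g) (l : Fin 3) :
    Adm p (fun x => f x • e l) (fun k x => g k x • e l) := by
  have hn : ∀ {h : Space → ℝ} {q : ℝ≥0∞}, MemLp h q volume →
      lpNorm (fun x => h x • e l) q volume = lpNorm h q volume := fun {h q} hh =>
    lpNorm_congr_norm (hh.1.smul_const _) hh.1 (Eventually.of_forall fun x => by simp [norm_smul])
  refine ⟨?_, fun k => ?_, fun ε hε => ?_⟩
  · exact (ContinuousLinearMap.smulRight (1 : ℝ →L[ℝ] ℝ) (e l)).comp_memLp' h.1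
  · exact (ContinuousLinearMap.smulRight (1 : ℝ →L[ℝ] ℝ) (e l)).comp_memLp' (h.2.1 k)
  obtain ⟨φ, h1, h2, h3⟩ := h.2.2 ε hε
  refine ⟨_, h1.clm (ContinuousLinearMap.smulRight (1 : ℝ →L[ℝ] ℝ) (e l)), ?_, fun k => ?_⟩
  · simp only [ContinuousLinearMap.smulRight_apply, one_apply_eq_self, ← sub_smul,
      hn (memLp_fun_sub h.1 (h1.memLp p))]
    exact h2
  · rw [pdv_clm h1.differentiable]
    simp only [ContinuousLinearMap.smulRight_apply, one_apply_eq_self, ← sub_smul,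
      hn (memLp_fun_sub (h.2.1 k) ((h1.pdv k).memLp 2))]
    exact h3 k

theorem Adm.of_coord (hp : 1 ≤ p) {b : Fin 3 → Space → ℝ} {g : Fin 3 → Fin 3 → Space → ℝ}
    (h : ∀ l, Adm p (b l) (g l)) :
    Adm p (fun x => ∑ l, b l x • e l) (fun k x => ∑ l, g l k x • e l) := by
  simp only [Fin.sum_univ_three]
  exact (((h 0).smul_e 0).add hp ((h 1).smul_e 1)).add hp ((h 2).smul_e 2)

/-- The derivatives of a field and of a function can be interchanged under the integral. -/
theorem Adm.integral_mul_comm {A : Space → Space} {G : Fin 3 → Space → Space} (hA : Adm 6 A G)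
    {f : Space → ℝ} {g : Fin 3 → Space → ℝ} (hf : Adm p f g) (a l i : Fin 3) :
    ∫ x, G a x i * g l x = ∫ x, G l x i * g a x := by
  obtain ⟨φ, h1, -, h3⟩ := hf.exists_seq
  have t : ∀ a l, Tendsto (fun n => ∫ x, G a x i * pdv l (φ n) x) atTop
      (𝓝 (∫ x, G a x i * g l x)) := fun a l => by
    refine tendsto_integral_smul_of_lpNorm (p := 2) (by norm_num) ?_
      (fun n => ((h1 n).pdv l).memLp 2) (hf.2.1 l) (h3 l)
    rw [ENNReal.HolderConjugate.conjExponent_eq (q := 2)]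
    exact Params.coord_memLp (hA.2.1 a) i
  refine tendsto_nhds_unique (t a l) ((t l a).congr fun n => ?_)
  have e1 : ∀ a l, ∫ x, G a x i * pdv l (φ n) x = -(pair (pdv a (pdv l (φ n))) A) i := fun a l => by
    have h2 : pair (pdv a (pdv l (φ n))) A i = (-pair (pdv l (φ n)) (G a)) i := by
      rw [pair_weakDeriv ((h1 n).pdv l) (hA.hasWeakDeriv (by norm_num) a)]
    rw [h2, PiLp.neg_apply, neg_neg, pair_apply ((h1 n).pdv l) (Params.li (hA.2.1 a))]
    exact integral_congr_ae (Eventually.of_forall fun x => mul_comm _ _)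
  rw [e1, e1, pdv_comm (h1 n).1]

end Coordinates

/-! ### The stationary Maxwell equation -/

namespace Params

variable (P : Params) (u : Conf)

/-- The current density. -/
def cur (x : Space) : Space := ∑ k, (-(P.Q / P.m) * inner ℝ (u.ψ x) (P.covK u k x)) • e k

theorem cur_apply (x : Space) (k : Fin 3) :
    P.cur u x k = -(P.Q / P.m) * inner ℝ (u.ψ x) (P.covK u k x) := sum_smul_e_apply _ k

theorem current_eq (x : Space) :
    current P.ħ P.c P.m P.Q P.j (u.ψ x) (fun l => u.D l x) (u.A x) = P.cur u x := by
  ext k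
  simp only [cur_apply, current, cov_eq, inner_spinor]

theorem cur_integrable : Integrable (P.cur u) volume :=
  integrable_finsetSum _ fun k _ =>
    ((integrable_inner u.ψ2 (P.covK_memLp u k)).const_mul _).smul_const _

variable {u} {lam : ℝ} (hd : u.DivFree) (hm : u.mass = lam)
  (hmin : ∀ w : Conf, w.DivFree → w.mass = lam → P.energy u ≤ P.energy w)

-- The velocity in the covariant derivative contributes `m vₖ |ψ|²` by `inner_velL_self`, which
-- cancels the variation of the coupling term. What remains is the physical current.
include hd hm hmin in
theorem potential_equation_coord {b : Fin 3 → Space → ℝ} {g : Fin 3 → Fin 3 → Space → ℝ}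
    (hb : ∀ l, Adm 6 (b l) (g l)) (hdiv : ∀ x, ∑ l, g l l x = 0) :
    2 * P.fieldForm u.G (fun k x => ∑ l, g l k x • e l) =
      1 / P.c * ∑ l, ∫ x, b l x * P.cur u x l := by
  have hB := Adm.of_coord (by norm_num) hb
  have h := P.potential_equation u hB hd hm hmin
    (Eventually.of_forall fun x => by simpa only [sum_smul_e_apply] using hdiv x)
  have hcp := coupling_memLp u hB
  rw [kin_eq_sum (P.cd_memLp u) hcp] at h
  simp only [sum_smul_e_apply] at h hcp
  have hi1 : ∀ k, Integrable (fun x => inner ℝ (P.covK u k x) (b k x • u.ψ x)) volume :=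
    fun k => integrable_inner (P.covK_memLp u k) (hcp k)
  have hi3 : ∀ k, Integrable (fun x => P.v k * (b k x * ‖u.ψ x‖ ^ 2)) volume := fun k => by
    refine ((integrable_inner u.ψ2 (hcp k)).const_mul (P.v k)).congr
      (Eventually.of_forall fun x => ?_)
    simp only [inner_smul_right, real_inner_self_eq_norm_sq]
  have e1 : ∀ k, ∫ x, inner ℝ (spinOp P.j (P.cd u · x) k) (b k x • u.ψ x) =
      (∫ x, inner ℝ (P.covK u k x) (b k x • u.ψ x)) +
        P.m * ∫ x, P.v k * (b k x * ‖u.ψ x‖ ^ 2) := fun k => by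
    rw [← integral_const_mul, ← integral_add (hi1 k) ((hi3 k).const_mul _)]
    refine integral_congr_ae (Eventually.of_forall fun x => ?_)
    simp only [P.spinOp_cd, inner_add_left, real_inner_smul_left, inner_smul_right,
      inner_velL_self]
    ring
  have e2 : ∫ x, inner ℝ P.v (∑ l, b l x • e l) * ‖u.ψ x‖ ^ 2 =
      ∑ k, ∫ x, P.v k * (b k x * ‖u.ψ x‖ ^ 2) := by
    rw [← integral_finsetSum _ fun k _ => hi3 k]
    simp only [inner_sum_smul_e, Finset.sum_mul, mul_assoc]
  have e3 : ∀ k, ∫ x, b k x * P.cur u x k =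
      -(P.Q / P.m) * ∫ x, inner ℝ (P.covK u k x) (b k x • u.ψ x) := fun k => by
    rw [← integral_const_mul]
    refine integral_congr_ae (Eventually.of_forall fun x => ?_)
    simp only [cur_apply, inner_smul_right, real_inner_comm (u.ψ x)]
    ring
  simp only [e1, e2, Finset.sum_add_distrib, ← Finset.mul_sum] at h
  simp only [e3, ← Finset.mul_sum]
  have hmm := P.hm.ne'
  have hcc := P.hc.ne'
  field_simp at h ⊢
  linear_combination h

theorem fieldForm_coord {G : Fin 3 → Space → Space} (hG : ∀ k, MemLp (G k) 2 volume)
    {g : Fin 3 → Fin 3 → Space → ℝ} (hg : ∀ l k, MemLp (g l k) 2 volume) :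
    P.fieldForm G (fun k x => ∑ l, g l k x • e l) = 1 / (8 * Real.pi) *
      (∑ a, ∑ l, (∫ x, G a x l * g l a x) - 1 / P.c ^ 2 *
        ∑ a, ∑ b, P.v a * P.v b * ∑ l, ∫ x, G a x l * g l b x) := by
  have hi : ∀ a b l, Integrable (fun x => G a x l * g l b x) volume := fun a b l =>
    (coord_memLp (hG a) l).integrable_mul (hg l b)
  rw [fieldForm]
  congr 1
  have e1 : ∀ x, ∑ k, inner ℝ (G k x) (∑ l, g l k x • e l) -
      1 / P.c ^ 2 * inner ℝ (∑ k, P.v k • G k x) (∑ k, P.v k • ∑ l, g l k x • e l) =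
      ∑ a, ∑ l, G a x l * g l a x - 1 / P.c ^ 2 *
        ∑ a, ∑ b, ∑ l, P.v a * P.v b * (G a x l * g l b x) := by
    intro x
    rw [sum_inner]
    have e0 : ∀ w : Space, inner ℝ w (∑ k, P.v k • ∑ l, g l k x • e l) =
        ∑ k, P.v k * ∑ l, w l * g l k x := fun w => by
      rw [inner_sum]
      simp only [inner_smul_right, inner_sum_smul_e]
    simp only [e0, inner_sum_smul_e, Finset.mul_sum, PiLp.smul_apply, smul_eq_mul]
    congr 1
    refine Finset.sum_congr rfl fun a _ => Finset.sum_congr rfl fun b _ =>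
      Finset.sum_congr rfl fun l _ => ?_
    ring
  simp only [e1]
  rw [integral_sub, integral_const_mul]
  · congr 1
    · rw [integral_finsetSum _ fun a _ => integrable_finsetSum _ fun l _ => hi a a l]
      exact Finset.sum_congr rfl fun a _ => integral_finsetSum _ fun l _ => hi a a l
    · congr 1
      rw [integral_finsetSum _ fun a _ => integrable_finsetSum _ fun b _ =>
        integrable_finsetSum _ fun l _ => (hi a b l).const_mul _]
      refine Finset.sum_congr rfl fun a _ => ?_
      rw [integral_finsetSum _ fun b _ =>
        integrable_finsetSum _ fun l _ => (hi a b l).const_mul _]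
      refine Finset.sum_congr rfl fun b _ => ?_
      rw [integral_finsetSum _ fun l _ => (hi a b l).const_mul _, Finset.mul_sum]
      exact Finset.sum_congr rfl fun l _ => integral_const_mul _ _
  · exact integrable_finsetSum _ fun a _ => integrable_finsetSum _ fun l _ => hi a a l
  · exact (integrable_finsetSum _ fun a _ => integrable_finsetSum _ fun b _ =>
      integrable_finsetSum _ fun l _ => (hi a b l).const_mul _).const_mul _

include hd hm hmin in
/-- The Maxwell equation of the travelling wave. -/
theorem stationary_maxwell {η : Space → ℝ} (hη : VTest η) (k : Fin 3) :
    1 / P.c ^ 2 * ∑ a, ∑ b, P.v a * P.v b * pair (pdv a (pdv b η)) u.A k -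
        ∑ l, pair (pdv l (pdv l η)) u.A k =
      4 * Real.pi / P.c * (pair η (P.cur u) k -
        ∑ l, pair (pdv k (pdv l η)) (invLaplace (P.cur u)) l) := by
  -- The coordinates of the Helmholtz projection of `η eₖ`: the field itself minus the gradient of
  -- the Newtonian potential of its divergence.
  set b : Fin 3 → Space → ℝ := fun l x => (if l = k then η x else 0) - newt (pdv l (pdv k η)) x
    with hbdef
  set g : Fin 3 → Fin 3 → Space → ℝ := fun l i x =>
    (if l = k then pdv i η x else 0) - newt (pdv i (pdv l (pdv k η))) x with hgdef
  have hN : ∀ l, Adm 6 (newt (pdv l (pdv k η))) fun i => newt (pdv i (pdv l (pdv k η))) :=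
    fun l => newt_adm (hη.pdv k) l
  have hb : ∀ l, Adm 6 (b l) (g l) := fun l => by
    refine Adm.sub (by norm_num) ?_ (hN l)
    split_ifs
    · exact hη.adm 6
    · have h0 := (vtest_zero (F := ℝ)).adm 6
      have h1 : (pdv · fun _ : Space => (0 : ℝ)) = fun _ _ => 0 := by
        ext i x; simp [pdv]
      rwa [h1] at h0
  -- On the field side the gradient part drops out: interchanging derivatives moves the index `l`
  -- onto the potential, where the sum is `div A = 0`. Only `η eₖ` survives.
  have hT : ∀ a b, ∑ l, ∫ x, u.G a x l * g l b x = -(pair (pdv a (pdv b η)) u.A) k := by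
    intro a b
    have i1 : ∀ l, Integrable (fun x => u.G a x l * if l = k then pdv b η x else 0) volume := by
      intro l
      split_ifs
      · exact (coord_memLp (u.G2 a) l).integrable_mul ((hη.pdv b).memLp 2)
      · simp
    have i2 : ∀ l i j, Integrable (fun x => u.G i x l * newt (pdv j (pdv b (pdv k η))) x) volume :=
      fun l i j => (coord_memLp (u.G2 i) l).integrable_mul ((hN b).2.1 j)
    have e1 : ∀ l, ∫ x, u.G a x l * g l b x =
        (∫ x, u.G a x l * if l = k then pdv b η x else 0) -
          ∫ x, u.G l x l * newt (pdv a (pdv b (pdv k η))) x := fun l => by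
      rw [← u.hA.integral_mul_comm (hN b) a l l, ← integral_sub (i1 l) (i2 l a l)]
      refine integral_congr_ae (Eventually.of_forall fun x => ?_)
      simp only [hgdef, mul_sub]
      rw [pdv_comm (hη.pdv k).1 b l]
    have e2 : ∑ l, ∫ x, u.G l x l * newt (pdv a (pdv b (pdv k η))) x = 0 := by
      rw [← integral_finsetSum _ fun l _ => i2 l l a]
      refine integral_eq_zero_of_ae ?_
      filter_upwards [hd] with x hx
      rw [← Finset.sum_mul, hx, zero_mul]; rfl
    have e3 : ∑ l, (∫ x, u.G a x l * if l = k then pdv b η x else 0) =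
        ∫ x, u.G a x k * pdv b η x := by
      rw [Finset.sum_eq_single k (fun l _ hl => by simp [hl]) (by simp)]
      simp
    simp only [e1, Finset.sum_sub_distrib, e2, e3, sub_zero]
    rw [pair_weakDeriv (hη.pdv b) (u.hA.hasWeakDeriv (by norm_num) a), PiLp.neg_apply, neg_neg]
    rw [pair_apply (hη.pdv b) (li (u.G2 a))]
    exact integral_congr_ae (Eventually.of_forall fun x => mul_comm _ _)
  have hdiv : ∀ x, ∑ l, g l l x = 0 := fun x => by
    simp only [hgdef, Finset.sum_sub_distrib, sum_newt_pdv_pdv (hη.pdv k) x]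
    simp
  have h := P.potential_equation_coord hd hm hmin hb hdiv
  rw [P.fieldForm_coord u.G2 fun l i => (hb l).2.1 i] at h
  simp only [hT] at h
  have hJ := P.cur_integrable u
  have hJl : ∀ {φ : Space → ℝ}, VTest φ → ∀ l, Integrable (fun x => φ x * P.cur u x l) volume :=
    fun hφ l => by
      have := (EuclideanSpace.proj l : Space →L[ℝ] ℝ).integrable_comp
        (pair_integrable hφ hJ.locallyIntegrable)
      simpa using this
  have hNl : ∀ {φ : Space → ℝ}, VTest φ → ∀ l,
      Integrable (fun x => newt φ x * P.cur u x l) volume := fun hφ l => by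
    have := (EuclideanSpace.proj l : Space →L[ℝ] ℝ).integrable_comp (integrable_newt_smul hφ hJ)
    simpa using this
  -- On the side of the current the gradient part stays; symmetry of the Newtonian potential
  -- transfers it to the current and thus forms `P J`.
  have e5 : ∀ l, ∫ x, b l x * P.cur u x l = (if l = k then pair η (P.cur u) k else 0) -
      pair (pdv k (pdv l η)) (invLaplace (P.cur u)) l := fun l => by
    have e6 : pair (pdv k (pdv l η)) (invLaplace (P.cur u)) l =
        ∫ x, newt (pdv l (pdv k η)) x * P.cur u x l := by
      rw [pdv_comm hη.1, pair_invLaplace ((hη.pdv k).pdv l) hJ]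
      exact integral_apply_coord (integrable_newt_smul ((hη.pdv k).pdv l) hJ) l
    have e7 : (∫ x, (if l = k then η x else 0) * P.cur u x l) =
        if l = k then pair η (P.cur u) k else 0 := by
      split_ifs with hl
      · rw [hl, pair_apply hη hJ.locallyIntegrable]
      · simp
    have i3 : Integrable (fun x => (if l = k then η x else 0) * P.cur u x l) volume := by
      split_ifs
      · exact hJl hη l
      · simp
    rw [e6, ← e7, ← integral_sub i3 (hNl ((hη.pdv k).pdv l) l)]
    simp only [hbdef, sub_mul]
  simp only [e5, Finset.sum_sub_distrib, Finset.sum_ite_eq', Finset.mem_univ, if_true, mul_neg,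
    Finset.sum_neg_distrib] at h
  have hcc := P.hc.ne'
  have hpi := Real.pi_pos.ne'
  have h' : ∀ S T R : ℝ, 2 * (1 / (8 * Real.pi) * (-T - -(1 / P.c ^ 2 * S))) = 1 / P.c * R →
      1 / P.c ^ 2 * S - T = 4 * Real.pi / P.c * R := by
    intro S T R hh
    field_simp at hh ⊢
    linear_combination hh / 2
  exact h' _ _ _ h

end Params

/-! ### Test functions on space-time -/

section SpaceTimeTests

variable {X : Type*} [NormedAddCommGroup X] [NormedSpace ℝ X] {φ : X → ℝ}

theorem IsTest.pd (hφ : IsTest φ) (u : X) : IsTest (pd u φ) :=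
  ⟨(hφ.1.fderiv_right (m := (⊤ : ℕ∞)) (by simp)).clm_apply contDiff_const,
    hφ.2.fderiv_apply ℝ u⟩

theorem pd_comm (hφ : IsTest φ) (u w : X) : pd u (pd w φ) = pd w (pd u φ) := by
  ext1 x
  have hs : IsSymmSndFDerivAt ℝ φ x :=
    hφ.1.contDiffAt.isSymmSndFDerivAt (by
      rw [minSmoothness_of_isRCLikeNormedField]
      exact (WithTop.coe_le_coe.2 le_top : ((2 : ℕ∞) : WithTop ℕ∞) ≤ ((⊤ : ℕ∞) : WithTop ℕ∞)))
  have hd : DifferentiableAt ℝ (fderiv ℝ φ) x :=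
    (hφ.1.fderiv_right (m := (⊤ : ℕ∞)) (by simp)).differentiable (by simp) x
  have key : ∀ a b : X, pd a (pd b φ) x = fderiv ℝ (fderiv ℝ φ) x a b := by
    intro a b
    change fderiv ℝ (fun y => fderiv ℝ φ y b) x a = _
    rw [fderiv_clm_apply hd (differentiableAt_const _)]
    simp
  rw [key, key]
  exact hs _ _

/-- The shear `(t, x) ↦ (t, x + t v)`. -/
def shear (v : Space) : SpaceTime ≃L[ℝ] SpaceTime :=
  ContinuousLinearEquiv.equivOfInverse
    ((ContinuousLinearMap.fst ℝ ℝ Space).prod (ContinuousLinearMap.snd ℝ ℝ Space +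
      (ContinuousLinearMap.fst ℝ ℝ Space).smulRight v))
    ((ContinuousLinearMap.fst ℝ ℝ Space).prod (ContinuousLinearMap.snd ℝ ℝ Space -
      (ContinuousLinearMap.fst ℝ ℝ Space).smulRight v))
    (fun z => by ext1 <;> simp) (fun z => by ext1 <;> simp)

theorem shear_apply (v : Space) (z : SpaceTime) : shear v z = (z.1, z.2 + z.1 • v) := rfl

theorem shear_measurePreserving (v : Space) :
    MeasurePreserving (shear v) (volume : Measure SpaceTime) volume := by
  refine (MeasurePreserving.id (volume : Measure ℝ)).skew_product
    (g := fun t (x : Space) => x + t • v) ?_ (Eventually.of_forall fun t => ?_)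
  · exact (measurable_snd.add (measurable_fst.smul_const v))
  · exact (measurePreserving_add_right volume (t • v)).map_eq

/-- The restriction of a function on space-time to time `t` in the moving frame. -/
def slice (v : Space) (φ : SpaceTime → ℝ) (t : ℝ) (x : Space) : ℝ := φ (t, x + t • v)

variable {φ : SpaceTime → ℝ} {v : Space}

theorem IsTest.comp_shear (hφ : IsTest φ) (v : Space) : IsTest (φ ∘ shear v) :=
  ⟨hφ.1.comp (shear v).contDiff, hφ.2.comp_homeomorph (shear v).toHomeomorph⟩

theorem hasCompactSupport_space (hφ : HasCompactSupport φ) (t : ℝ) :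
    HasCompactSupport fun x => φ (t, x) :=
  hφ.comp_isClosedEmbedding (g := fun x : Space => (t, x)) ⟨isEmbedding_prodMkRight t, by
    rw [show Set.range (fun x : Space => (t, x)) = Prod.fst ⁻¹' {t} by ext ⟨a, b⟩; simp [eq_comm]]
    exact isClosed_singleton.preimage continuous_fst⟩

theorem hasCompactSupport_time (hφ : HasCompactSupport φ) (x : Space) :
    HasCompactSupport fun t => φ (t, x) :=
  hφ.comp_isClosedEmbedding (g := fun t : ℝ => (t, x)) ⟨isEmbedding_prodMkLeft x, by
    rw [show Set.range (fun t : ℝ => (t, x)) = Prod.snd ⁻¹' {x} by ext ⟨a, b⟩; simp [eq_comm]]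
    exact isClosed_singleton.preimage continuous_snd⟩

theorem IsTest.slice (hφ : IsTest φ) (v : Space) (t : ℝ) : VTest (slice v φ t) := by
  have h := hφ.comp_shear v
  have hc : ContDiff ℝ (⊤ : ℕ∞) fun x : Space => ((t, x) : SpaceTime) :=
    contDiff_const.prodMk contDiff_id
  exact ⟨h.1.comp hc, hasCompactSupport_space h.2 t⟩

theorem pdv_slice (hφ : IsTest φ) (t : ℝ) (k : Fin 3) :
    pdv k (slice v φ t) = slice v (pd (dirX k) φ) t := by
  ext1 x
  have h1 : HasFDerivAt (fun x : Space => ((t, x + t • v) : SpaceTime))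
      (ContinuousLinearMap.inr ℝ ℝ Space) x :=
    (hasFDerivAt_const (𝕜 := ℝ) t x).prodMk ((hasFDerivAt_id x).add_const (t • v))
  have h2 := ((hφ.1.differentiable (by simp) (t, x + t • v)).hasFDerivAt).comp x h1
  rw [pdv, show slice v φ t = φ ∘ fun x => (t, x + t • v) from rfl, h2.fderiv]
  rfl

end SpaceTimeTests

/-! ### Functions on space-time moving with constant velocity -/

section Boost

variable {𝕜 : Type*} [RCLike 𝕜] {F : Type*} [NormedAddCommGroup F] [NormedSpace ℝ F]
  [NormedSpace 𝕜 F] [IsScalarTower ℝ 𝕜 F]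

/-- The function `g`, moving with velocity `v` and multiplied with `θ(t)`. -/
def boost (v : Space) (θ : ℝ → 𝕜) (g : Space → F) (z : SpaceTime) : F :=
  θ z.1 • g (z.2 - z.1 • v)

theorem boost_one (v : Space) (g : Space → F) :
    boost v (fun _ => (1 : ℝ)) g = fun z : SpaceTime => g (z.2 - z.1 • v) := by
  ext1 z; simp [boost]

variable {v : Space} {θ θ' : ℝ → 𝕜} {g h : Space → F} {φ : SpaceTime → ℝ}

theorem locallyIntegrable_snd (hg : LocallyIntegrable g) :
    LocallyIntegrable fun z : SpaceTime => g z.2 := by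
  intro z
  obtain ⟨U, hU, hgU⟩ := hg z.2
  refine ⟨Metric.ball z.1 1 ×ˢ U, prod_mem_nhds (Metric.ball_mem_nhds _ one_pos) hU, ?_⟩
  have : IsFiniteMeasure (volume.restrict (Metric.ball z.1 1) : Measure ℝ) :=
    ⟨by simp⟩
  have h := Integrable.comp_snd hgU (volume.restrict (Metric.ball z.1 1) : Measure ℝ)
  rw [Measure.prod_restrict] at h
  exact h

theorem locallyIntegrable_prod_smul (hθ : Continuous θ) (hg : LocallyIntegrable g) :
    LocallyIntegrable fun z : SpaceTime => θ z.1 • g z.2 :=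
  (locallyIntegrable_snd hg).continuous_smul (hθ.comp continuous_fst)

theorem locallyIntegrable_boost (hθ : Continuous θ) (hg : LocallyIntegrable g) :
    LocallyIntegrable (boost v θ g) := by
  intro z
  obtain ⟨U, hU, hgU⟩ := locallyIntegrable_prod_smul hθ hg ((shear v).symm z)
  refine ⟨(shear v).symm ⁻¹' U, (shear v).symm.continuous.continuousAt.preimage_mem_nhds hU, ?_⟩
  have hmp : MeasurePreserving (shear v).symm (volume : Measure SpaceTime) volume :=
    (shear_measurePreserving v).symm (shear v).toHomeomorph.toMeasurableEquiv
  exact (hmp.integrableOn_comp_preimage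
    (shear v).symm.toHomeomorph.measurableEmbedding).2 hgU

theorem integrable_test_boost (hφ : IsTest φ) (hθ : Continuous θ) (hg : LocallyIntegrable g) :
    Integrable (fun z => φ z • boost v θ g z) volume :=
  (locallyIntegrable_boost hθ hg).integrable_smul_left_of_hasCompactSupport hφ.1.continuous hφ.2

theorem integral_boost_eq_shear (v : Space) (θ : ℝ → 𝕜) (φ : SpaceTime → ℝ) (g : Space → F) :
    ∫ z, φ z • boost v θ g z = ∫ z : SpaceTime, φ (shear v z) • θ z.1 • g z.2 := by
  rw [← (shear_measurePreserving v).integral_comp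
    (shear v).toHomeomorph.measurableEmbedding]
  refine integral_congr_ae (Eventually.of_forall fun z => ?_)
  simp [boost, shear_apply]

/-- `f` is integrable with integral `a`. -/
def HasInt {F : Type*} [NormedAddCommGroup F] [NormedSpace ℝ F] (f : ℝ → F) (a : F) : Prop :=
  Integrable f volume ∧ ∫ t, f t = a

/-- After the measure preserving shear, Fubini writes the space-time pairing as a time integral of
pairings with the fixed profile. Each slice of the test function is a test function on space, so
stationary identities apply for every `t`. -/
theorem hasInt_boost (hφ : IsTest φ) (hθ : Continuous θ) (hg : LocallyIntegrable g) :
    HasInt (fun t => θ t • pair (slice v φ t) g) (∫ z, φ z • boost v θ g z) := by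
  have hi : Integrable (fun z : SpaceTime => φ (shear v z) • θ z.1 • g z.2)
      ((volume : Measure ℝ).prod (volume : Measure Space)) :=
    (locallyIntegrable_prod_smul hθ hg).integrable_smul_left_of_hasCompactSupport
      (hφ.comp_shear v).1.continuous (hφ.comp_shear v).2
  have e1 : ∀ t, ∫ x, φ (shear v (t, x)) • θ t • g x = θ t • pair (slice v φ t) g := fun t => by
    simp only [pair, slice, shear_apply, smul_comm _ (θ t), integral_smul]
  refine ⟨?_, ?_⟩
  · simpa only [e1] using hi.integral_prod_left
  · rw [integral_boost_eq_shear, Measure.volume_eq_prod, integral_prod _ hi]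
    simp only [e1]

/-- With the time integral innermost, `g` is a constant at each point, so no regularity of the
profile is needed. -/
theorem integral_pd_dirT_prod {Φ : SpaceTime → ℝ} (hΦ : IsTest Φ)
    (hθ : ∀ t, HasDerivAt θ (θ' t) t) (hθ' : Continuous θ') (hg : LocallyIntegrable g) :
    ∫ z : SpaceTime, pd dirT Φ z • θ z.1 • g z.2 = -∫ z : SpaceTime, Φ z • θ' z.1 • g z.2 := by
  have hθc : Continuous θ := continuous_iff_continuousAt.2 fun t => (hθ t).continuousAt
  have i1 := (locallyIntegrable_prod_smul hθc hg).integrable_smul_left_of_hasCompactSupport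
    (hΦ.pd dirT).1.continuous (hΦ.pd dirT).2
  have i2 := (locallyIntegrable_prod_smul hθ' hg).integrable_smul_left_of_hasCompactSupport
    hΦ.1.continuous hΦ.2
  rw [Measure.volume_eq_prod] at i1 i2 ⊢
  rw [integral_prod_symm _ i1, integral_prod_symm _ i2, ← integral_neg]
  refine integral_congr_ae (Eventually.of_forall fun x => ?_)
  have hcs : ∀ {χ : SpaceTime → ℝ}, IsTest χ → HasCompactSupport fun t => χ (t, x) := fun hχ =>
    hasCompactSupport_time hχ.2 x
  have hct : ∀ {χ : SpaceTime → ℝ}, IsTest χ → Continuous fun t => χ (t, x) := fun hχ =>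
    hχ.1.continuous.comp (continuous_id.prodMk continuous_const)
  have hd : ∀ t, HasDerivAt (fun t => Φ (t, x) • θ t • g x)
      (Φ (t, x) • θ' t • g x + pd dirT Φ (t, x) • θ t • g x) t := fun t => by
    have h1 : HasDerivAt (fun t : ℝ => ((t, x) : SpaceTime)) dirT t :=
      (hasDerivAt_id t).prodMk (hasDerivAt_const t x)
    have h2 : HasDerivAt (fun t => Φ (t, x)) (pd dirT Φ (t, x)) t :=
      ((hΦ.1.differentiable (by simp) (t, x)).hasFDerivAt).comp_hasDerivAt t h1
    exact h2.smul ((hθ t).smul_const (g x))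
  have j1 : Integrable (fun t => Φ (t, x) • θ' t • g x) volume :=
    ((hct hΦ).smul (hθ'.smul continuous_const)).integrable_of_hasCompactSupport
      (hcs hΦ).smul_right
  have j2 : Integrable (fun t => pd dirT Φ (t, x) • θ t • g x) volume :=
    ((hct (hΦ.pd dirT)).smul (hθc.smul continuous_const)).integrable_of_hasCompactSupport
      (hcs (hΦ.pd dirT)).smul_right
  have j3 : Integrable (fun t => Φ (t, x) • θ t • g x) volume :=
    ((hct hΦ).smul (hθc.smul continuous_const)).integrable_of_hasCompactSupport
      (hcs hΦ).smul_right
  have := integral_eq_zero_of_hasDerivAt_of_integrable hd (j1.add j2) j3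
  rw [integral_add j1 j2] at this
  exact eq_neg_of_add_eq_zero_right this

/-- Integration by parts in time. -/
theorem integral_pd_dirT_boost (hφ : IsTest φ) (hθ : ∀ t, HasDerivAt θ (θ' t) t)
    (hθ' : Continuous θ') (hg : LocallyIntegrable g) :
    ∫ z, pd dirT φ z • boost v θ g z = -(∫ z, φ z • boost v θ' g z) -
      ∑ k, v k • ∫ z, pd (dirX k) φ z • boost v θ g z := by
  have hθc : Continuous θ := continuous_iff_continuousAt.2 fun t => (hθ t).continuousAt
  set Φ := φ ∘ shear v
  have hΦ : IsTest Φ := hφ.comp_shear v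
  -- By the chain rule, the time derivative in sheared coordinates is `∂ₜ + v·∇`.
  have e1 : ∀ z, pd dirT Φ z = pd dirT φ (shear v z) + ∑ k, v k * pd (dirX k) φ (shear v z) := by
    intro z
    have h1 := ((hφ.1.differentiable (by simp) (shear v z)).hasFDerivAt).comp z
      (shear v).hasFDerivAt
    have h2 : shear v dirT = dirT + ∑ k, v k • dirX k := by
      rw [shear_apply]
      ext1
      · simp [dirT, dirX, Prod.fst_sum]
      · simp only [dirT, dirX, Prod.snd_add, Prod.snd_sum, Prod.smul_snd, zero_add, one_smul]
        exact space_eq_sum v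
    simp only [pd, Φ, h1.fderiv, ContinuousLinearMap.comp_apply]
    erw [h2]
    simp [map_add, map_sum]
  have e2 : ∫ z : SpaceTime, pd dirT Φ z • θ z.1 • g z.2 = -∫ z : SpaceTime, Φ z • θ' z.1 • g z.2 :=
    integral_pd_dirT_prod hΦ hθ hθ' hg
  have i3 : ∀ {χ : SpaceTime → ℝ}, IsTest χ →
      Integrable (fun z : SpaceTime => χ (shear v z) • θ z.1 • g z.2) volume := fun hχ =>
    (locallyIntegrable_prod_smul hθc hg).integrable_smul_left_of_hasCompactSupport
      (hχ.comp_shear v).1.continuous (hχ.comp_shear v).2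
  simp only [integral_boost_eq_shear]
  simp only [e1, add_smul, Finset.sum_smul, mul_smul] at e2
  have i4 : ∀ k, Integrable (fun z : SpaceTime =>
      v k • pd (dirX k) φ (shear v z) • θ z.1 • g z.2) volume := fun k =>
    (i3 (hφ.pd (dirX k))).smul (v k)
  rw [integral_add (i3 (hφ.pd dirT)) (integrable_finsetSum _ fun k _ => i4 k),
    integral_finsetSum _ fun k _ => i4 k] at e2
  simp only [integral_smul] at e2
  rw [eq_sub_iff_add_eq]
  exact e2

theorem boost_hasWeakDeriv {k : Fin 3} (hθ : Continuous θ) (hgh : HasWeakDeriv (e k) g h) :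
    HasWeakDeriv (dirX k) (boost v θ g) (boost v θ h) := by
  refine ⟨locallyIntegrable_boost hθ hgh.1, locallyIntegrable_boost hθ hgh.2.1, fun φ hφ => ?_⟩
  rw [← (hasInt_boost (hφ.pd (dirX k)) hθ hgh.1).2, ← (hasInt_boost hφ hθ hgh.2.1).2,
    ← integral_neg]
  refine integral_congr_ae (Eventually.of_forall fun t => ?_)
  simp only
  rw [← pdv_slice hφ, pair_weakDeriv (hφ.slice v t) hgh, smul_neg]

end Boost

section HasInt

variable {F F' : Type*} [NormedAddCommGroup F] [NormedSpace ℝ F] [NormedAddCommGroup F']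
  [NormedSpace ℝ F'] {f g : ℝ → F} {a b : F}

/-- Carries an identity that holds on every time slice over to the space-time integrals. -/
theorem HasInt.unique (hf : HasInt f a) (hg : HasInt g b) (h : ∀ t, f t = g t) : a = b := by
  rw [← hf.2, ← hg.2]; simp only [h]

theorem HasInt.add (hf : HasInt f a) (hg : HasInt g b) : HasInt (fun t => f t + g t) (a + b) :=
  ⟨hf.1.add hg.1, by rw [integral_add hf.1 hg.1, hf.2, hg.2]⟩

theorem HasInt.sub (hf : HasInt f a) (hg : HasInt g b) : HasInt (fun t => f t - g t) (a - b) :=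
  ⟨hf.1.sub hg.1, by rw [integral_sub hf.1 hg.1, hf.2, hg.2]⟩

theorem HasInt.neg (hf : HasInt f a) : HasInt (fun t => -f t) (-a) :=
  ⟨hf.1.neg, by rw [integral_neg, hf.2]⟩

theorem HasInt.smul {𝕜 : Type*} [RCLike 𝕜] [NormedSpace 𝕜 F] [IsScalarTower ℝ 𝕜 F] (c : 𝕜)
    (hf : HasInt f a) : HasInt (fun t => c • f t) (c • a) :=
  ⟨hf.1.smul c, by rw [integral_smul, hf.2]⟩

theorem HasInt.sum {ι : Type*} (s : Finset ι) {f : ι → ℝ → F} {a : ι → F}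
    (hf : ∀ i, HasInt (f i) (a i)) : HasInt (fun t => ∑ i ∈ s, f i t) (∑ i ∈ s, a i) :=
  ⟨integrable_finsetSum _ fun i _ => (hf i).1, by
    rw [integral_finsetSum _ fun i _ => (hf i).1]; simp only [(hf _).2]⟩

theorem HasInt.clm [CompleteSpace F] [CompleteSpace F'] (L : F →L[ℝ] F') (hf : HasInt f a) :
    HasInt (fun t => L (f t)) (L a) :=
  ⟨L.integrable_comp hf.1, by rw [L.integral_comp_comm hf.1, hf.2]⟩

end HasInt

/-! ### Travelling waves -/

section Phase

theorem act_smul (M : Matrix (Fin 2) (Fin 2) ℂ) (z : ℂ) (w : Spinor) :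
    act M (z • w) = z • act M w := by
  simp only [act, WithLp.ofLp_smul, Matrix.mulVec_smul, WithLp.toLp_smul]

theorem cov_smul (ħ c Q : ℝ) (j : Model) (z : ℂ) (w : Spinor) (Dw : Fin 3 → Spinor) (a : Space)
    (k : Fin 3) : cov ħ c Q j (z • w) (fun l => z • Dw l) a k = z • cov ħ c Q j w Dw a k := by
  have h : ∀ l, covS ħ c Q (z • w) (fun l => z • Dw l) a l = z • covS ħ c Q w Dw a l := fun l => by
    simp only [covS, smul_add, smul_comm z]
  cases j
  · exact h k
  · simp only [cov, covP, h, act_smul, ← Finset.smul_sum]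

/-- The oscillating phase drops out of the current, so the source of the Maxwell equation is a
translated fixed profile. -/
theorem current_smul (ħ c m Q : ℝ) (j : Model) {z : ℂ} (hz : ‖z‖ = 1) (w : Spinor)
    (Dw : Fin 3 → Spinor) (a : Space) :
    current ħ c m Q j (z • w) (fun l => z • Dw l) a = current ħ c m Q j w Dw a := by
  have h : ∀ a b : Spinor, inner ℂ (z • a) (z • b) = inner ℂ a b := fun a b => by
    rw [inner_smul_left, inner_smul_right, ← mul_assoc, RCLike.conj_mul, hz]; simp
  simp only [current, cov_smul, h]

/-- The phase `e^{-iωt}`. -/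
def phase (ω t : ℝ) : ℂ := Complex.exp (-Complex.I * ((ω * t : ℝ) : ℂ))

theorem phase_hasDerivAt (ω t : ℝ) : HasDerivAt (phase ω) (-(Complex.I * ω) * phase ω t) t := by
  have h1 : HasDerivAt (fun t : ℝ => -Complex.I * ((ω * t : ℝ) : ℂ)) (-Complex.I * ω) t := by
    have := ((hasDerivAt_id t).const_mul ω).ofReal_comp.const_mul (-Complex.I)
    simpa using this
  refine h1.cexp.congr_deriv ?_
  rw [phase]; ring

theorem phase_continuous (ω : ℝ) : Continuous (phase ω) := by
  unfold phase; fun_prop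

theorem norm_phase (ω t : ℝ) : ‖phase ω t‖ = 1 := by
  rw [phase, Complex.norm_exp]; simp

end Phase

theorem invLaplace_translate (J : Space → Space) (a x : Space) :
    invLaplace (fun y => J (y - a)) x = invLaplace J (x - a) := by
  simp only [invLaplace]
  rw [← integral_add_right_eq_self _ a]
  simp only [add_sub_cancel_right, sub_add_eq_sub_sub, sub_right_comm x _ a]

/-- Translation invariance makes the field energy of a travelling wave independent of time, so in
the spinor equation it acts as a constant and is absorbed into the frequency. -/
theorem fieldEnergy_translate (c : ℝ) (DA : Fin 3 → Space → Space) (dtA : Space → Space)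
    (a : Space) : fieldEnergy c (fun k y => DA k (y - a)) (fun y => dtA (y - a)) =
      fieldEnergy c DA dtA := by
  simp only [fieldEnergy]
  rw [integral_sub_right_eq_self
    (fun y => ‖curl fun k => DA k y‖ ^ 2 + ‖c⁻¹ • dtA y‖ ^ 2) a]

theorem curl_memLp {G : Fin 3 → Space → Space} (hG : ∀ k, MemLp (G k) 2 volume) :
    MemLp (fun x => curl fun k => G k x) 2 volume := by
  have h : ∀ a b i j, MemLp (fun x => G a x i - G b x j) 2 volume := fun a b i j =>
    (Params.coord_memLp (hG a) i).sub (Params.coord_memLp (hG b) j)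
  rw [memLp_piLp_iff]
  intro i
  fin_cases i
  · exact h 1 2 2 1
  · exact h 2 0 0 2
  · exact h 0 1 1 0

theorem Adm.memH1 {f : Space → Spinor} {G : Fin 3 → Space → Spinor} (h : Adm 2 f G) : MemH1 f :=
  ⟨h.1, G, fun k => ⟨h.hasWeakDeriv (by norm_num) k, h.2.1 k⟩⟩

theorem Adm.memD1 {f : Space → Space} {G : Fin 3 → Space → Space} (h : Adm 6 f G) : MemD1 f := by
  refine ⟨h.1.locallyIntegrable (by norm_num), fun t ht => ?_,
    G, fun k => ⟨h.hasWeakDeriv (by norm_num) k, h.2.1 k⟩⟩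
  refine lt_of_le_of_lt (measure_mono fun x hx => ?_)
    (h.1.meas_ge_lt_top (by norm_num) (by norm_num) (ε := t.toNNReal) (by simpa using ht))
  rw [Set.mem_ofPred_eq, ← NNReal.coe_le_coe, Real.coe_toNNReal _ ht.le, coe_nnnorm]
  exact le_of_lt hx

/-! ### The equations in space-time -/

namespace Params

variable (P : Params) (u : Conf)

theorem A_li : LocallyIntegrable u.A := u.A6.locallyIntegrable (by norm_num)

theorem spacetime_integral_apply {f : SpaceTime → Space} (hf : Integrable f volume) (k : Fin 3) :
    ∫ z, f z k = (∫ z, f z) k :=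
  (EuclideanSpace.proj k : Space →L[ℝ] ℝ).integral_comp_comm hf

theorem integral_test_boost_apply {φ : SpaceTime → ℝ} (hφ : IsTest φ) {g : Space → Space}
    (hg : LocallyIntegrable g) (v : Space) (k : Fin 3) :
    ∫ z : SpaceTime, φ z * g (z.2 - z.1 • v) k =
      (∫ z, φ z • boost v (fun _ => (1 : ℝ)) g z) k := by
  rw [← spacetime_integral_apply (integrable_test_boost hφ continuous_const hg)]
  simp [boost]

theorem integral_pd_dirT_boost_one {φ : SpaceTime → ℝ} (hφ : IsTest φ) {g : Space → Space}
    (hg : LocallyIntegrable g) (v : Space) :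
    ∫ z, pd dirT φ z • boost v (fun _ => (1 : ℝ)) g z =
      -∑ k, v k • ∫ z, pd (dirX k) φ z • boost v (fun _ => (1 : ℝ)) g z := by
  have h := integral_pd_dirT_boost (v := v) (θ := fun _ => (1 : ℝ)) (θ' := fun _ => 0) hφ
    (fun t => hasDerivAt_const t 1) continuous_const hg
  have h0 : ∀ z, boost v (fun _ => (0 : ℝ)) g z = 0 := fun z => by simp [boost]
  simpa only [h0, smul_zero, integral_zero, neg_zero, zero_sub] using h

theorem boost_hasWeakDeriv_dirT {g : Space → Space} {h : Fin 3 → Space → Space}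
    (hgh : ∀ k, HasWeakDeriv (e k) g (h k)) (v : Space) :
    HasWeakDeriv dirT (fun z : SpaceTime => g (z.2 - z.1 • v))
      (fun z : SpaceTime => -∑ k, v k • h k (z.2 - z.1 • v)) := by
  have h1 : Continuous fun _ : ℝ => (1 : ℝ) := continuous_const
  have hw := fun k => boost_hasWeakDeriv (v := v) h1 (hgh k)
  rw [← boost_one]
  have e1 : (fun z : SpaceTime => -∑ k, v k • h k (z.2 - z.1 • v)) =
      fun z => -∑ k, v k • boost v (fun _ => (1 : ℝ)) (h k) z := by simp only [boost_one]
  rw [e1]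
  refine ⟨locallyIntegrable_boost h1 (hgh 0).1, ?_, fun φ hφ => ?_⟩
  · refine LocallyIntegrable.neg ?_
    exact locallyIntegrable_finsetSum _ fun k _ => (hw k).2.1.smul (v k)
  · rw [integral_pd_dirT_boost_one hφ (hgh 0).1, ← integral_neg]
    simp only [(hw _).2.2 φ hφ, smul_neg, Finset.sum_neg_distrib, neg_neg, Finset.smul_sum,
      smul_comm (φ _)]
    have hi : ∀ k, Integrable (fun z => v k • φ z • boost v (fun _ => (1 : ℝ)) (h k) z) volume :=
      fun k => (integrable_test_boost hφ h1 (hgh k).2.1).smul (v k)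
    rw [integral_finsetSum _ fun k _ => hi k]
    simp only [integral_smul]

variable {u}

/-- The equation for the spinor field in space-time. -/
theorem spacetime_spinor {ν : ℝ}
    (hν : ∀ (χ : Space → Spinor) (E : Fin 3 → Space → Spinor) (h : Adm 2 χ E),
      1 / (2 * P.m) * kin P.j (P.cd u) (P.cd (u.withSpinor h)) -
        P.Q / P.c * (∫ x, inner ℝ P.v (u.A x) * inner ℝ (u.ψ x) (χ x)) =
      ν * ∫ x, inner ℝ (u.ψ x) (χ x)) {ω E : ℝ} (hω : P.ħ * ω = ν - P.m * ‖P.v‖ ^ 2 / 2 + E)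
    {φ : SpaceTime → ℝ} (hφ : IsTest φ) :
    -((Complex.I * (P.ħ : ℂ)) • ∫ z, pd dirT φ z • boost P.v (phase ω) u.ψ z) =
      ((1 / (2 * P.m) : ℝ) : ℂ) •
        ∑ k, (-((Complex.I * (P.ħ : ℂ)) • ∫ z, pd (dirX k) φ z • boost P.v (phase ω) (P.covK u k) z)
          + ((P.Q / P.c : ℝ) : ℂ) •
            ∫ z, φ z • boost P.v (phase ω) (fun x => u.A x k • P.covK u k x) z)
      + E • ∫ z, φ z • boost P.v (phase ω) u.ψ z := by
  have hθ := phase_continuous ω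
  have hb : ∀ {χ : SpaceTime → ℝ} {g : Space → Spinor}, IsTest χ → LocallyIntegrable g →
      HasInt (fun t => phase ω t • pair (slice P.v χ t) g) (∫ z, χ z • boost P.v (phase ω) g z) :=
    fun hχ hg => hasInt_boost hχ hθ hg
  have hψ := li u.ψ2
  have hK := fun k => li (P.covK_memLp u k)
  have hAK := fun k => locallyIntegrable_coord_smul u.A6 (P.covK_memLp u k) k
  have hL := HasInt.smul (1 / (2 * P.m)) (HasInt.sum Finset.univ fun k =>
    ((hb (hφ.pd (dirX k)) (hK k)).smul Complex.I |>.smul P.ħ).neg.add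
      ((hb hφ (hAK k)).smul (P.Q / P.c)))
  have hR := ((hb hφ hψ).smul (ν - P.m * ‖P.v‖ ^ 2 / 2)).add
    (((HasInt.sum Finset.univ fun k => (hb (hφ.pd (dirX k)) hψ).smul (P.v k)).smul
      Complex.I).smul P.ħ)
  -- On each slice the integrands are the two sides of `stationary_spinor`, multiplied by the phase.
  have key := hL.unique hR fun t => by
    have h := congrArg (phase ω t • ·) (P.stationary_spinor hν (hφ.slice P.v t))
    simp only [pdv_slice hφ] at h
    simpa only [smul_add, smul_neg, Finset.smul_sum, smul_comm (phase ω t)] using h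
  have hT := integral_pd_dirT_boost (v := P.v) (θ := phase ω) (g := u.ψ) hφ (phase_hasDerivAt ω)
    (continuous_const.mul hθ) hψ
  have e1 : ∫ z, φ z • boost P.v (fun t => -(Complex.I * ω) * phase ω t) u.ψ z =
      -(Complex.I * ω) • ∫ z, φ z • boost P.v (phase ω) u.ψ z := by
    rw [← integral_smul]
    simp only [boost, mul_smul, smul_comm (φ _)]
  rw [e1] at hT
  rw [hT]
  simp only [← Complex.coe_smul] at key ⊢
  have hω' : (P.ħ : ℂ) * ω = ((ν - P.m * ‖P.v‖ ^ 2 / 2 : ℝ) : ℂ) + E := by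
    rw [← Complex.ofReal_mul, hω, Complex.ofReal_add]
  simp only [mul_comm Complex.I (P.ħ : ℂ), mul_smul] at key ⊢
  rw [key]
  generalize ∑ k, ((P.v k : ℝ) : ℂ) • ∫ z, pd (dirX k) φ z • boost P.v (phase ω) u.ψ z = S
  generalize ∫ z, φ z • boost P.v (phase ω) u.ψ z = a
  have h1 : -((P.ħ : ℂ) • Complex.I • (-(-(Complex.I * (ω : ℂ)) • a) - S)) =
      (-(Complex.I * Complex.I) * (P.ħ * ω)) • a + (P.ħ : ℂ) • Complex.I • S := by module
  have h2 := h1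
  rw [Complex.I_mul_I, hω'] at h2
  linear_combination (norm := module) h2

/-- The Maxwell equation in space-time. -/
theorem spacetime_maxwell {lam : ℝ} (hd : u.DivFree) (hm : u.mass = lam)
    (hmin : ∀ w : Conf, w.DivFree → w.mass = lam → P.energy u ≤ P.energy w) (k : Fin 3)
    {φ : SpaceTime → ℝ} (hφ : IsTest φ) :
    ∫ z : SpaceTime, (1 / P.c ^ 2 * pd dirT (pd dirT φ) z -
        ∑ l, pd (dirX l) (pd (dirX l) φ) z) * u.A (z.2 - z.1 • P.v) k =
      4 * Real.pi / P.c * ((∫ z : SpaceTime, φ z * P.cur u (z.2 - z.1 • P.v) k) -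
        ∑ l, ∫ z : SpaceTime, pd (dirX k) (pd (dirX l) φ) z *
          invLaplace (P.cur u) (z.2 - z.1 • P.v) l) := by
  have hA := A_li u
  have hJ := P.cur_integrable u
  have hN := locallyIntegrable_invLaplace hJ
  set I : (SpaceTime → ℝ) → (Space → Space) → Space :=
    fun χ g => ∫ z, χ z • boost P.v (fun _ => (1 : ℝ)) g z with hI
  have hb : ∀ {χ : SpaceTime → ℝ} {g : Space → Space}, IsTest χ → LocallyIntegrable g → ∀ k,
      HasInt (fun t => pair (slice P.v χ t) g k) (I χ g k) := fun hχ hg k => by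
    have := (hasInt_boost (v := P.v) (θ := fun _ => (1 : ℝ)) hχ continuous_const hg).clm
      (EuclideanSpace.proj k : Space →L[ℝ] ℝ)
    simp only [one_smul] at this
    exact this
  have hT : ∀ {χ : SpaceTime → ℝ}, IsTest χ →
      I (pd dirT χ) u.A = -∑ a, P.v a • I (pd (dirX a) χ) u.A := fun hχ =>
    integral_pd_dirT_boost_one hχ hA P.v
  -- Against a rigidly moving field each time derivative of the test function acts as `-v·∇`, so two
  -- of them give `(v·∇)²`.
  have hTT : I (pd dirT (pd dirT φ)) u.A k =
      ∑ a, ∑ b, P.v a * P.v b * I (pd (dirX a) (pd (dirX b) φ)) u.A k := by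
    rw [hT (hφ.pd dirT)]
    have h1 : ∀ a, I (pd (dirX a) (pd dirT φ)) u.A =
        -∑ b, P.v b • I (pd (dirX a) (pd (dirX b) φ)) u.A := fun a => by
      rw [pd_comm hφ, hT (hφ.pd (dirX a))]
      simp only [pd_comm hφ (dirX a)]
    simp only [h1, smul_neg, Finset.sum_neg_distrib, neg_neg, Finset.smul_sum, smul_smul]
    simp
  have hS := ((HasInt.sum Finset.univ fun a => HasInt.sum Finset.univ fun b =>
    (hb ((hφ.pd (dirX b)).pd (dirX a)) hA k).smul (P.v a * P.v b)).smul (1 / P.c ^ 2)).sub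
      (HasInt.sum Finset.univ fun l => hb ((hφ.pd (dirX l)).pd (dirX l)) hA k)
  have hR := ((hb hφ hJ.locallyIntegrable k).sub (HasInt.sum Finset.univ fun l =>
    hb ((hφ.pd (dirX l)).pd (dirX k)) hN l)).smul (4 * Real.pi / P.c)
  have key := hS.unique hR fun t => by
    have h := P.stationary_maxwell hd hm hmin (hφ.slice P.v t) k
    simpa only [pdv_slice hφ, pdv_slice (hφ.pd _), smul_eq_mul] using h
  simp only [integral_test_boost_apply hφ hJ.locallyIntegrable,
    integral_test_boost_apply ((hφ.pd (dirX _)).pd (dirX k)) hN]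
  simp only [smul_eq_mul] at key
  rw [← hTT] at key
  refine Eq.trans ?_ key
  have i1 : ∀ {χ : SpaceTime → ℝ}, IsTest χ →
      Integrable (fun z : SpaceTime => χ z * u.A (z.2 - z.1 • P.v) k) volume := fun hχ => by
    have := (EuclideanSpace.proj k : Space →L[ℝ] ℝ).integrable_comp
      (integrable_test_boost (v := P.v) (θ := fun _ => (1 : ℝ)) hχ continuous_const hA)
    simpa [boost] using this
  simp only [sub_mul, Finset.sum_mul, mul_assoc (1 / P.c ^ 2)]
  rw [integral_sub ((i1 ((hφ.pd dirT).pd dirT)).const_mul _)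
    (integrable_finsetSum _ fun l _ => i1 ((hφ.pd (dirX l)).pd (dirX l))), integral_const_mul,
    integral_finsetSum _ fun l _ => i1 ((hφ.pd (dirX l)).pd (dirX l)),
    integral_test_boost_apply ((hφ.pd dirT).pd dirT) hA]
  simp only [integral_test_boost_apply ((hφ.pd (dirX _)).pd (dirX _)) hA, hI]

/-- The Coulomb gauge condition in space-time. -/
theorem spacetime_gauge (hd : u.DivFree) (v : Space) {φ : SpaceTime → ℝ} (hφ : IsTest φ) :
    ∑ k, ∫ z : SpaceTime, pd (dirX k) φ z * u.A (z.2 - z.1 • v) k = 0 := by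
  have hG := fun k => li (u.G2 k)
  simp only [integral_test_boost_apply (hφ.pd (dirX _)) (A_li u)]
  have h1 : ∀ k, (∫ z, pd (dirX k) φ z • boost v (fun _ => (1 : ℝ)) u.A z) =
      -∫ z, φ z • boost v (fun _ => (1 : ℝ)) (u.G k) z := fun k =>
    (boost_hasWeakDeriv (v := v) (θ := fun _ => (1 : ℝ)) continuous_const
      (u.hA.hasWeakDeriv (by norm_num) k)).2.2 φ hφ
  have h2 := HasInt.sum Finset.univ fun k => ((hasInt_boost (v := v) (θ := fun _ => (1 : ℝ)) hφ
    continuous_const (hG k)).clm (EuclideanSpace.proj k : Space →L[ℝ] ℝ)).neg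
  have h3 : HasInt (fun _ => 0 : ℝ → ℝ) 0 := ⟨integrable_zero _ _ _, integral_zero _ _⟩
  have key := h2.unique h3 fun t => by
    simp only [one_smul, Finset.sum_neg_distrib, neg_eq_zero]
    have h4 : ∀ k, (EuclideanSpace.proj k : Space →L[ℝ] ℝ) (pair (slice v φ t) (u.G k)) =
        ∫ x, slice v φ t x * u.G k x k := fun k => pair_apply (hφ.slice v t) (hG k) k
    have h5 : ∀ k, Integrable (fun x => slice v φ t x * u.G k x k) volume := fun k =>
      (EuclideanSpace.proj k : Space →L[ℝ] ℝ).integrable_comp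
        (pair_integrable (hφ.slice v t) (hG k))
    simp only [h4]
    rw [← integral_finsetSum _ fun k _ => h5 k]
    refine integral_eq_zero_of_ae ?_
    filter_upwards [hd] with x hx
    rw [← Finset.mul_sum, hx, mul_zero]; rfl
  simp only [h1]
  exact key

/-- Minimizers of the energy give travelling wave solutions. -/
theorem isSolution {lam : ℝ} (hd : u.DivFree) (hm : u.mass = lam)
    (hmin : ∀ w : Conf, w.DivFree → w.mass = lam → P.energy u ≤ P.energy w) {ν : ℝ}
    (hν : ∀ (χ : Space → Spinor) (E : Fin 3 → Space → Spinor) (h : Adm 2 χ E),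
      1 / (2 * P.m) * kin P.j (P.cd u) (P.cd (u.withSpinor h)) -
        P.Q / P.c * (∫ x, inner ℝ P.v (u.A x) * inner ℝ (u.ψ x) (χ x)) =
      ν * ∫ x, inner ℝ (u.ψ x) (χ x)) {ω E : ℝ} (hω : P.ħ * ω = ν - P.m * ‖P.v‖ ^ 2 / 2 + E)
    (hE : fieldEnergy P.c u.G (fun y => -∑ k, P.v k • u.G k y) = E) :
    IsSolution P.ħ P.c P.m P.Q P.j (fun t x => phase ω t • u.ψ (x - t • P.v))
      (fun t x => u.A (x - t • P.v)) := by
  have hθ := phase_continuous ω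
  have h1 : Continuous fun _ : ℝ => (1 : ℝ) := continuous_const
  have hTm : MemLp (fun y => -∑ k, P.v k • u.G k y) 2 volume := (sum_smul_memLp u.G2 P.v).neg
  have hJ := P.cur_integrable u
  have hK := fun k => li (P.covK_memLp u k)
  have hψ := li u.ψ2
  have eK : ∀ k t x, cov P.ħ P.c P.Q P.j (phase ω t • u.ψ (x - t • P.v))
      (fun l => phase ω t • u.D l (x - t • P.v)) (u.A (x - t • P.v)) k =
      phase ω t • P.covK u k (x - t • P.v) := fun k t x => by rw [cov_smul, cov_eq]
  have eJ : ∀ t x, current P.ħ P.c P.m P.Q P.j (phase ω t • u.ψ (x - t • P.v))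
      (fun l => phase ω t • u.D l (x - t • P.v)) (u.A (x - t • P.v)) =
      P.cur u (x - t • P.v) := fun t x => by rw [current_smul _ _ _ _ _ (norm_phase ω t), current_eq]
  have eE : ∀ t : ℝ, fieldEnergy P.c (fun k x => u.G k (x - t • P.v))
      (fun x => -∑ k, P.v k • u.G k (x - t • P.v)) = E := fun t => by
    rw [← hE, ← fieldEnergy_translate P.c u.G (fun y => -∑ k, P.v k • u.G k y) (t • P.v)]
  have eN : ∀ (t : ℝ) x, invLaplace (fun y => P.cur u (y - t • P.v)) x =
      invLaplace (P.cur u) (x - t • P.v) := fun t x => invLaplace_translate _ _ _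
  have hb : ∀ {g : Space → Space}, LocallyIntegrable g →
      LocallyIntegrable fun z : SpaceTime => g (z.2 - z.1 • P.v) := fun hg => by
    rw [← boost_one]; exact locallyIntegrable_boost h1 hg
  have hAK : ∀ k, (fun z : SpaceTime => u.A (z.2 - z.1 • P.v) k •
      phase ω z.1 • P.covK u k (z.2 - z.1 • P.v)) =
      boost P.v (phase ω) fun x => u.A x k • P.covK u k x := fun k => by
    ext1 z; simp only [boost, smul_comm (phase ω z.1)]
  unfold IsSolution
  refine ⟨fun k t x => phase ω t • u.D k (x - t • P.v), fun k t x => u.G k (x - t • P.v),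
    fun t x => -∑ k, P.v k • u.G k (x - t • P.v), ?_⟩
  simp only [eK, eJ, eE, eN, helmholtzPairing]
  refine ⟨fun k => ?_, fun k => ?_, ?_, Eventually.of_forall fun t => ⟨?_, ?_⟩, ?_, fun k => ?_,
    fun k => ?_, ?_, Eventually.of_forall fun t => ?_, ?_, fun k φ hφ => ?_, fun φ hφ => ?_,
    fun φ hφ => ?_⟩
  · exact boost_hasWeakDeriv hθ (u.hψ.hasWeakDeriv (by norm_num) k)
  · have := boost_hasWeakDeriv (v := P.v) h1 (u.hA.hasWeakDeriv (by norm_num) k)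
    simpa only [boost_one] using this
  · exact boost_hasWeakDeriv_dirT (fun k => u.hA.hasWeakDeriv (by norm_num) k) P.v
  · exact curl_memLp fun k => by
      simpa only [sub_eq_add_neg] using (Adm.lpNorm_translate (u.G2 k) (-(t • P.v))).1
  · simpa only [sub_eq_add_neg] using (Adm.lpNorm_translate hTm (-(t • P.v))).1
  · exact (locallyIntegrable_boost hθ hψ).smul E
  · exact locallyIntegrable_boost hθ (hK k)
  · rw [hAK]
    exact locallyIntegrable_boost hθ (locallyIntegrable_coord_smul u.A6 (P.covK_memLp u k) k)
  · exact hb hJ.locallyIntegrable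
  · refine (hJ.comp_sub_right (t • P.v)).mono ?_ (Eventually.of_forall fun y => ?_)
    · exact AEStronglyMeasurable.smul (f := fun y : Space => (1 + ‖y‖)⁻¹)
        (measurable_const.add measurable_norm).inv.aestronglyMeasurable
        (hJ.comp_sub_right (t • P.v)).1
    · rw [norm_smul, norm_inv, Real.norm_of_nonneg (by positivity)]
      refine mul_le_of_le_one_left (norm_nonneg _) (inv_le_one_of_one_le₀ ?_)
      linarith [norm_nonneg y]
  · exact hb (locallyIntegrable_invLaplace hJ)
  · exact P.spacetime_maxwell hd hm hmin k hφ
  · have h := P.spacetime_spinor hν hω hφ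
    simp only [← hAK] at h
    have h2 : ∫ z, φ z • E • boost P.v (phase ω) u.ψ z =
        E • ∫ z, φ z • boost P.v (phase ω) u.ψ z := by
      rw [← integral_smul]
      simp only [smul_comm E]
    rw [← h2] at h
    exact h
  · exact spacetime_gauge hd P.v hφ

end Params

end MaxwellPauli

end

theorem theorem1 (ħ c m Q : ℝ) (hħ : 0 < ħ) (hc : 0 < c) (hm : 0 < m) (hQ : Q ≠ 0)
    (j : MaxwellPauli.Model) (lam : ℝ) (hlam : 0 < lam) (v : MaxwellPauli.Space)
    (hv0 : 0 < ‖v‖) (hv : ‖v‖ < MaxwellPauli.criticalSpeed ħ c Q j lam) :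
    ∃ (ω : ℝ) (ψ : MaxwellPauli.Space → MaxwellPauli.Spinor)
      (A : MaxwellPauli.Space → MaxwellPauli.Space),
      MaxwellPauli.MemH1 ψ ∧ MaxwellPauli.MemD1 A ∧ (∫ x, ‖ψ x‖ ^ 2) = lam ∧
      MaxwellPauli.IsSolution ħ c m Q j
        (fun t x => Complex.exp (-Complex.I * ((ω * t : ℝ) : ℂ)) • ψ (x - t • v))
        (fun t x => A (x - t • v)) := by
  let P : MaxwellPauli.Params :=
    ⟨ħ, c, m, Q, j, v, hħ, hc, hm, hQ, MaxwellPauli.lt_of_lt_criticalSpeed hħ hc hlam hv⟩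
  obtain ⟨u, hd, hmass, hmin⟩ := P.exists_minimizer hlam hv0 hv
  obtain ⟨ν, hν⟩ := P.spinor_equation u hlam hd hmass hmin
  -- The frequency is `ω = (ν - m|v|²/2 + E)/ħ`, where `E` is the field energy of the moving
  -- profile; unification supplies it.
  exact ⟨_, u.ψ, u.A, u.hψ.memH1, u.hA.memD1, hmass,
    P.isSolution hd hmass hmin hν (mul_div_cancel₀ _ hħ.ne') rfl⟩
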